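/- **Setting.** Let $\alpha>0$, $u_0>0$, $u_\pm\in\mathbb C$ with $|u_\pm|=u_0$, and let $u\in C^2(\mathbb R^2)$ be a classical solution of $$iu_t+u_{xx}+4i\alpha u_x+\tfrac{i}{\alpha}(|u|^2u)_x=0$$ with $u\to u_\pm$ as $x\to\pm\infty$, in the following sense: for every $T>0$ there is $g\ge 0$ with $\int(1+x^2)g(x)\,dx<\infty$ such that, for $|t|\le T$, $|u-u_+|\le g$ on $x\ge0$, $|u-u_-|\le g$ on $x\le 0$, and $|u_x|,|u_{xx}|\le g$ on $\mathbb R$. Write $$k(z)=\tfrac1{2\alpha}\Big(z-\tfrac{u_0^2}{z}\Big),\quad \lambda(z)=\tfrac12\Big(z+\tfrac{u_0^2}{z}\Big),\quad \gamma(z)=1+\tfrac{u_0^2}{z^2},\quad \theta=-k\lambda\Big[x+\big(2\alpha k^2-4\alpha-\tfrac{u_0^2}{\alpha}\big)t\Big],$$ $$\sigma_3=\mathrm{diag}(1,-1),\quad Q=\begin{pmatrix}0&u\\u^*&0\end{pmatrix},\quad Q_\pm=\begin{pmatrix}0&u_\pm\\u_\pm^*&0\end{pmatrix},\quad Y_\pm=I+\tfrac1z\sigma_3Q_\pm,$$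 $$D^+=\{\mathrm{Re}\,z\,\mathrm{Im}\,z<0\},\quad D^-=\{\mathrm{Re}\,z\,\mathrm{Im}\,z>0\},\quad \Sigma=(\mathbb R\cup i\mathbb R)\setminus\{0\},\quad \Sigma'=\Sigma\setminus\{\pm iu_0\}.$$ The Lax pair is $\phi_x=X\phi$, $\phi_t=T\phi$ with $$X=-i\alpha k^2\sigma_3+ikQ,$$ $$T=(-2i\alpha^2k^4+4i\alpha^2k^2+ik^2|u|^2)\sigma_3+2i\alpha k(k^2-2)Q-\tfrac i\alpha kQ^3-k\sigma_3Q_x.$$ The Jost solutions $\phi_\pm=(\phi_{\pm,1},\phi_{\pm,2})$ are the solutions of the Lax pair with $\varphi_\pm:=\phi_\pm e^{-i\theta\sigma_3}\to Y_\pm$ as $x\to\pm\infty$ for every $t$, taken column by column: $\phi_{+,1},\phi_{-,2}$ for $z\in D^+\cup\Sigma'$, and $\phi_{-,1},\phi_{+,2}$ for $z\in D^-\cup\Sigma'$. With $\mathrm{Wr}(a,b)=\det(a,b)$, the scattering data (evaluated at $x=t=0$) are $$s_{11}=\tfrac{\mathrm{Wr}(\phi_{+,1},\phi_{-,2})}{\gamma},\quad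 s_{12}=\tfrac{\mathrm{Wr}(\phi_{+,2},\phi_{-,2})}{\gamma},\quad s_{21}=\tfrac{\mathrm{Wr}(\phi_{-,1},\phi_{+,1})}{\gamma},\quad s_{22}=\tfrac{\mathrm{Wr}(\phi_{-,1},\phi_{+,2})}{\gamma},$$ and $\rho=s_{21}/s_{11}$, $\tilde\rho=s_{12}/s_{22}$. Put $\nu_-(x,t)=\frac1{2\alpha}\int_{-\infty}^x(u_0^2-|u|^2)\,dy$. Assume that $s_{11}$ has no zeros on $\Sigma'$, and that its zeros in the second quadrant with $|z|>u_0$ are exactly $N_1$ simple zeros $z_1,\dots,z_{N_1}$, and those with $|z|=u_0$ are exactly $N_2$ simple zeros $w_1,\dots,w_{N_2}$ ($N_1,N_2\ge0$). Put $\zeta_n=z_n$ and $\zeta_{N_1+n}=-u_0^2/z_n^*$ for $n\le N_1$, and $\zeta_{2N_1+m}=w_m$ for $m\le N_2$. Finally let $$M=M^+=\Big(\tfrac{\varphi_{+,1}}{s_{11}},\ \varphi_{-,2}\Big)\ \text{in }D^+,\qquad M=M^-=\Big(\varphi_{-,1},\ \tfrac{\varphi_{+,2}}{s_{22}}\Big)\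 \text{in }D^-.$$ **Statement.** 0. The columns of $\phi_\pm$ above exist and are unique. On $\Sigma'$, $\phi_+=\phi_-S$ with $S=(s_{ij}(z))$ for all $x,t$; and $\mathrm{Wr}(\phi_{+,1},\phi_{-,2})=\gamma s_{11}$ in $D^+$, $\mathrm{Wr}(\phi_{-,1},\phi_{+,2})=\gamma s_{22}$ in $D^-$, for all $x,t$. 1. (Analyticity) For all $x,t$, $M(x,t,\cdot)$ is analytic in $(D^+\cup D^-)\setminus\{\pm\zeta_n,\pm\zeta_n^*\}$ and has simple poles at the points $\pm\zeta_n,\pm\zeta_n^*$, $n=1,\dots,2N_1+N_2$. There are constants $b_n\neq0$, independent of $x,t$, with $\phi_{+,1}(\zeta_n)=b_n\phi_{-,2}(\zeta_n)$; moreover $s_{11}'(\zeta_n)\ne0$ and, with $C_n=b_n/s_{11}'(\zeta_n)$, $\tilde C_n=-C_n^*$, $$\operatorname*{Res}_{\zeta_n}M=\big(C_ne^{-2i\theta(\zeta_n)}\varphi_{-,2}(\zeta_n),\,0\big),\qquad \operatorname*{Res}_{-\zeta_n}M=\big(-C_ne^{-2i\theta(\zeta_n)}\sigma_3\varphi_{-,2}(\zeta_n),\,0\big),$$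 $$\operatorname*{Res}_{\zeta_n^*}M=\big(0,\,\tilde C_ne^{2i\theta(\zeta_n^*)}\varphi_{-,1}(\zeta_n^*)\big),\qquad \operatorname*{Res}_{-\zeta_n^*}M=\big(0,\,\tilde C_ne^{2i\theta(\zeta_n^*)}\sigma_3\varphi_{-,1}(\zeta_n^*)\big).$$ 2. (Jump) For $z\in\Sigma'$, $s_{11}(z)\ne0\ne s_{22}(z)$, the boundary values of $M$ at $z$ from $D^\pm$ exist and equal $M^\pm(x,t,z)$ (the same formulas at $z$), and $$M^-=M^+(I-G),\qquad G=\begin{pmatrix}0&-e^{2i\theta}\tilde\rho\\ e^{-2i\theta}\rho&\rho\tilde\rho\end{pmatrix}.$$ 3. (Asymptotics) For fixed $x,t$, in $D^+\cup D^-$, $$M=e^{i\nu_-\sigma_3}+O(z^{-1})\ (z\to\infty),\qquad M=\tfrac1z e^{i\nu_-\sigma_3}\sigma_3Q_-+O(1)\ (z\to0).$$ 4. (Reconstruction) For all $x,t$, $u(x,t)=e^{i\nu_-}\lim_{z\to\infty}(zM)_{12}$ (limit in $D^+\cup D^-$), the function $(M^+G)_{12}$ is absolutely integrable on $\Sigma$,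 and $$u(x,t)=e^{2i\nu_-}u_-+e^{i\nu_-}\Big\{2\sum_{n=1}^{2N_1+N_2}\tilde C_ne^{2i\theta(\zeta_n^*)}\varphi_{-,11}(x,t,\zeta_n^*)-\frac1{2\pi i}\int_\Sigma(M^+G)_{12}(x,t,\zeta)\,d\zeta\Big\},$$ where $\varphi_{-,11}$ is the first entry of $\varphi_{-,1}$ and $\Sigma$ is oriented with $D^+$ on its left. -/

import Mathlib

open Complex Filter Topology MeasureTheory Set
open scoped Matrix ComplexConjugate

noncomputable section

/-- The data of the problem: the coefficient `α`, the amplitude `u₀`, the boundary values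
`um = u₋`, `up = u₊`, and the potential `u x t`. -/
structure NZBC where
  α : ℝ
  u₀ : ℝ
  um : ℂ
  up : ℂ
  u : ℝ → ℝ → ℂ

/-- The third Pauli matrix. -/
def sigma3 : Matrix (Fin 2) (Fin 2) ℂ := !![1, 0; 0, -1]

/-- `Q(w)`, the off-diagonal matrix with entries `w` and `w*`. -/
def potQ (w : ℂ) : Matrix (Fin 2) (Fin 2) ℂ := !![0, w; conj w, 0]

/-- The open set `Re z · Im z < 0`. -/
def Dplus : Set ℂ := {z | z.re * z.im < 0}

/-- The open set `Re z · Im z > 0`. -/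
def Dminus : Set ℂ := {z | 0 < z.re * z.im}

/-- The contour `Σ = (ℝ ∪ iℝ) \ {0}`. -/
def Contour : Set ℂ := {z | z.re * z.im = 0 ∧ z ≠ 0}

/-- The integral over `Σ`, oriented so that `Dplus` lies on the left: both real half-axes run
towards `0`, both imaginary half-axes run away from `0`. -/
def contourIntegral (f : ℂ → ℂ) : ℂ :=
  (∫ s in Iio (0 : ℝ), f s) - (∫ s in Ioi (0 : ℝ), f s)
    + I * (∫ s in Ioi (0 : ℝ), f (I * s)) - I * (∫ s in Iio (0 : ℝ), f (I * s))

/-- Absolute integrability over `Σ`. -/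
def ContourIntegrable (f : ℂ → ℂ) : Prop :=
  Integrable (fun s : ℝ => f s) ∧ Integrable (fun s : ℝ => f (I * s))

/-- The matrix function `f` has a simple pole at `a` with (nonzero) residue `R`. -/
def HasSimplePoleAt (f : ℂ → Matrix (Fin 2) (Fin 2) ℂ) (a : ℂ)
    (R : Matrix (Fin 2) (Fin 2) ℂ) : Prop :=
  R ≠ 0 ∧ ∃ g : ℂ → Matrix (Fin 2) (Fin 2) ℂ,
    (∀ i j, AnalyticAt ℂ (fun z => g z i j) a) ∧ g a = R ∧
      ∀ᶠ z in 𝓝[≠] a, f z = (z - a)⁻¹ • g z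

/-- The Wronskian `det (a, b)`. -/
def wronskian (a b : Fin 2 → ℂ) : ℂ := a 0 * b 1 - a 1 * b 0

/-- The matrix with the given columns. -/
def colMatrix (a b : Fin 2 → ℂ) : Matrix (Fin 2) (Fin 2) ℂ :=
  Matrix.of fun i j => if j = 0 then a i else b i

namespace NZBC

/-- `u` is a classical solution of
`i u_t + u_xx + 4 i α u_x + (i/α) (|u|² u)_x = 0` which tends to `u₊`, `u₋` with `|u₊| = |u₋| = u₀`
as `x → +∞`, `x → -∞`; on bounded time intervals `u - u₊` (on `x ≥ 0`), `u - u₋` (on `x ≤ 0`),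
`u_x` and `u_xx` are dominated by a function with finite second moment. -/
structure IsSolution (P : NZBC) : Prop where
  α_pos : 0 < P.α
  u₀_pos : 0 < P.u₀
  norm_um : ‖P.um‖ = P.u₀
  norm_up : ‖P.up‖ = P.u₀
  contDiff : ContDiff ℝ 2 (fun p : ℝ × ℝ => P.u p.1 p.2)
  equation : ∀ x t : ℝ,
    I * deriv (fun s => P.u x s) t + deriv (deriv (fun y => P.u y t)) x
      + 4 * I * P.α * deriv (fun y => P.u y t) x
      + I / P.α * deriv (fun y => ((‖P.u y t‖ ^ 2 : ℝ) : ℂ) * P.u y t) x = 0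
  decay : ∀ T : ℝ, ∃ g : ℝ → ℝ, Integrable (fun x => (1 + x ^ 2) * g x) ∧
    ∀ t : ℝ, |t| ≤ T →
      (∀ x, 0 ≤ x → ‖P.u x t - P.up‖ ≤ g x) ∧
      (∀ x, x ≤ 0 → ‖P.u x t - P.um‖ ≤ g x) ∧
      (∀ x, ‖deriv (fun y => P.u y t) x‖ ≤ g x) ∧
      (∀ x, ‖deriv (deriv (fun y => P.u y t)) x‖ ≤ g x)

variable (P : NZBC)

/-- `k(z) = (z - u₀²/z) / (2α)`. -/
def k (z : ℂ) : ℂ := (z - (P.u₀ : ℂ) ^ 2 / z) / (2 * P.α)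

/-- `λ(z) = (z + u₀²/z) / 2`. -/
def lam (z : ℂ) : ℂ := (z + (P.u₀ : ℂ) ^ 2 / z) / 2

/-- `γ(z) = 1 + u₀²/z²`. -/
def gam (z : ℂ) : ℂ := 1 + (P.u₀ : ℂ) ^ 2 / z ^ 2

/-- `θ(x,t,z) = -k λ [x + (2αk² - 4α - u₀²/α) t]`. -/
def theta (x t : ℝ) (z : ℂ) : ℂ :=
  -(P.k z * P.lam z) *
    (x + (2 * P.α * P.k z ^ 2 - 4 * P.α - (P.u₀ : ℂ) ^ 2 / P.α) * t)

/-- The matrix `X` of the Lax pair `φ_x = X φ`, `φ_t = T φ`. -/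
def laxX (x t : ℝ) (z : ℂ) : Matrix (Fin 2) (Fin 2) ℂ :=
  (-I * P.α * P.k z ^ 2) • sigma3 + (I * P.k z) • potQ (P.u x t)

/-- The matrix `T` of the Lax pair `φ_x = X φ`, `φ_t = T φ`. -/
def laxT (x t : ℝ) (z : ℂ) : Matrix (Fin 2) (Fin 2) ℂ :=
  (-2 * I * P.α ^ 2 * P.k z ^ 4 + 4 * I * P.α ^ 2 * P.k z ^ 2
      + I * P.k z ^ 2 * ((‖P.u x t‖ ^ 2 : ℝ) : ℂ)) • sigma3
    + (2 * I * P.α * P.k z * (P.k z ^ 2 - 2)) • potQ (P.u x t)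
    - (I / P.α * P.k z) • potQ (P.u x t) ^ 3
    - P.k z • (sigma3 * potQ (deriv (fun y => P.u y t) x))

/-- `Y(w,z) = I + z⁻¹ σ₃ Q(w)`; then `Y± = Y(u±, z)`. -/
def asymY (w z : ℂ) : Matrix (Fin 2) (Fin 2) ℂ := 1 + z⁻¹ • (sigma3 * potQ w)

/-- `f x t` is the `j`-th column of the Jost solution at `z`: a solution of both equations of the
Lax pair that is asymptotic to the `j`-th column of `Y e^{iθσ₃}` as `x` tends to infinity
along `l`. -/
structure IsJostColumn (w : ℂ) (l : Filter ℝ) (j : Fin 2) (z : ℂ)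
    (f : ℝ → ℝ → Fin 2 → ℂ) : Prop where
  x_part : ∀ x t : ℝ, HasDerivAt (fun y => f y t) (P.laxX x t z *ᵥ f x t) x
  t_part : ∀ x t : ℝ, HasDerivAt (fun s => f x s) (P.laxT x t z *ᵥ f x t) t
  asymp : ∀ t : ℝ, Tendsto (fun x => exp (-(I * P.theta x t z * sigma3 j j)) • f x t) l
    (𝓝 (fun i => asymY w z i j))

/-- The `j`-th column of the Jost solution `φ₊`, normalised as `x → +∞`. -/
def phiPlus (j : Fin 2) (x t : ℝ) (z : ℂ) : Fin 2 → ℂ :=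
  Classical.epsilon (P.IsJostColumn P.up atTop j z) x t

/-- The `j`-th column of the Jost solution `φ₋`, normalised as `x → -∞`. -/
def phiMinus (j : Fin 2) (x t : ℝ) (z : ℂ) : Fin 2 → ℂ :=
  Classical.epsilon (P.IsJostColumn P.um atBot j z) x t

/-- The `j`-th column of `φ₊ e^{-iθσ₃}`. -/
def varphiPlus (j : Fin 2) (x t : ℝ) (z : ℂ) : Fin 2 → ℂ :=
  exp (-(I * P.theta x t z * sigma3 j j)) • P.phiPlus j x t z

/-- The `j`-th column of `φ₋ e^{-iθσ₃}`. -/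
def varphiMinus (j : Fin 2) (x t : ℝ) (z : ℂ) : Fin 2 → ℂ :=
  exp (-(I * P.theta x t z * sigma3 j j)) • P.phiMinus j x t z

/-- The scattering coefficient `s₁₁`, as a Wronskian (evaluated at `x = t = 0`). -/
def s11 (z : ℂ) : ℂ := wronskian (P.phiPlus 0 0 0 z) (P.phiMinus 1 0 0 z) / P.gam z

/-- The scattering coefficient `s₁₂`. -/
def s12 (z : ℂ) : ℂ := wronskian (P.phiPlus 1 0 0 z) (P.phiMinus 1 0 0 z) / P.gam z

/-- The scattering coefficient `s₂₁`. -/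
def s21 (z : ℂ) : ℂ := wronskian (P.phiMinus 0 0 0 z) (P.phiPlus 0 0 0 z) / P.gam z

/-- The scattering coefficient `s₂₂`. -/
def s22 (z : ℂ) : ℂ := wronskian (P.phiMinus 0 0 0 z) (P.phiPlus 1 0 0 z) / P.gam z

/-- The reflection coefficient `ρ = s₂₁ / s₁₁`. -/
def rho (z : ℂ) : ℂ := P.s21 z / P.s11 z

/-- The reflection coefficient `ρ̃ = s₁₂ / s₂₂`. -/
def rhoT (z : ℂ) : ℂ := P.s12 z / P.s22 z

/-- The contour without the zeros `± i u₀` of `γ`. -/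
def regularContour : Set ℂ := Contour \ {I * P.u₀, -(I * P.u₀)}

/-- `M⁺ = (φ₊,₁ / s₁₁, φ₋,₂)` (columns normalised by `e^{-iθσ₃}`). -/
def Mplus (x t : ℝ) (z : ℂ) : Matrix (Fin 2) (Fin 2) ℂ :=
  Matrix.of fun i j => if j = 0 then P.varphiPlus 0 x t z i / P.s11 z else P.varphiMinus 1 x t z i

/-- `M⁻ = (φ₋,₁, φ₊,₂ / s₂₂)` (columns normalised by `e^{-iθσ₃}`). -/
def Mminus (x t : ℝ) (z : ℂ) : Matrix (Fin 2) (Fin 2) ℂ :=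
  Matrix.of fun i j => if j = 0 then P.varphiMinus 0 x t z i else P.varphiPlus 1 x t z i / P.s22 z

open Classical in
/-- `M = M⁺` on `Dplus`, `M = M⁻` on `Dminus` (value `0` on the axes, never used). -/
def M (x t : ℝ) (z : ℂ) : Matrix (Fin 2) (Fin 2) ℂ :=
  if z ∈ Dplus then P.Mplus x t z else if z ∈ Dminus then P.Mminus x t z else 0

/-- The matrix `G` in the jump condition. -/
def G (x t : ℝ) (z : ℂ) : Matrix (Fin 2) (Fin 2) ℂ :=
  !![0, -(exp (2 * I * P.theta x t z) * P.rhoT z);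
     exp (-(2 * I * P.theta x t z)) * P.rho z, P.rho z * P.rhoT z]

/-- `ν₋(x,t) = (1/2α) ∫_{-∞}^x (u₀² - |u|²) dy`. -/
def nuMinus (x t : ℝ) : ℝ := 1 / (2 * P.α) * ∫ y in Iic x, (P.u₀ ^ 2 - ‖P.u y t‖ ^ 2)

/-- `e^{iν₋σ₃}`. -/
def expNu (x t : ℝ) : Matrix (Fin 2) (Fin 2) ℂ :=
  !![exp (I * P.nuMinus x t), 0; 0, exp (-(I * P.nuMinus x t))]

/-- The zeros of `s₁₁` in the second quadrant: finitely many simple zeros `zs` outside the circle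
`|z| = u₀` and finitely many simple zeros `ws` on it; and no zeros of `s₁₁` on the contour. -/
structure HasSimpleSpectrum {N₁ N₂ : ℕ} (zs : Fin N₁ → ℂ) (ws : Fin N₂ → ℂ) : Prop where
  zs_injective : Function.Injective zs
  ws_injective : Function.Injective ws
  range_zs : range zs = {z | z ∈ Dplus ∧ 0 < z.im ∧ P.u₀ < ‖z‖ ∧ P.s11 z = 0}
  range_ws : range ws = {z | z ∈ Dplus ∧ 0 < z.im ∧ ‖z‖ = P.u₀ ∧ P.s11 z = 0}
  zs_simple : ∀ n, deriv P.s11 (zs n) ≠ 0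
  ws_simple : ∀ n, deriv P.s11 (ws n) ≠ 0
  contour : ∀ z ∈ P.regularContour, P.s11 z ≠ 0

/-- The points `ζ`: the `z_n`, the `-u₀²/z_n*`, and the `w_m`. -/
def zeta {N₁ N₂ : ℕ} (zs : Fin N₁ → ℂ) (ws : Fin N₂ → ℂ) : Fin N₁ ⊕ Fin N₁ ⊕ Fin N₂ → ℂ :=
  Sum.elim zs (Sum.elim (fun n => -((P.u₀ : ℂ) ^ 2 / conj (zs n))) ws)

/-- The discrete spectrum `{± ζ_n, ± ζ_n*}`. -/
def spectralSet {N₁ N₂ : ℕ} (zs : Fin N₁ → ℂ) (ws : Fin N₂ → ℂ) : Set ℂ :=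
  {z | ∃ n, z = P.zeta zs ws n ∨ z = -P.zeta zs ws n ∨
    z = conj (P.zeta zs ws n) ∨ z = -conj (P.zeta zs ws n)}

end NZBC

end

/-! Everything is reduced to one object, the first column of φ₊. The reflection u(x,t) ↦ -u*(-x,-t)
turns it into φ₋,₂, the map z ↦ z* gives the two remaining columns, and z ↦ -z and z ↦ -u₀²/z supply
the symmetries of the poles and the behaviour at the origin.

Jost solutions. After removal of e^{iθ} the column satisfies ψ' = Aψ + ikQ(u - u₊)ψ, where A = X₊ +
ikλ has rank one and A² = μA with μ = 2ikλ (`asymA_asymA`). Hence e^{sA} = 1 + E(μ,s)A with E(μ,s) =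
∫₀ˢ e^{μr} dr, a formula without division by μ. On the closed sector Re z Im z ≤ 0 one has Re μ ≥ 0
(`re_rate_nonneg`), and the Volterra equation on a half-line (x₀,∞) is solvable in an exponentially
weighted sup norm (`IsVolterraKernel.isUnit_one_sub`). E grows linearly and its μ-derivative
quadratically, so two moments of u - u₊ make ψ complex differentiable within the closed sector, even
where kλ = 0 (`differentiableOn_jost`). This yields analyticity inside, continuity on the contour
and a derivative at ±iu₀ together. Uniqueness is a Wronskian argument (`eq_zero_of_tendsto_zero`).
The same argument gives the time equation: by zero curvature ψ_t - (T - iθ_t)ψ solves the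
x-equation, and it tends to 0.

Large z. A change of unknowns isolates a quantity with a large rate of nonnegative real part and
forcing of size 1/z. Two explicit corrections, in the spirit of integration by parts, give the
leading terms of both entries of ψ (`jost_asymptotics`). The inversion z ↦ -u₀²/z carries them to z
= 0.

Poles. At a zero of s₁₁ the Wronskian of φ₊,₁ and φ₋,₂ vanishes, so the columns are proportional,
with a constant independent of x and t because both solve the Lax pair. This gives the residue at ζ,
and the symmetries of M give the other three. The zeros inside the circle |z| = u₀ are the
reflections of those outside.

Reconstruction. The jump relation says M⁺G = M⁺ - M⁻ on the contour, so only the 1/z coefficient at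
infinity of the (1,2) entry is needed, and no singular integral operator. Cauchy's theorem in each
of the four quadrants, after removing the poles at ±ζ* and the term e^{iν₋}u₋/z at the origin,
evaluates the contour integral of the jump (`contourIntegral_jump`). The delicate points are ±iu₀,
where γ vanishes: det S = 1 and the symmetries give |s₁₁| ≥ 1 on the imaginary axis, and therefore
1/s₁₁ is bounded near these points (`inv_s11_bounded`). -/

set_option linter.unusedSectionVars false

/-! ### Volterra integral operators on bounded continuous functions -/

section Volterra

open BoundedContinuousFunction

variable {𝕜 E : Type*} [RCLike 𝕜] [NormedAddCommGroup E] [NormedSpace 𝕜 E] [NormedSpace ℝ E]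
  [SMulCommClass ℝ 𝕜 E] [CompleteSpace E]

/-- A kernel dominated by an integrable function of the second variable. -/
structure IsDominatedKernel (H : ℝ → ℝ) (κ : ℝ → ℝ → E →L[𝕜] E) : Prop where
  integrable : Integrable H
  meas : ∀ x, AEStronglyMeasurable (κ x) volume
  bound : ∀ x y, ‖κ x y‖ ≤ H y
  cont : ∀ x, ∀ᵐ y, ContinuousAt (fun s => κ s y) x

theorem IsDominatedKernel.integrable_apply {H : ℝ → ℝ} {κ : ℝ → ℝ → E →L[𝕜] E}
    (h : IsDominatedKernel H κ) (ψ : ℝ →ᵇ E) (x : ℝ) : Integrable fun y => κ x y (ψ y) := by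
  refine Integrable.mono' (h.integrable.mul_const ‖ψ‖) ?_ (ae_of_all _ fun y => ?_)
  · exact isBoundedBilinearMap_apply.continuous.comp_aestronglyMeasurable
      ((h.meas x).prodMk ψ.continuous.aestronglyMeasurable)
  · exact ((κ x y).le_opNorm _).trans (mul_le_mul (h.bound x y) (ψ.norm_coe_le_norm y)
      (norm_nonneg _) ((norm_nonneg _).trans (h.bound x y)))

theorem IsDominatedKernel.integrable_norm {H : ℝ → ℝ} {κ : ℝ → ℝ → E →L[𝕜] E}
    (h : IsDominatedKernel H κ) (x : ℝ) : Integrable fun y => ‖κ x y‖ :=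
  Integrable.mono' h.integrable (h.meas x).norm
    (ae_of_all _ fun y => by simpa using h.bound x y)

/-- The integral operator with kernel `κ` on bounded continuous functions. -/
noncomputable def kerOp (κ : ℝ → ℝ → E →L[𝕜] E) : (ℝ →ᵇ E) →L[𝕜] (ℝ →ᵇ E) :=
  Classical.epsilon fun K => ∀ ψ x, K ψ x = ∫ y, κ x y (ψ y)

/-- `kerOp` selects an operator by its description and is informative only if one exists. Domination
provides it: the majorant bounds the image, and dominated convergence with almost everywhere
continuity of the kernel in x makes the image continuous. -/
theorem IsDominatedKernel.kerOp_apply {H : ℝ → ℝ} {κ : ℝ → ℝ → E →L[𝕜] E}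
    (h : IsDominatedKernel H κ) (ψ : ℝ →ᵇ E) (x : ℝ) : kerOp κ ψ x = ∫ y, κ x y (ψ y) := by
  have hH : ∀ y, 0 ≤ H y := fun y => (norm_nonneg _).trans (h.bound 0 y)
  have hb : ∀ (ψ : ℝ →ᵇ E) x, ‖∫ y, κ x y (ψ y)‖ ≤ (∫ y, H y) * ‖ψ‖ := by
    intro ψ x
    rw [← integral_mul_const]
    refine norm_integral_le_of_norm_le (h.integrable.mul_const ‖ψ‖) (ae_of_all _ fun y => ?_)
    exact ((κ x y).le_opNorm _).trans (mul_le_mul (h.bound x y) (ψ.norm_coe_le_norm y)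
      (norm_nonneg _) (hH y))
  have hc : ∀ ψ : ℝ →ᵇ E, Continuous fun x => ∫ y, κ x y (ψ y) := by
    intro ψ
    rw [continuous_iff_continuousAt]
    intro x
    refine continuousAt_of_dominated (bound := fun y => H y * ‖ψ‖)
      (Eventually.of_forall fun s => (h.integrable_apply ψ s).aestronglyMeasurable)
      (Eventually.of_forall fun s => ae_of_all _ fun y => ?_) (h.integrable.mul_const _) ?_
    · exact ((κ s y).le_opNorm _).trans (mul_le_mul (h.bound s y) (ψ.norm_coe_le_norm y)
        (norm_nonneg _) (hH y))
    · filter_upwards [h.cont x] with y hy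
      exact hy.clm_apply continuousAt_const
  let K : (ℝ →ᵇ E) →L[𝕜] (ℝ →ᵇ E) := LinearMap.mkContinuous
    { toFun := fun ψ => ofNormedAddCommGroup (fun x => ∫ y, κ x y (ψ y)) (hc ψ) _ (hb ψ)
      map_add' := fun ψ χ => by
        ext x
        simp only [coe_ofNormedAddCommGroup, BoundedContinuousFunction.coe_add, Pi.add_apply,
          map_add]
        exact integral_add (h.integrable_apply ψ x) (h.integrable_apply χ x)
      map_smul' := fun c ψ => by
        ext x
        simp only [coe_ofNormedAddCommGroup, BoundedContinuousFunction.coe_smul, map_smul,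
          RingHom.id_apply]
        exact integral_smul c _ } (∫ y, H y) fun ψ =>
      norm_ofNormedAddCommGroup_le _ (mul_nonneg (integral_nonneg hH) (norm_nonneg ψ)) (hb ψ)
  have := Classical.epsilon_spec (p := fun K : (ℝ →ᵇ E) →L[𝕜] (ℝ →ᵇ E) =>
    ∀ ψ x, K ψ x = ∫ y, κ x y (ψ y)) ⟨K, fun ψ x => rfl⟩
  exact this ψ x

theorem IsDominatedKernel.norm_kerOp_le {H : ℝ → ℝ} {κ : ℝ → ℝ → E →L[𝕜] E}
    (h : IsDominatedKernel H κ) {c : ℝ} (hc : ∀ x, ∫ y, ‖κ x y‖ ≤ c) : ‖kerOp κ‖ ≤ c := by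
  have hc0 : 0 ≤ c := (integral_nonneg fun y => norm_nonneg _).trans (hc 0)
  refine ContinuousLinearMap.opNorm_le_bound _ hc0 fun ψ => ?_
  refine (BoundedContinuousFunction.norm_le (mul_nonneg hc0 (norm_nonneg _))).2 fun x => ?_
  rw [h.kerOp_apply]
  calc ‖∫ y, κ x y (ψ y)‖ ≤ ∫ y, ‖κ x y‖ * ‖ψ‖ :=
        norm_integral_le_of_norm_le ((h.integrable_norm x).mul_const _)
          (ae_of_all _ fun y => (κ x y).le_of_opNorm_le_of_le le_rfl (ψ.norm_coe_le_norm y))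
    _ = (∫ y, ‖κ x y‖) * ‖ψ‖ := integral_mul_const _ _
    _ ≤ c * ‖ψ‖ := by gcongr; exact hc x

/-- Differentiability in operator norm of a family of integral operators. -/
theorem hasDerivWithinAt_kerOp {H : ℝ → ℝ} {κ : 𝕜 → ℝ → ℝ → E →L[𝕜] E}
    {κ' : ℝ → ℝ → E →L[𝕜] E} {S : Set 𝕜} {p₀ : 𝕜} (hp₀ : p₀ ∈ S)
    (h : ∀ p ∈ S, IsDominatedKernel H (κ p)) (h' : IsDominatedKernel H κ') {η : 𝕜 → ℝ → ℝ}
    (hη : ∀ p ∈ S, ∀ x y, ‖κ p x y - κ p₀ x y - (p - p₀) • κ' x y‖ ≤ ‖p - p₀‖ * η p y)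
    (hηi : ∀ p ∈ S, Integrable (η p))
    (hη0 : Tendsto (fun p => ∫ y, η p y) (𝓝[S] p₀) (𝓝 0)) :
    HasDerivWithinAt (fun p => kerOp (κ p)) (kerOp κ') S p₀ := by
  rw [hasDerivWithinAt_iff_isLittleO, Asymptotics.isLittleO_iff]
  intro c hc
  filter_upwards [hη0.eventually (ge_mem_nhds hc), self_mem_nhdsWithin] with p hpc hpS
  -- The remainder of the operators is the integral operator of the remainder kernel, so its norm is
  -- at most ‖p - p₀‖ ∫ η p.
  have e : ∀ ψ x, (kerOp (κ p) - kerOp (κ p₀) - (p - p₀) • kerOp κ') ψ x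
      = ∫ y, (κ p x y - κ p₀ x y - (p - p₀) • κ' x y) (ψ y) := by
    intro ψ x
    have i1 := (h p hpS).integrable_apply ψ x
    have i2 := (h p₀ hp₀).integrable_apply ψ x
    have i3 := h'.integrable_apply ψ x
    calc _ = kerOp (κ p) ψ x - kerOp (κ p₀) ψ x - (p - p₀) • kerOp κ' ψ x := rfl
      _ = _ := by
        rw [(h p hpS).kerOp_apply, (h p₀ hp₀).kerOp_apply, h'.kerOp_apply]
        have e1 := integral_sub (i1.sub i2) (i3.smul (p - p₀))
        have e2 := integral_sub i1 i2
        have e3 := integral_smul (μ := volume) (p - p₀) (fun y => κ' x y (ψ y))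
        simp only [Pi.sub_apply, Pi.smul_apply] at e1 e2 e3
        rw [← e3, ← e2, ← e1]
        rfl
  refine ContinuousLinearMap.opNorm_le_bound _ (by positivity) fun ψ => ?_
  refine (BoundedContinuousFunction.norm_le (by positivity)).2 fun x => ?_
  rw [e]
  calc _ ≤ ∫ y, ‖p - p₀‖ * η p y * ‖ψ‖ :=
        norm_integral_le_of_norm_le (((hηi p hpS).const_mul _).mul_const _)
          (ae_of_all _ fun y => ContinuousLinearMap.le_of_opNorm_le_of_le _ (hη p hpS x y)
            (ψ.norm_coe_le_norm y))
    _ = ‖p - p₀‖ * (∫ y, η p y) * ‖ψ‖ := by rw [integral_mul_const, integral_const_mul]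
    _ ≤ c * ‖p - p₀‖ * ‖ψ‖ := by
        rw [mul_comm c]; gcongr

/-- Multiplication of bounded continuous functions by a bounded continuous real weight. -/
noncomputable def weightOp (𝕜 : Type*) {E : Type*} [RCLike 𝕜] [NormedAddCommGroup E]
    [NormedSpace 𝕜 E] (a : ℝ → ℝ) (ha : Continuous a) (C : ℝ)
    (hC : ∀ x, |a x| ≤ C) : (ℝ →ᵇ E) →L[𝕜] (ℝ →ᵇ E) :=
  LinearMap.mkContinuous
    { toFun := fun ψ => ofNormedAddCommGroup (fun x => (a x : 𝕜) • ψ x)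
        ((RCLike.continuous_ofReal.comp ha).smul ψ.continuous) (C * ‖ψ‖) fun x => by
          rw [norm_smul, RCLike.norm_ofReal]
          exact mul_le_mul (hC x) (ψ.norm_coe_le_norm x) (norm_nonneg _)
            ((abs_nonneg _).trans (hC x))
      map_add' := fun ψ χ => by ext x; simp
      map_smul' := fun c ψ => by ext x; simp [smul_comm c] } C fun ψ =>
    norm_ofNormedAddCommGroup_le _
      (mul_nonneg ((abs_nonneg _).trans (hC 0)) (norm_nonneg ψ)) fun x => by
        rw [norm_smul, RCLike.norm_ofReal]
        exact mul_le_mul (hC x) (ψ.norm_coe_le_norm x) (norm_nonneg _)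
          ((abs_nonneg _).trans (hC x))

/-- `∫_{max(x, x₀)}^∞ G`. -/
noncomputable def tailInt (G : ℝ → ℝ) (x₀ x : ℝ) : ℝ := ∫ y in Ioi (max x x₀), G y

theorem hasDerivAt_integral_Ioi {F : Type*} [NormedAddCommGroup F] [NormedSpace ℝ F]
    [CompleteSpace F] {f : ℝ → F} {a x : ℝ} (hf : IntegrableOn f (Ioi a)) (hx : a < x)
    (hc : ContinuousAt f x) (hm : ∀ b > a, StronglyMeasurableAtFilter f (𝓝 b)) :
    HasDerivAt (fun s => ∫ y in Ioi s, f y) (-f x) x := by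
  have key : ∀ᶠ s in 𝓝 x, ∫ y in Ioi s, f y = (∫ y in Ioi x, f y) - ∫ y in x..s, f y := by
    filter_upwards [Ioi_mem_nhds hx] with s hs
    have := intervalIntegral.integral_Ioi_sub_Ioi' (a := x) (b := s)
      (hf.mono_set (Ioi_subset_Ioi hx.le)) (hf.mono_set (Ioi_subset_Ioi (le_of_lt hs)))
    rw [← this]; abel
  refine HasDerivAt.congr_of_eventuallyEq ?_ key
  have := intervalIntegral.integral_hasDerivAt_right (a := x) (b := x) (f := f)
    (by simp) (hm x hx) hc
  simpa using this.const_sub (∫ y in Ioi x, f y)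

theorem continuous_tailInt {G : ℝ → ℝ} {x₀ : ℝ} (hi : IntegrableOn G (Ioi x₀)) :
    Continuous (tailInt G x₀) := by
  have : ∀ x, tailInt G x₀ x = (∫ y in Ioi x₀, G y) - ∫ y in x₀..max x x₀,
      (Ioi x₀).indicator G y := by
    intro x
    have := intervalIntegral.integral_Ioi_sub_Ioi' (a := x₀) (b := max x x₀) hi
      (hi.mono_set (Ioi_subset_Ioi (le_max_right _ _)))
    have h2 : ∫ y in x₀..max x x₀, (Ioi x₀).indicator G y = ∫ y in x₀..max x x₀, G y := by
      rw [intervalIntegral.integral_of_le (le_max_right _ _),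
        intervalIntegral.integral_of_le (le_max_right _ _)]
      exact setIntegral_congr_fun measurableSet_Ioc fun y hy => indicator_of_mem hy.1 _
    rw [h2, ← this, tailInt]; abel
  have e : tailInt G x₀ = fun x => (∫ y in Ioi x₀, G y) - ∫ y in x₀..max x x₀,
      (Ioi x₀).indicator G y := funext this
  rw [e]
  have hii : Integrable ((Ioi x₀).indicator G) := hi.integrable_indicator measurableSet_Ioi
  exact continuous_const.sub ((intervalIntegral.continuous_primitive
    (fun a b => hii.intervalIntegrable) x₀).comp (continuous_id.max continuous_const))

/-- With Γ = `tailInt G x₀` one has Γ' = -G to the right of x₀, so the integrand is the derivative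
of -½ e^{2Γ}. As Γ → 0, the exact value is ½ (e^{2Γ(x)} - 1). The factor ½ is the contraction
constant of the weighted norm. -/
theorem integral_exp_tailInt_le {G : ℝ → ℝ} {x₀ : ℝ} (hG : Continuous G)
    (hi : IntegrableOn G (Ioi x₀)) (x : ℝ) (hG0 : ∀ x, 0 ≤ G x) :
    IntegrableOn (fun y => Real.exp (2 * tailInt G x₀ y) * G y) (Ioi (max x x₀)) ∧
    ∫ y in Ioi (max x x₀), Real.exp (2 * tailInt G x₀ y) * G y
      ≤ 1 / 2 * Real.exp (2 * tailInt G x₀ x) := by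
  set m := max x x₀
  have hm : x₀ ≤ m := le_max_right _ _
  have hT0 : Tendsto (tailInt G x₀) atTop (𝓝 0) := by
    have : Tendsto (fun s => ∫ y in Ioi s, G y) atTop (𝓝 0) := by
      have h1 := intervalIntegral_tendsto_integral_Ioi x₀ hi tendsto_id
      have h2 := (h1.const_sub (∫ y in Ioi x₀, G y))
      rw [sub_self] at h2
      refine h2.congr' ?_
      filter_upwards [eventually_ge_atTop x₀] with s hs
      have := intervalIntegral.integral_Ioi_sub_Ioi' (a := x₀) (b := s) hi
        (hi.mono_set (Ioi_subset_Ioi hs))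
      simp only [id]; rw [← this]; abel
    refine this.congr' ?_
    filter_upwards [eventually_ge_atTop x₀] with s hs
    simp [tailInt, max_eq_left hs]
  have hd : ∀ y ∈ Ioi m, HasDerivAt (fun y => -(1 / 2) * Real.exp (2 * tailInt G x₀ y))
      (Real.exp (2 * tailInt G x₀ y) * G y) y := by
    intro y hy
    have hy' : x₀ < y := lt_of_le_of_lt hm hy
    have h1 : HasDerivAt (tailInt G x₀) (-G y) y := by
      refine (hasDerivAt_integral_Ioi hi hy' hG.continuousAt
        (fun b _ => hG.stronglyMeasurableAtFilter _ _)).congr_of_eventuallyEq ?_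
      filter_upwards [Ioi_mem_nhds hy'] with s hs
      rw [tailInt, max_eq_left (le_of_lt (mem_Ioi.1 hs))]
    have := ((h1.const_mul 2).exp).const_mul (-(1 / 2))
    exact this.congr_deriv (by ring)
  have hcont := continuous_tailInt hi
  have htend : Tendsto (fun y => -(1 / 2) * Real.exp (2 * tailInt G x₀ y)) atTop
      (𝓝 (-(1 / 2) * Real.exp (2 * 0))) :=
    (Real.continuous_exp.continuousAt.tendsto.comp (hT0.const_mul 2)).const_mul _
  have hnn : ∀ y ∈ Ioi m, 0 ≤ Real.exp (2 * tailInt G x₀ y) * G y := fun y _ =>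
    mul_nonneg (Real.exp_pos _).le (hG0 y)
  have hcw : ContinuousWithinAt (fun y => -(1 / 2) * Real.exp (2 * tailInt G x₀ y)) (Ici m) m := by
    apply Continuous.continuousWithinAt; fun_prop
  refine ⟨integrableOn_Ioi_deriv_of_nonneg hcw hd hnn htend, ?_⟩
  rw [integral_Ioi_of_hasDerivAt_of_nonneg hcw hd hnn htend]
  have : tailInt G x₀ m = tailInt G x₀ x := by simp [tailInt, m]
  rw [this]; norm_num

/-- A Volterra kernel on `(x₀, ∞)`. -/
structure IsVolterraKernel (G : ℝ → ℝ) (x₀ : ℝ) (κ : ℝ → ℝ → E →L[𝕜] E) : Prop where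
  continuous : Continuous G
  nonneg : ∀ x, 0 ≤ G x
  integrable : IntegrableOn G (Ioi x₀)
  meas : ∀ x, AEStronglyMeasurable (κ x) volume
  bound : ∀ x y, ‖κ x y‖ ≤ (Ioi (max x x₀)).indicator G y
  cont : ∀ x, ∀ᵐ y, ContinuousAt (fun s => κ s y) x

theorem IsVolterraKernel.isDominatedKernel {G : ℝ → ℝ} {x₀ : ℝ} {κ : ℝ → ℝ → E →L[𝕜] E}
    (h : IsVolterraKernel G x₀ κ) : IsDominatedKernel ((Ioi x₀).indicator G) κ where
  integrable := h.integrable.integrable_indicator measurableSet_Ioi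
  meas := h.meas
  bound := fun x y => (h.bound x y).trans <|
    indicator_le_indicator_of_subset (Ioi_subset_Ioi (le_max_right _ _)) h.nonneg y
  cont := h.cont

/-- Conjugation by the multiplication operator e^{2Γ}, with Γ(x) = ∫_{max(x,x₀)}^∞ G, turns the
operator into one of norm at most ½, whatever the size of ∫ G. Hence 1 - K is conjugate to an
operator invertible by a Neumann series. -/
theorem IsVolterraKernel.isUnit_one_sub {G : ℝ → ℝ} {x₀ : ℝ} {κ : ℝ → ℝ → E →L[𝕜] E}
    (h : IsVolterraKernel G x₀ κ) : IsUnit (1 - kerOp κ) := by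
  set Γ := tailInt G x₀ with hΓ
  have hΓc : Continuous Γ := continuous_tailInt h.integrable
  have hΓ0 : ∀ x, 0 ≤ Γ x := fun x => setIntegral_nonneg measurableSet_Ioi fun y _ => h.nonneg y
  have hΓanti : ∀ x y, x ≤ y → Γ y ≤ Γ x := fun x y hxy =>
    setIntegral_mono_set (h.integrable.mono_set (Ioi_subset_Ioi (le_max_right _ _)))
      (ae_of_all _ h.nonneg) (Ioi_subset_Ioi (max_le_max_right _ hxy)).eventuallyLE
  have hΓm : ∀ x, Γ x ≤ Γ x₀ := by
    intro x
    rcases le_total x x₀ with hx | hx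
    · exact le_of_eq (by simp [hΓ, tailInt, max_eq_right hx])
    · exact hΓanti _ _ hx
  have ha1 : ∀ x, |Real.exp (2 * Γ x)| ≤ Real.exp (2 * Γ x₀) := fun x => by
    rw [abs_of_pos (Real.exp_pos _)]; exact Real.exp_le_exp.2 (by linarith [hΓm x])
  have ha2 : ∀ x, |Real.exp (-(2 * Γ x))| ≤ 1 := fun x => by
    rw [abs_of_pos (Real.exp_pos _)]; exact Real.exp_le_one_iff.2 (by linarith [hΓ0 x])
  have hac : Continuous fun x => Real.exp (2 * Γ x) := by fun_prop
  have hac' : Continuous fun x => Real.exp (-(2 * Γ x)) := by fun_prop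
  set m : (ℝ →ᵇ E) →L[𝕜] (ℝ →ᵇ E) := weightOp 𝕜 _ hac _ ha1
  set m' : (ℝ →ᵇ E) →L[𝕜] (ℝ →ᵇ E) := weightOp 𝕜 _ hac' _ ha2
  have hmm' : m * m' = 1 := by
    ext ψ x
    change ((Real.exp (2 * Γ x) : ℝ) : 𝕜) • ((Real.exp (-(2 * Γ x)) : ℝ) : 𝕜) • ψ x = ψ x
    rw [smul_smul, ← RCLike.ofReal_mul, ← Real.exp_add]; simp
  have hm'm : m' * m = 1 := by
    ext ψ x
    change ((Real.exp (-(2 * Γ x)) : ℝ) : 𝕜) • ((Real.exp (2 * Γ x) : ℝ) : 𝕜) • ψ x = ψ x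
    rw [smul_smul, ← RCLike.ofReal_mul, ← Real.exp_add]; simp
  -- The kernel of m⁻¹ K m. Since κ(x,y) lives on y > x and Γ is nonincreasing, the extra factor is
  -- at most 1 there, so the old majorant still applies.
  set κ₂ : ℝ → ℝ → E →L[𝕜] E := fun x y => ((Real.exp (2 * Γ y - 2 * Γ x) : ℝ) : 𝕜) • κ x y
  have hn : ∀ x y, ‖κ₂ x y‖ = Real.exp (2 * Γ y - 2 * Γ x) * ‖κ x y‖ := fun x y => by
    simp only [κ₂]
    rw [norm_smul, RCLike.norm_ofReal, abs_of_pos (Real.exp_pos _)]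
  have hD : IsDominatedKernel ((Ioi x₀).indicator G) κ₂ := by
    refine ⟨h.isDominatedKernel.integrable, fun x => ?_, fun x y => ?_, fun x => ?_⟩
    · have : Continuous fun y => Real.exp (2 * Γ y - 2 * Γ x) := by fun_prop
      have h2 : Continuous fun y => ((Real.exp (2 * Γ y - 2 * Γ x) : ℝ) : 𝕜) :=
        RCLike.continuous_ofReal.comp this
      exact h2.aestronglyMeasurable.smul (h.meas x)
    · rw [hn]
      rcases le_or_gt y x with hyx | hyx
      · have : ‖κ x y‖ ≤ 0 := (h.bound x y).trans (by
          rw [indicator_of_notMem]; simp [hyx])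
        rw [le_antisymm this (norm_nonneg _), mul_zero]
        exact indicator_nonneg (fun y _ => h.nonneg y) _
      · refine le_trans ?_ (h.isDominatedKernel.bound x y)
        exact mul_le_of_le_one_left (norm_nonneg _)
          (Real.exp_le_one_iff.2 (by linarith [hΓanti x y hyx.le]))
    · filter_upwards [h.cont x] with y hy
      have : Continuous fun s => Real.exp (2 * Γ y - 2 * Γ s) := by fun_prop
      have h2 : Continuous fun s => ((Real.exp (2 * Γ y - 2 * Γ s) : ℝ) : 𝕜) :=
        RCLike.continuous_ofReal.comp this
      exact h2.continuousAt.smul hy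
  have hnorm : ‖kerOp κ₂‖ ≤ 1 / 2 := by
    refine hD.norm_kerOp_le fun x => ?_
    obtain ⟨hi1, hi2⟩ := integral_exp_tailInt_le h.continuous h.integrable x h.nonneg
    have hb : ∀ y, ‖κ₂ x y‖ ≤ (Ioi (max x x₀)).indicator
        (fun y => Real.exp (-(2 * Γ x)) * (Real.exp (2 * Γ y) * G y)) y := by
      intro y
      rw [hn]
      have := h.bound x y
      by_cases hy : y ∈ Ioi (max x x₀)
      · rw [indicator_of_mem hy] at this ⊢
        rw [← mul_assoc, ← Real.exp_add]
        rw [show 2 * Γ y - 2 * Γ x = -(2 * Γ x) + 2 * Γ y by ring]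
        gcongr
      · rw [indicator_of_notMem hy] at this ⊢
        rw [le_antisymm this (norm_nonneg _), mul_zero]
    calc ∫ y, ‖κ₂ x y‖ ≤ ∫ y, (Ioi (max x x₀)).indicator
          (fun y => Real.exp (-(2 * Γ x)) * (Real.exp (2 * Γ y) * G y)) y :=
          integral_mono (hD.integrable_norm x)
            (IntegrableOn.integrable_indicator (hi1.const_mul _) measurableSet_Ioi) hb
      _ = Real.exp (-(2 * Γ x)) * ∫ y in Ioi (max x x₀), Real.exp (2 * Γ y) * G y := by
          rw [integral_indicator measurableSet_Ioi, integral_const_mul]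
      _ ≤ Real.exp (-(2 * Γ x)) * (1 / 2 * Real.exp (2 * Γ x)) := by gcongr
      _ = 1 / 2 := by rw [mul_left_comm, ← Real.exp_add]; simp
  have hK : kerOp κ * m = m * kerOp κ₂ := by
    ext ψ x
    change kerOp κ (m ψ) x = ((Real.exp (2 * Γ x) : ℝ) : 𝕜) • kerOp κ₂ ψ x
    rw [h.isDominatedKernel.kerOp_apply, hD.kerOp_apply, ← integral_smul]
    congr 1; ext y
    change κ x y (((Real.exp (2 * Γ y) : ℝ) : 𝕜) • ψ y) =
      ((Real.exp (2 * Γ x) : ℝ) : 𝕜) • (((Real.exp (2 * Γ y - 2 * Γ x) : ℝ) : 𝕜) • κ x y) (ψ y)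
    rw [map_smul, _root_.smul_apply, smul_smul, ← RCLike.ofReal_mul, ← Real.exp_add]
    ring_nf
  have h1 : 1 - kerOp κ = m * (1 - kerOp κ₂) * m' := by
    have : kerOp κ = m * kerOp κ₂ * m' := by rw [← hK, mul_assoc, hmm', mul_one]
    rw [mul_sub, sub_mul, mul_one, hmm', this]
  rw [h1]
  have u1 : IsUnit m := ⟨⟨m, m', hmm', hm'm⟩, rfl⟩
  have u2 : IsUnit m' := ⟨⟨m', m, hm'm, hmm'⟩, rfl⟩
  exact (u1.mul (isUnit_one_sub_of_norm_lt_one (by linarith))).mul u2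

end Volterra

/-- Solutions of `(1 - K p) ψ = f p` depend differentiably on the parameter. -/
theorem hasDerivWithinAt_inverse_one_sub {𝕜 B : Type*} [RCLike 𝕜] [NormedAddCommGroup B]
    [NormedSpace 𝕜 B] [CompleteSpace B] {K : 𝕜 → B →L[𝕜] B} {K' : B →L[𝕜] B} {f : 𝕜 → B} {f' : B}
    {S : Set 𝕜} {p : 𝕜} (hu : IsUnit (1 - K p)) (hK : HasDerivWithinAt K K' S p)
    (hf : HasDerivWithinAt f f' S p) :
    HasDerivWithinAt (fun s => Ring.inverse (1 - K s) (f s))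
      (Ring.inverse (1 - K p) (f' + K' (Ring.inverse (1 - K p) (f p)))) S p := by
  obtain ⟨U, hU⟩ := hu
  have h1 : HasDerivWithinAt (fun s => 1 - K s) (-K') S p := by
    simpa using hK.const_sub 1
  have h2 := hasFDerivAt_ringInverse (𝕜 := 𝕜) U
  rw [hU] at h2
  have h3 := h2.comp_hasDerivWithinAt p h1
  have h4 := h3.clm_apply hf
  refine h4.congr_deriv ?_
  simp only [Function.comp_apply, ← hU, Ring.inverse_unit]
  simp [ContinuousLinearMap.mulLeftRight_apply, map_add, add_comm]

open BoundedContinuousFunction in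
theorem IsVolterraKernel.exists_solution {𝕜 E : Type*} [RCLike 𝕜] [NormedAddCommGroup E]
    [NormedSpace 𝕜 E] [NormedSpace ℝ E] [SMulCommClass ℝ 𝕜 E] [CompleteSpace E]
    {G : ℝ → ℝ} {x₀ : ℝ} {κ : ℝ → ℝ → E →L[𝕜] E}
    (h : IsVolterraKernel G x₀ κ) (f : ℝ →ᵇ E) (x : ℝ) :
    Ring.inverse (1 - kerOp κ) f x = f x + ∫ y, κ x y (Ring.inverse (1 - kerOp κ) f y) := by
  have h1 := Ring.mul_inverse_cancel _ h.isUnit_one_sub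
  have h2 : (1 - kerOp κ) (Ring.inverse (1 - kerOp κ) f) = f :=
    congrArg (fun L : (ℝ →ᵇ E) →L[𝕜] (ℝ →ᵇ E) => L f) h1
  have h3 : Ring.inverse (1 - kerOp κ) f - kerOp κ (Ring.inverse (1 - kerOp κ) f) = f := h2
  have h4 := congrArg (fun g : ℝ →ᵇ E => g x) h3
  simp only [BoundedContinuousFunction.coe_sub, Pi.sub_apply] at h4
  rw [← h.isDominatedKernel.kerOp_apply, ← h4]; abel

/-! ### The function E(μ,s) and its dependence on μ in the closed right half-plane -/

/-- `∫₀ˢ e^{μ r} dr`. -/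
noncomputable def expInt (μ : ℂ) (s : ℝ) : ℂ := ∫ r in (0 : ℝ)..s, exp (μ * r)

theorem hasDerivAt_expInt (μ : ℂ) (s : ℝ) : HasDerivAt (expInt μ) (exp (μ * s)) s := by
  have : Continuous fun r : ℝ => exp (μ * r) := by fun_prop
  exact this.integral_hasStrictDerivAt 0 s |>.hasDerivAt

theorem continuous_expInt (μ : ℂ) : Continuous (expInt μ) :=
  continuous_iff_continuousAt.2 fun s => (hasDerivAt_expInt μ s).continuousAt

@[simp] theorem expInt_zero (μ : ℂ) : expInt μ 0 = 0 := by simp [expInt]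

/-- This is what makes 1 + E(μ,s)A equal to e^{sA} when A² = μA. Nothing is divided by μ, so the
formula persists at μ = 0, that is at z = ±u₀ and z = ±iu₀. -/
theorem one_add_mul_expInt (μ : ℂ) (s : ℝ) : 1 + μ * expInt μ s = exp (μ * s) := by
  have h : ∀ r ∈ uIcc (0 : ℝ) s, HasDerivAt (fun r : ℝ => exp (μ * r)) (μ * exp (μ * r)) r := by
    intro r _
    have := ((hasDerivAt_id r).ofReal_comp.const_mul μ).cexp
    simpa [mul_comm] using this
  have h2 := intervalIntegral.integral_eq_sub_of_hasDerivAt h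
    (by apply Continuous.intervalIntegrable; fun_prop)
  rw [intervalIntegral.integral_const_mul] at h2
  rw [expInt, h2]; simp

theorem norm_exp_mul_le_one {μ : ℂ} (hμ : 0 ≤ μ.re) {s : ℝ} (hs : s ≤ 0) :
    ‖exp (μ * s)‖ ≤ 1 := by
  rw [norm_exp, Real.exp_le_one_iff]
  simpa using mul_nonpos_of_nonneg_of_nonpos hμ hs

/-- The exponential is bounded by 1 in this range, so E grows at most linearly, uniformly up to Re μ
= 0. This costs one moment of the potential; the derivative in μ costs two. -/
theorem norm_expInt_le {μ : ℂ} (hμ : 0 ≤ μ.re) {s : ℝ} (hs : s ≤ 0) : ‖expInt μ s‖ ≤ -s := by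
  have := intervalIntegral.norm_integral_le_of_norm_le_const (a := 0) (b := s) (C := 1)
    (f := fun r : ℝ => exp (μ * r)) (fun r hr => norm_exp_mul_le_one hμ (by
      rw [uIoc_of_ge hs] at hr; exact hr.2))
  simpa [expInt, abs_of_nonpos hs] using this

theorem norm_exp_sub_exp_le {a b : ℂ} (ha : a.re ≤ 0) (hb : b.re ≤ 0) :
    ‖exp a - exp b‖ ≤ ‖a - b‖ := by
  have := (convex_halfSpace_re_le 0).norm_image_sub_le_of_norm_hasDerivWithin_le
    (f := exp) (f' := exp) (C := 1) (x := b) (y := a)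
    (fun x _ => (hasDerivAt_exp x).hasDerivWithinAt)
    (fun x hx => by rw [norm_exp, Real.exp_le_one_iff]; exact hx) hb ha
  simpa using this

/-- Mean value inequality for w ↦ e^w - w e^b on the segment, its derivative e^w - e^b being bounded
both by 2 and by |a - b|. The first bound supplies a majorant without a further moment, the second
the convergence to zero. -/
theorem norm_exp_sub_exp_sub_le {a b : ℂ} (ha : a.re ≤ 0) (hb : b.re ≤ 0) :
    ‖exp a - exp b - (a - b) * exp b‖ ≤ ‖a - b‖ * min 2 ‖a - b‖ := by
  have hconv : Convex ℝ (segment ℝ b a) := convex_segment b a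
  have hsub : segment ℝ b a ⊆ {c : ℂ | c.re ≤ 0} :=
    (convex_halfSpace_re_le 0).segment_subset hb ha
  have h1 : ∀ C : ℝ, (∀ w ∈ segment ℝ b a, ‖exp w - exp b‖ ≤ C) →
      ‖exp a - exp b - (a - b) * exp b‖ ≤ C * ‖a - b‖ := by
    intro C hC
    have := hconv.norm_image_sub_le_of_norm_hasDerivWithin_le
      (f := fun w => exp w - w * exp b) (f' := fun w => exp w - exp b) (C := C) (x := b) (y := a)
      (fun x _ => by
        have := (hasDerivAt_exp x).sub ((hasDerivAt_id x).mul_const (exp b))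
        exact (this.congr_deriv (by simp)).hasDerivWithinAt) hC (left_mem_segment _ _ _) (right_mem_segment _ _ _)
    refine le_trans (le_of_eq ?_) this
    congr 1; ring
  rw [mul_comm ‖a - b‖, min_mul_of_nonneg _ _ (norm_nonneg _)]
  refine le_min (h1 2 fun w hw => ?_) (h1 _ fun w hw => ?_)
  · have e1 : ‖exp w‖ ≤ 1 := by rw [norm_exp, Real.exp_le_one_iff]; exact hsub hw
    have e2 : ‖exp b‖ ≤ 1 := by rw [norm_exp, Real.exp_le_one_iff]; exact hb
    linarith [norm_sub_le (exp w) (exp b)]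
  · refine (norm_exp_sub_exp_le (hsub hw) hb).trans ?_
    exact norm_sub_le_of_mem_segment hw

/-- The derivative of `expInt` with respect to its first argument. -/
noncomputable def expIntDeriv (μ : ℂ) (s : ℝ) : ℂ := ∫ r in (0 : ℝ)..s, r * exp (μ * r)

theorem continuous_expIntDeriv (μ : ℂ) : Continuous (expIntDeriv μ) :=
  intervalIntegral.continuous_primitive (fun a b => by
    apply Continuous.intervalIntegrable; fun_prop) 0

theorem norm_expIntDeriv_le {μ : ℂ} (hμ : 0 ≤ μ.re) {s : ℝ} (hs : s ≤ 0) :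
    ‖expIntDeriv μ s‖ ≤ s ^ 2 := by
  have := intervalIntegral.norm_integral_le_of_norm_le_const (a := 0) (b := s) (C := -s)
    (f := fun r : ℝ => r * exp (μ * r)) (fun r hr => by
      rw [uIoc_of_ge hs] at hr
      rw [norm_mul, norm_real, Real.norm_eq_abs, abs_of_nonpos hr.2]
      have := norm_exp_mul_le_one hμ hr.2
      nlinarith [hr.1, hr.2, norm_nonneg (exp (μ * r))])
  rw [sub_zero, abs_of_nonpos hs] at this
  rw [expIntDeriv]; nlinarith

/-- A quadratic Taylor remainder would grow like |s|³ and need a third moment. The minimum keeps the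
growth at s² while the factor still tends to 0 as μ → ν for fixed s. -/
theorem norm_expInt_sub_sub_le {μ ν : ℂ} (hμ : 0 ≤ μ.re) (hν : 0 ≤ ν.re) {s : ℝ} (hs : s ≤ 0) :
    ‖expInt μ s - expInt ν s - (μ - ν) * expIntDeriv ν s‖
      ≤ ‖μ - ν‖ * (s ^ 2 * min 2 (‖μ - ν‖ * -s)) := by
  have e : expInt μ s - expInt ν s - (μ - ν) * expIntDeriv ν s
      = ∫ r in (0 : ℝ)..s, (exp (μ * r) - exp (ν * r) - (μ * r - ν * r) * exp (ν * r)) := by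
    rw [expInt, expInt, expIntDeriv, ← intervalIntegral.integral_const_mul,
      ← intervalIntegral.integral_sub, ← intervalIntegral.integral_sub]
    · congr 1; ext r; ring
    all_goals (apply Continuous.intervalIntegrable; fun_prop)
  rw [e]
  have := intervalIntegral.norm_integral_le_of_norm_le_const (a := 0) (b := s)
    (C := ‖μ - ν‖ * -s * min 2 (‖μ - ν‖ * -s))
    (f := fun r : ℝ => exp (μ * r) - exp (ν * r) - (μ * r - ν * r) * exp (ν * r)) (fun r hr => by
      rw [uIoc_of_ge hs] at hr
      have h0 : (μ * r).re ≤ 0 := by simpa using mul_nonpos_of_nonneg_of_nonpos hμ hr.2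
      have h1 : (ν * r).re ≤ 0 := by simpa using mul_nonpos_of_nonneg_of_nonpos hν hr.2
      refine (norm_exp_sub_exp_sub_le h0 h1).trans ?_
      have h2 : ‖μ * r - ν * r‖ ≤ ‖μ - ν‖ * -s := by
        rw [← sub_mul, norm_mul, norm_real, Real.norm_eq_abs, abs_of_nonpos hr.2]
        gcongr; exact hr.1.le
      exact mul_le_mul h2 (min_le_min le_rfl h2) (le_min zero_le_two (norm_nonneg _))
        ((norm_nonneg _).trans h2))
  rw [sub_zero, abs_of_nonpos hs] at this
  refine this.trans (le_of_eq ?_); ring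

/-- The linear map on `ℂ²` with the given entries. -/
noncomputable def mat2 (a b c d : ℂ) : (Fin 2 → ℂ) →L[ℂ] (Fin 2 → ℂ) :=
  a • (ContinuousLinearMap.proj (R := ℂ) (φ := fun _ : Fin 2 => ℂ) 0).smulRight ![1, 0]
    + b • (ContinuousLinearMap.proj (R := ℂ) (φ := fun _ : Fin 2 => ℂ) 1).smulRight ![1, 0]
    + c • (ContinuousLinearMap.proj (R := ℂ) (φ := fun _ : Fin 2 => ℂ) 0).smulRight ![0, 1]
    + d • (ContinuousLinearMap.proj (R := ℂ) (φ := fun _ : Fin 2 => ℂ) 1).smulRight ![0, 1]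

theorem mat2_apply (a b c d : ℂ) (v : Fin 2 → ℂ) :
    mat2 a b c d v = ![a * v 0 + b * v 1, c * v 0 + d * v 1] := by
  ext i; fin_cases i <;> simp [mat2]

/-- Multiplication by the matrix `Q(w)`. -/
noncomputable def potL (w : ℂ) : (Fin 2 → ℂ) →L[ℂ] (Fin 2 → ℂ) := mat2 0 w (conj w) 0

theorem potL_apply (w : ℂ) (v : Fin 2 → ℂ) : potL w v = ![w * v 1, conj w * v 0] := by
  simp [potL, mat2_apply]

theorem norm_potL_le (w : ℂ) : ‖potL w‖ ≤ ‖w‖ := by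
  refine ContinuousLinearMap.opNorm_le_bound _ (norm_nonneg _) fun v => ?_
  rw [potL_apply, pi_norm_le_iff_of_nonneg (by positivity)]
  intro i
  fin_cases i
  · simpa using mul_le_mul_of_nonneg_left (norm_le_pi_norm v 1) (norm_nonneg w)
  · simpa using mul_le_mul_of_nonneg_left (norm_le_pi_norm v 0) (norm_nonneg w)

theorem continuous_potL : Continuous potL := by
  have : Continuous (fun w : ℂ => conj w) := continuous_conj
  unfold potL mat2; fun_prop

/-- Only a real scalar can be pulled out: Q(w) contains w* and is not complex linear in w. -/
theorem potL_sub_sub (a b c : ℂ) (r : ℝ) : potL a - potL b - r • potL c = potL (a - b - r * c) := by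
  ext v i
  fin_cases i <;> simp [potL_apply] <;> ring

/-! ### The Volterra equation of the Jost solution and its differential equation -/

section Kernel

variable {E : Type*} [NormedAddCommGroup E] [NormedSpace ℂ E]

/-- The kernel `(1_{y > m} + A E(μ, m - y)) B(y)`, `m = max(x, x₀)`; for `A² = μ A` its first factor
is `e^{(m-y)A}`. -/
noncomputable def jostKer (μ : ℂ) (A : E →L[ℂ] E) (B : ℝ → E →L[ℂ] E) (x₀ x y : ℝ) : E →L[ℂ] E :=
  ((Ioi (max x x₀)).indicator (fun _ => ContinuousLinearMap.id ℂ E) y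
    + expInt μ (min (max x x₀ - y) 0) • A) ∘L B y

theorem ae_continuousAt_indicator_Ioi (x₀ x : ℝ) (v : E →L[ℂ] E) : ∀ᵐ y : ℝ,
    ContinuousAt (fun s => (Ioi (max s x₀)).indicator (fun _ => v) y) x := by
  have : ∀ᵐ y : ℝ, y ≠ max x x₀ := Measure.ae_ne volume (max x x₀)
  filter_upwards [this] with y hy
  have hc : Continuous fun s : ℝ => max s x₀ := by fun_prop
  rcases lt_or_gt_of_ne hy with h | h
  · refine (continuousAt_const (y := 0)).congr ?_
    filter_upwards [hc.continuousAt.eventually (lt_mem_nhds h)] with s hs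
    rw [indicator_of_notMem]; exact not_lt.2 hs.le
  · refine (continuousAt_const (y := v)).congr ?_
    filter_upwards [hc.continuousAt.eventually (gt_mem_nhds h)] with s hs
    rw [indicator_of_mem]; exact hs

/-- The cut-off min(m - y, 0) makes the second term vanish for y ≤ m without an indicator, because
E(μ,0) = 0, so the kernel jumps only at y = m. The bound |E(μ, m - y)| ≤ y - m ≤ y - x₀ produces the
weight in the hypothesis. -/
theorem isVolterraKernel_jostKer {μ : ℂ} (hμ : 0 ≤ μ.re) (A : E →L[ℂ] E) {B : ℝ → E →L[ℂ] E}
    (hB : Continuous B) {x₀ : ℝ} {G : ℝ → ℝ} (hG : Continuous G)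
    (hi : IntegrableOn G (Ioi x₀)) (hG0 : ∀ x, 0 ≤ G x)
    (hb : ∀ y, x₀ < y → (1 + (y - x₀) * ‖A‖) * ‖B y‖ ≤ G y) :
    IsVolterraKernel G x₀ (jostKer μ A B x₀) where
  continuous := hG
  nonneg := hG0
  integrable := hi
  meas := fun x => by
    have h1 : Continuous fun y => expInt μ (min (max x x₀ - y) 0) • A :=
      ((continuous_expInt μ).comp (by fun_prop)).smul continuous_const
    have h2 : AEStronglyMeasurable (fun y => (Ioi (max x x₀)).indicator
        (fun _ => ContinuousLinearMap.id ℂ E) y) volume :=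
      (aestronglyMeasurable_const).indicator measurableSet_Ioi
    have h3 := h2.add h1.aestronglyMeasurable
    exact (ContinuousLinearMap.compL ℂ E E E).isBoundedBilinearMap.continuous
      |>.comp_aestronglyMeasurable (h3.prodMk hB.aestronglyMeasurable)
  bound := fun x y => by
    have hx : x₀ ≤ max x x₀ := le_max_right _ _
    by_cases hy : y ∈ Ioi (max x x₀)
    · rw [indicator_of_mem hy]
      have hy' : max x x₀ < y := hy
      refine le_trans ?_ (hb y (hx.trans_lt hy'))
      refine (ContinuousLinearMap.opNorm_comp_le _ _).trans ?_
      gcongr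
      rw [indicator_of_mem hy]
      refine (norm_add_le _ _).trans ?_
      gcongr
      · exact ContinuousLinearMap.norm_id_le
      · rw [norm_smul]
        gcongr
        refine (norm_expInt_le hμ (min_le_right _ _)).trans ?_
        rw [min_eq_left (by linarith)]; linarith
    · rw [indicator_of_notMem hy]
      have hy' : y ≤ max x x₀ := not_lt.1 hy
      simp [jostKer, indicator_of_notMem hy, min_eq_right (sub_nonneg.2 hy')]
  cont := fun x => by
    filter_upwards [ae_continuousAt_indicator_Ioi x₀ x (ContinuousLinearMap.id ℂ E)] with y hy
    have h1 : Continuous fun s => expInt μ (min (max s x₀ - y) 0) • A :=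
      ((continuous_expInt μ).comp (by fun_prop)).smul continuous_const
    exact (hy.add h1.continuousAt).clm_comp continuousAt_const

/-- The Volterra representation `ψ(x) = Y - ∫_x^∞ e^{(x-y)A} F(y) dy` yields the differential
equation `ψ' = A ψ + F`. -/
theorem jost_ode [CompleteSpace E] {μ : ℂ} (hμ : 0 ≤ μ.re) {A : E →L[ℂ] E}
    (hA : ∀ v, A (A v) = μ • A v) {F : ℝ → E} (hF : Continuous F) {x₀ : ℝ}
    (hFi : IntegrableOn (fun y => (1 + |y - x₀|) * ‖F y‖) (Ioi x₀)) {Y : E} (hY : A Y = 0)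
    {ψ : ℝ → E} (hψ : ∀ x, x₀ < x → ψ x = Y - ((∫ y in Ioi x, F y)
      + A (∫ y in Ioi x, expInt μ (x - y) • F y))) :
    (∀ x, x₀ < x → HasDerivAt ψ (A (ψ x) + F x) x) ∧ Tendsto ψ atTop (𝓝 Y) := by
  have hFi' : IntegrableOn F (Ioi x₀) := by
    refine Integrable.mono hFi hF.aestronglyMeasurable (ae_of_all _ fun y => ?_)
    rw [norm_mul, norm_norm, Real.norm_eq_abs, abs_of_nonneg (by positivity)]
    nlinarith [abs_nonneg (y - x₀), norm_nonneg (F y)]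
  have hEF : ∀ x y, x₀ < x → x₀ < y → ‖expInt μ (min (x - y) 0) • F y‖
      ≤ (1 + |y - x₀|) * ‖F y‖ := by
    intro x y hx hy
    rw [norm_smul]
    gcongr
    refine (norm_expInt_le hμ (min_le_right _ _)).trans ?_
    rw [abs_of_pos (by linarith)]
    rcases le_total (x - y) 0 with h | h
    · rw [min_eq_left h]; linarith
    · rw [min_eq_right h]; linarith
  have hEc : ∀ x, Continuous fun y => expInt μ (min (x - y) 0) • F y := fun x =>
    ((continuous_expInt μ).comp (by fun_prop)).smul hF
  -- The integral is moved to the fixed half-line (x₀,∞) by truncating the argument of E, so that it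
  -- can be differentiated under the integral sign.
  have hr : ∀ x, x₀ < x → ∫ y in Ioi x, expInt μ (x - y) • F y
      = ∫ y in Ioi x₀, expInt μ (min (x - y) 0) • F y := by
    intro x hx
    have h1 : ∫ y in Ioi x, expInt μ (x - y) • F y
        = ∫ y in Ioi x, expInt μ (min (x - y) 0) • F y :=
      setIntegral_congr_fun measurableSet_Ioi fun y hy => by
        simp only [min_eq_left (sub_nonpos.2 (le_of_lt (mem_Ioi.1 hy)))]
    rw [h1]
    refine (setIntegral_eq_of_subset_of_forall_sdiff_eq_zero measurableSet_Ioi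
      (Ioi_subset_Ioi hx.le) fun y hy => ?_).symm
    have : y ≤ x := not_lt.1 hy.2
    simp [min_eq_right (sub_nonneg.2 this)]
  have hderiv : ∀ x, x₀ < x → HasDerivAt (fun x => ∫ y in Ioi x₀, expInt μ (min (x - y) 0) • F y)
      ((∫ y in Ioi x, F y) + μ • ∫ y in Ioi x, expInt μ (x - y) • F y) x := by
    intro x hx
    -- The truncated integrand has a corner at y = x, so only a Lipschitz bound is available; the
    -- constant is ‖F y‖ because |e^{μr}| ≤ 1 for r ≤ 0.
    have hlip : ∀ y, LipschitzOnWith (Real.nnabs ‖F y‖)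
        (fun x => expInt μ (min (x - y) 0) • F y) (Ioi x₀) := by
      intro y
      have h1 : LipschitzOnWith 1 (expInt μ) (Iic 0) :=
        (convex_Iic (0 : ℝ)).lipschitzOnWith_of_nnnorm_hasDerivWithin_le
          (fun s _ => (hasDerivAt_expInt μ s).hasDerivWithinAt)
          (fun s hs => by simpa using! norm_exp_mul_le_one hμ hs)
      refine LipschitzOnWith.of_dist_le_mul fun a _ b _ => ?_
      rw [dist_eq_norm, ← sub_smul, norm_smul]
      have h2 := h1.dist_le_mul _ (min_le_right (a - y) 0) _ (min_le_right (b - y) 0)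
      rw [dist_eq_norm] at h2
      have h3 : dist (min (a - y) 0) (min (b - y) 0) ≤ dist a b := by
        rw [Real.dist_eq, Real.dist_eq]
        refine (abs_min_sub_min_le_max _ _ _ _).trans ?_
        simp
      have h4 : ‖expInt μ (min (a - y) 0) - expInt μ (min (b - y) 0)‖ ≤ dist a b := by
        refine h2.trans ?_; simpa using h3
      simp only [Real.coe_nnabs, abs_norm]
      rw [mul_comm]; gcongr
    have := hasDerivAt_integral_of_dominated_loc_of_lip (μ := volume.restrict (Ioi x₀))
      (F := fun x y => expInt μ (min (x - y) 0) • F y) (x₀ := x) (s := Ioi x₀)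
      (F' := fun y => (Ioi x).indicator (fun y => exp (μ * ((x - y : ℝ) : ℂ)) • F y) y)
      (bound := fun y => ‖F y‖) (Ioi_mem_nhds hx)
      (Eventually.of_forall fun s => (hEc s).aestronglyMeasurable)
      (Integrable.mono' hFi (hEc x).aestronglyMeasurable
        ((ae_restrict_iff' measurableSet_Ioi).2 (ae_of_all _ fun y hy => hEF x y hx hy)))
      (by
        refine AEStronglyMeasurable.indicator ?_ measurableSet_Ioi
        apply Continuous.aestronglyMeasurable; fun_prop)
      (ae_of_all _ hlip) hFi'.norm (by
        have : ∀ᵐ y ∂(volume.restrict (Ioi x₀)), y ≠ x :=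
          ae_restrict_of_ae (Measure.ae_ne volume x)
        filter_upwards [this] with y hy
        rcases lt_or_gt_of_ne hy with h | h
        · rw [indicator_of_notMem (by simpa using h.le)]
          refine (hasDerivAt_const x (0 : E)).congr_of_eventuallyEq ?_
          filter_upwards [lt_mem_nhds h] with s hs
          simp [min_eq_right (sub_nonneg.2 hs.le)]
        · rw [indicator_of_mem (by simpa using h)]
          have h1 : HasDerivAt (fun s : ℝ => expInt μ (s - y)) (exp (μ * ((x - y : ℝ) : ℂ))) x := by
            have := (hasDerivAt_expInt μ (x - y)).scomp x ((hasDerivAt_id x).sub_const y)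
            simpa [Function.comp_def] using this
          refine (h1.smul_const (F y)).congr_of_eventuallyEq ?_
          filter_upwards [gt_mem_nhds h] with s hs
          rw [min_eq_left (sub_nonpos.2 hs.le)])
    convert this.2 using 1
    have hsub : Ioi x ⊆ Ioi x₀ := Ioi_subset_Ioi hx.le
    have iE : IntegrableOn (fun y => expInt μ (x - y) • F y) (Ioi x) := by
      have : IntegrableOn (fun y => expInt μ (min (x - y) 0) • F y) (Ioi x) :=
        Integrable.mono' (hFi.mono_set hsub) (hEc x).aestronglyMeasurable
          ((ae_restrict_iff' measurableSet_Ioi).2 (ae_of_all _ fun y hy => hEF x y hx (hsub hy)))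
      exact this.congr_fun (fun y hy => by
        simp only [min_eq_left (sub_nonpos.2 (le_of_lt (mem_Ioi.1 hy)))]) measurableSet_Ioi
    rw [integral_indicator measurableSet_Ioi, Measure.restrict_restrict measurableSet_Ioi,
      inter_eq_left.2 hsub, ← integral_smul]
    have e1 := integral_add (hFi'.mono_set hsub) (iE.smul μ)
    simp only [Pi.smul_apply] at e1
    rw [← e1]
    refine setIntegral_congr_fun measurableSet_Ioi fun y _ => ?_
    rw [← one_add_mul_expInt, add_smul, one_smul, mul_smul]
  constructor
  · intro x hx
    have h1 := hasDerivAt_integral_Ioi hFi' hx hF.continuousAt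
      (fun b _ => hF.stronglyMeasurableAtFilter _ _)
    have h2 := (A.hasFDerivAt (x := ∫ y in Ioi x₀, expInt μ (min (x - y) 0) • F y)
      |>.restrictScalars ℝ).comp_hasDerivAt x (hderiv x hx)
    have h3 := (h1.add h2).const_sub Y
    have h4 : HasDerivAt ψ _ x := h3.congr_of_eventuallyEq (by
      filter_upwards [Ioi_mem_nhds hx] with s hs
      rw [hψ s hs, hr s hs]; rfl)
    refine h4.congr_deriv ?_
    rw [hψ x hx]
    simp only [ContinuousLinearMap.coe_restrictScalars', map_add, map_sub, map_smul, hA, hY]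
    abel
  · have h1 : Tendsto (fun x => ∫ y in Ioi x, F y) atTop (𝓝 0) := by
      have h1 := intervalIntegral_tendsto_integral_Ioi x₀ hFi' tendsto_id
      have h2 := (h1.const_sub (∫ y in Ioi x₀, F y))
      rw [sub_self] at h2
      refine h2.congr' ?_
      filter_upwards [eventually_ge_atTop x₀] with s hs
      have := intervalIntegral.integral_Ioi_sub_Ioi' (a := x₀) (b := s) hFi'
        (hFi'.mono_set (Ioi_subset_Ioi hs))
      simp only [id]; rw [← this]; abel
    have h2 : Tendsto (fun x => ∫ y in Ioi x₀, expInt μ (min (x - y) 0) • F y) atTop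
        (𝓝 (∫ y in Ioi x₀, (0 : E))) := by
      refine tendsto_integral_filter_of_dominated_convergence _
        (Eventually.of_forall fun s => (hEc s).aestronglyMeasurable) ?_ hFi
        (ae_of_all _ fun y => ?_)
      · filter_upwards [eventually_gt_atTop x₀] with s hs
        exact (ae_restrict_iff' measurableSet_Ioi).2 (ae_of_all _ fun y hy => hEF s y hs hy)
      · refine tendsto_const_nhds.congr' ?_
        filter_upwards [eventually_ge_atTop y] with s hs
        simp [min_eq_right (sub_nonneg.2 hs)]
    rw [integral_zero] at h2
    have h3 := (h1.add ((A.continuous.tendsto 0).comp h2)).const_sub Y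
    simp only [map_zero, add_zero, sub_zero] at h3
    refine h3.congr' ?_
    filter_upwards [eventually_gt_atTop x₀] with s hs
    rw [hψ s hs, hr s hs]; rfl

end Kernel

section JostFamily

open BoundedContinuousFunction

variable {E : Type*} [NormedAddCommGroup E] [NormedSpace ℂ E]

/-- The kernel `E(μ, m - y) V(y)`, `m = max(x, x₀)`. -/
noncomputable def expKer (μ : ℂ) (V : ℝ → E →L[ℂ] E) (x₀ x y : ℝ) : E →L[ℂ] E :=
  expInt μ (min (max x x₀ - y) 0) • V y

/-- The derivative of `expKer` with respect to its first argument. -/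
noncomputable def expKerDeriv (μ : ℂ) (V : ℝ → E →L[ℂ] E) (x₀ x y : ℝ) : E →L[ℂ] E :=
  expIntDeriv μ (min (max x x₀ - y) 0) • V y

theorem neg_min_sub_le {x₀ x y : ℝ} (hy : x₀ < y) : -(min (max x x₀ - y) 0) ≤ y - x₀ := by
  rcases le_total (max x x₀ - y) 0 with h | h
  · rw [min_eq_left h]; linarith [le_max_right x x₀]
  · rw [min_eq_right h]; linarith

theorem min_sub_eq_zero {x₀ x y : ℝ} (hy : y ≤ x₀) : min (max x x₀ - y) 0 = 0 :=
  min_eq_right (by linarith [le_max_right x x₀])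

theorem isDominatedKernel_expKer {μ : ℂ} (hμ : 0 ≤ μ.re) {V : ℝ → E →L[ℂ] E} (hV : Continuous V)
    {x₀ : ℝ} (hi : IntegrableOn (fun y => (1 + |y - x₀|) ^ 2 * ‖V y‖) (Ioi x₀)) :
    IsDominatedKernel ((Ioi x₀).indicator fun y => (1 + |y - x₀|) ^ 2 * ‖V y‖)
      (expKer μ V x₀) where
  integrable := hi.integrable_indicator measurableSet_Ioi
  meas := fun x => (((continuous_expInt μ).comp (by fun_prop)).smul hV).aestronglyMeasurable
  bound := fun x y => by
    by_cases hy : y ∈ Ioi x₀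
    · rw [indicator_of_mem hy, expKer, norm_smul]
      gcongr
      refine (norm_expInt_le hμ (min_le_right _ _)).trans ((neg_min_sub_le hy).trans ?_)
      nlinarith [le_abs_self (y - x₀), abs_nonneg (y - x₀)]
    · rw [indicator_of_notMem hy, expKer, min_sub_eq_zero (not_lt.1 hy)]; simp
  cont := fun x => ae_of_all _ fun y => by
    have : Continuous fun s => expInt μ (min (max s x₀ - y) 0) • V y :=
      ((continuous_expInt μ).comp (by fun_prop)).smul continuous_const
    exact this.continuousAt

theorem isDominatedKernel_expKerDeriv {μ : ℂ} (hμ : 0 ≤ μ.re) {V : ℝ → E →L[ℂ] E}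
    (hV : Continuous V) {x₀ : ℝ}
    (hi : IntegrableOn (fun y => (1 + |y - x₀|) ^ 2 * ‖V y‖) (Ioi x₀)) :
    IsDominatedKernel ((Ioi x₀).indicator fun y => (1 + |y - x₀|) ^ 2 * ‖V y‖)
      (expKerDeriv μ V x₀) where
  integrable := hi.integrable_indicator measurableSet_Ioi
  meas := fun x => (((continuous_expIntDeriv μ).comp (by fun_prop)).smul hV).aestronglyMeasurable
  bound := fun x y => by
    by_cases hy : y ∈ Ioi x₀
    · rw [indicator_of_mem hy, expKerDeriv, norm_smul]
      gcongr
      refine (norm_expIntDeriv_le hμ (min_le_right _ _)).trans ?_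
      have h1 := neg_min_sub_le (x := x) hy
      have h2 : 0 ≤ -(min (max x x₀ - y) 0) := neg_nonneg.2 (min_le_right _ _)
      nlinarith [le_abs_self (y - x₀), abs_nonneg (y - x₀)]
    · rw [indicator_of_notMem hy, expKerDeriv, min_sub_eq_zero (not_lt.1 hy)]; simp [expIntDeriv]
  cont := fun x => ae_of_all _ fun y => by
    have : Continuous fun s => expIntDeriv μ (min (max s x₀ - y) 0) • V y :=
      ((continuous_expIntDeriv μ).comp (by fun_prop)).smul continuous_const
    exact this.continuousAt

/-- Dominated convergence with majorant 2(1 + |y - x₀|)² ‖V y‖: exactly two moments suffice. The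
derivative is taken within the closed half-plane, so boundary points Re μ = 0 are included. -/
theorem hasDerivWithinAt_kerOp_expKer [CompleteSpace E] {μ₀ : ℂ} (hμ₀ : 0 ≤ μ₀.re)
    {V : ℝ → E →L[ℂ] E} (hV : Continuous V) {x₀ : ℝ}
    (hi : IntegrableOn (fun y => (1 + |y - x₀|) ^ 2 * ‖V y‖) (Ioi x₀)) :
    HasDerivWithinAt (fun μ => kerOp (expKer μ V x₀)) (kerOp (expKerDeriv μ₀ V x₀))
      {μ | 0 ≤ μ.re} μ₀ := by
  set η : ℂ → ℝ → ℝ := fun μ => (Ioi x₀).indicator fun y =>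
    (y - x₀) ^ 2 * min 2 (‖μ - μ₀‖ * (y - x₀)) * ‖V y‖ with hη
  have hηc : ∀ μ, Continuous fun y => (y - x₀) ^ 2 * min 2 (‖μ - μ₀‖ * (y - x₀)) * ‖V y‖ :=
    fun μ => by fun_prop
  have hηm : ∀ μ, AEStronglyMeasurable (η μ) volume := fun μ =>
    (hηc μ).aestronglyMeasurable.indicator measurableSet_Ioi
  have hηb : ∀ μ y, ‖η μ y‖ ≤ 2 * (Ioi x₀).indicator (fun y => (1 + |y - x₀|) ^ 2 * ‖V y‖) y := by
    intro μ y
    by_cases hy : y ∈ Ioi x₀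
    · have hy' : 0 < y - x₀ := sub_pos.2 hy
      simp only [hη]
      rw [indicator_of_mem hy, indicator_of_mem hy, Real.norm_eq_abs, abs_of_nonneg (by positivity),
        abs_of_pos hy', ← mul_assoc]
      refine mul_le_mul_of_nonneg_right ?_ (norm_nonneg _)
      calc (y - x₀) ^ 2 * min 2 (‖μ - μ₀‖ * (y - x₀)) ≤ (y - x₀) ^ 2 * 2 := by
            gcongr; exact min_le_left _ _
        _ ≤ 2 * (1 + (y - x₀)) ^ 2 := by nlinarith
    · simp [hη, indicator_of_notMem hy]
  have hI := (hi.integrable_indicator measurableSet_Ioi).const_mul 2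
  refine hasDerivWithinAt_kerOp (η := η) (show μ₀ ∈ {μ : ℂ | 0 ≤ μ.re} from hμ₀)
    (fun μ hμ => isDominatedKernel_expKer hμ hV hi) (isDominatedKernel_expKerDeriv hμ₀ hV hi)
    (fun μ hμ x y => ?_)
    (fun μ _ => hI.mono' (hηm μ) (ae_of_all _ (hηb μ))) ?_
  · by_cases hy : y ∈ Ioi x₀
    · have h1 := neg_min_sub_le (x := x) hy
      have h0 : min (max x x₀ - y) 0 ≤ 0 := min_le_right _ _
      simp only [expKer, expKerDeriv, hη]
      rw [indicator_of_mem hy, ← sub_smul, smul_smul, ← sub_smul, norm_smul, ← mul_assoc]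
      gcongr
      refine (norm_expInt_sub_sub_le hμ hμ₀ h0).trans ?_
      have h3 : (min (max x x₀ - y) 0) ^ 2 ≤ (y - x₀) ^ 2 := by nlinarith
      have h4 : 0 < y - x₀ := sub_pos.2 hy
      have h5 : 0 ≤ min 2 (‖μ - μ₀‖ * -(min (max x x₀ - y) 0)) :=
        le_min zero_le_two (mul_nonneg (norm_nonneg _) (neg_nonneg.2 h0))
      gcongr
    · rw [expKer, expKer, expKerDeriv, min_sub_eq_zero (not_lt.1 hy)]
      simp [expIntDeriv, hη, indicator_of_notMem hy]
  · have : Tendsto (fun μ => ∫ y, η μ y) (𝓝[{μ : ℂ | 0 ≤ μ.re}] μ₀) (𝓝 (∫ _ : ℝ, (0 : ℝ))) := by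
      refine tendsto_integral_filter_of_dominated_convergence _ (Eventually.of_forall hηm)
        (Eventually.of_forall fun μ => ae_of_all _ (hηb μ)) hI (ae_of_all _ fun y => ?_)
      refine tendsto_nhdsWithin_of_tendsto_nhds ?_
      have : Continuous fun μ => η μ y := by
        by_cases hy : y ∈ Ioi x₀
        · simp only [hη, indicator_of_mem hy]; fun_prop
        · simp only [hη, indicator_of_notMem hy]; fun_prop
      have h2 := this.tendsto μ₀
      by_cases hy : y ∈ Ioi x₀
      · simpa [hη, indicator_of_mem hy] using h2
      · simp [hη, indicator_of_notMem hy]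
    simpa using this

/-- Pointwise application of a linear map, as a continuous linear function of the map. -/
noncomputable def pointwiseOp (E : Type*) [NormedAddCommGroup E] [NormedSpace ℂ E] :
    (E →L[ℂ] E) →L[ℂ] ((ℝ →ᵇ E) →L[ℂ] (ℝ →ᵇ E)) :=
  LinearMap.mkContinuous
    { toFun := fun g => g.compLeftContinuousBounded ℝ
      map_add' := fun g h => by ext; simp
      map_smul' := fun c g => by ext; simp } 1 fun g => by
    rw [one_mul]
    refine ContinuousLinearMap.opNorm_le_bound _ (norm_nonneg _) fun ψ => ?_
    refine (BoundedContinuousFunction.norm_le (by positivity)).2 fun x => ?_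
    exact g.le_opNorm_of_le (ψ.norm_coe_le_norm x)

theorem integrableOn_weight_of_sq {V : ℝ → E →L[ℂ] E} (hV : Continuous V)
    {x₀ : ℝ} (hi : IntegrableOn (fun y => (1 + |y - x₀|) ^ 2 * ‖V y‖) (Ioi x₀)) (C : ℝ) :
    IntegrableOn (fun y => C * ((1 + |y - x₀|) * ‖V y‖)) (Ioi x₀) := by
  refine Integrable.const_mul ?_ C
  refine Integrable.mono hi (by apply Continuous.aestronglyMeasurable; fun_prop)
    (ae_of_all _ fun y => ?_)
  rw [Real.norm_of_nonneg (by positivity), Real.norm_of_nonneg (by positivity)]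
  gcongr
  nlinarith [abs_nonneg (y - x₀)]

theorem isVolterraKernel_jostKer' {μ : ℂ} (hμ : 0 ≤ μ.re) (A : E →L[ℂ] E) {V : ℝ → E →L[ℂ] E}
    (hV : Continuous V) {x₀ : ℝ}
    (hi : IntegrableOn (fun y => (1 + |y - x₀|) ^ 2 * ‖V y‖) (Ioi x₀)) :
    IsVolterraKernel (fun y => (1 + ‖A‖) * ((1 + |y - x₀|) * ‖V y‖)) x₀ (jostKer μ A V x₀) := by
  refine isVolterraKernel_jostKer hμ A hV (by fun_prop) (integrableOn_weight_of_sq hV hi _)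
    (fun x => by positivity) fun y hy => ?_
  have : 0 < y - x₀ := sub_pos.2 hy
  rw [← mul_assoc, abs_of_pos this]
  gcongr
  nlinarith [norm_nonneg A]

/-- Separates the dependence on the spectral parameter: c and A enter as plain factors and μ only
through `expKer`. Differentiability in z is then the product rule and the chain rule. -/
theorem kerOp_jostKer_eq [CompleteSpace E] {μ : ℂ} (hμ : 0 ≤ μ.re) (A : E →L[ℂ] E) (c : ℂ)
    {V : ℝ → E →L[ℂ] E} (hV : Continuous V) {x₀ : ℝ}
    (hi : IntegrableOn (fun y => (1 + |y - x₀|) ^ 2 * ‖V y‖) (Ioi x₀)) :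
    kerOp (jostKer μ A (fun y => c • V y) x₀)
      = c • (kerOp (jostKer 0 0 V x₀) + pointwiseOp E A * kerOp (expKer μ V x₀)) := by
  have hV' : Continuous fun y => c • V y := hV.const_smul c
  have hi' : IntegrableOn (fun y => (1 + |y - x₀|) ^ 2 * ‖c • V y‖) (Ioi x₀) := by
    refine (Integrable.const_mul hi ‖c‖).congr (ae_of_all _ fun y => ?_)
    simp only [norm_smul]; ring
  have k1 := (isVolterraKernel_jostKer' hμ A hV' hi').isDominatedKernel
  have k2 := (isVolterraKernel_jostKer' (μ := 0) (by simp) 0 hV hi).isDominatedKernel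
  have k3 := isDominatedKernel_expKer hμ hV hi
  ext1 ψ
  refine BoundedContinuousFunction.ext fun x => ?_
  have e : (c • (kerOp (jostKer 0 0 V x₀) + pointwiseOp E A * kerOp (expKer μ V x₀))) ψ x
      = c • (kerOp (jostKer 0 0 V x₀) ψ x + A (kerOp (expKer μ V x₀) ψ x)) := rfl
  rw [e, k1.kerOp_apply, k2.kerOp_apply, k3.kerOp_apply,
    ← ContinuousLinearMap.integral_comp_comm A (k3.integrable_apply ψ x),
    ← integral_add (k2.integrable_apply ψ x) (A.integrable_comp (k3.integrable_apply ψ x)),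
    ← integral_smul]
  congr 1; ext y
  simp only [jostKer, expKer, ContinuousLinearMap.comp_apply, _root_.add_apply,
    _root_.smul_apply, map_smul, smul_zero, add_zero, smul_add]

/-- The solution of the Volterra equation `ψ = Y + ∫ jostKer μ A V ψ`. -/
noncomputable def jostVolterra (μ : ℂ) (A : E →L[ℂ] E) (V : ℝ → E →L[ℂ] E) (Y : E) (x₀ : ℝ) :
    ℝ →ᵇ E :=
  Ring.inverse (1 - kerOp (jostKer μ A V x₀)) (BoundedContinuousFunction.const ℝ Y)

theorem differentiableWithinAt_jostVolterra [CompleteSpace E] {S : Set ℂ} {z₀ : ℂ} (hz₀ : z₀ ∈ S)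
    {μ c : ℂ → ℂ} {A : ℂ → E →L[ℂ] E} {Y : ℂ → E} (hμ : ∀ z ∈ S, 0 ≤ (μ z).re)
    (dμ : DifferentiableWithinAt ℂ μ S z₀) (dc : DifferentiableWithinAt ℂ c S z₀)
    (dA : DifferentiableWithinAt ℂ A S z₀) (dY : DifferentiableWithinAt ℂ Y S z₀)
    {V : ℝ → E →L[ℂ] E} (hV : Continuous V) {x₀ : ℝ}
    (hi : IntegrableOn (fun y => (1 + |y - x₀|) ^ 2 * ‖V y‖) (Ioi x₀)) :
    DifferentiableWithinAt ℂ
      (fun z => jostVolterra (μ z) (A z) (fun y => c z • V y) (Y z) x₀) S z₀ := by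
  have d1 : DifferentiableWithinAt ℂ (fun z => kerOp (expKer (μ z) V x₀)) S z₀ :=
    ((hasDerivWithinAt_kerOp_expKer (hμ z₀ hz₀) hV hi).differentiableWithinAt).comp z₀ dμ hμ
  have d2 : DifferentiableWithinAt ℂ (fun z => pointwiseOp E (A z)) S z₀ :=
    (pointwiseOp E).differentiableAt.comp_differentiableWithinAt z₀ dA
  have d3 : DifferentiableWithinAt ℂ (fun z => c z • (kerOp (jostKer 0 0 V x₀)
      + pointwiseOp E (A z) * kerOp (expKer (μ z) V x₀))) S z₀ :=
    dc.smul ((differentiableWithinAt_const _).add (d2.mul d1))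
  have d4 : DifferentiableWithinAt ℂ
      (fun z => kerOp (jostKer (μ z) (A z) (fun y => c z • V y) x₀)) S z₀ :=
    d3.congr (fun z hz => kerOp_jostKer_eq (hμ z hz) (A z) (c z) hV hi)
      (kerOp_jostKer_eq (hμ z₀ hz₀) (A z₀) (c z₀) hV hi)
  have hi' : IntegrableOn (fun y => (1 + |y - x₀|) ^ 2 * ‖c z₀ • V y‖) (Ioi x₀) := by
    refine (Integrable.const_mul hi ‖c z₀‖).congr (ae_of_all _ fun y => ?_)
    simp only [norm_smul]; ring
  have hu := (isVolterraKernel_jostKer' (hμ z₀ hz₀) (A z₀) (hV.const_smul (c z₀))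
    hi').isUnit_one_sub
  have d5 : DifferentiableWithinAt ℂ (fun z => BoundedContinuousFunction.const ℝ (Y z)) S z₀ :=
    (ContinuousLinearMap.differentiableAt (LinearMap.mkContinuous
      { toFun := fun v : E => BoundedContinuousFunction.const ℝ v
        map_add' := fun v w => by ext; rfl
        map_smul' := fun c v => by ext; rfl } 1 fun v => by
      rw [one_mul]; exact BoundedContinuousFunction.norm_const_le v)).comp_differentiableWithinAt
      z₀ dY
  exact (hasDerivWithinAt_inverse_one_sub hu d4.hasDerivWithinAt
    d5.hasDerivWithinAt).differentiableWithinAt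

theorem jostVolterra_apply [CompleteSpace E] {μ : ℂ} (hμ : 0 ≤ μ.re) (A : E →L[ℂ] E)
    {V : ℝ → E →L[ℂ] E} (hV : Continuous V) {x₀ : ℝ}
    (hi : IntegrableOn (fun y => (1 + |y - x₀|) ^ 2 * ‖V y‖) (Ioi x₀)) (Y : E) (x : ℝ) :
    jostVolterra μ A V Y x₀ x = Y + ∫ y, jostKer μ A V x₀ x y (jostVolterra μ A V Y x₀ y) :=
  (isVolterraKernel_jostKer' hμ A hV hi).exists_solution _ x

theorem integral_jostKer_apply [CompleteSpace E] {μ : ℂ} (hμ : 0 ≤ μ.re) (A : E →L[ℂ] E)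
    {V : ℝ → E →L[ℂ] E} (hV : Continuous V) {x₀ : ℝ}
    (hi : IntegrableOn (fun y => (1 + |y - x₀|) ^ 2 * ‖V y‖) (Ioi x₀)) (ψ : ℝ →ᵇ E) {x : ℝ}
    (hx : x₀ < x) :
    ∫ y, jostKer μ A V x₀ x y (ψ y)
      = (∫ y in Ioi x, V y (ψ y)) + A (∫ y in Ioi x, expInt μ (x - y) • V y (ψ y)) := by
  have k2 := (isVolterraKernel_jostKer' (μ := 0) (by simp) 0 hV hi).isDominatedKernel
  have k3 := isDominatedKernel_expKer hμ hV hi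
  have hm : max x x₀ = x := max_eq_left hx.le
  have e2 : (∫ y in Ioi x, V y (ψ y)) = ∫ y, jostKer 0 0 V x₀ x y (ψ y) := by
    rw [← integral_indicator measurableSet_Ioi]
    congr 1; ext y
    by_cases hy : y ∈ Ioi x <;> simp [jostKer, hm, hy]
  have e3 : (∫ y in Ioi x, expInt μ (x - y) • V y (ψ y)) = ∫ y, expKer μ V x₀ x y (ψ y) := by
    rw [← integral_indicator measurableSet_Ioi]
    congr 1; ext y
    by_cases hy : y ∈ Ioi x
    · simp only [expKer, hm, indicator_of_mem hy]
      rw [min_eq_left (sub_nonpos.2 (le_of_lt (mem_Ioi.1 hy)))]; rfl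
    · simp only [expKer, hm, indicator_of_notMem hy]
      rw [min_eq_right (sub_nonneg.2 (not_lt.1 hy))]; simp
  rw [e2, e3, ← ContinuousLinearMap.integral_comp_comm A (k3.integrable_apply ψ x),
    ← integral_add (k2.integrable_apply ψ x) (A.integrable_comp (k3.integrable_apply ψ x))]
  congr 1; ext y
  simp only [jostKer, expKer, ContinuousLinearMap.comp_apply, _root_.add_apply,
    _root_.smul_apply, map_smul, smul_zero, add_zero]

theorem jostVolterra_ode [CompleteSpace E] {μ : ℂ} (hμ : 0 ≤ μ.re) {A : E →L[ℂ] E}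
    (hA : ∀ v, A (A v) = μ • A v)
    {V : ℝ → E →L[ℂ] E} (hV : Continuous V) {x₀ : ℝ}
    (hi : IntegrableOn (fun y => (1 + |y - x₀|) ^ 2 * ‖V y‖) (Ioi x₀)) {Y : E} (hY : A Y = 0) :
    (∀ x, x₀ < x → HasDerivAt (jostVolterra μ A V Y x₀)
      (A (jostVolterra μ A V Y x₀ x) - V x (jostVolterra μ A V Y x₀ x)) x) ∧
    Tendsto (jostVolterra μ A V Y x₀) atTop (𝓝 Y) := by
  set ψ := jostVolterra μ A V Y x₀
  have hF : Continuous fun y => -(V y (ψ y)) := (hV.clm_apply ψ.continuous).neg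
  have := jost_ode hμ hA hF (x₀ := x₀) (Y := Y) (ψ := ψ) ?_ hY ?_
  · simpa [sub_eq_add_neg] using this
  · refine Integrable.mono' (integrableOn_weight_of_sq hV hi ‖ψ‖)
      (by apply Continuous.aestronglyMeasurable; fun_prop) (ae_of_all _ fun y => ?_)
    rw [Real.norm_eq_abs, abs_of_nonneg (by positivity), norm_neg]
    have := (V y).le_opNorm_of_le (ψ.norm_coe_le_norm y)
    calc (1 + |y - x₀|) * ‖V y (ψ y)‖ ≤ (1 + |y - x₀|) * (‖V y‖ * ‖ψ‖) := by gcongr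
      _ = _ := by ring
  · intro x hx
    rw [jostVolterra_apply hμ A hV hi, integral_jostKer_apply hμ A hV hi ψ hx]
    simp only [smul_neg, integral_neg, map_neg]
    abel

end JostFamily

/-! ### Regularity and uniform bounds for the potential -/

namespace NZBC

variable {P : NZBC}

/-- The derivative `u_x`. -/
noncomputable def ux (P : NZBC) (x t : ℝ) : ℂ := deriv (fun y => P.u y t) x

/-- The derivative `u_xx`. -/
noncomputable def uxx (P : NZBC) (x t : ℝ) : ℂ := deriv (deriv (fun y => P.u y t)) x

/-- The derivative `u_t`. -/
noncomputable def ut (P : NZBC) (x t : ℝ) : ℂ := deriv (fun s => P.u x s) t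

namespace IsSolution

theorem ux_eq (hP : P.IsSolution) (x t : ℝ) :
    P.ux x t = fderiv ℝ (fun p : ℝ × ℝ => P.u p.1 p.2) (x, t) (1, 0) ∧
    HasDerivAt (fun y => P.u y t) (P.ux x t) x := by
  have h1 : HasFDerivAt (fun p : ℝ × ℝ => P.u p.1 p.2) _ (x, t) :=
    ((hP.contDiff.differentiable (by norm_num)) (x, t)).hasFDerivAt
  have h2 : HasDerivAt (fun y : ℝ => (y, t)) ((1 : ℝ), (0 : ℝ)) x :=
    (hasDerivAt_id x).prodMk (hasDerivAt_const x t)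
  have h3 : HasDerivAt ((fun p : ℝ × ℝ => P.u p.1 p.2) ∘ fun y : ℝ => (y, t)) _ x :=
    h1.comp_hasDerivAt x h2
  change HasDerivAt (fun y => P.u y t) _ x at h3
  exact ⟨h3.deriv, h3.differentiableAt.hasDerivAt⟩

theorem ut_eq (hP : P.IsSolution) (x t : ℝ) :
    P.ut x t = fderiv ℝ (fun p : ℝ × ℝ => P.u p.1 p.2) (x, t) (0, 1) ∧
    HasDerivAt (fun s => P.u x s) (P.ut x t) t := by
  have h1 : HasFDerivAt (fun p : ℝ × ℝ => P.u p.1 p.2) _ (x, t) :=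
    ((hP.contDiff.differentiable (by norm_num)) (x, t)).hasFDerivAt
  have h2 : HasDerivAt (fun s : ℝ => (x, s)) ((0 : ℝ), (1 : ℝ)) t :=
    (hasDerivAt_const t x).prodMk (hasDerivAt_id t)
  have h3 : HasDerivAt (fun s => P.u x s) _ t := h1.comp_hasDerivAt t h2
  exact ⟨h3.deriv, h3.differentiableAt.hasDerivAt⟩

theorem hasDerivAt_u (hP : P.IsSolution) (x t : ℝ) :
    HasDerivAt (fun y => P.u y t) (P.ux x t) x := (hP.ux_eq x t).2

theorem hasDerivAt_u_time (hP : P.IsSolution) (x t : ℝ) :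
    HasDerivAt (fun s => P.u x s) (P.ut x t) t := (hP.ut_eq x t).2

theorem hasDerivAt_ux (hP : P.IsSolution) (x t : ℝ) :
    HasDerivAt (fun y => P.ux y t) (P.uxx x t) x := by
  have h1 : ContDiff ℝ 1 (fun p : ℝ × ℝ => fderiv ℝ (fun p : ℝ × ℝ => P.u p.1 p.2) p (1, 0)) :=
    (hP.contDiff.fderiv_right (m := 1) (by norm_num)).clm_apply contDiff_const
  have h2 : Differentiable ℝ (fun y : ℝ => P.ux y t) := by
    have e : (fun y : ℝ => P.ux y t) = fun y =>
        fderiv ℝ (fun p : ℝ × ℝ => P.u p.1 p.2) (y, t) (1, 0) := funext fun y => (hP.ux_eq y t).1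
    rw [e]
    exact (h1.differentiable (by norm_num)).comp (by fun_prop : Differentiable ℝ fun y : ℝ => (y, t))
  exact (h2 x).hasDerivAt

theorem continuous_u (hP : P.IsSolution) (t : ℝ) : Continuous fun y => P.u y t :=
  continuous_iff_continuousAt.2 fun x => (hP.hasDerivAt_u x t).continuousAt

theorem continuous_ux (hP : P.IsSolution) (t : ℝ) : Continuous fun y => P.ux y t :=
  continuous_iff_continuousAt.2 fun x => (hP.hasDerivAt_ux x t).continuousAt

theorem continuous_ut (hP : P.IsSolution) (t : ℝ) : Continuous fun y => P.ut y t := by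
  have h1 : ContDiff ℝ 1 (fun p : ℝ × ℝ => fderiv ℝ (fun p : ℝ × ℝ => P.u p.1 p.2) p (0, 1)) :=
    (hP.contDiff.fderiv_right (m := 1) (by norm_num)).clm_apply contDiff_const
  have e : (fun y : ℝ => P.ut y t) = fun y =>
      fderiv ℝ (fun p : ℝ × ℝ => P.u p.1 p.2) (y, t) (0, 1) := funext fun y => (hP.ut_eq y t).1
  rw [e]
  exact h1.continuous.comp (by fun_prop : Continuous fun y : ℝ => (y, t))

theorem equation' (hP : P.IsSolution) (x t : ℝ) :
    I * P.ut x t + P.uxx x t + 4 * I * P.α * P.ux x t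
      + I / P.α * (2 * P.u x t * conj (P.u x t) * P.ux x t
        + P.u x t ^ 2 * conj (P.ux x t)) = 0 := by
  have h := hP.equation x t
  have e : deriv (fun y => ((‖P.u y t‖ ^ 2 : ℝ) : ℂ) * P.u y t) x
      = 2 * P.u x t * conj (P.u x t) * P.ux x t + P.u x t ^ 2 * conj (P.ux x t) := by
    have e1 : (fun y => ((‖P.u y t‖ ^ 2 : ℝ) : ℂ) * P.u y t)
        = fun y => P.u y t * conj (P.u y t) * P.u y t := by
      ext y; rw [mul_conj, normSq_eq_norm_sq]
    have h1 := hP.hasDerivAt_u x t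
    have h2 : HasDerivAt (fun y => conj (P.u y t)) (conj (P.ux x t)) x := by
      simpa using! h1.star
    have h3 : HasDerivAt (fun y => P.u y t * conj (P.u y t) * P.u y t) _ x := (h1.mul h2).mul h1
    rw [e1, h3.deriv]
    simp only [Pi.mul_apply]
    ring
  rw [e] at h
  exact h

end IsSolution

theorem integrable_of_weight {g : ℝ → ℝ} (hg : Integrable fun x => (1 + x ^ 2) * g x) (x₀ : ℝ) :
    Integrable fun y => (1 + |y - x₀|) ^ 2 * g y := by
  have hc : Continuous fun y : ℝ => (1 + |y - x₀|) ^ 2 / (1 + y ^ 2) :=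
    Continuous.div (by fun_prop) (by fun_prop) fun y => by positivity
  -- With a = 1 + |x₀| ≥ 1: (a + |y|)² ≤ 2(a² + y²) ≤ 2a²(1 + y²).
  have hb : ∀ y : ℝ, ‖(1 + |y - x₀|) ^ 2 / (1 + y ^ 2)‖ ≤ 2 * (1 + |x₀|) ^ 2 := by
    intro y
    rw [Real.norm_of_nonneg (by positivity), div_le_iff₀ (by positivity)]
    have h1 : |y - x₀| ≤ |y| + |x₀| := abs_sub _ _
    have h2 : (1 + |y - x₀|) ^ 2 ≤ (1 + |x₀| + |y|) ^ 2 := by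
      exact pow_le_pow_left₀ (by positivity) (by linarith) 2
    have h3 : y ^ 2 = |y| ^ 2 := (sq_abs y).symm
    rw [h3]
    nlinarith [sq_nonneg (1 + |x₀| - |y|), sq_nonneg (|x₀| * |y|), abs_nonneg x₀, abs_nonneg y,
      mul_nonneg (abs_nonneg x₀) (sq_nonneg |y|)]
  refine (hg.bdd_mul hc.aestronglyMeasurable (ae_of_all _ hb)).congr (ae_of_all _ fun y => ?_)
  have : (1 + y ^ 2 : ℝ) ≠ 0 := by positivity
  field_simp

theorem integrable_of_weight_one {g : ℝ → ℝ} (hg : Integrable fun x => (1 + x ^ 2) * g x) :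
    Integrable g := by
  have hc : Continuous fun y : ℝ => (1 + y ^ 2)⁻¹ :=
    Continuous.inv₀ (by fun_prop) fun y => by positivity
  refine (hg.bdd_mul (c := 1) hc.aestronglyMeasurable (ae_of_all _ fun y => ?_)).congr
    (ae_of_all _ fun y => ?_)
  · rw [norm_inv, Real.norm_of_nonneg (by positivity)]
    exact inv_le_one_of_one_le₀ (by nlinarith [sq_nonneg y])
  · have : (1 + y ^ 2 : ℝ) ≠ 0 := by positivity
    field_simp

/-- A dominating function for `u - u₊` and the derivatives of `u` on a strip. -/
structure IsDominating (P : NZBC) (T U : ℝ) (G : ℝ → ℝ) : Prop where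
  nonneg : ∀ y, 0 ≤ G y
  integrableOn : ∀ x₀, IntegrableOn (fun y => (1 + |y - x₀|) ^ 2 * G y) (Ioi x₀)
  sub_le : ∀ t, |t| ≤ T → ∀ y, ‖P.u y t - P.up‖ ≤ G y
  ux_le : ∀ t, |t| ≤ T → ∀ y, ‖P.ux y t‖ ≤ G y
  uxx_le : ∀ t, |t| ≤ T → ∀ y, ‖P.uxx y t‖ ≤ G y
  ut_le : ∀ t, |t| ≤ T → ∀ y, ‖P.ut y t‖ ≤ G y
  le : ∀ t, |t| ≤ T → ∀ y, ‖P.u y t‖ ≤ U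
  tendsto_u : ∀ t, |t| ≤ T → Tendsto (fun y => P.u y t) atTop (𝓝 P.up)
  tendsto_ux : ∀ t, |t| ≤ T → Tendsto (fun y => P.ux y t) atTop (𝓝 0)

/-- Integrability is needed only on half-lines (x₀,∞), so on the left, where u tends to u₋ instead
of u₊, a constant 2u₀ may be added to g. The limits of u and u_x hold because an integrable function
with integrable derivative tends to zero; the bound on u_t is read off the equation. -/
theorem IsSolution.exists_isDominating (hP : P.IsSolution) (T : ℝ) :
    ∃ U G, P.IsDominating T U G := by
  obtain ⟨g, hgi, hg⟩ := hP.decay T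
  have hg1 : Integrable g := integrable_of_weight_one hgi
  -- The time interval is empty and there is nothing to dominate.
  by_cases hT : T < 0
  · refine ⟨0, 0, ⟨fun _ => le_rfl, fun x₀ => by simp, ?_, ?_, ?_, ?_, ?_, ?_, ?_⟩⟩ <;>
    exact fun t ht => absurd (abs_nonneg t) (by linarith)
  have hT0 : |(0 : ℝ)| ≤ T := by simpa using not_lt.1 hT
  have hg0 : ∀ x, 0 ≤ g x := fun x => (norm_nonneg _).trans ((hg 0 hT0).2.2.1 x)
  have hux : ∀ t, |t| ≤ T → ∀ x, ‖P.ux x t‖ ≤ g x := fun t ht => (hg t ht).2.2.1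
  have huxx : ∀ t, |t| ≤ T → ∀ x, ‖P.uxx x t‖ ≤ g x := fun t ht => (hg t ht).2.2.2
  have iux : ∀ t, |t| ≤ T → Integrable fun y => P.ux y t := fun t ht =>
    hg1.mono' (hP.continuous_ux t).aestronglyMeasurable (ae_of_all _ (hux t ht))
  have iuxx : ∀ t, |t| ≤ T → Integrable fun y => P.uxx y t := fun t ht => by
    refine hg1.mono' ?_ (ae_of_all _ (huxx t ht))
    exact aestronglyMeasurable_deriv _ _
  have tu : ∀ t, |t| ≤ T → Tendsto (fun y => P.u y t) atTop (𝓝 P.up) := by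
    intro t ht
    have h1 : IntegrableOn (fun y => P.u y t - P.up) (Ioi 0) :=
      Integrable.mono' hg1.integrableOn
        ((hP.continuous_u t).sub continuous_const).aestronglyMeasurable
        ((ae_restrict_iff' measurableSet_Ioi).2
          (ae_of_all _ fun y hy => (hg t ht).1 y (le_of_lt hy)))
    have := tendsto_zero_of_hasDerivAt_of_integrableOn_Ioi (a := 0)
      (fun y _ => (hP.hasDerivAt_u y t).sub_const P.up) (iux t ht).integrableOn h1
    simpa using this.add_const P.up
  have tux : ∀ t, |t| ≤ T → Tendsto (fun y => P.ux y t) atTop (𝓝 0) := fun t ht =>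
    tendsto_zero_of_hasDerivAt_of_integrableOn_Ioi (a := 0)
      (fun y _ => hP.hasDerivAt_ux y t) (iuxx t ht).integrableOn (iux t ht).integrableOn
  set U := P.u₀ + ∫ y, g y with hU
  have hu : ∀ t, |t| ≤ T → ∀ y, ‖P.u y t‖ ≤ U := by
    intro t ht y
    have h1 := integral_Ioi_of_hasDerivAt_of_tendsto' (a := y)
      (fun s _ => hP.hasDerivAt_u s t) (iux t ht).integrableOn (tu t ht)
    have h2 : ‖∫ s in Ioi y, P.ux s t‖ ≤ ∫ s, g s :=
      (norm_integral_le_of_norm_le hg1.integrableOn (ae_of_all _ (hux t ht))).trans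
        (setIntegral_le_integral hg1 (ae_of_all _ hg0))
    have h3 : P.u y t = P.up - ∫ s in Ioi y, P.ux s t := by rw [h1]; ring
    rw [h3, hU, ← hP.norm_up]
    exact (norm_sub_le _ _).trans (by linarith)
  have hα := hP.α_pos
  -- The coefficients of the equation solved for u_t: 1 from u_xx, 4α from u_x, and 3U²/α from the
  -- derivative of the cubic term.
  set C := 1 + 4 * P.α + 3 * U ^ 2 / P.α with hC
  have hC1 : 1 ≤ C := by rw [hC]; have : 0 ≤ 3 * U ^ 2 / P.α := by positivity
                         linarith
  set G : ℝ → ℝ := fun y => C * g y + (Iic (0 : ℝ)).indicator (fun _ => 2 * P.u₀) y with hG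
  have hind : ∀ y, 0 ≤ (Iic (0 : ℝ)).indicator (fun _ => 2 * P.u₀) y := fun y =>
    indicator_nonneg (fun _ _ => by linarith [hP.u₀_pos]) _
  have hgG : ∀ y, C * g y ≤ G y := fun y => by simp only [hG]; linarith [hind y]
  have hgG' : ∀ y, g y ≤ G y := fun y => le_trans (le_mul_of_one_le_left (hg0 y) hC1) (hgG y)
  refine ⟨U, G, ⟨fun y => (hg0 y).trans (hgG' y), fun x₀ => ?_, fun t ht y => ?_,
    fun t ht y => (hux t ht y).trans (hgG' y), fun t ht y => (huxx t ht y).trans (hgG' y),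
    fun t ht y => ?_, hu, tu, tux⟩⟩
  · have e : (fun y => (1 + |y - x₀|) ^ 2 * G y) = fun y => C * ((1 + |y - x₀|) ^ 2 * g y)
        + (Iic (0 : ℝ)).indicator (fun y => (1 + |y - x₀|) ^ 2 * (2 * P.u₀)) y := by
      ext y
      by_cases hy : y ∈ Iic (0 : ℝ) <;> simp only [hG, hy, indicator_of_mem, indicator_of_notMem,
        not_false_eq_true] <;> ring
    rw [e]
    refine Integrable.add ((integrable_of_weight hgi x₀).const_mul C).integrableOn ?_
    rw [integrable_indicator_iff measurableSet_Iic, IntegrableOn,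
      Measure.restrict_restrict measurableSet_Iic]
    refine IntegrableOn.mono_set (t := Icc x₀ 0) ?_ fun y hy => ⟨le_of_lt hy.2, hy.1⟩
    exact Continuous.integrableOn_Icc (by fun_prop)
  · rcases le_or_gt y 0 with hy | hy
    · simp only [hG]
      rw [indicator_of_mem (mem_Iic.2 hy)]
      have h1 := (hg t ht).2.1 y hy
      have h2 : ‖P.um - P.up‖ ≤ 2 * P.u₀ := by
        refine (norm_sub_le _ _).trans ?_
        rw [hP.norm_um, hP.norm_up]; linarith
      have h3 : P.u y t - P.up = (P.u y t - P.um) + (P.um - P.up) := by ring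
      rw [h3]
      refine (norm_add_le _ _).trans (add_le_add (h1.trans ?_) h2)
      exact le_mul_of_one_le_left (hg0 y) hC1
    · exact ((hg t ht).1 y hy.le).trans (hgG' y)
  · have h1 := hP.equation' y t
    have h2 : P.ut y t = I * P.uxx y t - 4 * P.α * P.ux y t
        - 1 / P.α * (2 * P.u y t * conj (P.u y t) * P.ux y t + P.u y t ^ 2 * conj (P.ux y t)) := by
      have hne : (P.α : ℂ) ≠ 0 := by exact_mod_cast hα.ne'
      have h3 := congrArg (fun w => -I * w) h1
      simp only [mul_zero] at h3
      have h4 : P.ut y t = -I * (I * P.ut y t) := by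
        rw [← mul_assoc]; simp
      linear_combination h3 + (-P.ut y t - 4 * P.α * P.ux y t - 1 / P.α *
        (2 * P.u y t * conj (P.u y t) * P.ux y t + P.u y t ^ 2 * conj (P.ux y t)) + 2 *P.ut y t
          + 4 * 2 * P.α * P.ux y t + 2 / P.α *
        (2 * P.u y t * conj (P.u y t) * P.ux y t + P.u y t ^ 2 * conj (P.ux y t))) * I_mul_I
    refine le_trans ?_ (hgG y)
    have b1 := hux t ht y
    have b2 := huxx t ht y
    have b3 := hu t ht y
    have b4 : ‖2 * P.u y t * conj (P.u y t) * P.ux y t + P.u y t ^ 2 * conj (P.ux y t)‖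
        ≤ 3 * U ^ 2 * g y := by
      refine (norm_add_le _ _).trans ?_
      simp only [norm_mul, norm_pow, RCLike.norm_conj, Complex.norm_ofNat]
      have : ‖P.u y t‖ ^ 2 ≤ U ^ 2 := by gcongr
      calc _ = 3 * ‖P.u y t‖ ^ 2 * ‖P.ux y t‖ := by ring
        _ ≤ _ := by gcongr
    rw [h2]
    refine (norm_sub_le _ _).trans ((add_le_add (norm_sub_le _ _) le_rfl).trans ?_)
    simp only [norm_mul, norm_I, one_mul, norm_div, norm_one, norm_real, Complex.norm_ofNat,
      Real.norm_eq_abs, abs_of_pos hα]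
    calc _ ≤ g y + 4 * P.α * g y + 1 / P.α * (3 * U ^ 2 * g y) := by gcongr
      _ = C * g y := by rw [hC]; ring

end NZBC

/-- A solution of a linear differential equation that vanishes at one point vanishes. -/
theorem eq_zero_of_hasDerivAt_linear {E : Type*} [NormedAddCommGroup E] [NormedSpace ℂ E]
    {M : ℝ → E →L[ℂ] E} (hM : Continuous M) {x₀ b : ℝ} (hb : x₀ < b) {D : ℝ → E}
    (hD : ∀ x, x₀ < x → HasDerivAt D (M x (D x)) x) (h0 : D b = 0) {x : ℝ} (hx : x₀ < x) :
    D x = 0 := by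
  set c := (x₀ + min x b) / 2 with hc
  set d := max x b + 1 with hd
  have hm : x₀ < min x b := lt_min hx hb
  have h1 : x₀ < c := by rw [hc]; linarith
  have h2 : c < min x b := by rw [hc]; linarith
  have h3 : c < x ∧ c < b := ⟨h2.trans_le (min_le_left _ _), h2.trans_le (min_le_right _ _)⟩
  have h4 : x < d ∧ b < d := ⟨by linarith [le_max_left x b], by linarith [le_max_right x b]⟩
  obtain ⟨K, hK⟩ := (isCompact_Icc (a := c) (b := d)).exists_bound_of_continuousOn hM.continuousOn
  have hK0 : 0 ≤ K := (norm_nonneg _).trans (hK b ⟨h3.2.le, h4.2.le⟩)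
  have := ODE_solution_unique_of_mem_Ioo (v := fun t w => M t w) (s := fun _ => univ)
    (K := K.toNNReal) (f := D) (g := fun _ => 0) (a := c) (b := d) (t₀ := b)
    (fun t ht => by
      refine (LipschitzWith.weaken (M t).lipschitz ?_).lipschitzOnWith
      rw [← NNReal.coe_le_coe, Real.coe_toNNReal _ hK0]
      exact hK t ⟨ht.1.le, ht.2.le⟩)
    ⟨h3.2, h4.2⟩ (fun t ht => ⟨hD t (h1.trans ht.1), mem_univ _⟩)
    (fun t ht => ⟨by simpa using hasDerivAt_const t (0 : E), mem_univ _⟩) h0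
  exact this ⟨h3.1, h4.1⟩

/-! ### The normalised Jost solution at +∞ -/

/-- The closure of `Dplus`, without the origin. -/
def Dbar : Set ℂ := {z | z.re * z.im ≤ 0 ∧ z ≠ 0}

theorem Dplus_subset_Dbar : Dplus ⊆ Dbar := fun z hz => ⟨le_of_lt hz, by
  rintro rfl; simp [Dplus] at hz⟩

theorem Contour_subset_Dbar : Contour ⊆ Dbar := fun _ hz => ⟨hz.1.le, hz.2⟩

theorem isOpen_Dplus : IsOpen Dplus :=
  isOpen_lt (continuous_re.mul continuous_im) continuous_const

theorem isOpen_Dminus : IsOpen Dminus :=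
  isOpen_lt continuous_const (continuous_re.mul continuous_im)

theorem im_sq_nonpos {z : ℂ} (hz : z ∈ Dbar) : (z ^ 2).im ≤ 0 := by
  have : (z ^ 2).im = 2 * (z.re * z.im) := by rw [sq, mul_im]; ring
  rw [this]; linarith [hz.1]

theorem im_inv_sq_nonneg {z : ℂ} (hz : z ∈ Dbar) : 0 ≤ ((z ^ 2)⁻¹).im := by
  rw [inv_im]
  exact div_nonneg (neg_nonneg.2 (im_sq_nonpos hz)) (normSq_nonneg _)

namespace NZBC

variable {P : NZBC}

theorem k_mul_lam (P : NZBC) {z : ℂ} (hz : z ≠ 0) :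
    P.k z * P.lam z = (z ^ 2 - (P.u₀ : ℂ) ^ 4 * (z ^ 2)⁻¹) / (4 * P.α) := by
  unfold k lam
  by_cases hα : (P.α : ℂ) = 0
  · simp [hα]
  · field_simp; ring

/-- Since kλ = (z² - u₀⁴ z⁻²)/(4α), the real part equals (-Im z² + u₀⁴ Im z⁻²)/(2α), and both terms
are nonnegative when Re z Im z ≤ 0. -/
theorem re_rate_nonneg (hα : 0 < P.α) {z : ℂ} (hz : z ∈ Dbar) :
    0 ≤ (2 * I * P.k z * P.lam z).re := by
  have : 2 * I * P.k z * P.lam z = I * ((z ^ 2 - ((P.u₀ ^ 4 : ℝ) : ℂ) * (z ^ 2)⁻¹)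
      / ((2 * P.α : ℝ) : ℂ)) := by
    rw [mul_assoc, k_mul_lam P hz.2]
    have : (P.α : ℂ) ≠ 0 := by exact_mod_cast hα.ne'
    push_cast; field_simp; ring
  rw [this, I_mul_re, div_ofReal_im, sub_im, im_ofReal_mul, ← neg_div]
  have h1 := im_sq_nonpos hz
  have h2 := im_inv_sq_nonneg hz
  have h3 : 0 ≤ P.u₀ ^ 4 * ((z ^ 2)⁻¹).im := mul_nonneg (by positivity) h2
  apply div_nonneg <;> linarith

/-- The matrix `X₊ + ikλ`. -/
noncomputable def asymA (P : NZBC) (z : ℂ) : (Fin 2 → ℂ) →L[ℂ] (Fin 2 → ℂ) :=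
  mat2 (I * P.k z * P.u₀ ^ 2 / z) (I * P.k z * P.up) (I * P.k z * conj P.up) (I * P.k z * z)

/-- The matrix `X + ikλ`. -/
noncomputable def shiftX (P : NZBC) (x t : ℝ) (z : ℂ) : (Fin 2 → ℂ) →L[ℂ] (Fin 2 → ℂ) :=
  mat2 (I * P.k z * P.u₀ ^ 2 / z) (I * P.k z * P.u x t) (I * P.k z * conj (P.u x t)) (I * P.k z * z)

/-- The first column of `Y₊`. -/
noncomputable def asymCol (P : NZBC) (z : ℂ) : Fin 2 → ℂ := ![1, -conj P.up / z]

theorem conj_mul_up (hP : P.IsSolution) : P.up * conj P.up = (P.u₀ : ℂ) ^ 2 := by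
  rw [mul_conj, normSq_eq_norm_sq, hP.norm_up]; push_cast; rfl

theorem conj_mul_um (hP : P.IsSolution) : P.um * conj P.um = (P.u₀ : ℂ) ^ 2 := by
  rw [mul_conj, normSq_eq_norm_sq, hP.norm_um]; push_cast; rfl

/-- The matrix has trace 2ikλ, and its determinant vanishes because |u₊| = u₀; this is
Cayley–Hamilton. -/
theorem asymA_asymA (hP : P.IsSolution) {z : ℂ} (hz : z ≠ 0) (v : Fin 2 → ℂ) :
    P.asymA z (P.asymA z v) = (2 * I * P.k z * P.lam z) • P.asymA z v := by
  have h := conj_mul_up hP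
  ext i
  fin_cases i
  · simp [asymA, mat2_apply, lam]
    field_simp
    linear_combination (P.k z ^ 2 * z ^ 2 * v 0 : ℂ) * h
  · simp [asymA, mat2_apply, lam]
    field_simp
    linear_combination (P.k z ^ 2 * z * v 1 : ℂ) * h

theorem asymA_asymCol (hP : P.IsSolution) {z : ℂ} (hz : z ≠ 0) : P.asymA z (P.asymCol z) = 0 := by
  have h := conj_mul_up hP
  ext i
  fin_cases i
  · simp [asymA, mat2_apply, asymCol]
    field_simp
    linear_combination (-(I * P.k z)) * h
  · simp [asymA, mat2_apply, asymCol]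
    field_simp
    ring

theorem shiftX_eq (x t : ℝ) (z : ℂ) (v : Fin 2 → ℂ) :
    P.shiftX x t z v = P.asymA z v - (-(I * P.k z)) • potL (P.u x t - P.up) v := by
  ext i
  fin_cases i <;> simp [asymA, shiftX, mat2_apply, potL_apply] <;> ring

theorem continuous_mat2 {X : Type*} [TopologicalSpace X] {a b c d : X → ℂ} (ha : Continuous a)
    (hb : Continuous b) (hc : Continuous c) (hd : Continuous d) :
    Continuous fun x => mat2 (a x) (b x) (c x) (d x) := by
  unfold mat2; fun_prop

theorem continuous_shiftX (hP : P.IsSolution) (t : ℝ) (z : ℂ) :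
    Continuous fun x => P.shiftX x t z := by
  have h := hP.continuous_u t
  exact continuous_mat2 continuous_const (by fun_prop)
    (continuous_const.mul (continuous_conj.comp h)) continuous_const

/-- The Wronskian argument: a solution tending to zero vanishes. -/
theorem eq_zero_of_tendsto_zero (hP : P.IsSolution) {t : ℝ} {z : ℂ} (hz : z ∈ Dbar) {x₀ : ℝ}
    {ψ D : ℝ → Fin 2 → ℂ} (hψ : ∀ x, x₀ < x → HasDerivAt ψ (P.shiftX x t z (ψ x)) x)
    (hψ' : Tendsto ψ atTop (𝓝 (P.asymCol z)))
    (hD : ∀ x, x₀ < x → HasDerivAt D (P.shiftX x t z (D x)) x) (hD' : Tendsto D atTop (𝓝 0))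
    {x : ℝ} (hx : x₀ < x) : D x = 0 := by
  set μ := 2 * I * P.k z * P.lam z with hμ
  have hμ0 : 0 ≤ μ.re := re_rate_nonneg hP.α_pos hz
  have comp : ∀ {f : ℝ → Fin 2 → ℂ} {f' : Fin 2 → ℂ} {x : ℝ}, HasDerivAt f f' x →
      ∀ i, HasDerivAt (fun s => f s i) (f' i) x := fun h i => (hasDerivAt_pi.1 h) i
  have lim : ∀ {f : ℝ → Fin 2 → ℂ} {l : Fin 2 → ℂ}, Tendsto f atTop (𝓝 l) →
      ∀ i, Tendsto (fun s => f s i) atTop (𝓝 (l i)) := fun h i => (tendsto_pi_nhds.1 h) i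
  -- The trace of X + ikλ is μ, so W' = μW. From W(s) = e^{μ(s-r)} W(r) with s ≤ r and Re μ ≥ 0 one
  -- gets |W(s)| ≤ |W(r)| → 0. This works equally for Re μ = 0.
  set W : ℝ → ℂ := fun s => D s 0 * ψ s 1 - D s 1 * ψ s 0 with hW
  have hWd : ∀ s, x₀ < s → HasDerivAt W (μ * W s) s := by
    intro s hs
    have a0 := comp (hD s hs) 0
    have a1 := comp (hD s hs) 1
    have b0 := comp (hψ s hs) 0
    have b1 := comp (hψ s hs) 1
    refine ((a0.mul b1).sub (a1.mul b0)).congr_deriv ?_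
    have hz0 := hz.2
    simp [shiftX, mat2_apply, hW, hμ, lam]
    field_simp
    ring
  have hWE : ∀ s, x₀ < s → HasDerivAt (fun s : ℝ => exp (-(μ * s)) * W s) 0 s := by
    intro s hs
    have h1 : HasDerivAt (fun s : ℝ => exp (-(μ * s))) (exp (-(μ * s)) * -(μ * 1)) s :=
      (((hasDerivAt_id s).ofReal_comp.const_mul μ).neg).cexp
    refine (h1.mul (hWd s hs)).congr_deriv ?_
    ring
  have hWc : ∀ s r, x₀ < s → s ≤ r → exp (-(μ * r)) * W r = exp (-(μ * s)) * W s := by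
    intro s r hs hr
    refine constant_of_has_deriv_right_zero (f := fun s : ℝ => exp (-(μ * s)) * W s) (a := s)
      (b := r) (fun y hy => (hWE y (hs.trans_le hy.1)).continuousAt.continuousWithinAt)
      (fun y hy => (hWE y (hs.trans_le hy.1)).hasDerivWithinAt) r ⟨hr, le_rfl⟩
  have hWt : Tendsto W atTop (𝓝 0) := by
    have := ((lim hD' 0).mul (lim hψ' 1)).sub ((lim hD' 1).mul (lim hψ' 0))
    simpa using this
  have hW0 : ∀ s, x₀ < s → W s = 0 := by
    intro s hs
    rw [← norm_eq_zero]
    refine le_antisymm ?_ (norm_nonneg _)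
    refine ge_of_tendsto (by simpa using hWt.norm) ?_
    filter_upwards [eventually_ge_atTop s] with r hr
    have h1 : W s = exp (μ * ((s - r : ℝ) : ℂ)) * W r := by
      have h2 := hWc s r hs hr
      calc W s = exp (μ * s) * (exp (-(μ * s)) * W s) := by
            rw [← mul_assoc, ← exp_add]; simp
        _ = exp (μ * s) * (exp (-(μ * r)) * W r) := by rw [h2]
        _ = _ := by rw [← mul_assoc, ← exp_add]; push_cast; ring_nf
    rw [h1, norm_mul]
    exact mul_le_of_le_one_left (norm_nonneg _) (norm_exp_mul_le_one hμ0 (by linarith))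
  -- As W = 0, D is a multiple of ψ wherever ψ₁ ≠ 0. The multiple is constant near +∞ and tends to
  -- 0/1, so D vanishes at one point and then everywhere by uniqueness for the linear equation.
  have hψ0 : ∀ᶠ s in atTop, ψ s 0 ≠ 0 := by
    have := lim hψ' 0
    refine this.eventually_ne ?_
    simp [asymCol]
  obtain ⟨b, hb⟩ := (hψ0.and (eventually_gt_atTop x₀)).exists_forall_of_atTop
  have hbx : x₀ < b := (hb b le_rfl).2
  have hcd : ∀ s, b ≤ s → HasDerivAt (fun s => D s 0 / ψ s 0) 0 s := by
    intro s hs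
    have hs' := (hb s hs).2
    have a0 := comp (hD s hs') 0
    have b0 := comp (hψ s hs') 0
    refine (a0.div b0 (hb s hs).1).congr_deriv ?_
    have := hW0 s hs'
    rw [div_eq_zero_iff]
    left
    simp [shiftX, mat2_apply]
    simp only [hW] at this
    linear_combination (-(I * P.k z * P.u s t)) * this
  have hc0 : D b 0 / ψ b 0 = 0 := by
    have h1 : Tendsto (fun s => D s 0 / ψ s 0) atTop (𝓝 (0 / 1)) := by
      have h2 := (lim hD' 0).div (lim hψ' 0) (by simp [asymCol])
      simpa [asymCol] using! h2
    rw [zero_div] at h1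
    refine tendsto_nhds_unique (tendsto_const_nhds.congr' ?_) h1
    filter_upwards [eventually_ge_atTop b] with r hr
    exact (constant_of_has_deriv_right_zero (f := fun s => D s 0 / ψ s 0) (a := b)
      (b := r) (fun y hy => (hcd y hy.1).continuousAt.continuousWithinAt)
      (fun y hy => (hcd y hy.1).hasDerivWithinAt) r ⟨hr, le_rfl⟩).symm
  have hD0 : D b 0 = 0 := by
    rcases div_eq_zero_iff.1 hc0 with h | h
    · exact h
    · exact absurd h (hb b le_rfl).1
  have hD1 : D b 1 = 0 := by
    have := hW0 b hbx
    simp only [hW, hD0, zero_mul, zero_sub, neg_eq_zero, mul_eq_zero] at this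
    exact this.resolve_right (hb b le_rfl).1
  refine eq_zero_of_hasDerivAt_linear (continuous_shiftX hP t z) hbx hD ?_ hx
  ext i; fin_cases i
  · exact hD0
  · exact hD1

/-- The normalised Jost solution `φ₊,₁ e^{-iθ}` on `(x₀, ∞)` at time `t`. -/
noncomputable def jostHalf (P : NZBC) (t x₀ : ℝ) (z : ℂ) : BoundedContinuousFunction ℝ (Fin 2 → ℂ) :=
  jostVolterra (2 * I * P.k z * P.lam z) (P.asymA z)
    (fun y => (-(I * P.k z)) • potL (P.u y t - P.up)) (P.asymCol z) x₀

/-- The normalised Jost solution `φ₊,₁ e^{-iθ}`. -/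
noncomputable def jost (P : NZBC) (x t : ℝ) (z : ℂ) : Fin 2 → ℂ := P.jostHalf t (x - 1) z x

theorem continuous_potL_u (hP : P.IsSolution) (t : ℝ) :
    Continuous fun y => potL (P.u y t - P.up) :=
  continuous_potL.comp ((hP.continuous_u t).sub continuous_const)

theorem integrableOn_potL (hP : P.IsSolution) (t x₀ : ℝ) :
    IntegrableOn (fun y => (1 + |y - x₀|) ^ 2 * ‖potL (P.u y t - P.up)‖) (Ioi x₀) := by
  obtain ⟨U, G, hG⟩ := hP.exists_isDominating |t|
  refine Integrable.mono' (hG.integrableOn x₀) ?_ (ae_of_all _ fun y => ?_)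
  · have := continuous_potL_u hP t
    apply Continuous.aestronglyMeasurable; fun_prop
  · rw [Real.norm_of_nonneg (by positivity)]
    gcongr
    exact (norm_potL_le _).trans (hG.sub_le t le_rfl y)

theorem integrableOn_smul_potL (hP : P.IsSolution) (t x₀ : ℝ) (c : ℂ) :
    IntegrableOn (fun y => (1 + |y - x₀|) ^ 2 * ‖c • potL (P.u y t - P.up)‖) (Ioi x₀) := by
  refine ((integrableOn_potL hP t x₀).const_mul ‖c‖).congr (ae_of_all _ fun y => ?_)
  simp only [norm_smul]; ring

theorem jostHalf_spec (hP : P.IsSolution) (t x₀ : ℝ) {z : ℂ} (hz : z ∈ Dbar) :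
    (∀ x, x₀ < x → HasDerivAt (P.jostHalf t x₀ z) (P.shiftX x t z (P.jostHalf t x₀ z x)) x) ∧
    Tendsto (P.jostHalf t x₀ z) atTop (𝓝 (P.asymCol z)) := by
  obtain ⟨h1, h2⟩ := jostVolterra_ode (re_rate_nonneg hP.α_pos hz) (asymA_asymA hP hz.2)
    ((continuous_potL_u hP t).const_smul (-(I * P.k z))) (integrableOn_smul_potL hP t x₀ _)
    (asymA_asymCol hP hz.2)
  refine ⟨fun x hx => ?_, h2⟩
  rw [shiftX_eq]
  exact h1 x hx

/-- A half-line is used because u - u₊ need not decay at -∞. By uniqueness, solutions built from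
different left endpoints agree where both solve the equation, so the choice x - 1 in `jost` is
immaterial. -/
theorem jost_eq (hP : P.IsSolution) {t x₀ : ℝ} {z : ℂ} (hz : z ∈ Dbar) {x : ℝ} (hx : x₀ < x) :
    P.jost x t z = P.jostHalf t x₀ z x := by
  obtain ⟨a1, a2⟩ := jostHalf_spec hP t x₀ hz
  obtain ⟨b1, b2⟩ := jostHalf_spec hP t (x - 1) hz
  have hm : max x₀ (x - 1) < x := max_lt hx (by linarith)
  refine sub_eq_zero.1 (eq_zero_of_tendsto_zero hP (t := t) hz (x₀ := max x₀ (x - 1))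
    (ψ := P.jostHalf t x₀ z) (D := fun s => P.jostHalf t (x - 1) z s - P.jostHalf t x₀ z s)
    (fun s hs => a1 s ((le_max_left _ _).trans_lt hs)) a2 (fun s hs => ?_)
    (by simpa using b2.sub a2) hm)
  rw [map_sub]
  exact (b1 s ((le_max_right _ _).trans_lt hs)).sub (a1 s ((le_max_left _ _).trans_lt hs))

theorem hasDerivAt_jost (hP : P.IsSolution) (x t : ℝ) {z : ℂ} (hz : z ∈ Dbar) :
    HasDerivAt (fun s => P.jost s t z) (P.shiftX x t z (P.jost x t z)) x := by
  have h1 := (jostHalf_spec hP t (x - 1) hz).1 x (by linarith)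
  refine h1.congr_of_eventuallyEq ?_
  filter_upwards [Ioi_mem_nhds (show x - 1 < x by linarith)] with s hs
  exact jost_eq hP hz hs

theorem tendsto_jost (hP : P.IsSolution) (t : ℝ) {z : ℂ} (hz : z ∈ Dbar) :
    Tendsto (fun s => P.jost s t z) atTop (𝓝 (P.asymCol z)) := by
  refine (jostHalf_spec hP t 0 hz).2.congr' ?_
  filter_upwards [eventually_gt_atTop 0] with s hs
  exact (jost_eq hP hz hs).symm

theorem differentiableAt_k (P : NZBC) {z : ℂ} (hz : z ≠ 0) : DifferentiableAt ℂ P.k z := by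
  unfold k; fun_prop (disch := exact hz)

theorem differentiableAt_lam (P : NZBC) {z : ℂ} (hz : z ≠ 0) : DifferentiableAt ℂ P.lam z := by
  unfold lam; fun_prop (disch := exact hz)

/-- The Jost solution is complex differentiable within the closed set `Dbar`. -/
theorem differentiableOn_jost (hP : P.IsSolution) (x t : ℝ) :
    DifferentiableOn ℂ (fun z => P.jost x t z) Dbar := by
  intro z hz
  have dk := (differentiableAt_k P hz.2).differentiableWithinAt (s := Dbar)
  have dl := (differentiableAt_lam P hz.2).differentiableWithinAt (s := Dbar)
  have dz : DifferentiableWithinAt ℂ (fun z : ℂ => z) Dbar z := differentiableWithinAt_id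
  have dA : DifferentiableWithinAt ℂ (fun z => P.asymA z) Dbar z := by
    unfold asymA mat2
    fun_prop (disch := exact hz.2)
  have dY : DifferentiableWithinAt ℂ (fun z => P.asymCol z) Dbar z := by
    rw [differentiableWithinAt_pi]
    intro i
    fin_cases i
    · exact differentiableWithinAt_const (1 : ℂ)
    · exact (differentiableWithinAt_const (-conj P.up)).div dz hz.2
  have := differentiableWithinAt_jostVolterra hz (x₀ := x - 1)
    (μ := fun z => 2 * I * P.k z * P.lam z) (c := fun z => -(I * P.k z)) (A := fun z => P.asymA z)
    (Y := fun z => P.asymCol z) (fun z hz => re_rate_nonneg hP.α_pos hz) (by fun_prop)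
    (by fun_prop) dA dY (continuous_potL_u hP t) (integrableOn_potL hP t (x - 1))
  exact (BoundedContinuousFunction.evalCLM ℂ x).differentiableAt.comp_differentiableWithinAt z this

end NZBC

/-! ### Differentiability of the Jost solution in time -/

section

variable {E : Type*} [NormedAddCommGroup E] [NormedSpace ℂ E]

theorem norm_jostKer_le {μ : ℂ} (hμ : 0 ≤ μ.re) (A : E →L[ℂ] E) (B : ℝ → E →L[ℂ] E) (x₀ x y : ℝ) :
    ‖jostKer μ A B x₀ x y‖
      ≤ (Ioi x₀).indicator (fun y => (1 + ‖A‖) * (1 + |y - x₀|) * ‖B y‖) y := by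
  have hx : x₀ ≤ max x x₀ := le_max_right _ _
  by_cases hy : y ∈ Ioi (max x x₀)
  · have hy' : x₀ < y := hx.trans_lt hy
    rw [indicator_of_mem (mem_Ioi.2 hy')]
    refine (ContinuousLinearMap.opNorm_comp_le _ _).trans ?_
    gcongr
    rw [indicator_of_mem hy]
    have h1 : ‖expInt μ (min (max x x₀ - y) 0) • A‖ ≤ (y - x₀) * ‖A‖ := by
      rw [norm_smul]
      gcongr
      exact (norm_expInt_le hμ (min_le_right _ _)).trans (neg_min_sub_le hy')
    refine (norm_add_le _ _).trans ((add_le_add ContinuousLinearMap.norm_id_le h1).trans ?_)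
    rw [abs_of_pos (sub_pos.2 hy')]
    nlinarith [norm_nonneg A, sub_pos.2 hy']
  · have hy' : y ≤ max x x₀ := not_lt.1 hy
    have : jostKer μ A B x₀ x y = 0 := by
      simp [jostKer, indicator_of_notMem hy, min_eq_right (sub_nonneg.2 hy')]
    rw [this, norm_zero]
    exact indicator_nonneg (fun _ _ => by positivity) _

/-- Time is a real parameter, so the resolvent calculus in t has to be run over ℝ although the
operators are complex linear. -/
theorem IsVolterraKernel.restrictScalars {G : ℝ → ℝ} {x₀ : ℝ} {κ : ℝ → ℝ → E →L[ℂ] E}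
    (h : IsVolterraKernel G x₀ κ) :
    IsVolterraKernel G x₀ (fun x y => (κ x y).restrictScalars ℝ) where
  continuous := h.continuous
  nonneg := h.nonneg
  integrable := h.integrable
  meas := fun x => (ContinuousLinearMap.restrictScalarsIsometry ℂ E E ℝ
    ℝ).continuous.comp_aestronglyMeasurable (h.meas x)
  bound := fun x y => by rw [ContinuousLinearMap.norm_restrictScalars]; exact h.bound x y
  cont := fun x => (h.cont x).mono fun y hy => (ContinuousLinearMap.restrictScalarsIsometry ℂ E E ℝ
    ℝ).continuous.continuousAt.comp hy

theorem IsDominatedKernel.mono {𝕜 E : Type*} [RCLike 𝕜] [NormedAddCommGroup E] [NormedSpace 𝕜 E]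
    {H H' : ℝ → ℝ} {κ : ℝ → ℝ → E →L[𝕜] E}
    (h : IsDominatedKernel H κ) (hi : Integrable H') (hb : ∀ x y, ‖κ x y‖ ≤ H' y) :
    IsDominatedKernel H' κ := ⟨hi, h.meas, hb, h.cont⟩

end

namespace NZBC

variable {P : NZBC}

theorem jostKer_potL_sub_sub (μ : ℂ) (A : (Fin 2 → ℂ) →L[ℂ] (Fin 2 → ℂ)) (c a b d : ℂ)
    (r x₀ x y : ℝ) :
    (jostKer μ A (fun _ => c • potL a) x₀ x y).restrictScalars ℝ
      - (jostKer μ A (fun _ => c • potL b) x₀ x y).restrictScalars ℝ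
      - r • (jostKer μ A (fun _ => c • potL d) x₀ x y).restrictScalars ℝ
      = (jostKer μ A (fun _ => c • potL (a - b - r * d)) x₀ x y).restrictScalars ℝ := by
  have e : c • potL (a - b - r * d) = c • potL a - c • potL b - r • c • potL d := by
    rw [← potL_sub_sub, smul_sub, smul_sub, smul_comm c r]
  simp only [jostKer, e, ContinuousLinearMap.comp_sub, ContinuousLinearMap.comp_smul]
  ext1 v
  simp

theorem integrableOn_smul_potL_ut (hP : P.IsSolution) (t x₀ : ℝ) (c : ℂ) :
    IntegrableOn (fun y => (1 + |y - x₀|) ^ 2 * ‖c • potL (P.ut y t)‖) (Ioi x₀) := by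
  obtain ⟨U, G, hG⟩ := hP.exists_isDominating |t|
  have cV := continuous_potL.comp (hP.continuous_ut t)
  simp only [Function.comp_def] at cV
  refine Integrable.mono' ((hG.integrableOn x₀).const_mul ‖c‖)
    (by apply Continuous.aestronglyMeasurable; fun_prop) (ae_of_all _ fun y => ?_)
  rw [Real.norm_of_nonneg (by positivity)]
  simp only [norm_smul]
  have := (norm_potL_le (P.ut y t)).trans (hG.ut_le t le_rfl y)
  calc _ ≤ (1 + |y - x₀|) ^ 2 * (‖c‖ * G y) := by gcongr
    _ = _ := by ring

/-- The difference quotients of u in t are bounded by the dominating function of u_t, uniformly for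
t near t₀, and converge pointwise to u_t. Dominated convergence makes the operators differentiable
in norm. -/
theorem hasDerivAt_kerOp_time (hP : P.IsSolution) (t₀ x₀ : ℝ) {μ : ℂ} (hμ0 : 0 ≤ μ.re)
    (A : (Fin 2 → ℂ) →L[ℂ] (Fin 2 → ℂ)) (c : ℂ) :
    HasDerivAt (fun t => kerOp fun x y =>
        (jostKer μ A (fun y => c • potL (P.u y t - P.up)) x₀ x y).restrictScalars ℝ)
      (kerOp fun x y => (jostKer μ A (fun y => c • potL (P.ut y t₀)) x₀ x y).restrictScalars ℝ)
      t₀ := by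
  set T := |t₀| + 1
  obtain ⟨U, G, hG⟩ := hP.exists_isDominating T
  have ht₀ : |t₀| ≤ T := by simp [T]
  set V : ℝ → ℝ → (Fin 2 → ℂ) →L[ℂ] (Fin 2 → ℂ) := fun t y => c • potL (P.u y t - P.up) with hV
  set V' : ℝ → (Fin 2 → ℂ) →L[ℂ] (Fin 2 → ℂ) := fun y => c • potL (P.ut y t₀) with hV'
  have cV : ∀ t, Continuous (V t) := fun t => (continuous_potL_u hP t).const_smul c
  have cV' : Continuous V' := (continuous_potL.comp (hP.continuous_ut t₀)).const_smul c
  have iV : ∀ t, IntegrableOn (fun y => (1 + |y - x₀|) ^ 2 * ‖V t y‖) (Ioi x₀) := fun t =>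
    integrableOn_smul_potL hP t x₀ c
  have iV' : IntegrableOn (fun y => (1 + |y - x₀|) ^ 2 * ‖V' y‖) (Ioi x₀) :=
    integrableOn_smul_potL_ut hP t₀ x₀ c
  set κ : ℝ → ℝ → ℝ → (Fin 2 → ℂ) →L[ℝ] (Fin 2 → ℂ) :=
    fun t x y => (jostKer μ A (V t) x₀ x y).restrictScalars ℝ with hκ
  set κ' : ℝ → ℝ → (Fin 2 → ℂ) →L[ℝ] (Fin 2 → ℂ) :=
    fun x y => (jostKer μ A V' x₀ x y).restrictScalars ℝ with hκ'
  have kV : ∀ t, IsVolterraKernel _ x₀ (κ t) := fun t =>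
    (isVolterraKernel_jostKer' hμ0 A (cV t) (iV t)).restrictScalars
  have kV' : IsVolterraKernel _ x₀ κ' :=
    (isVolterraKernel_jostKer' hμ0 A cV' iV').restrictScalars
  set H : ℝ → ℝ := (Ioi x₀).indicator fun y => (1 + ‖A‖) * (1 + |y - x₀|) * (‖c‖ * G y) with hH
  have iH : Integrable H := by
    rw [hH, integrable_indicator_iff measurableSet_Ioi]
    have h1 : Continuous fun y : ℝ => (1 + |y - x₀|)⁻¹ :=
      Continuous.inv₀ (by fun_prop) fun y => by positivity
    refine (((hG.integrableOn x₀).bdd_mul (c := 1) h1.aestronglyMeasurable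
      (ae_of_all _ fun y => ?_)).const_mul ((1 + ‖A‖) * ‖c‖)).congr (ae_of_all _ fun y => ?_)
    · rw [norm_inv, Real.norm_of_nonneg (by positivity)]
      exact inv_le_one_of_one_le₀ (by linarith [abs_nonneg (y - x₀)])
    · have : 1 + |y - x₀| ≠ 0 := by positivity
      field_simp
  have hHnn : ∀ y, 0 ≤ H y := fun y => indicator_nonneg (fun y _ => by
    have := hG.nonneg y; positivity) y
  have hle : ∀ {B : ℝ → (Fin 2 → ℂ) →L[ℂ] (Fin 2 → ℂ)} {b : ℝ} {y : ℝ}, ‖B y‖ ≤ b * (‖c‖ * G y) →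
      ∀ x, ‖jostKer μ A B x₀ x y‖ ≤ b * H y := by
    intro B b y hB x
    refine (norm_jostKer_le hμ0 A B x₀ x y).trans ?_
    by_cases hy : y ∈ Ioi x₀
    · simp only [hH, indicator_of_mem hy]
      calc _ ≤ (1 + ‖A‖) * (1 + |y - x₀|) * (b * (‖c‖ * G y)) := by gcongr
        _ = _ := by ring
    · simp [hH, indicator_of_notMem hy]
  set S : Set ℝ := Icc (-T) T with hS
  have hSt : ∀ t ∈ S, |t| ≤ T := fun t ht => abs_le.2 ht
  have hSn : S ∈ 𝓝 t₀ := Icc_mem_nhds (by linarith [neg_abs_le t₀, show T = |t₀| + 1 from rfl])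
    (by linarith [le_abs_self t₀, show T = |t₀| + 1 from rfl])
  suffices dK : HasDerivWithinAt (fun t => kerOp (κ t)) (kerOp κ') S t₀ from dK.hasDerivAt hSn
  -- `dslope` is the difference quotient, given the value u_t at t = t₀; D is its error.
  set D : ℝ → ℝ → ℂ := fun t y => dslope (fun s => P.u y s) t₀ t - P.ut y t₀ with hD
  have hDb : ∀ t ∈ S, ∀ y, ‖D t y‖ ≤ 2 * G y := by
    intro t ht y
    have h1 : ‖dslope (fun s => P.u y s) t₀ t‖ ≤ G y := by
      by_cases h : t = t₀
      · rw [h, dslope_same]; exact hG.ut_le t₀ ht₀ y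
      · rw [dslope_of_ne _ h, slope, norm_smul, norm_inv, inv_mul_le_iff₀ (norm_pos_iff.2
          (sub_ne_zero.2 h)), mul_comm]
        exact (convex_Icc (-T) T).norm_image_sub_le_of_norm_hasDerivWithin_le
          (fun s hs => (hP.hasDerivAt_u_time y s).hasDerivWithinAt)
          (fun s hs => hG.ut_le s (hSt s hs) y) (abs_le.1 ht₀) ht
    have := norm_sub_le (dslope (fun s => P.u y s) t₀ t) (P.ut y t₀)
    linarith [hG.ut_le t₀ ht₀ y]
  have hDc : ∀ t, Continuous (D t) := by
    intro t
    by_cases h : t = t₀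
    · have : D t = fun _ => 0 := by
        ext y; simp only [hD, h, dslope_same]; exact sub_self _
      rw [this]; exact continuous_const
    · have h2 : D t = fun y => (t - t₀)⁻¹ • (P.u y t - P.u y t₀) - P.ut y t₀ := by
        ext y; simp only [hD, dslope_of_ne _ h, slope]; rfl
      have := hP.continuous_u t
      have := hP.continuous_u t₀
      have := hP.continuous_ut t₀
      rw [h2]; fun_prop
  set η : ℝ → ℝ → ℝ := fun t => (Ioi x₀).indicator fun y =>
    (1 + ‖A‖) * (1 + |y - x₀|) * (‖c‖ * ‖D t y‖) with hη
  have hηm : ∀ t, AEStronglyMeasurable (η t) volume := fun t => by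
    refine AEStronglyMeasurable.indicator ?_ measurableSet_Ioi
    have := hDc t
    apply Continuous.aestronglyMeasurable; fun_prop
  have hηb : ∀ t ∈ S, ∀ y, ‖η t y‖ ≤ 2 * H y := by
    intro t ht y
    by_cases hy : y ∈ Ioi x₀
    · simp only [hη, hH, indicator_of_mem hy]
      rw [Real.norm_of_nonneg (by positivity)]
      calc _ ≤ (1 + ‖A‖) * (1 + |y - x₀|) * (‖c‖ * (2 * G y)) := by
            gcongr; exact hDb t ht y
        _ = _ := by ring
    · simp [hη, hH, indicator_of_notMem hy]
  refine hasDerivWithinAt_kerOp (H := H) (η := η) (mem_of_mem_nhds hSn)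
    (fun t ht => (kV t).isDominatedKernel.mono iH fun x y => ?_)
    (kV'.isDominatedKernel.mono iH fun x y => ?_)
    (fun t ht x y => ?_)
    (fun t ht => (iH.const_mul 2).mono' (hηm t) (ae_of_all _ (hηb t ht))) ?_
  · rw [ContinuousLinearMap.norm_restrictScalars]
    have := hle (B := V t) (b := 1) (y := y) (by
      simp only [hV, norm_smul, one_mul]
      gcongr
      exact (norm_potL_le _).trans (hG.sub_le t (hSt t ht) y)) x
    simpa using this
  · rw [ContinuousLinearMap.norm_restrictScalars]
    have := hle (B := V') (b := 1) (y := y) (by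
      simp only [hV', norm_smul, one_mul]
      gcongr
      exact (norm_potL_le _).trans (hG.ut_le t₀ ht₀ y)) x
    simpa using this
  · have e : κ t x y - κ t₀ x y - (t - t₀) • κ' x y
        = (jostKer μ A (fun y => c • potL (((t - t₀ : ℝ) : ℂ) * D t y)) x₀ x y).restrictScalars ℝ := by
      have e1 : ((t - t₀ : ℝ) : ℂ) * D t y
          = (P.u y t - P.up) - (P.u y t₀ - P.up) - ((t - t₀ : ℝ) : ℂ) * P.ut y t₀ := by
        have := sub_smul_dslope (fun s => P.u y s) t₀ t
        simp only [hD, mul_sub]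
        rw [← real_smul, this]; ring
      have := jostKer_potL_sub_sub μ A c (P.u y t - P.up) (P.u y t₀ - P.up) (P.ut y t₀) (t - t₀)
        x₀ x y
      rw [← e1] at this
      exact this
    rw [e, ContinuousLinearMap.norm_restrictScalars]
    refine (norm_jostKer_le hμ0 A _ x₀ x y).trans ?_
    by_cases hy : y ∈ Ioi x₀
    · simp only [hη, indicator_of_mem hy, norm_smul]
      have : ‖potL (((t - t₀ : ℝ) : ℂ) * D t y)‖ ≤ ‖t - t₀‖ * ‖D t y‖ := by
        refine (norm_potL_le _).trans ?_
        rw [norm_mul, norm_real]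
      calc _ ≤ (1 + ‖A‖) * (1 + |y - x₀|) * (‖c‖ * (‖t - t₀‖ * ‖D t y‖)) := by gcongr
        _ = _ := by ring
    · simp [hη, indicator_of_notMem hy]
  · have : Tendsto (fun t => ∫ y, η t y) (𝓝[S] t₀) (𝓝 (∫ _ : ℝ, (0 : ℝ))) := by
      refine tendsto_integral_filter_of_dominated_convergence (fun y => 2 * H y)
        (Eventually.of_forall hηm)
        (eventually_of_mem self_mem_nhdsWithin fun t ht => ae_of_all _ (hηb t ht))
        (iH.const_mul 2) (ae_of_all _ fun y => ?_)
      refine tendsto_nhdsWithin_of_tendsto_nhds ?_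
      have h1 : Tendsto (fun t => D t y) (𝓝 t₀) (𝓝 0) := by
        have h1 := (continuousAt_dslope_same.2 (hP.hasDerivAt_u_time y t₀).differentiableAt).tendsto
        have h2 := h1.sub_const (P.ut y t₀)
        rw [dslope_same] at h2
        simpa [hD, ut] using h2
      by_cases hy : y ∈ Ioi x₀
      · simp only [hη, indicator_of_mem hy]
        simpa using (h1.norm.const_mul ‖c‖).const_mul ((1 + ‖A‖) * (1 + |y - x₀|))
      · simp [hη, indicator_of_notMem hy]
    simpa using this

open BoundedContinuousFunction in
-- Differentiating (1 - K_t)ψ_t = Y, with Y independent of t, gives χ = (1 - K)⁻¹ K'ψ. This is a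
-- Volterra equation with source, equivalent to the variational equation χ' = Xχ + X_t ψ (with X
-- shifted by ikλ) and χ → 0 at +∞.
theorem exists_hasDerivAt_jostHalf_time (hP : P.IsSolution) (t₀ x₀ : ℝ) {z : ℂ} (hz : z ∈ Dbar) :
    ∃ χ : ℝ →ᵇ (Fin 2 → ℂ), HasDerivAt (fun t => P.jostHalf t x₀ z) χ t₀ ∧
      (∀ x, x₀ < x → HasDerivAt χ (P.shiftX x t₀ z (χ x)
        + (I * P.k z) • potL (P.ut x t₀) (P.jostHalf t₀ x₀ z x)) x) ∧ Tendsto χ atTop (𝓝 0) := by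
  set μ := 2 * I * P.k z * P.lam z with hμ
  have hμ0 : 0 ≤ μ.re := re_rate_nonneg hP.α_pos hz
  set A := P.asymA z with hA
  set c := -(I * P.k z) with hc
  set V : ℝ → ℝ → (Fin 2 → ℂ) →L[ℂ] (Fin 2 → ℂ) := fun t y => c • potL (P.u y t - P.up) with hV
  set V' : ℝ → (Fin 2 → ℂ) →L[ℂ] (Fin 2 → ℂ) := fun y => c • potL (P.ut y t₀) with hV'
  have cV : ∀ t, Continuous (V t) := fun t => (continuous_potL_u hP t).const_smul c
  have cV' : Continuous V' := (continuous_potL.comp (hP.continuous_ut t₀)).const_smul c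
  have iV : ∀ t, IntegrableOn (fun y => (1 + |y - x₀|) ^ 2 * ‖V t y‖) (Ioi x₀) := fun t =>
    integrableOn_smul_potL hP t x₀ c
  have iV' : IntegrableOn (fun y => (1 + |y - x₀|) ^ 2 * ‖V' y‖) (Ioi x₀) :=
    integrableOn_smul_potL_ut hP t₀ x₀ c
  set κ : ℝ → ℝ → ℝ → (Fin 2 → ℂ) →L[ℝ] (Fin 2 → ℂ) :=
    fun t x y => (jostKer μ A (V t) x₀ x y).restrictScalars ℝ with hκ
  set κ' : ℝ → ℝ → (Fin 2 → ℂ) →L[ℝ] (Fin 2 → ℂ) :=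
    fun x y => (jostKer μ A V' x₀ x y).restrictScalars ℝ with hκ'
  have kV : ∀ t, IsVolterraKernel _ x₀ (κ t) := fun t =>
    (isVolterraKernel_jostKer' hμ0 A (cV t) (iV t)).restrictScalars
  have kV' : IsVolterraKernel _ x₀ κ' :=
    (isVolterraKernel_jostKer' hμ0 A cV' iV').restrictScalars
  -- The complex solution is recovered from the real resolvent: it satisfies the same equation, and
  -- the real operator 1 - K is invertible.
  have eqJ : ∀ t, P.jostHalf t x₀ z
      = Ring.inverse (1 - kerOp (κ t)) (const ℝ (P.asymCol z)) := by
    intro t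
    have hu := (kV t).isUnit_one_sub
    have h1 : (1 - kerOp (κ t)) (P.jostHalf t x₀ z) = const ℝ (P.asymCol z) := by
      refine BoundedContinuousFunction.ext fun x => ?_
      change P.jostHalf t x₀ z x - kerOp (κ t) (P.jostHalf t x₀ z) x = P.asymCol z
      rw [(kV t).isDominatedKernel.kerOp_apply]
      have := jostVolterra_apply hμ0 A (cV t) (iV t) (P.asymCol z) x
      change P.jostHalf t x₀ z x = P.asymCol z + ∫ y, jostKer μ A (V t) x₀ x y
        (P.jostHalf t x₀ z y) at this
      rw [sub_eq_iff_eq_add]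
      exact this
    rw [← h1]
    exact (congrArg (fun L : (ℝ →ᵇ (Fin 2 → ℂ)) →L[ℝ] (ℝ →ᵇ (Fin 2 → ℂ)) => L (P.jostHalf t x₀ z))
      (Ring.inverse_mul_cancel _ hu)).symm
  have dK : HasDerivAt (fun t => kerOp (κ t)) (kerOp κ') t₀ := hasDerivAt_kerOp_time hP t₀ x₀ hμ0 A c
  have key := hasDerivWithinAt_inverse_one_sub (kV t₀).isUnit_one_sub (dK.hasDerivWithinAt (s := univ))
    (hasDerivWithinAt_const t₀ univ (const ℝ (P.asymCol z)))
  simp only [← eqJ] at key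
  set χ := Ring.inverse (1 - kerOp (κ t₀)) (0 + kerOp κ' (P.jostHalf t₀ x₀ z)) with hχ
  refine ⟨χ, key.hasDerivAt univ_mem, ?_⟩
  set ψ := P.jostHalf t₀ x₀ z with hψ
  have hχe : ∀ x, χ x = (∫ y, jostKer μ A V' x₀ x y (ψ y))
      + ∫ y, jostKer μ A (V t₀) x₀ x y (χ y) := by
    intro x
    have := (kV t₀).exists_solution (0 + kerOp κ' ψ) x
    rw [← hχ, zero_add, kV'.isDominatedKernel.kerOp_apply] at this
    exact this
  set F : ℝ → Fin 2 → ℂ := fun y => -(V' y (ψ y) + V t₀ y (χ y)) with hF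
  have cF : Continuous F := ((cV'.clm_apply ψ.continuous).add
    ((cV t₀).clm_apply χ.continuous)).neg
  have iF : IntegrableOn (fun y => (1 + |y - x₀|) * ‖F y‖) (Ioi x₀) := by
    refine Integrable.mono' ((integrableOn_weight_of_sq cV' iV' ‖ψ‖).add
      (integrableOn_weight_of_sq (cV t₀) (iV t₀) ‖χ‖))
      (by apply Continuous.aestronglyMeasurable; fun_prop) (ae_of_all _ fun y => ?_)
    rw [Real.norm_of_nonneg (by positivity)]
    have h1 := (V' y).le_opNorm_of_le (ψ.norm_coe_le_norm y)
    have h2 := (V t₀ y).le_opNorm_of_le (χ.norm_coe_le_norm y)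
    have h3 : ‖F y‖ ≤ ‖V' y‖ * ‖ψ‖ + ‖V t₀ y‖ * ‖χ‖ := by
      simp only [hF, norm_neg]
      exact (norm_add_le _ _).trans (add_le_add h1 h2)
    calc _ ≤ (1 + |y - x₀|) * (‖V' y‖ * ‖ψ‖ + ‖V t₀ y‖ * ‖χ‖) := by gcongr
      _ = _ := by simp only [Pi.add_apply]; ring
  have := jost_ode hμ0 (asymA_asymA hP hz.2) cF iF (Y := 0) (map_zero _) (ψ := χ) (fun x hx => by
    rw [hχe, integral_jostKer_apply hμ0 A cV' iV' ψ hx,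
      integral_jostKer_apply hμ0 A (cV t₀) (iV t₀) χ hx]
    have i1 : IntegrableOn F (Ioi x) := by
      have h0 : IntegrableOn F (Ioi x₀) := by
        refine Integrable.mono iF cF.aestronglyMeasurable (ae_of_all _ fun y => ?_)
        rw [norm_mul, norm_norm, Real.norm_eq_abs, abs_of_nonneg (by positivity)]
        nlinarith [abs_nonneg (y - x₀), norm_nonneg (F y)]
      exact h0.mono_set (Ioi_subset_Ioi hx.le)
    have k1 := (isVolterraKernel_jostKer' (μ := 0) (by simp) 0 cV' iV').isDominatedKernel
    have k2 := (isVolterraKernel_jostKer' (μ := 0) (by simp) 0 (cV t₀) (iV t₀)).isDominatedKernel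
    have k3 := isDominatedKernel_expKer hμ0 cV' iV'
    have k4 := isDominatedKernel_expKer hμ0 (cV t₀) (iV t₀)
    have hm : max x x₀ = x := max_eq_left hx.le
    have j1 : IntegrableOn (fun y => V' y (ψ y)) (Ioi x) := by
      refine ((k1.integrable_apply ψ x).integrableOn (s := Ioi x)).congr_fun (fun y hy => ?_)
        measurableSet_Ioi
      simp only [jostKer, hm, indicator_of_mem hy]; simp
    have j2 : IntegrableOn (fun y => V t₀ y (χ y)) (Ioi x) := by
      refine ((k2.integrable_apply χ x).integrableOn (s := Ioi x)).congr_fun (fun y hy => ?_)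
        measurableSet_Ioi
      simp only [jostKer, hm, indicator_of_mem hy]; simp
    have j3 : IntegrableOn (fun y => expInt μ (x - y) • V' y (ψ y)) (Ioi x) := by
      refine ((k3.integrable_apply ψ x).integrableOn (s := Ioi x)).congr_fun (fun y hy => ?_)
        measurableSet_Ioi
      simp only [expKer, hm, min_eq_left (sub_nonpos.2 (le_of_lt (mem_Ioi.1 hy)))]; rfl
    have j4 : IntegrableOn (fun y => expInt μ (x - y) • V t₀ y (χ y)) (Ioi x) := by
      refine ((k4.integrable_apply χ x).integrableOn (s := Ioi x)).congr_fun (fun y hy => ?_)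
        measurableSet_Ioi
      simp only [expKer, hm, min_eq_left (sub_nonpos.2 (le_of_lt (mem_Ioi.1 hy)))]; rfl
    simp only [hF, smul_neg, integral_neg, smul_add, map_neg]
    rw [integral_add j1 j2, integral_add j3 j4, map_add]
    abel)
  refine ⟨fun x hx => ?_, this.2⟩
  refine (this.1 x hx).congr_deriv ?_
  rw [shiftX_eq]
  simp only [hF, hV, hV', hc, _root_.smul_apply, neg_smul]
  abel

end NZBC

/-! ### Zero curvature and the full Lax pair -/

namespace NZBC

variable {P : NZBC}

/-- The diagonal entry of `T`. -/
noncomputable def laxTdiag (P : NZBC) (x t : ℝ) (z : ℂ) : ℂ :=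
  -2 * I * P.α ^ 2 * P.k z ^ 4 + 4 * I * P.α ^ 2 * P.k z ^ 2
    + I * P.k z ^ 2 * (P.u x t * conj (P.u x t))

/-- The upper right entry of `T`. -/
noncomputable def laxTup (P : NZBC) (x t : ℝ) (z : ℂ) : ℂ :=
  2 * I * P.α * P.k z * (P.k z ^ 2 - 2) * P.u x t
    - I / P.α * P.k z * (P.u x t * conj (P.u x t) * P.u x t) - P.k z * P.ux x t

/-- The lower left entry of `T`. -/
noncomputable def laxTdown (P : NZBC) (x t : ℝ) (z : ℂ) : ℂ :=
  2 * I * P.α * P.k z * (P.k z ^ 2 - 2) * conj (P.u x t)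
    - I / P.α * P.k z * (P.u x t * conj (P.u x t) * conj (P.u x t)) + P.k z * conj (P.ux x t)

theorem laxT_eq (x t : ℝ) (z : ℂ) :
    P.laxT x t z = !![P.laxTdiag x t z, P.laxTup x t z; P.laxTdown x t z, -P.laxTdiag x t z] := by
  have h : ((‖P.u x t‖ ^ 2 : ℝ) : ℂ) = P.u x t * conj (P.u x t) := by
    rw [mul_conj, normSq_eq_norm_sq]
  unfold laxT
  rw [h]
  ext i j
  fin_cases i <;> fin_cases j
  · simp [laxTdiag, sigma3, potQ, pow_succ]
  · simp [laxTup, sigma3, potQ, pow_succ, ux]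
  · simp [laxTdown, sigma3, potQ, pow_succ, ux]
    left; left; ring
  · simp [laxTdiag, sigma3, potQ, pow_succ]

/-- The matrix `T - iθ_t`. -/
noncomputable def shiftT (P : NZBC) (x t : ℝ) (z : ℂ) : (Fin 2 → ℂ) →L[ℂ] (Fin 2 → ℂ) :=
  mat2 (P.laxTdiag x t z + I * (P.k z * P.lam z)
      * (2 * P.α * P.k z ^ 2 - 4 * P.α - (P.u₀ : ℂ) ^ 2 / P.α))
    (P.laxTup x t z) (P.laxTdown x t z)
    (-P.laxTdiag x t z + I * (P.k z * P.lam z)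
      * (2 * P.α * P.k z ^ 2 - 4 * P.α - (P.u₀ : ℂ) ^ 2 / P.α))

theorem laxT_mulVec (x t : ℝ) (z : ℂ) (v : Fin 2 → ℂ) :
    P.laxT x t z *ᵥ v = P.shiftT x t z v - (I * (P.k z * P.lam z)
      * (2 * P.α * P.k z ^ 2 - 4 * P.α - (P.u₀ : ℂ) ^ 2 / P.α)) • v := by
  rw [laxT_eq]
  ext i
  fin_cases i <;> simp [shiftT, mat2_apply, Matrix.mulVec, dotProduct, Fin.sum_univ_two] <;> ring

theorem laxX_mulVec (hP : P.IsSolution) (x t : ℝ) {z : ℂ} (hz : z ≠ 0) (v : Fin 2 → ℂ) :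
    P.laxX x t z *ᵥ v = P.shiftX x t z v - (I * (P.k z * P.lam z)) • v := by
  have hα : (P.α : ℂ) ≠ 0 := by exact_mod_cast hP.α_pos.ne'
  ext i
  fin_cases i
  · simp [laxX, shiftX, mat2_apply, Matrix.mulVec, dotProduct, Fin.sum_univ_two, sigma3, potQ,
      Matrix.add_apply, k, lam]
    field_simp
    ring
  · simp [laxX, shiftX, mat2_apply, Matrix.mulVec, dotProduct, Fin.sum_univ_two, sigma3, potQ,
      Matrix.add_apply, k, lam]
    field_simp
    ring

/-- The limiting column lies in the kernel of the limit of T - iθ_t. This is where the coefficient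
2αk² - 4α - u₀²/α in θ and the condition |u₊| = u₀ are used. -/
theorem tendsto_shiftT (hP : P.IsSolution) (t : ℝ) {z : ℂ} (hz : z ∈ Dbar) {ψ : ℝ → Fin 2 → ℂ}
    (hψ : Tendsto ψ atTop (𝓝 (P.asymCol z))) :
    Tendsto (fun x => P.shiftT x t z (ψ x)) atTop (𝓝 0) := by
  obtain ⟨U, G, hG⟩ := hP.exists_isDominating |t|
  have h1 := hG.tendsto_u t le_rfl
  have h2 : Tendsto (fun x => conj (P.u x t)) atTop (𝓝 (conj P.up)) :=
    (continuous_conj.tendsto _).comp h1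
  have h3 := hG.tendsto_ux t le_rfl
  have h4 : Tendsto (fun x => conj (P.ux x t)) atTop (𝓝 0) := by
    have := (continuous_conj.tendsto _).comp h3
    simpa using! this
  have p0 := tendsto_pi_nhds.1 hψ 0
  have p1 := tendsto_pi_nhds.1 hψ 1
  have hd : Tendsto (fun x => P.laxTdiag x t z) atTop (𝓝 (-2 * I * P.α ^ 2 * P.k z ^ 4
      + 4 * I * P.α ^ 2 * P.k z ^ 2 + I * P.k z ^ 2 * (P.up * conj P.up))) :=
    ((h1.mul h2).const_mul _).const_add _
  have hu : Tendsto (fun x => P.laxTup x t z) atTop (𝓝 (2 * I * P.α * P.k z * (P.k z ^ 2 - 2)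
      * P.up - I / P.α * P.k z * (P.up * conj P.up * P.up) - P.k z * 0)) :=
    ((h1.const_mul _).sub (((h1.mul h2).mul h1).const_mul _)).sub (h3.const_mul _)
  have hl : Tendsto (fun x => P.laxTdown x t z) atTop (𝓝 (2 * I * P.α * P.k z * (P.k z ^ 2 - 2)
      * conj P.up - I / P.α * P.k z * (P.up * conj P.up * conj P.up) + P.k z * 0)) :=
    ((h2.const_mul _).sub (((h1.mul h2).mul h2).const_mul _)).add (h4.const_mul _)
  have hα : (P.α : ℂ) ≠ 0 := by exact_mod_cast hP.α_pos.ne'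
  have hz0 := hz.2
  have hup := conj_mul_up hP
  rw [tendsto_pi_nhds]
  intro i
  simp only [shiftT, mat2_apply]
  fin_cases i
  · have := ((hd.add_const (I * (P.k z * P.lam z)
      * (2 * P.α * P.k z ^ 2 - 4 * P.α - (P.u₀ : ℂ) ^ 2 / P.α))).mul p0).add (hu.mul p1)
    refine (Eq.subst (motive := fun w => Tendsto _ atTop (𝓝 w)) ?_ this)
    rw [hup]
    simp [asymCol, k, lam]
    field_simp
    have h6 : conj P.up * P.up = (P.u₀ : ℂ) ^ 2 := by rw [mul_comm]; exact hup
    ring_nf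
    simp only [mul_assoc, h6, mul_left_comm _ (conj P.up), mul_comm P.up, mul_left_comm P.up]
    ring
  · have := (hl.mul p0).add ((hd.neg.add_const (I * (P.k z * P.lam z)
      * (2 * P.α * P.k z ^ 2 - 4 * P.α - (P.u₀ : ℂ) ^ 2 / P.α))).mul p1)
    refine (Eq.subst (motive := fun w => Tendsto _ atTop (𝓝 w)) ?_ this)
    rw [hup]
    simp [asymCol, k, lam]
    field_simp
    ring

/-- The zero curvature condition: `ψ_t - (T - iθ_t)ψ` solves the `x`-equation. -/
theorem hasDerivAt_zero_curvature (hP : P.IsSolution) (x t : ℝ) {z : ℂ} (hz : z ≠ 0)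
    {ψ χ : ℝ → Fin 2 → ℂ} (hψ : HasDerivAt ψ (P.shiftX x t z (ψ x)) x)
    (hχ : HasDerivAt χ (P.shiftX x t z (χ x) + (I * P.k z) • potL (P.ut x t) (ψ x)) x) :
    HasDerivAt (fun s => χ s - P.shiftT s t z (ψ s))
      (P.shiftX x t z (χ x - P.shiftT x t z (ψ x))) x := by
  have hα : (P.α : ℂ) ≠ 0 := by exact_mod_cast hP.α_pos.ne'
  have h1 := hP.hasDerivAt_u x t
  have h2 : HasDerivAt (fun s => conj (P.u s t)) (conj (P.ux x t)) x := by simpa using! h1.star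
  have h3 := hP.hasDerivAt_ux x t
  have h4 : HasDerivAt (fun s => conj (P.ux s t)) (conj (P.uxx x t)) x := by simpa using! h3.star
  have p0 := hasDerivAt_pi.1 hψ 0
  have p1 := hasDerivAt_pi.1 hψ 1
  have q0 := hasDerivAt_pi.1 hχ 0
  have q1 := hasDerivAt_pi.1 hχ 1
  have hd : HasDerivAt (fun s => P.laxTdiag s t z) (I * P.k z ^ 2
      * (P.ux x t * conj (P.u x t) + P.u x t * conj (P.ux x t))) x :=
    ((h1.mul h2).const_mul (I * P.k z ^ 2)).const_add _
  have hu : HasDerivAt (fun s => P.laxTup s t z) (2 * I * P.α * P.k z * (P.k z ^ 2 - 2) * P.ux x t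
      - I / P.α * P.k z * ((P.ux x t * conj (P.u x t) + P.u x t * conj (P.ux x t)) * P.u x t
        + P.u x t * conj (P.u x t) * P.ux x t) - P.k z * P.uxx x t) x :=
    ((h1.const_mul _).sub (((h1.mul h2).mul h1).const_mul _)).sub (h3.const_mul _)
  have hl : HasDerivAt (fun s => P.laxTdown s t z) (2 * I * P.α * P.k z * (P.k z ^ 2 - 2)
      * conj (P.ux x t)
      - I / P.α * P.k z * ((P.ux x t * conj (P.u x t) + P.u x t * conj (P.ux x t)) * conj (P.u x t)
        + P.u x t * conj (P.u x t) * conj (P.ux x t)) + P.k z * conj (P.uxx x t)) x :=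
    ((h2.const_mul _).sub (((h1.mul h2).mul h2).const_mul _)).add (h4.const_mul _)
  have e1 := hP.equation' x t
  have e2 := congrArg conj e1
  simp only [map_add, map_mul, map_zero, conj_I, conj_ofReal, map_ofNat, map_div₀, conj_conj,
    map_pow] at e2
  rw [hasDerivAt_pi]
  intro i
  simp only [shiftT, mat2_apply, Pi.sub_apply]
  have r1 : P.ut x t = I * P.uxx x t - 4 * P.α * P.ux x t
      - 1 / P.α * (2 * P.u x t * conj (P.u x t) * P.ux x t + P.u x t ^ 2 * conj (P.ux x t)) := by
    linear_combination (-I) * e1 + (P.ut x t + 4 * P.α * P.ux x t + 1 / P.α *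
        (2 * P.u x t * conj (P.u x t) * P.ux x t + P.u x t ^ 2 * conj (P.ux x t))) * I_mul_I
  have r2 : conj (P.ut x t) = -I * conj (P.uxx x t) - 4 * P.α * conj (P.ux x t)
      - 1 / P.α * (2 * conj (P.u x t) * P.u x t * conj (P.ux x t)
        + conj (P.u x t) ^ 2 * P.ux x t) := by
    rw [r1]
    simp only [map_add, map_sub, map_mul, conj_I, conj_ofReal, map_ofNat, map_div₀, conj_conj,
      map_pow, map_one]
  -- Removes z in favour of k and a = iku₀²/z, using 2αk = z - u₀²/z. With u_t eliminated through
  -- the equation, the claim is then a polynomial identity.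
  have ha : I * P.k z * z = I * P.k z * P.u₀ ^ 2 / z + 2 * I * P.α * P.k z ^ 2 := by
    have hk : P.k z * 2 * P.α = z - (P.u₀ : ℂ) ^ 2 / z := by unfold k; field_simp
    linear_combination (-(I * P.k z)) * hk
  have hI : I ^ 3 = -I := by rw [pow_succ, I_sq]; ring
  have hI4 : I ^ 4 = 1 := I_pow_four
  fin_cases i
  · refine (q0.sub (((hd.add_const _).mul p0).add (hu.mul p1))).congr_deriv ?_
    simp only [shiftX, ha, mat2_apply, potL_apply, laxTdiag, laxTup, laxTdown, r1,
      Fin.zero_eta, Fin.isValue, Matrix.cons_val_zero, Matrix.cons_val_one, Pi.add_apply,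
      Pi.smul_apply, smul_eq_mul, Pi.sub_apply, Matrix.cons_val_fin_one]
    generalize I * P.k z * P.u₀ ^ 2 / z = a
    generalize I * (P.k z * P.lam z) * (2 * P.α * P.k z ^ 2 - 4 * P.α - (P.u₀ : ℂ) ^ 2 / P.α) = c
    field_simp
    ring_nf
    simp only [I_sq, hI, hI4]
    ring
  · have hdn : HasDerivAt (fun s => -P.laxTdiag s t z) _ x := hd.neg
    refine (q1.sub ((hl.mul p0).add ((hdn.add_const _).mul p1))).congr_deriv ?_
    simp only [shiftX, ha, mat2_apply, potL_apply, laxTdiag, laxTup, laxTdown, r2,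
      Fin.mk_one, Fin.isValue, Matrix.cons_val_zero, Matrix.cons_val_one, Pi.add_apply,
      Pi.smul_apply, smul_eq_mul, Pi.sub_apply, Matrix.cons_val_fin_one]
    generalize I * P.k z * P.u₀ ^ 2 / z = a
    generalize I * (P.k z * P.lam z) * (2 * P.α * P.k z ^ 2 - 4 * P.α - (P.u₀ : ℂ) ^ 2 / P.α) = c
    field_simp
    ring_nf
    simp only [I_sq, hI, hI4]
    ring

/-- The defect ψ_t - (T - iθ_t)ψ solves the x-equation by zero curvature and tends to 0 at +∞, so
the Wronskian argument forces it to vanish. -/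
theorem hasDerivAt_jost_time (hP : P.IsSolution) (x t : ℝ) {z : ℂ} (hz : z ∈ Dbar) :
    HasDerivAt (fun s => P.jost x s z) (P.shiftT x t z (P.jost x t z)) t := by
  obtain ⟨χ, h1, h2, h3⟩ := exists_hasDerivAt_jostHalf_time hP t (x - 1) hz
  obtain ⟨a1, a2⟩ := jostHalf_spec hP t (x - 1) hz
  have h4 : HasDerivAt (fun s => P.jost x s z) (χ x) t := by
    have := (BoundedContinuousFunction.evalCLM ℝ (β := Fin 2 → ℂ) x).hasFDerivAt.comp_hasDerivAt t h1
    exact this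
  refine h4.congr_deriv (sub_eq_zero.1 ?_)
  refine eq_zero_of_tendsto_zero hP (t := t) hz a1 a2
    (D := fun s => χ s - P.shiftT s t z (P.jostHalf t (x - 1) z s))
    (fun s hs => hasDerivAt_zero_curvature hP s t hz.2 (a1 s hs) (h2 s hs)) ?_
    (show x - 1 < x by linarith)
  simpa using h3.sub (tendsto_shiftT hP t hz a2)

/-- The first column of the Jost solution `φ₊`. -/
noncomputable def jostFull (P : NZBC) (z : ℂ) (x t : ℝ) : Fin 2 → ℂ :=
  exp (I * P.theta x t z) • P.jost x t z

theorem asymY_col_zero (w z : ℂ) : (fun i => asymY w z i 0) = ![1, -conj w / z] := by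
  ext i
  fin_cases i <;> simp [asymY, sigma3, potQ, div_eq_inv_mul]

theorem asymY_col_one (w z : ℂ) : (fun i => asymY w z i 1) = ![w / z, 1] := by
  ext i
  fin_cases i <;> simp [asymY, sigma3, potQ, div_eq_inv_mul]

theorem isJostColumn_jostFull (hP : P.IsSolution) {z : ℂ} (hz : z ∈ Dbar) :
    P.IsJostColumn P.up atTop 0 z (P.jostFull z) where
  x_part := fun x t => by
    have h1 : HasDerivAt (fun y : ℝ => P.theta y t z) (-(P.k z * P.lam z)) x := by
      have := ((hasDerivAt_id x).ofReal_comp.add_const ((2 * P.α * P.k z ^ 2 - 4 * P.α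
        - (P.u₀ : ℂ) ^ 2 / P.α) * t)).const_mul (-(P.k z * P.lam z))
      refine this.congr_deriv ?_
      simp
    have h2 := ((h1.const_mul I).cexp).smul (hasDerivAt_jost hP x t hz)
    refine h2.congr_deriv ?_
    rw [laxX_mulVec hP x t hz.2, jostFull, map_smul]
    simp only [smul_smul]
    module
  t_part := fun x t => by
    have h1 : HasDerivAt (fun s : ℝ => P.theta x s z) (-(P.k z * P.lam z)
        * (2 * P.α * P.k z ^ 2 - 4 * P.α - (P.u₀ : ℂ) ^ 2 / P.α)) t := by
      have := (((hasDerivAt_id t).ofReal_comp.const_mul (2 * P.α * P.k z ^ 2 - 4 * P.α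
        - (P.u₀ : ℂ) ^ 2 / P.α)).const_add (x : ℂ)).const_mul (-(P.k z * P.lam z))
      refine this.congr_deriv ?_
      simp
    have h2 := ((h1.const_mul I).cexp).smul (hasDerivAt_jost_time hP x t hz)
    refine h2.congr_deriv ?_
    rw [laxT_mulVec, jostFull, map_smul]
    simp only [smul_smul]
    module
  asymp := fun t => by
    have h := tendsto_jost hP t hz
    rw [asymY_col_zero]
    refine h.congr fun x => ?_
    simp only [jostFull, sigma3, smul_smul, ← exp_add]
    simp

/-- Uniqueness of the first Jost column at `+∞`. -/
theorem isJostColumn_unique (hP : P.IsSolution) {z : ℂ} (hz : z ∈ Dbar)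
    {f : ℝ → ℝ → Fin 2 → ℂ} (hf : P.IsJostColumn P.up atTop 0 z f) : f = P.jostFull z := by
  funext x t
  have key : exp (-(I * P.theta x t z)) • f x t = P.jost x t z := by
    refine sub_eq_zero.1 (eq_zero_of_tendsto_zero hP (t := t) hz (x₀ := x - 1)
      (ψ := fun s => P.jost s t z)
      (D := fun s => exp (-(I * P.theta s t z)) • f s t - P.jost s t z)
      (fun s _ => hasDerivAt_jost hP s t hz) (tendsto_jost hP t hz) (fun s _ => ?_) ?_
      (show x - 1 < x by linarith))
    · rw [map_sub]
      refine HasDerivAt.sub ?_ (hasDerivAt_jost hP s t hz)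
      have h1 : HasDerivAt (fun y : ℝ => P.theta y t z) (-(P.k z * P.lam z)) s := by
        have := ((hasDerivAt_id s).ofReal_comp.add_const ((2 * P.α * P.k z ^ 2 - 4 * P.α
          - (P.u₀ : ℂ) ^ 2 / P.α) * t)).const_mul (-(P.k z * P.lam z))
        refine this.congr_deriv ?_
        simp
      refine (((h1.const_mul I).neg.cexp).smul (hf.x_part s t)).congr_deriv ?_
      rw [laxX_mulVec hP s t hz.2, map_smul]
      module
    · have h1 := hf.asymp t
      rw [asymY_col_zero] at h1
      have h2 := h1.sub (tendsto_jost hP t hz)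
      simp only [asymCol, sub_self] at h2
      refine h2.congr fun s => ?_
      simp [sigma3]
  rw [jostFull, ← key, smul_smul, ← exp_add]
  simp

end NZBC

/-! ### Asymptotics of the Jost solution for large z -/

/-- A solution of `y' = r y + f` with `Re r ≥ 0` is bounded by its limit and the forcing. -/
theorem norm_le_of_hasDerivAt {y y' r : ℝ → ℂ} {F : ℝ → ℝ} {x₀ : ℝ} {L : ℂ} (hr : Continuous r)
    (hr0 : ∀ s, 0 ≤ (r s).re) (hy : ∀ s, x₀ < s → HasDerivAt y (y' s) s)
    (hF : ∀ s, x₀ < s → ‖y' s - r s * y s‖ ≤ F s) (hFi : IntegrableOn F (Ioi x₀))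
    (hF0 : ∀ s, 0 ≤ F s) (hL : Tendsto y atTop (𝓝 L)) {s : ℝ} (hs : x₀ < s) :
    ‖y s‖ ≤ ‖L‖ + ∫ τ in Ioi x₀, F τ := by
  have key : ∀ X, s ≤ X → ‖y s‖ ≤ ‖y X‖ + ∫ τ in Ioi x₀, F τ := by
    intro X hX
    -- Integrating factor based at s; |e^{-R}| ≤ 1 to the right of s because Re r ≥ 0. Only this
    -- sign is used, so large or oscillating rates do no harm.
    set R : ℝ → ℂ := fun τ => ∫ ξ in s..τ, r ξ with hR
    have dR : ∀ τ, HasDerivAt R (r τ) τ := fun τ =>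
      intervalIntegral.integral_hasDerivAt_right (hr.intervalIntegrable _ _)
        (hr.stronglyMeasurableAtFilter _ _) hr.continuousAt
    have hR0 : R s = 0 := by simp [hR]
    have hRe : ∀ τ, s ≤ τ → 0 ≤ (R τ).re := by
      intro τ hτ
      have : (R τ).re = ∫ ξ in s..τ, (r ξ).re := by
        have := intervalIntegral.intervalIntegral_re (𝕜 := ℂ) (hr.intervalIntegrable (μ := volume) s τ)
        simpa using this.symm
      rw [this]
      exact intervalIntegral.integral_nonneg hτ fun ξ _ => hr0 ξ
    set g : ℝ → ℂ := fun τ => exp (-R τ) * (y' τ - r τ * y τ) with hg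
    have dY : ∀ τ, x₀ < τ → HasDerivAt (fun τ => exp (-R τ) * y τ) (g τ) τ := by
      intro τ hτ
      refine ((dR τ).neg.cexp.mul (hy τ hτ)).congr_deriv ?_
      simp only [hg, Pi.neg_apply]; ring
    have hsub : uIoc s X ⊆ Ioi x₀ := fun τ hτ => by
      rw [uIoc_of_le hX] at hτ; exact hs.trans hτ.1
    have hgF : ∀ τ ∈ Ioc s X, ‖g τ‖ ≤ F τ := by
      intro τ hτ
      have h1 : ‖exp (-R τ)‖ ≤ 1 := by
        rw [norm_exp, neg_re]; exact Real.exp_le_one_iff.2 (neg_nonpos.2 (hRe τ hτ.1.le))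
      rw [hg, norm_mul]
      exact (mul_le_of_le_one_left (norm_nonneg _) h1).trans (hF τ (hs.trans hτ.1))
    have hFI : IntegrableOn F (Ioc s X) := hFi.mono_set fun τ hτ => hs.trans hτ.1
    -- No measurability of y' is assumed; g is measurable as the derivative of e^{-R}y.
    have hgm : AEStronglyMeasurable g (volume.restrict (Ioc s X)) := by
      have h1 : AEStronglyMeasurable (deriv fun τ => exp (-R τ) * y τ)
          (volume.restrict (Ioc s X)) := (stronglyMeasurable_deriv _).aestronglyMeasurable
      refine h1.congr ?_
      filter_upwards [ae_restrict_mem measurableSet_Ioc] with τ hτ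
      exact (dY τ (hs.trans hτ.1)).deriv
    have hgi : IntegrableOn g (Ioc s X) := Integrable.mono' hFI hgm
      ((ae_restrict_iff' measurableSet_Ioc).2 (ae_of_all _ hgF))
    have ftc := intervalIntegral.integral_eq_sub_of_hasDerivAt (a := s) (b := X)
      (f := fun τ => exp (-R τ) * y τ) (f' := g) (fun τ hτ => dY τ (by
        rw [uIcc_of_le hX] at hτ; exact hs.trans_le hτ.1))
      ((intervalIntegrable_iff_integrableOn_Ioc_of_le hX).2 hgi)
    simp only [hR0, neg_zero, exp_zero, one_mul] at ftc
    have e1 : y s = exp (-R X) * y X - ∫ τ in s..X, g τ := by rw [ftc]; ring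
    have h1 : ‖exp (-R X)‖ ≤ 1 := by
      rw [norm_exp, neg_re]; exact Real.exp_le_one_iff.2 (neg_nonpos.2 (hRe X hX))
    have h2 : ‖∫ τ in s..X, g τ‖ ≤ ∫ τ in Ioi x₀, F τ := by
      rw [intervalIntegral.integral_of_le hX]
      refine (norm_integral_le_of_norm_le hFI
        ((ae_restrict_iff' measurableSet_Ioc).2 (ae_of_all _ hgF))).trans ?_
      exact setIntegral_mono_set hFi (ae_of_all _ hF0)
        (LE.le.eventuallyLE fun τ hτ => hs.trans hτ.1)
    rw [e1]
    refine (norm_sub_le _ _).trans (add_le_add ?_ h2)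
    rw [norm_mul]
    exact mul_le_of_le_one_left (norm_nonneg _) h1
  refine ge_of_tendsto (hL.norm.add_const _) ?_
  filter_upwards [eventually_ge_atTop s] with X hX using key X hX

namespace NZBC

variable {P : NZBC}

/-- `u₀² - |u|²`. -/
noncomputable def defect (P : NZBC) (t s : ℝ) : ℂ := P.u₀ ^ 2 - P.u s t * conj (P.u s t)

/-- The coefficient `ik/z`. -/
noncomputable def kap (P : NZBC) (z : ℂ) : ℂ := I * P.k z / z

/-- The forcing term `ū_x + (ik/z) ū (u₀² - |u|²)`. -/
noncomputable def forcing (P : NZBC) (t : ℝ) (z : ℂ) (s : ℝ) : ℂ :=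
  conj (P.ux s t) + P.kap z * (conj (P.u s t) * P.defect t s)

/-- The derivative of `forcing`. -/
noncomputable def forcing' (P : NZBC) (t : ℝ) (z : ℂ) (s : ℝ) : ℂ :=
  conj (P.uxx s t) + P.kap z * (conj (P.ux s t) * P.defect t s
    - conj (P.u s t) * (P.ux s t * conj (P.u s t) + P.u s t * conj (P.ux s t)))

theorem kap_eq (hP : P.IsSolution) {z : ℂ} (hz : z ≠ 0) :
    P.kap z = I / (2 * P.α) * (1 - (P.u₀ : ℂ) ^ 2 / z ^ 2) := by
  have hα : (P.α : ℂ) ≠ 0 := by exact_mod_cast hP.α_pos.ne'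
  unfold kap k
  field_simp

theorem norm_I_div (hP : P.IsSolution) : ‖I / (2 * (P.α : ℂ))‖ = 1 / (2 * P.α) := by
  simp [abs_of_pos hP.α_pos]

section

variable {z : ℂ} (hP : P.IsSolution) (hz2 : 2 * P.u₀ ^ 2 ≤ ‖z‖ ^ 2) (hz0 : z ≠ 0)

include hP hz2 hz0

theorem norm_ratio_le : ‖(P.u₀ : ℂ) ^ 2 / z ^ 2‖ ≤ 1 / 2 := by
  have : 0 < ‖z‖ := norm_pos_iff.2 hz0
  rw [norm_div, norm_pow, norm_pow, norm_real, Real.norm_of_nonneg hP.u₀_pos.le,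
    div_le_div_iff₀ (by positivity) two_pos]
  linarith

theorem norm_kap_le : ‖P.kap z‖ ≤ 1 / P.α := by
  have h := norm_ratio_le hP hz2 hz0
  have h1 : ‖1 - (P.u₀ : ℂ) ^ 2 / z ^ 2‖ ≤ 2 := by
    refine (norm_sub_le _ _).trans ?_
    rw [norm_one]; linarith
  rw [kap_eq hP hz0, norm_mul, norm_I_div hP]
  have hα := hP.α_pos
  calc 1 / (2 * P.α) * ‖1 - (P.u₀ : ℂ) ^ 2 / z ^ 2‖ ≤ 1 / (2 * P.α) * 2 := by gcongr
    _ = 1 / P.α := by field_simp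

theorem kap_inv : P.kap z ≠ 0 ∧ ‖(P.kap z)⁻¹‖ ≤ 4 * P.α := by
  have h := norm_ratio_le hP hz2 hz0
  have hα := hP.α_pos
  have h1 : 1 / 2 ≤ ‖1 - (P.u₀ : ℂ) ^ 2 / z ^ 2‖ := by
    have := norm_sub_norm_le (1 : ℂ) ((P.u₀ : ℂ) ^ 2 / z ^ 2)
    rw [norm_one] at this; linarith
  have h2 : 1 / (4 * P.α) ≤ ‖P.kap z‖ := by
    rw [kap_eq hP hz0, norm_mul, norm_I_div hP]
    calc 1 / (4 * P.α) = 1 / (2 * P.α) * (1 / 2) := by field_simp; norm_num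
      _ ≤ _ := by gcongr
  have h3 : 0 < 1 / (4 * P.α) := by positivity
  refine ⟨norm_pos_iff.1 (h3.trans_le h2), ?_⟩
  rw [norm_inv]
  calc ‖P.kap z‖⁻¹ ≤ (1 / (4 * P.α))⁻¹ := inv_anti₀ h3 h2
    _ = 4 * P.α := by simp

theorem ell_inv : z + (P.u₀ : ℂ) ^ 2 / z ≠ 0 ∧ ‖(z + (P.u₀ : ℂ) ^ 2 / z)⁻¹‖ ≤ 2 / ‖z‖ := by
  have h := norm_ratio_le hP hz2 hz0
  have hn : 0 < ‖z‖ := norm_pos_iff.2 hz0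
  have e : z + (P.u₀ : ℂ) ^ 2 / z = z * (1 + (P.u₀ : ℂ) ^ 2 / z ^ 2) := by field_simp
  have h1 : 1 / 2 ≤ ‖1 + (P.u₀ : ℂ) ^ 2 / z ^ 2‖ := by
    have := norm_sub_le (1 + (P.u₀ : ℂ) ^ 2 / z ^ 2) ((P.u₀ : ℂ) ^ 2 / z ^ 2)
    rw [add_sub_cancel_right, norm_one] at this; linarith
  have h2 : ‖z‖ / 2 ≤ ‖z + (P.u₀ : ℂ) ^ 2 / z‖ := by
    rw [e, norm_mul]
    calc ‖z‖ / 2 = ‖z‖ * (1 / 2) := by ring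
      _ ≤ _ := by gcongr
  have h3 : 0 < ‖z‖ / 2 := by positivity
  refine ⟨norm_pos_iff.1 (h3.trans_le h2), ?_⟩
  rw [norm_inv]
  calc _ ≤ (‖z‖ / 2)⁻¹ := inv_anti₀ h3 h2
    _ = 2 / ‖z‖ := by simp

end

theorem hasDerivAt_conj_u (hP : P.IsSolution) (s t : ℝ) :
    HasDerivAt (fun s => conj (P.u s t)) (conj (P.ux s t)) s := by
  simpa using! (hP.hasDerivAt_u s t).star

theorem hasDerivAt_defect (hP : P.IsSolution) (s t : ℝ) : HasDerivAt (P.defect t)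
    (-(P.ux s t * conj (P.u s t) + P.u s t * conj (P.ux s t))) s :=
  ((hP.hasDerivAt_u s t).mul (hasDerivAt_conj_u hP s t)).const_sub _

theorem hasDerivAt_forcing (hP : P.IsSolution) (s t : ℝ) (z : ℂ) :
    HasDerivAt (P.forcing t z) (P.forcing' t z s) s := by
  have h4 : HasDerivAt (fun s => conj (P.ux s t)) (conj (P.uxx s t)) s := by
    simpa using! (hP.hasDerivAt_ux s t).star
  refine (h4.add (((hasDerivAt_conj_u hP s t).mul (hasDerivAt_defect hP s t)).const_mul
    (P.kap z))).congr_deriv ?_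
  rw [forcing']; ring

theorem continuous_defect (hP : P.IsSolution) (t : ℝ) : Continuous (P.defect t) := by
  have := hP.continuous_u t
  exact continuous_const.sub (this.mul (continuous_conj.comp this))

section

variable {t U : ℝ} {G : ℝ → ℝ} (hP : P.IsSolution) (hG : P.IsDominating |t| U G)

include hP hG

theorem norm_defect_le (s : ℝ) : ‖P.defect t s‖ ≤ (U + P.u₀) * G s := by
  have e : P.defect t s = (P.up - P.u s t) * conj P.up + P.u s t * conj (P.up - P.u s t) := by
    rw [defect, map_sub, ← conj_mul_up hP]; ring
  have h1 := hG.sub_le t le_rfl s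
  have h2 := hG.le t le_rfl s
  have h0 : ‖P.up - P.u s t‖ ≤ G s := by rw [norm_sub_rev]; exact h1
  rw [e]
  refine (norm_add_le _ _).trans ?_
  rw [norm_mul, norm_mul, RCLike.norm_conj, RCLike.norm_conj, hP.norm_up]
  have := hP.u₀_pos
  have := hG.nonneg s
  have := (norm_nonneg _).trans h2
  calc _ ≤ G s * P.u₀ + U * G s := by gcongr
    _ = _ := by ring

theorem norm_defect_le' (s : ℝ) : ‖P.defect t s‖ ≤ (U + P.u₀) ^ 2 := by
  have h2 := hG.le t le_rfl s
  have h3 := (norm_nonneg _).trans h2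
  have h0 := hP.u₀_pos
  rw [defect]
  refine (norm_sub_le _ _).trans ?_
  rw [norm_mul, RCLike.norm_conj, norm_pow, norm_real, Real.norm_of_nonneg h0.le]
  calc _ ≤ P.u₀ ^ 2 + U * U := by gcongr
    _ ≤ _ := by nlinarith

theorem U_nonneg : 0 ≤ U := (norm_nonneg _).trans (hG.le t le_rfl 0)

variable {z : ℂ} (hz2 : 2 * P.u₀ ^ 2 ≤ ‖z‖ ^ 2) (hz0 : z ≠ 0)

include hz2 hz0

theorem norm_forcing_le (s : ℝ) :
    ‖P.forcing t z s‖ ≤ (1 + 1 / P.α * (U * (U + P.u₀))) * G s := by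
  have h1 := norm_kap_le hP hz2 hz0
  have h2 := hG.le t le_rfl s
  have h3 := norm_defect_le hP hG s
  have h4 := hG.ux_le t le_rfl s
  have hU := U_nonneg hP hG
  have hα := hP.α_pos
  have h0 := hG.nonneg s
  rw [forcing]
  refine (norm_add_le _ _).trans ?_
  rw [norm_mul, norm_mul, RCLike.norm_conj, RCLike.norm_conj]
  calc _ ≤ G s + 1 / P.α * (U * ((U + P.u₀) * G s)) := by gcongr
    _ = _ := by ring

theorem norm_forcing'_le (s : ℝ) :
    ‖P.forcing' t z s‖ ≤ (1 + 1 / P.α * ((U + P.u₀) ^ 2 + 2 * U ^ 2)) * G s := by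
  have h1 := norm_kap_le hP hz2 hz0
  have h2 := hG.le t le_rfl s
  have h3 := norm_defect_le' hP hG s
  have h4 := hG.ux_le t le_rfl s
  have h5 := hG.uxx_le t le_rfl s
  have hU := U_nonneg hP hG
  have hα := hP.α_pos
  have h0 := hG.nonneg s
  have h6 : ‖P.ux s t * conj (P.u s t) + P.u s t * conj (P.ux s t)‖ ≤ 2 * U * G s := by
    refine (norm_add_le _ _).trans ?_
    rw [norm_mul, norm_mul, RCLike.norm_conj, RCLike.norm_conj]
    calc _ ≤ G s * U + U * G s := by gcongr
      _ = _ := by ring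
  rw [forcing']
  refine (norm_add_le _ _).trans ?_
  rw [norm_mul, RCLike.norm_conj]
  have h7 : ‖conj (P.ux s t) * P.defect t s
    - conj (P.u s t) * (P.ux s t * conj (P.u s t) + P.u s t * conj (P.ux s t))‖
      ≤ G s * (U + P.u₀) ^ 2 + U * (2 * U * G s) := by
    refine (norm_sub_le _ _).trans ?_
    rw [norm_mul, norm_mul, RCLike.norm_conj, RCLike.norm_conj]
    gcongr
  calc _ ≤ G s + 1 / P.α * (G s * (U + P.u₀) ^ 2 + U * (2 * U * G s)) := by gcongr
    _ = _ := by ring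

end

end NZBC

namespace NZBC

variable {P : NZBC}

theorem integrableOn_defect (hP : P.IsSolution) (t x₀ : ℝ) : IntegrableOn (P.defect t) (Ioi x₀) := by
  obtain ⟨U, G, hG⟩ := hP.exists_isDominating |t|
  have hGi : IntegrableOn (fun y => (U + P.u₀) * ((1 + |y - x₀|) ^ 2 * G y)) (Ioi x₀) :=
    (hG.integrableOn x₀).const_mul _
  refine Integrable.mono' hGi (continuous_defect hP t).aestronglyMeasurable
    (ae_of_all _ fun y => (norm_defect_le hP hG y).trans ?_)
  have hU := U_nonneg hP hG
  have hu := hP.u₀_pos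
  gcongr
  have : 0 ≤ |y - x₀| := abs_nonneg _
  exact le_mul_of_one_le_left (hG.nonneg y) (by nlinarith)

/-- `exp(-(i/2α) ∫_x^∞ (u₀² - |u|²))`. -/
noncomputable def limPhase (P : NZBC) (t s : ℝ) : ℂ :=
  exp (-∫ y in Ioi s, I / (2 * P.α) * P.defect t y)

theorem defect_im (t s : ℝ) : (P.defect t s).im = 0 := by
  rw [defect, mul_conj, ← ofReal_pow, ← ofReal_sub, ofReal_im]

/-- `limPhase` is the solution of the limiting equation for `mainPart`, normalised to 1 at +∞. -/
theorem hasDerivAt_limPhase (hP : P.IsSolution) (t s : ℝ) :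
    HasDerivAt (P.limPhase t) (I / (2 * P.α) * P.defect t s * P.limPhase t s) s := by
  have hc : Continuous fun y => I / (2 * P.α) * P.defect t y :=
    continuous_const.mul (continuous_defect hP t)
  have h := hasDerivAt_integral_Ioi (f := fun y => I / (2 * P.α) * P.defect t y) (a := s - 1)
    ((integrableOn_defect hP t (s - 1)).const_mul _) (show s - 1 < s by linarith)
    hc.continuousAt (fun b _ => hc.stronglyMeasurableAtFilter _ _)
  refine h.neg.cexp.congr_deriv ?_
  rw [limPhase]
  simp only [Pi.neg_apply]
  ring

theorem tendsto_limPhase (P : NZBC) (t : ℝ) : Tendsto (P.limPhase t) atTop (𝓝 1) := by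
  have h : Tendsto (fun s => ∫ y in Ioi s, I / (2 * P.α) * P.defect t y) atTop (𝓝 0) := by
    exact tendsto_integral_Ioi_zero (μ := volume) tendsto_id
  have := (continuous_exp.tendsto _).comp h.neg
  rw [neg_zero, exp_zero] at this
  exact this

/-- The rate `(ik/z)(z² + |u|²)`. -/
noncomputable def rate (P : NZBC) (t : ℝ) (z : ℂ) (s : ℝ) : ℂ :=
  P.kap z * (z ^ 2 + P.u s t * conj (P.u s t))

theorem continuous_rate (hP : P.IsSolution) (t : ℝ) (z : ℂ) : Continuous (P.rate t z) := by
  have := hP.continuous_u t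
  exact continuous_const.mul (continuous_const.add (this.mul (continuous_conj.comp this)))

/-- With m = |u|² the rate is (i/2α)(z² + m - u₀² - u₀² m z⁻²), and the signs of Im z² and Im z⁻²
decide as for μ. -/
theorem rate_re_nonneg (hP : P.IsSolution) (t s : ℝ) {z : ℂ} (hz : z ∈ Dbar) :
    0 ≤ (P.rate t z s).re := by
  have hα := hP.α_pos
  have h1 := im_sq_nonpos hz
  have h2 := im_inv_sq_nonneg hz
  set m : ℝ := ‖P.u s t‖ ^ 2 with hm
  have hm0 : 0 ≤ m := by positivity
  have e : P.rate t z s = I * ((1 / (2 * P.α) : ℝ) * (z ^ 2 + (m : ℂ) - ((P.u₀ ^ 2 : ℝ) : ℂ)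
      - ((P.u₀ ^ 2 * m : ℝ) : ℂ) * (z ^ 2)⁻¹)) := by
    rw [rate, kap_eq hP hz.2, mul_conj, normSq_eq_norm_sq, ← hm]
    have := hz.2
    have hα' : (P.α : ℂ) ≠ 0 := by exact_mod_cast hα.ne'
    push_cast
    field_simp
    ring
  rw [e, I_mul_re, im_ofReal_mul, sub_im, sub_im, add_im, ofReal_im, ofReal_im, im_ofReal_mul]
  have : 0 ≤ P.u₀ ^ 2 * m * ((z ^ 2)⁻¹).im := by positivity
  have h3 : 0 < 1 / (2 * P.α) := by positivity
  nlinarith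

theorem rate_defect_re (t s : ℝ) : (I / (2 * P.α) * P.defect t s).re = 0 := by
  have : P.defect t s = (((P.defect t s).re : ℝ) : ℂ) := Complex.ext rfl (by simp [defect_im])
  rw [this, show I / (2 * (P.α : ℂ)) * (((P.defect t s).re : ℝ) : ℂ)
    = I * (((P.defect t s).re / (2 * P.α) : ℝ) : ℂ) by push_cast; ring, I_mul_re, ofReal_im,
    neg_zero]


/-- The combination `ψ₂ + (ū/z) ψ₁`. -/
noncomputable def slowPart (P : NZBC) (t : ℝ) (z : ℂ) (ψ : ℝ → Fin 2 → ℂ) (s : ℝ) : ℂ :=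
  ψ s 1 + conj (P.u s t) / z * ψ s 0

/-- The combination `ψ₁ - (u/ℓ)(ψ₂ + (ū/z) ψ₁)`, where `ℓ = z + u₀²/z`. -/
noncomputable def mainPart (P : NZBC) (t : ℝ) (z : ℂ) (ψ : ℝ → Fin 2 → ℂ) (s : ℝ) : ℂ :=
  ψ s 0 - P.u s t * (z + (P.u₀ : ℂ) ^ 2 / z)⁻¹ * P.slowPart t z ψ s

section

variable {ψ : ℝ → Fin 2 → ℂ} {s t : ℝ} {z : ℂ} (hP : P.IsSolution) (hz0 : z ≠ 0)
  (hψ : HasDerivAt ψ (P.shiftX s t z (ψ s)) s)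

include hP hz0 hψ

theorem hasDerivAt_fst : HasDerivAt (fun s => ψ s 0) (P.kap z * P.defect t s * ψ s 0
    + P.kap z * z * P.u s t * P.slowPart t z ψ s) s := by
  refine (hasDerivAt_pi.1 hψ 0).congr_deriv ?_
  simp only [shiftX, mat2_apply, kap, defect, slowPart]
  simp
  field_simp
  ring

/-- The vector (1, -ū/z) nearly lies in the kernel of the coefficient matrix at the local value of
u, and `slowPart` measures the deviation from it. The rate has nonnegative real part and the forcing
carries an integrable factor and 1/z, hence a bound of order 1/z once ψ₁ is bounded. -/
theorem hasDerivAt_slowPart : HasDerivAt (P.slowPart t z ψ)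
    (P.rate t z s * P.slowPart t z ψ s + P.forcing t z s / z * ψ s 0) s := by
  have h1 := (hasDerivAt_pi.1 hψ 1).add
    (((hasDerivAt_conj_u hP s t).div_const z).mul (hasDerivAt_fst hP hz0 hψ))
  refine h1.congr_deriv ?_
  simp only [shiftX, mat2_apply, kap, defect, slowPart, rate, forcing]
  simp
  field_simp
  ring

/-- The term κzu·`slowPart` in ψ₁' (κ = `kap`) is only bounded. Subtracting (u/ℓ)`slowPart` cancels
it, since rate/ℓ equals κz up to κ(|u|² - u₀²)/ℓ. What remains is the phase term (i/2α)(u₀² - |u|²)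
and errors of order 1/z. -/
theorem hasDerivAt_mainPart (hl : z + (P.u₀ : ℂ) ^ 2 / z ≠ 0) : HasDerivAt (P.mainPart t z ψ)
    (I / (2 * P.α) * P.defect t s * P.mainPart t z ψ s
      + ((P.kap z - I / (2 * P.α)) * P.defect t s
        - P.u s t * (z + (P.u₀ : ℂ) ^ 2 / z)⁻¹ * (P.forcing t z s / z)) * ψ s 0
      + (P.kap z * P.u s t * P.defect t s - P.ux s t + I / (2 * P.α) * P.defect t s * P.u s t)
        * (z + (P.u₀ : ℂ) ^ 2 / z)⁻¹ * P.slowPart t z ψ s) s := by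
  have h1 := (hasDerivAt_fst hP hz0 hψ).sub
    (((hP.hasDerivAt_u s t).mul_const (z + (P.u₀ : ℂ) ^ 2 / z)⁻¹).mul
      (hasDerivAt_slowPart hP hz0 hψ))
  refine h1.congr_deriv ?_
  have e : (z + (P.u₀ : ℂ) ^ 2 / z) * z = z ^ 2 + (P.u₀ : ℂ) ^ 2 := by field_simp
  rw [mainPart]
  generalize P.slowPart t z ψ s = v
  generalize P.forcing t z s = h
  generalize z + (P.u₀ : ℂ) ^ 2 / z = L at *
  rw [rate, defect]
  generalize P.kap z = κ
  field_simp
  linear_combination (2 * v * κ * P.u s t * z) * e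

/-- The balance κz² v + (h/z)ψ₁ = 0 suggests v ≈ -hψ₁/(κz³) for v = `slowPart`, h = `forcing`, κ =
`kap`. Removing this term leaves forcing of order z⁻³ψ₁ and z⁻²v, at the cost of h' and hence of
u_xx. The gain of one power of 1/z gives the second entry to order z⁻². -/
theorem hasDerivAt_corrected (hk : P.kap z ≠ 0) :
    HasDerivAt (fun s => P.slowPart t z ψ s + P.forcing t z s * ((P.kap z)⁻¹ / z ^ 3) * ψ s 0)
    (P.rate t z s * (P.slowPart t z ψ s + P.forcing t z s * ((P.kap z)⁻¹ / z ^ 3) * ψ s 0)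
      + (P.forcing' t z s * (P.kap z)⁻¹ + P.forcing t z s *
        (P.defect t s - P.u s t * conj (P.u s t))) / z ^ 3 * ψ s 0
      + P.forcing t z s * P.u s t / z ^ 2 * P.slowPart t z ψ s) s := by
  have h1 := (hasDerivAt_slowPart hP hz0 hψ).add (((hasDerivAt_forcing hP s t z).mul_const
    ((P.kap z)⁻¹ / z ^ 3)).mul (hasDerivAt_fst hP hz0 hψ))
  refine h1.congr_deriv ?_
  rw [rate]
  generalize P.slowPart t z ψ s = v
  generalize P.forcing t z s = h
  field_simp
  ring

end

end NZBC

namespace NZBC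

variable {P : NZBC}

theorem norm_limPhase (P : NZBC) (t s : ℝ) : ‖P.limPhase t s‖ = 1 := by
  rw [limPhase, norm_exp]
  have : (∫ y in Ioi s, I / (2 * P.α) * P.defect t y).re = 0 := by
    rw [integral_const_mul]
    have h : ∫ y in Ioi s, P.defect t y = ((∫ y in Ioi s, (P.defect t y).re : ℝ) : ℂ) := by
      rw [← integral_complex_ofReal]
      exact integral_congr_ae (ae_of_all _ fun y => Complex.ext rfl (by simp [defect_im]))
    rw [h, show ∀ r : ℝ, I / (2 * (P.α : ℂ)) * (r : ℂ) = I * ((r / (2 * P.α) : ℝ) : ℂ) from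
      fun r => by push_cast; ring, I_mul_re, ofReal_im, neg_zero]
  rw [neg_re, this]; simp

section

variable {t U : ℝ} {G : ℝ → ℝ} (hP : P.IsSolution) (hG : P.IsDominating |t| U G) {x₀ : ℝ}
  {z : ℂ} (hz : z ∈ Dbar) (hz2 : 2 * P.u₀ ^ 2 ≤ ‖z‖ ^ 2) (hz1 : 1 ≤ ‖z‖)
  {ψ : ℝ → Fin 2 → ℂ} (hψ : ∀ s, x₀ < s → HasDerivAt ψ (P.shiftX s t z (ψ s)) s)
  (hψ' : Tendsto ψ atTop (𝓝 (P.asymCol z))) {B : ℝ} (hB : ∀ s, x₀ < s → ‖ψ s 0‖ ≤ B)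

include hP hG hz hψ'

theorem tendsto_slowPart : Tendsto (P.slowPart t z ψ) atTop (𝓝 0) := by
  have p0 := tendsto_pi_nhds.1 hψ' 0
  have p1 := tendsto_pi_nhds.1 hψ' 1
  have h2 : Tendsto (fun x => conj (P.u x t)) atTop (𝓝 (conj P.up)) :=
    (continuous_conj.tendsto _).comp (hG.tendsto_u t le_rfl)
  have := p1.add ((h2.div_const z).mul p0)
  refine Eq.subst (motive := fun w => Tendsto (P.slowPart t z ψ) atTop (𝓝 w)) ?_ this
  simp [asymCol]
  ring

theorem tendsto_mainPart : Tendsto (P.mainPart t z ψ) atTop (𝓝 1) := by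
  have p0 := tendsto_pi_nhds.1 hψ' 0
  have := p0.sub (((hG.tendsto_u t le_rfl).mul_const (z + (P.u₀ : ℂ) ^ 2 / z)⁻¹).mul
    (tendsto_slowPart hP hG hz hψ'))
  simpa [asymCol] using! this

theorem tendsto_defect : Tendsto (P.defect t) atTop (𝓝 0) := by
  have h1 := hG.tendsto_u t le_rfl
  have h2 : Tendsto (fun x => conj (P.u x t)) atTop (𝓝 (conj P.up)) :=
    (continuous_conj.tendsto _).comp h1
  have := (h1.mul h2).const_sub ((P.u₀ : ℂ) ^ 2)
  rw [conj_mul_up hP, sub_self] at this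
  exact this

theorem tendsto_forcing : Tendsto (P.forcing t z) atTop (𝓝 0) := by
  have h1 := hG.tendsto_u t le_rfl
  have h2 : Tendsto (fun x => conj (P.u x t)) atTop (𝓝 (conj P.up)) :=
    (continuous_conj.tendsto _).comp h1
  have h4 : Tendsto (fun x => conj (P.ux x t)) atTop (𝓝 (conj 0)) :=
    (continuous_conj.tendsto _).comp (hG.tendsto_ux t le_rfl)
  have := h4.add ((h2.mul (tendsto_defect hP hG hz hψ')).const_mul (P.kap z))
  simpa using! this

include hz2 hψ hB

theorem norm_slowPart_le {s : ℝ} (hs : x₀ < s) :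
    ‖P.slowPart t z ψ s‖ ≤ (1 + 1 / P.α * (U * (U + P.u₀)))
      * (∫ y in Ioi x₀, (1 + |y - x₀|) ^ 2 * G y) * B / ‖z‖ := by
  set H := 1 + 1 / P.α * (U * (U + P.u₀)) with hH
  have hU := U_nonneg hP hG
  have hu := hP.u₀_pos
  have hα := hP.α_pos
  have hH0 : 0 ≤ H := by positivity
  have hB0 : 0 ≤ B := (norm_nonneg _).trans (hB s hs)
  have hn : 0 < ‖z‖ := norm_pos_iff.2 hz.2
  have hGF : ∀ y, G y ≤ (1 + |y - x₀|) ^ 2 * G y := fun y => by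
    have : 0 ≤ |y - x₀| := abs_nonneg _
    exact le_mul_of_one_le_left (hG.nonneg y) (by nlinarith)
  have key := norm_le_of_hasDerivAt (continuous_rate hP t z) (fun s => rate_re_nonneg hP t s hz)
    (fun s hs => hasDerivAt_slowPart hP hz.2 (hψ s hs))
    (F := fun y => H * B / ‖z‖ * ((1 + |y - x₀|) ^ 2 * G y)) (fun y hy => ?_)
    ((hG.integrableOn x₀).const_mul _)
    (fun y => by have := hG.nonneg y; positivity) (tendsto_slowPart hP hG hz hψ') hs
  · rw [norm_zero, zero_add, integral_const_mul] at key
    refine key.trans (le_of_eq ?_); ring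
  · rw [add_sub_cancel_left, norm_mul, norm_div]
    calc _ ≤ H * G y / ‖z‖ * B := by
          gcongr
          · have := hG.nonneg y; positivity
          · exact norm_forcing_le hP hG hz2 hz.2 y
          · exact hB y hy
      _ = H * B / ‖z‖ * G y := by ring
      _ ≤ _ := mul_le_mul_of_nonneg_left (hGF y) (by positivity)

include hz1

theorem norm_mainPart_sub_le {s : ℝ} (hs : x₀ < s) {V : ℝ}
    (hV : ∀ s, x₀ < s → ‖P.slowPart t z ψ s‖ ≤ V) :
    ‖P.mainPart t z ψ s - P.limPhase t s‖ ≤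
      ((1 / (2 * P.α) * P.u₀ ^ 2 * (U + P.u₀)
        + 2 * U * (1 + 1 / P.α * (U * (U + P.u₀)))) * B
        + 2 * (1 + 2 / P.α * (U * (U + P.u₀))) * V)
      * (∫ y in Ioi x₀, (1 + |y - x₀|) ^ 2 * G y) / ‖z‖ := by
  have hU := U_nonneg hP hG
  have hu := hP.u₀_pos
  have hα := hP.α_pos
  have hB0 : 0 ≤ B := (norm_nonneg _).trans (hB s hs)
  have hV0 : 0 ≤ V := (norm_nonneg _).trans (hV s hs)
  have hn : 0 < ‖z‖ := norm_pos_iff.2 hz.2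
  obtain ⟨hl, hl'⟩ := ell_inv hP hz2 hz.2
  have hk := norm_kap_le hP hz2 hz.2
  have hGF : ∀ y, G y ≤ (1 + |y - x₀|) ^ 2 * G y := fun y => by
    have : 0 ≤ |y - x₀| := abs_nonneg _
    exact le_mul_of_one_le_left (hG.nonneg y) (by nlinarith)
  set K := (1 / (2 * P.α) * P.u₀ ^ 2 * (U + P.u₀)
        + 2 * U * (1 + 1 / P.α * (U * (U + P.u₀)))) * B
        + 2 * (1 + 2 / P.α * (U * (U + P.u₀))) * V with hK
  have hK0 : 0 ≤ K := by positivity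
  have key := norm_le_of_hasDerivAt (y := fun s => P.mainPart t z ψ s - P.limPhase t s)
    (r := fun s => I / (2 * P.α) * P.defect t s) (continuous_const.mul (continuous_defect hP t))
    (fun s => (rate_defect_re (P := P) t s).ge)
    (fun s hs => (hasDerivAt_mainPart hP hz.2 (hψ s hs) hl).sub (hasDerivAt_limPhase hP t s))
    (F := fun y => K / ‖z‖ * ((1 + |y - x₀|) ^ 2 * G y)) (fun y hy => ?_)
    ((hG.integrableOn x₀).const_mul _)
    (fun y => by have := hG.nonneg y; positivity)
    ((tendsto_mainPart hP hG hz hψ').sub (tendsto_limPhase P t)) hs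
  · rw [sub_self, norm_zero, zero_add, integral_const_mul] at key
    refine key.trans (le_of_eq ?_); ring
  · have e1 : P.kap z - I / (2 * P.α) = -(I / (2 * P.α) * ((P.u₀ : ℂ) ^ 2 / z ^ 2)) := by
      rw [kap_eq hP hz.2]; ring
    rw [show ∀ a b c d e : ℂ, a * b + c + d - a * e - a * (b - e) = c + d from
      fun a b c d e => by ring]
    · have hG0 := hG.nonneg y
      have g1 := norm_defect_le hP hG y
      have g2 := hG.le t le_rfl y
      have g3 := norm_forcing_le hP hG hz2 hz.2 y
      have g4 := hG.ux_le t le_rfl y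
      have g5 : ‖(P.u₀ : ℂ) ^ 2 / z ^ 2‖ ≤ P.u₀ ^ 2 / ‖z‖ := by
        rw [norm_div, norm_pow, norm_pow, norm_real, Real.norm_of_nonneg hu.le]
        gcongr
        exact le_self_pow₀ hz1 two_ne_zero
      have t1 : ‖(P.kap z - I / (2 * P.α)) * P.defect t y
          - P.u y t * (z + (P.u₀ : ℂ) ^ 2 / z)⁻¹ * (P.forcing t z y / z)‖ ≤
          (1 / (2 * P.α) * P.u₀ ^ 2 * (U + P.u₀)
            + 2 * U * (1 + 1 / P.α * (U * (U + P.u₀)))) * G y / ‖z‖ := by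
        refine (norm_sub_le _ _).trans ?_
        rw [e1, norm_mul, norm_neg, norm_mul, norm_I_div hP, norm_mul, norm_mul,
          norm_div (P.forcing t z y)]
        calc _ ≤ 1 / (2 * P.α) * (P.u₀ ^ 2 / ‖z‖) * ((U + P.u₀) * G y)
              + U * 2 * ((1 + 1 / P.α * (U * (U + P.u₀))) * G y / ‖z‖) := by
              gcongr
              exact hl'.trans (div_le_self (by norm_num) hz1)
          _ = _ := by ring
      have t2 : ‖(P.kap z * P.u y t * P.defect t y - P.ux y t
          + I / (2 * P.α) * P.defect t y * P.u y t) * (z + (P.u₀ : ℂ) ^ 2 / z)⁻¹‖ ≤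
          2 * (1 + 2 / P.α * (U * (U + P.u₀))) * G y / ‖z‖ := by
        have t3 : ‖P.kap z * P.u y t * P.defect t y - P.ux y t
          + I / (2 * P.α) * P.defect t y * P.u y t‖ ≤ (1 / P.α * U * ((U + P.u₀) * G y) + G y)
            + 1 / (2 * P.α) * ((U + P.u₀) * G y) * U := by
          refine (norm_add_le _ _).trans ?_
          refine add_le_add ((norm_sub_le _ _).trans ?_) ?_
          · rw [norm_mul, norm_mul]; gcongr
          · rw [norm_mul, norm_mul, norm_I_div hP]; gcongr
        rw [norm_mul]
        calc _ ≤ ((1 / P.α * U * ((U + P.u₀) * G y) + G y)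
            + 1 / (2 * P.α) * ((U + P.u₀) * G y) * U) * (2 / ‖z‖) := by gcongr
          _ = 2 * (1 + 3 / (2 * P.α) * (U * (U + P.u₀))) * G y / ‖z‖ := by field_simp; ring
          _ ≤ _ := by
            gcongr 2 * (1 + ?_ * _) * _ / _
            rw [div_le_div_iff₀ (by positivity) hα]; nlinarith
      refine (norm_add_le _ _).trans ?_
      rw [norm_mul, norm_mul _ (P.slowPart t z ψ y)]
      calc _ ≤ (1 / (2 * P.α) * P.u₀ ^ 2 * (U + P.u₀)
            + 2 * U * (1 + 1 / P.α * (U * (U + P.u₀)))) * G y / ‖z‖ * B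
            + 2 * (1 + 2 / P.α * (U * (U + P.u₀))) * G y / ‖z‖ * V := by
              gcongr
              · exact hB y hy
              · exact hV y hy
        _ = K / ‖z‖ * G y := by rw [hK]; ring
        _ ≤ _ := mul_le_mul_of_nonneg_left (hGF y) (by positivity)

theorem norm_corrected_le {s : ℝ} (hs : x₀ < s) {V : ℝ}
    (hV : ∀ s, x₀ < s → ‖P.slowPart t z ψ s‖ ≤ V) :
    ‖P.slowPart t z ψ s + P.forcing t z s * ((P.kap z)⁻¹ / z ^ 3) * ψ s 0‖ ≤
      (((1 + 1 / P.α * ((U + P.u₀) ^ 2 + 2 * U ^ 2)) * (4 * P.α)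
        + (1 + 1 / P.α * (U * (U + P.u₀))) * ((U + P.u₀) ^ 2 + U ^ 2)) * B
        + (1 + 1 / P.α * (U * (U + P.u₀))) * U * V)
      * (∫ y in Ioi x₀, (1 + |y - x₀|) ^ 2 * G y) / ‖z‖ ^ 2 := by
  have hU := U_nonneg hP hG
  have hu := hP.u₀_pos
  have hα := hP.α_pos
  have hB0 : 0 ≤ B := (norm_nonneg _).trans (hB s hs)
  have hV0 : 0 ≤ V := (norm_nonneg _).trans (hV s hs)
  have hn : 0 < ‖z‖ := norm_pos_iff.2 hz.2
  obtain ⟨hk, hk'⟩ := kap_inv hP hz2 hz.2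
  have hGF : ∀ y, G y ≤ (1 + |y - x₀|) ^ 2 * G y := fun y => by
    have : 0 ≤ |y - x₀| := abs_nonneg _
    exact le_mul_of_one_le_left (hG.nonneg y) (by nlinarith)
  set H := 1 + 1 / P.α * (U * (U + P.u₀)) with hH
  set H' := 1 + 1 / P.α * ((U + P.u₀) ^ 2 + 2 * U ^ 2) with hH'
  have hH0 : 0 ≤ H := by positivity
  have hH'0 : 0 ≤ H' := by positivity
  set K := (H' * (4 * P.α) + H * ((U + P.u₀) ^ 2 + U ^ 2)) * B + H * U * V with hK
  have hK0 : 0 ≤ K := by positivity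
  have p0 := tendsto_pi_nhds.1 hψ' 0
  have hlim := (tendsto_slowPart hP hG hz hψ').add
    (((tendsto_forcing hP hG hz hψ').mul_const ((P.kap z)⁻¹ / z ^ 3)).mul p0)
  rw [zero_mul, zero_mul, zero_add] at hlim
  have key := norm_le_of_hasDerivAt (continuous_rate hP t z) (fun s => rate_re_nonneg hP t s hz)
    (fun s hs => hasDerivAt_corrected hP hz.2 (hψ s hs) hk)
    (F := fun y => K / ‖z‖ ^ 2 * ((1 + |y - x₀|) ^ 2 * G y)) (fun y hy => ?_)
    ((hG.integrableOn x₀).const_mul _)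
    (fun y => by have := hG.nonneg y; positivity) hlim hs
  · rw [norm_zero, zero_add, integral_const_mul] at key
    refine key.trans (le_of_eq ?_); ring
  · rw [add_assoc, add_sub_cancel_left]
    have hG0 := hG.nonneg y
    have g1 := norm_defect_le' hP hG y
    have g2 := hG.le t le_rfl y
    have g3 := norm_forcing_le hP hG hz2 hz.2 y
    have g4 := norm_forcing'_le hP hG hz2 hz.2 y
    have g5 : ‖P.defect t y - P.u y t * conj (P.u y t)‖ ≤ (U + P.u₀) ^ 2 + U ^ 2 := by
      refine (norm_sub_le _ _).trans (add_le_add g1 ?_)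
      rw [norm_mul, RCLike.norm_conj, ← sq]; gcongr
    refine (norm_add_le _ _).trans ?_
    rw [norm_mul, norm_mul _ (P.slowPart t z ψ y), norm_div, norm_div, norm_pow, norm_pow,
      norm_mul (P.forcing t z y)]
    have g6 : ‖P.forcing' t z y * (P.kap z)⁻¹ + P.forcing t z y *
        (P.defect t y - P.u y t * conj (P.u y t))‖ ≤
        (H' * (4 * P.α) + H * ((U + P.u₀) ^ 2 + U ^ 2)) * G y := by
      refine (norm_add_le _ _).trans ?_
      rw [norm_mul, norm_mul]
      calc _ ≤ H' * G y * (4 * P.α) + H * G y * ((U + P.u₀) ^ 2 + U ^ 2) := by gcongr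
        _ = _ := by ring
    calc _ ≤ (H' * (4 * P.α) + H * ((U + P.u₀) ^ 2 + U ^ 2)) * G y / ‖z‖ ^ 2 * B
          + H * G y * U / ‖z‖ ^ 2 * V := by
            gcongr
            · norm_num
            · exact hB y hy
            · exact hV y hy
      _ = K / ‖z‖ ^ 2 * G y := by rw [hK]; ring
      _ ≤ _ := mul_le_mul_of_nonneg_left (hGF y) (by positivity)

end

/-- Asymptotic behaviour of the Jost solution for large spectral parameter. -/
theorem jost_asymptotics (hP : P.IsSolution) (x t : ℝ) : ∃ C Z : ℝ, ∀ z ∈ Dbar, Z ≤ ‖z‖ →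
    ‖P.jost x t z 0 - P.limPhase t x‖ ≤ C / ‖z‖ ∧
    ‖P.jost x t z 1 + conj (P.u x t) * P.limPhase t x / z‖ ≤ C / ‖z‖ ^ 2 := by
  obtain ⟨U, G, hG⟩ := hP.exists_isDominating |t|
  have hU := U_nonneg hP hG
  have hu := hP.u₀_pos
  have hα := hP.α_pos
  set x₀ := x - 1 with hx₀
  have hx : x₀ < x := by rw [hx₀]; linarith
  obtain ⟨J, hJ⟩ : ∃ J, J = ∫ y in Ioi x₀, (1 + |y - x₀|) ^ 2 * G y := ⟨_, rfl⟩
  have hJ0 : 0 ≤ J := hJ ▸ integral_nonneg fun y => mul_nonneg (by positivity) (hG.nonneg y)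
  obtain ⟨H, hH⟩ : ∃ H, H = 1 + 1 / P.α * (U * (U + P.u₀)) := ⟨_, rfl⟩
  have hH0 : 0 ≤ H := by rw [hH]; positivity
  obtain ⟨a, ha⟩ : ∃ a, a = 1 / (2 * P.α) * P.u₀ ^ 2 * (U + P.u₀) + 2 * U * H := ⟨_, rfl⟩
  obtain ⟨b, hb⟩ : ∃ b, b = 2 * (1 + 2 / P.α * (U * (U + P.u₀))) := ⟨_, rfl⟩
  obtain ⟨c, hc⟩ : ∃ c, c = (1 + 1 / P.α * ((U + P.u₀) ^ 2 + 2 * U ^ 2)) * (4 * P.α)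
        + H * ((U + P.u₀) ^ 2 + U ^ 2) := ⟨_, rfl⟩
  have ha0 : 0 ≤ a := by rw [ha]; positivity
  have hb0 : 0 ≤ b := by rw [hb]; positivity
  have hc0 : 0 ≤ c := by rw [hc]; positivity
  obtain ⟨K, hK⟩ : ∃ K, K = (a + b * (H * J)) * J := ⟨_, rfl⟩
  have hK0 : 0 ≤ K := by rw [hK]; positivity
  obtain ⟨C₁, hC₁⟩ : ∃ C₁, C₁ = 2 * K + 2 * (H * J) := ⟨_, rfl⟩
  have hC₁0 : 0 ≤ C₁ := by rw [hC₁]; positivity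
  obtain ⟨C₂, hC₂⟩ : ∃ C₂, C₂ = (c * 2 + H * U * (2 * (H * J))) * J + H * G x * (4 * P.α) * 2 + U * C₁ := ⟨_, rfl⟩
  have hG0 := hG.nonneg x
  have hC₂0 : 0 ≤ C₂ := by rw [hC₂]; positivity
  -- The threshold gives 2u₀² ≤ |z|², |u/ℓ| ≤ 1 (from 2U ≤ |z|), and (K + HJ)/|z| ≤ ½ for the
  -- absorption argument below.
  refine ⟨C₁ + C₂, 1 + 2 * P.u₀ ^ 2 + 2 * U + 2 * (K + H * J), fun z hz hZ => ?_⟩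
  have hHJ0 := mul_nonneg hH0 hJ0
  have hu2 := sq_nonneg P.u₀
  have hz1 : 1 ≤ ‖z‖ := by linarith
  have hn : 0 < ‖z‖ := by linarith
  have hz2 : 2 * P.u₀ ^ 2 ≤ ‖z‖ ^ 2 := by
    have : 2 * P.u₀ ^ 2 ≤ ‖z‖ := by linarith
    nlinarith
  have hzU : 2 * U ≤ ‖z‖ := by linarith
  have hzK : 2 * (K + H * J) ≤ ‖z‖ := by linarith
  obtain ⟨hψ, hψ'⟩ := jostHalf_spec hP t x₀ hz
  set ψ := P.jostHalf t x₀ z with hψdef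
  -- Estimates conditional on a bound B for ψ₁, used twice: with B the supremum, to bound it, and
  -- then with B = 2.
  have step : ∀ B, (∀ s, x₀ < s → ‖ψ s 0‖ ≤ B) → 0 ≤ B →
      (∀ s, x₀ < s → ‖P.slowPart t z ψ s‖ ≤ H * J * B / ‖z‖) ∧
      ∀ s, x₀ < s → ‖ψ s 0 - P.limPhase t s‖ ≤ (K + H * J) * B / ‖z‖ := by
    intro B hB hB0
    have s1 : ∀ s, x₀ < s → ‖P.slowPart t z ψ s‖ ≤ H * J * B / ‖z‖ := fun s hs => by
      rw [hH, hJ]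
      exact norm_slowPart_le hP hG hz hz2 hψ hψ' hB hs
    refine ⟨s1, fun s hs => ?_⟩
    have s2 := norm_mainPart_sub_le hP hG hz hz2 hz1 hψ hψ' hB hs (V := H * J * B) fun s hs =>
      (s1 s hs).trans (div_le_self (by positivity) hz1)
    rw [← hH, ← ha, ← hb, ← hJ] at s2
    have e : ψ s 0 - P.limPhase t s = (P.mainPart t z ψ s - P.limPhase t s)
        + P.u s t * (z + (P.u₀ : ℂ) ^ 2 / z)⁻¹ * P.slowPart t z ψ s := by
      rw [mainPart]; ring
    have s3 : ‖P.u s t * (z + (P.u₀ : ℂ) ^ 2 / z)⁻¹‖ ≤ 1 := by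
      rw [norm_mul]
      calc _ ≤ U * (2 / ‖z‖) := by
            gcongr
            · exact hG.le t le_rfl s
            · exact (ell_inv hP hz2 hz.2).2
        _ = 2 * U / ‖z‖ := by ring
        _ ≤ 1 := (div_le_one hn).2 hzU
    rw [e]
    refine (norm_add_le _ _).trans ?_
    rw [norm_mul (P.u s t * _)]
    calc _ ≤ (a * B + b * (H * J * B)) * J / ‖z‖ + 1 * (H * J * B / ‖z‖) := by
          gcongr
          exact s1 s hs
      _ = _ := by rw [hK]; ring
  -- The supremum B, finite but a priori dependent on z, satisfies B ≤ 1 + B/2 because |`limPhase`|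
  -- = 1. Hence B ≤ 2 uniformly in z.
  have hbound : ∀ s, x₀ < s → ‖ψ s 0‖ ≤ 2 := by
    have hbdd : BddAbove (range fun s : Ioi x₀ => ‖ψ s 0‖) := by
      refine ⟨‖ψ‖, ?_⟩
      rintro _ ⟨s, rfl⟩
      exact (norm_le_pi_norm (ψ s) 0).trans (ψ.norm_coe_le_norm s)
    set B := ⨆ s : Ioi x₀, ‖ψ s 0‖ with hBdef
    have hB : ∀ s, x₀ < s → ‖ψ s 0‖ ≤ B := fun s hs => le_ciSup hbdd (⟨s, hs⟩ : Ioi x₀)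
    have hB0 : 0 ≤ B := (norm_nonneg _).trans (hB x hx)
    have hB2 : B ≤ 1 + B / 2 := by
      have : Nonempty (Ioi x₀) := ⟨⟨x, hx⟩⟩
      refine ciSup_le fun s => ?_
      have h1 := (step B hB hB0).2 s s.2
      have h2 : (K + H * J) * B / ‖z‖ ≤ B / 2 := by
        rw [div_le_div_iff₀ hn two_pos]; nlinarith
      have h3 := norm_sub_norm_le (ψ s 0) (P.limPhase t s)
      rw [norm_limPhase] at h3
      linarith
    intro s hs
    linarith [hB s hs]
  obtain ⟨s1, s2⟩ := step 2 hbound two_pos.le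
  have e0 : P.jost x t z = ψ x := rfl
  have f1 : ‖ψ x 0 - P.limPhase t x‖ ≤ C₁ / ‖z‖ :=
    (s2 x hx).trans (le_of_eq (by rw [hC₁]; ring))
  rw [e0]
  refine ⟨f1.trans (by gcongr; linarith), ?_⟩
  have f2 := norm_corrected_le hP hG hz hz2 hz1 hψ hψ' hbound hx (V := 2 * (H * J)) fun s hs =>
    (s1 s hs).trans ((div_le_self (by positivity) hz1).trans (le_of_eq (by ring)))
  rw [← hH, ← hc, ← hJ] at f2
  have e2 : ψ x 1 + conj (P.u x t) * P.limPhase t x / z =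
      (P.slowPart t z ψ x + P.forcing t z x * ((P.kap z)⁻¹ / z ^ 3) * ψ x 0)
      - P.forcing t z x * ((P.kap z)⁻¹ / z ^ 3) * ψ x 0
      - conj (P.u x t) / z * (ψ x 0 - P.limPhase t x) := by
    rw [slowPart]; ring
  have f3 : ‖P.forcing t z x * ((P.kap z)⁻¹ / z ^ 3) * ψ x 0‖
      ≤ H * G x * (4 * P.α) * 2 / ‖z‖ ^ 2 := by
    rw [norm_mul, norm_mul, norm_div, norm_pow]
    calc _ ≤ H * G x * (4 * P.α / ‖z‖ ^ 2) * 2 := by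
          gcongr
          · rw [hH]; exact norm_forcing_le hP hG hz2 hz.2 x
          · exact (kap_inv hP hz2 hz.2).2
          · norm_num
          · exact hbound x hx
      _ = _ := by ring
  have f4 : ‖conj (P.u x t) / z * (ψ x 0 - P.limPhase t x)‖ ≤ U * C₁ / ‖z‖ ^ 2 := by
    rw [norm_mul, norm_div, RCLike.norm_conj]
    calc _ ≤ U / ‖z‖ * (C₁ / ‖z‖) := by
          gcongr
          exact hG.le t le_rfl x
      _ = _ := by field_simp
  rw [e2]
  refine (norm_sub_le _ _).trans ((add_le_add (norm_sub_le _ _) f4).trans ?_)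
  calc _ ≤ (c * 2 + H * U * (2 * (H * J))) * J / ‖z‖ ^ 2 + H * G x * (4 * P.α) * 2 / ‖z‖ ^ 2
        + U * C₁ / ‖z‖ ^ 2 := add_le_add (add_le_add f2 f3) le_rfl
    _ = C₂ / ‖z‖ ^ 2 := by rw [hC₂]; ring
    _ ≤ _ := by gcongr; linarith

end NZBC

/-! ### Symmetries: reflection of the potential, conjugation, sign change, inversion -/

theorem deriv_neg_conj_comp_neg (f : ℝ → ℂ) (x : ℝ) :
    deriv (fun y => -conj (f (-y))) x = conj (deriv f (-x)) := by
  have h1 : deriv (fun y => -conj (f (-y))) x = -deriv (fun y => conj (f (-y))) x := by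
    simp
  have h2 : deriv (fun y => conj (f (-y))) x = conj (deriv (fun y => f (-y)) x) :=
    deriv.star (f := fun y => f (-y))
  rw [h1, h2, deriv_comp_neg]
  simp

theorem HasDerivAt.conj_real {f : ℝ → ℂ} {f' : ℂ} {x : ℝ} (h : HasDerivAt f f' x) :
    HasDerivAt (fun s => conj (f s)) (conj f') x := by simpa using! h.star

/-- The set where the second column of `φ₊` and the first column of `φ₋` are defined. -/
def Dbar' : Set ℂ := {z | 0 ≤ z.re * z.im ∧ z ≠ 0}

theorem conj_mem_Dbar {z : ℂ} : conj z ∈ Dbar ↔ z ∈ Dbar' := by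
  simp [Dbar, Dbar']

theorem conj_mem_Dbar' {z : ℂ} : conj z ∈ Dbar' ↔ z ∈ Dbar := by
  simp [Dbar, Dbar']

theorem neg_mem_Dbar {z : ℂ} : -z ∈ Dbar ↔ z ∈ Dbar := by
  simp [Dbar]

theorem neg_mem_Dbar' {z : ℂ} : -z ∈ Dbar' ↔ z ∈ Dbar' := by
  simp [Dbar']

theorem Dminus_subset_Dbar' : Dminus ⊆ Dbar' := fun z hz => ⟨le_of_lt hz, by
  rintro rfl; simp [Dminus] at hz⟩

theorem Contour_subset_Dbar' : Contour ⊆ Dbar' := fun _ hz => ⟨hz.1.ge, hz.2⟩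

namespace NZBC

/-- The reflected potential `-u*(-x,-t)`. -/
noncomputable def refl (P : NZBC) : NZBC where
  α := P.α
  u₀ := P.u₀
  um := -conj P.up
  up := -conj P.um
  u := fun x t => -conj (P.u (-x) (-t))

variable {P : NZBC}

/-- The equation is invariant under u(x,t) ↦ -u*(-x,-t), and the two ends of the line are exchanged.
All statements at -∞ thus follow from those at +∞. -/
theorem IsSolution.refl (hP : P.IsSolution) : P.refl.IsSolution where
  α_pos := hP.α_pos
  u₀_pos := hP.u₀_pos
  norm_um := by simp [NZBC.refl, hP.norm_up]
  norm_up := by simp [NZBC.refl, hP.norm_um]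
  contDiff := by
    have h1 : ContDiff ℝ 2 fun p : ℝ × ℝ => P.u (-p.1) (-p.2) :=
      hP.contDiff.comp (contDiff_fst.neg.prodMk contDiff_snd.neg)
    exact ((conjCLE : ℂ →L[ℝ] ℂ).contDiff.comp h1).neg
  equation := fun x t => by
    have h := hP.equation (-x) (-t)
    have e1 : deriv (fun s => P.refl.u x s) t = conj (deriv (fun s => P.u (-x) s) (-t)) :=
      deriv_neg_conj_comp_neg (fun s => P.u (-x) s) t
    have e2 : ∀ y, deriv (fun y => P.refl.u y t) y = conj (deriv (fun y => P.u y (-t)) (-y)) :=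
      deriv_neg_conj_comp_neg (fun y => P.u y (-t))
    have e3 : deriv (deriv (fun y => P.refl.u y t)) x
        = -conj (deriv (deriv (fun y => P.u y (-t))) (-x)) := by
      have : deriv (fun y => P.refl.u y t)
          = fun y => -conj ((fun y => -deriv (fun y => P.u y (-t)) y) (-y)) := by
        funext y; rw [e2]; simp
      rw [this]
      exact (deriv_neg_conj_comp_neg (fun y => -deriv (fun y => P.u y (-t)) y) x).trans (by simp)
    have e4 : deriv (fun y => ((‖P.refl.u y t‖ ^ 2 : ℝ) : ℂ) * P.refl.u y t) x
        = conj (deriv (fun y => ((‖P.u y (-t)‖ ^ 2 : ℝ) : ℂ) * P.u y (-t)) (-x)) := by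
      rw [← deriv_neg_conj_comp_neg]
      congr 1
      funext y
      simp [NZBC.refl]
    rw [e1, e2, e3, e4]
    have h' := congrArg conj h
    simp only [map_add, map_mul, map_zero, conj_I, conj_ofReal, map_ofNat, map_div₀] at h'
    simp only [NZBC.refl]
    linear_combination -h'
  decay := fun T => by
    obtain ⟨g, hg, h⟩ := hP.decay T
    refine ⟨fun x => g (-x), by simpa using hg.comp_neg, fun t ht => ?_⟩
    obtain ⟨h1, h2, h3, h4⟩ := h (-t) (by rwa [abs_neg])
    have e2 : ∀ y, deriv (fun y => P.refl.u y t) y = conj (deriv (fun y => P.u y (-t)) (-y)) :=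
      deriv_neg_conj_comp_neg (fun y => P.u y (-t))
    have e3 : ∀ x, deriv (deriv (fun y => P.refl.u y t)) x
        = -conj (deriv (deriv (fun y => P.u y (-t))) (-x)) := by
      have : deriv (fun y => P.refl.u y t)
          = fun y => -conj ((fun y => -deriv (fun y => P.u y (-t)) y) (-y)) := by
        funext y; rw [e2]; simp
      intro x
      rw [this]
      exact (deriv_neg_conj_comp_neg (fun y => -deriv (fun y => P.u y (-t)) y) x).trans (by simp)
    have key : ∀ a b : ℂ, ‖-conj a - -conj b‖ = ‖a - b‖ := fun a b => by
      rw [← RCLike.norm_conj (a - b), ← norm_neg, map_sub]; congr 1; ring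
    refine ⟨fun x hx => ?_, fun x hx => ?_, fun x => ?_, fun x => ?_⟩
    · exact (key _ _).trans_le (h2 (-x) (by linarith))
    · exact (key _ _).trans_le (h1 (-x) (by linarith))
    · rw [e2, RCLike.norm_conj]; exact h3 (-x)
    · rw [e3, norm_neg, RCLike.norm_conj]; exact h4 (-x)

theorem refl_refl (P : NZBC) : P.refl.refl = P := by
  cases P; simp [refl]

theorem ux_refl (x t : ℝ) : P.refl.ux x t = conj (P.ux (-x) (-t)) :=
  deriv_neg_conj_comp_neg (fun y => P.u y (-t)) x

theorem k_refl : P.refl.k = P.k := rfl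

theorem theta_refl (x t : ℝ) (z : ℂ) : P.refl.theta x t z = -P.theta (-x) (-t) z := by
  simp [theta, refl, k, lam]; ring

/-- The entries of `X v`. -/
theorem laxX_apply (x t : ℝ) (z : ℂ) (v : Fin 2 → ℂ) : P.laxX x t z *ᵥ v =
    ![-I * P.α * P.k z ^ 2 * v 0 + I * P.k z * P.u x t * v 1,
      I * P.k z * conj (P.u x t) * v 0 + I * P.α * P.k z ^ 2 * v 1] := by
  ext i
  fin_cases i <;> simp [laxX, sigma3, potQ, Matrix.mulVec, dotProduct, Fin.sum_univ_two]

theorem laxT_apply (x t : ℝ) (z : ℂ) (v : Fin 2 → ℂ) : P.laxT x t z *ᵥ v =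
    ![P.laxTdiag x t z * v 0 + P.laxTup x t z * v 1,
      P.laxTdown x t z * v 0 - P.laxTdiag x t z * v 1] := by
  rw [laxT_eq]
  ext i
  fin_cases i <;> simp [Matrix.mulVec, dotProduct, Fin.sum_univ_two]
  ring

theorem k_conj (P : NZBC) (z : ℂ) : P.k (conj z) = conj (P.k z) := by
  simp [k, map_ofNat]

theorem lam_conj (P : NZBC) (z : ℂ) : P.lam (conj z) = conj (P.lam z) := by
  simp [lam, map_ofNat]

theorem theta_conj (P : NZBC) (x t : ℝ) (z : ℂ) : P.theta x t (conj z) = conj (P.theta x t z) := by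
  simp [theta, k_conj, lam_conj, map_ofNat]

theorem gam_conj (P : NZBC) (z : ℂ) : P.gam (conj z) = conj (P.gam z) := by
  simp [gam]

theorem k_neg (P : NZBC) (z : ℂ) : P.k (-z) = -P.k z := by
  simp [k, div_neg]; ring

theorem lam_neg (P : NZBC) (z : ℂ) : P.lam (-z) = -P.lam z := by
  simp [lam, div_neg]; ring

theorem theta_neg (P : NZBC) (x t : ℝ) (z : ℂ) : P.theta x t (-z) = P.theta x t z := by
  simp [theta, k_neg, lam_neg]

theorem gam_neg (P : NZBC) (z : ℂ) : P.gam (-z) = P.gam z := by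
  simp [gam]

/-- The inversion `z ↦ -u₀²/z`. -/
noncomputable def inv (P : NZBC) (z : ℂ) : ℂ := -((P.u₀ : ℂ) ^ 2 / z)

theorem inv_inv (hP : P.IsSolution) (z : ℂ) : P.inv (P.inv z) = z := by
  have : (P.u₀ : ℂ) ≠ 0 := by exact_mod_cast hP.u₀_pos.ne'
  simp [inv, div_neg]
  field_simp

theorem k_inv (hP : P.IsSolution) {z : ℂ} (hz : z ≠ 0) : P.k (P.inv z) = P.k z := by
  have : (P.u₀ : ℂ) ≠ 0 := by exact_mod_cast hP.u₀_pos.ne'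
  simp only [k, inv]; field_simp; ring

theorem lam_inv (hP : P.IsSolution) {z : ℂ} (hz : z ≠ 0) : P.lam (P.inv z) = -P.lam z := by
  have : (P.u₀ : ℂ) ≠ 0 := by exact_mod_cast hP.u₀_pos.ne'
  simp only [lam, inv]; field_simp; ring

theorem theta_inv (hP : P.IsSolution) (x t : ℝ) {z : ℂ} (hz : z ≠ 0) :
    P.theta x t (P.inv z) = -P.theta x t z := by
  simp only [theta, k_inv hP hz, lam_inv hP hz]; ring

theorem inv_ne_zero (hP : P.IsSolution) {z : ℂ} (hz : z ≠ 0) : P.inv z ≠ 0 := by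
  have : (P.u₀ : ℂ) ≠ 0 := by exact_mod_cast hP.u₀_pos.ne'
  simp [inv, hz, this]

theorem inv_re_mul_im (P : NZBC) (z : ℂ) :
    (P.inv z).re * (P.inv z).im = -(P.u₀ ^ 4 / normSq z ^ 2 * (z.re * z.im)) := by
  have : P.inv z = ((P.u₀ ^ 2 : ℝ) : ℂ) * -z⁻¹ := by
    rw [inv]; push_cast; ring
  rw [this, re_ofReal_mul, im_ofReal_mul, neg_re, neg_im, inv_re, inv_im]
  ring

theorem inv_mem_Dbar' (hP : P.IsSolution) {z : ℂ} : P.inv z ∈ Dbar' ↔ z ∈ Dbar := by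
  have key : ∀ z ∈ Dbar, P.inv z ∈ Dbar' := fun z hz => ⟨by
    rw [inv_re_mul_im]
    have := hz.1
    have h : 0 ≤ P.u₀ ^ 4 / normSq z ^ 2 := by positivity
    nlinarith, inv_ne_zero hP hz.2⟩
  have hu : 0 < P.u₀ ^ 4 := by have := hP.u₀_pos; positivity
  refine ⟨fun h => ?_, key z⟩
  have hz : z ≠ 0 := by rintro rfl; exact h.2 (by simp [inv])
  refine ⟨?_, hz⟩
  have h1 := h.1
  rw [inv_re_mul_im] at h1
  have h2 : 0 < P.u₀ ^ 4 / normSq z ^ 2 := div_pos hu (pow_pos (normSq_pos.2 hz) 2)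
  nlinarith

theorem inv_mem_Dminus (hP : P.IsSolution) {z : ℂ} : P.inv z ∈ Dminus ↔ z ∈ Dplus := by
  have hu : 0 < P.u₀ ^ 4 := by have := hP.u₀_pos; positivity
  simp only [Dminus, Dplus, mem_ofPred_eq, inv_re_mul_im]
  rcases eq_or_ne z 0 with rfl | hz
  · simp
  have h2 : 0 < P.u₀ ^ 4 / normSq z ^ 2 := div_pos hu (pow_pos (normSq_pos.2 hz) 2)
  constructor <;> intro h <;> nlinarith

theorem asymY_apply_zero (w z : ℂ) : asymY w z 0 0 = 1 ∧ asymY w z 1 0 = -conj w / z ∧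
    asymY w z 0 1 = w / z ∧ asymY w z 1 1 = 1 := by
  refine ⟨?_, ?_, ?_, ?_⟩ <;> simp [asymY, sigma3, potQ, div_eq_inv_mul]

/-- Reversing x and t changes the sign of both Lax matrices, and exchanging the two components
absorbs this for the reflected potential. The phase θ changes sign, so the column index changes too.
-/
theorem IsJostColumn.refl {w : ℂ} {l l' : Filter ℝ} {j : Fin 2} {z : ℂ} {f : ℝ → ℝ → Fin 2 → ℂ}
    (hl : Tendsto (fun x => -x) l' l) (h : P.IsJostColumn w l j z f) :
    P.refl.IsJostColumn (-conj w) l' (1 - j) z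
      (fun x t => ![f (-x) (-t) 1, f (-x) (-t) 0]) where
  x_part := fun x t => by
    have h0 := h.x_part (-x) (-t)
    rw [laxX_apply] at h0
    have h1 := (hasDerivAt_pi.1 (HasDerivAt.scomp x h0 (hasDerivAt_neg x)))
    rw [laxX_apply, hasDerivAt_pi]
    intro i
    fin_cases i
    · refine (h1 1).congr_deriv ?_
      simp [NZBC.refl, k]; ring
    · refine (h1 0).congr_deriv ?_
      simp [NZBC.refl, k]; ring
  t_part := fun x t => by
    have h0 := h.t_part (-x) (-t)
    rw [laxT_apply] at h0
    have h1 := (hasDerivAt_pi.1 (HasDerivAt.scomp t h0 (hasDerivAt_neg t)))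
    rw [laxT_apply, hasDerivAt_pi]
    intro i
    fin_cases i
    · refine (h1 1).congr_deriv ?_
      simp [laxTdiag, laxTup, laxTdown, ux_refl, k_refl]
      simp [NZBC.refl]
      ring
    · refine (h1 0).congr_deriv ?_
      simp [laxTdiag, laxTup, laxTdown, ux_refl, k_refl]
      simp [NZBC.refl]
      ring
  asymp := fun t => by
    have h1 := tendsto_pi_nhds.1 ((h.asymp (-t)).comp hl)
    have a := asymY_apply_zero w z
    have b := asymY_apply_zero (-conj w) z
    rw [tendsto_pi_nhds]
    intro i
    fin_cases j <;> fin_cases i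
    · simpa [theta_refl, sigma3, a, b] using! h1 1
    · simpa [theta_refl, sigma3, a, b] using! h1 0
    · simpa [theta_refl, sigma3, a, b] using! h1 1
    · simpa [theta_refl, sigma3, a, b] using! h1 0

/-- The map v ↦ (-v₂*, v₁*) intertwines the Lax pair at z with that at z*. It exchanges the columns
of Y, up to the sign recorded by σ₃. -/
theorem IsJostColumn.conj {w : ℂ} {l : Filter ℝ} {j : Fin 2} {z : ℂ} {f : ℝ → ℝ → Fin 2 → ℂ}
    (h : P.IsJostColumn w l j z f) :
    P.IsJostColumn w l (1 - j) (conj z)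
      (fun x t => ![-(sigma3 j j * conj (f x t 1)), sigma3 j j * conj (f x t 0)]) where
  x_part := fun x t => by
    have h0 := h.x_part x t
    rw [laxX_apply] at h0
    have h1 := hasDerivAt_pi.1 h0
    rw [laxX_apply, hasDerivAt_pi]
    intro i
    fin_cases i
    · refine ((h1 1).conj_real.const_mul (sigma3 j j)).neg.congr_deriv ?_
      simp [k_conj]; ring
    · refine ((h1 0).conj_real.const_mul (sigma3 j j)).congr_deriv ?_
      simp [k_conj]; ring
  t_part := fun x t => by
    have h0 := h.t_part x t
    rw [laxT_apply] at h0
    have h1 := hasDerivAt_pi.1 h0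
    rw [laxT_apply, hasDerivAt_pi]
    intro i
    fin_cases i
    · refine ((h1 1).conj_real.const_mul (sigma3 j j)).neg.congr_deriv ?_
      simp [laxTdiag, laxTup, laxTdown, k_conj, map_ofNat]
      ring
    · refine ((h1 0).conj_real.const_mul (sigma3 j j)).congr_deriv ?_
      simp [laxTdiag, laxTup, laxTdown, k_conj, map_ofNat]
      ring
  asymp := fun t => by
    have h1 := tendsto_pi_nhds.1 (h.asymp t)
    have h2 := fun i => (continuous_conj.tendsto _).comp (h1 i)
    have a := asymY_apply_zero w z
    have b := asymY_apply_zero w (starRingEnd ℂ z)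
    rw [tendsto_pi_nhds]
    intro i
    fin_cases j <;> fin_cases i
    · simpa [theta_conj, sigma3, a, b, ← exp_conj, neg_div] using! (h2 1).neg
    · simpa [theta_conj, sigma3, a, b, ← exp_conj, Function.comp_def] using! h2 0
    · simpa [theta_conj, sigma3, a, b, ← exp_conj, Function.comp_def] using! h2 1
    · simpa [theta_conj, sigma3, a, b, ← exp_conj, neg_div] using! (h2 0).neg

theorem IsJostColumn.neg {w : ℂ} {l : Filter ℝ} {j : Fin 2} {z : ℂ} {f : ℝ → ℝ → Fin 2 → ℂ}
    (h : P.IsJostColumn w l j z f) :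
    P.IsJostColumn w l j (-z) (fun x t => ![sigma3 j j * f x t 0, -(sigma3 j j * f x t 1)]) where
  x_part := fun x t => by
    have h0 := h.x_part x t
    rw [laxX_apply] at h0
    have h1 := hasDerivAt_pi.1 h0
    rw [laxX_apply, hasDerivAt_pi]
    intro i
    fin_cases i
    · refine ((h1 0).const_mul (sigma3 j j)).congr_deriv ?_
      simp [k_neg]; ring
    · refine ((h1 1).const_mul (sigma3 j j)).neg.congr_deriv ?_
      simp [k_neg]; ring
  t_part := fun x t => by
    have h0 := h.t_part x t
    rw [laxT_apply] at h0
    have h1 := hasDerivAt_pi.1 h0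
    rw [laxT_apply, hasDerivAt_pi]
    intro i
    fin_cases i
    · refine ((h1 0).const_mul (sigma3 j j)).congr_deriv ?_
      simp [laxTdiag, laxTup, laxTdown, k_neg]
      ring
    · refine ((h1 1).const_mul (sigma3 j j)).neg.congr_deriv ?_
      simp [laxTdiag, laxTup, laxTdown, k_neg]
      ring
  asymp := fun t => by
    have h1 := tendsto_pi_nhds.1 (h.asymp t)
    have a := asymY_apply_zero w z
    have b := asymY_apply_zero w (-z)
    rw [tendsto_pi_nhds]
    intro i
    fin_cases j <;> fin_cases i
    · simpa [theta_neg, sigma3, a, b] using! h1 0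
    · simpa [theta_neg, sigma3, a, b, div_neg] using! (h1 1).neg
    · simpa [theta_neg, sigma3, a, b, div_neg] using! (h1 0).neg
    · simpa [theta_neg, sigma3, a, b] using! h1 1

/-- The Lax pair depends on z only through k, which the inversion fixes, so a solution remains a
solution. λ and θ change sign, so the first column becomes the second; the scalar matches the
normalisation. -/
theorem IsJostColumn.inv_zero (hP : P.IsSolution) {w : ℂ} (hw : w * conj w = (P.u₀ : ℂ) ^ 2)
    {l : Filter ℝ} {z : ℂ} (hz : z ≠ 0) {f : ℝ → ℝ → Fin 2 → ℂ} (h : P.IsJostColumn w l 0 z f) :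
    P.IsJostColumn w l 1 (P.inv z) (fun x t => (w / P.inv z) • f x t) where
  x_part := fun x t => by
    have h1 := (h.x_part x t).const_smul (w / P.inv z)
    refine h1.congr_deriv ?_
    rw [Matrix.mulVec_smul, laxX, laxX, k_inv hP hz]
  t_part := fun x t => by
    have h1 := (h.t_part x t).const_smul (w / P.inv z)
    refine h1.congr_deriv ?_
    rw [Matrix.mulVec_smul, laxT, laxT, k_inv hP hz]
  asymp := fun t => by
    have hu : (P.u₀ : ℂ) ≠ 0 := by exact_mod_cast hP.u₀_pos.ne'
    have h1 := (h.asymp t).const_smul (w / P.inv z)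
    rw [asymY_col_zero] at h1
    rw [asymY_col_one]
    have e : (w / P.inv z) • ![1, -conj w / z] = ![w / P.inv z, 1] := by
      ext i
      fin_cases i
      · simp
      · simp [inv]
        field_simp
        linear_combination hw
    rw [← e]
    refine h1.congr fun x => ?_
    rw [theta_inv hP x t hz, smul_smul, smul_smul, mul_comm]
    simp [sigma3]

theorem IsJostColumn.inv_one (hP : P.IsSolution) {w : ℂ} (hw : w * conj w = (P.u₀ : ℂ) ^ 2)
    {l : Filter ℝ} {z : ℂ} (hz : z ≠ 0) {f : ℝ → ℝ → Fin 2 → ℂ} (h : P.IsJostColumn w l 1 z f) :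
    P.IsJostColumn w l 0 (P.inv z) (fun x t => (-conj w / P.inv z) • f x t) where
  x_part := fun x t => by
    have h1 := (h.x_part x t).const_smul (-conj w / P.inv z)
    refine h1.congr_deriv ?_
    rw [Matrix.mulVec_smul, laxX, laxX, k_inv hP hz]
  t_part := fun x t => by
    have h1 := (h.t_part x t).const_smul (-conj w / P.inv z)
    refine h1.congr_deriv ?_
    rw [Matrix.mulVec_smul, laxT, laxT, k_inv hP hz]
  asymp := fun t => by
    have hu : (P.u₀ : ℂ) ≠ 0 := by exact_mod_cast hP.u₀_pos.ne'
    have h1 := (h.asymp t).const_smul (-conj w / P.inv z)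
    rw [asymY_col_one] at h1
    rw [asymY_col_zero]
    have e : (-conj w / P.inv z) • ![w / z, 1] = ![1, -conj w / P.inv z] := by
      ext i
      fin_cases i
      · simp [inv]
        field_simp
        linear_combination hw
      · simp
    rw [← e]
    refine h1.congr fun x => ?_
    rw [theta_inv hP x t hz, smul_smul, smul_smul, mul_comm]
    simp [sigma3]

end NZBC

/-! ### All four Jost columns and the symmetries of the scattering coefficients -/

namespace NZBC

variable {P : NZBC}

theorem existsUnique_plus_zero (hP : P.IsSolution) {z : ℂ} (hz : z ∈ Dbar) :
    ∃! f, P.IsJostColumn P.up atTop 0 z f :=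
  ⟨P.jostFull z, isJostColumn_jostFull hP hz, fun _ hf => isJostColumn_unique hP hz hf⟩

/-- The reflection is an involution: a competitor is reflected back, compared there, and reflected
again. -/
theorem existsUnique_refl {w : ℂ} {l l' : Filter ℝ} {j : Fin 2} {z : ℂ}
    (hl : Tendsto (fun x => -x) l' l) (hl' : Tendsto (fun x => -x) l l')
    (h : ∃! f, P.IsJostColumn w l j z f) :
    ∃! f, P.refl.IsJostColumn (-conj w) l' (1 - j) z f := by
  obtain ⟨f, hf, hu⟩ := h
  refine ⟨_, hf.refl hl, fun g hg => ?_⟩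
  have h1 := hg.refl hl'
  rw [refl_refl, sub_sub_cancel, map_neg, conj_conj, neg_neg] at h1
  have h2 := hu _ h1
  rw [← h2]
  funext x t i
  fin_cases i <;> simp

theorem existsUnique_conj {w : ℂ} {l : Filter ℝ} {j : Fin 2} {z : ℂ}
    (h : ∃! f, P.IsJostColumn w l j z f) : ∃! f, P.IsJostColumn w l (1 - j) (conj z) f := by
  obtain ⟨f, hf, hu⟩ := h
  refine ⟨_, hf.conj, fun g hg => ?_⟩
  have h1 := hg.conj
  rw [sub_sub_cancel, conj_conj] at h1
  have h2 := hu _ h1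
  rw [← h2]
  funext x t i
  fin_cases j <;> fin_cases i <;> simp [sigma3]

theorem existsUnique_minus_one (hP : P.IsSolution) {z : ℂ} (hz : z ∈ Dbar) :
    ∃! f, P.IsJostColumn P.um atBot 1 z f := by
  have := existsUnique_refl tendsto_neg_atBot_atTop tendsto_neg_atTop_atBot
    (existsUnique_plus_zero hP.refl hz)
  rw [refl_refl] at this
  simpa [refl] using! this

theorem existsUnique_minus_zero (hP : P.IsSolution) {z : ℂ} (hz : z ∈ Dbar') :
    ∃! f, P.IsJostColumn P.um atBot 0 z f := by
  have := existsUnique_conj (existsUnique_minus_one hP (conj_mem_Dbar.2 hz))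
  rwa [sub_self, conj_conj] at this

theorem existsUnique_plus_one (hP : P.IsSolution) {z : ℂ} (hz : z ∈ Dbar') :
    ∃! f, P.IsJostColumn P.up atTop 1 z f := by
  have := existsUnique_conj (existsUnique_plus_zero hP (conj_mem_Dbar.2 hz))
  rwa [sub_zero, conj_conj] at this

theorem isJostColumn_phiPlus {j : Fin 2} {z : ℂ} (h : ∃! f, P.IsJostColumn P.up atTop j z f) :
    P.IsJostColumn P.up atTop j z fun x t => P.phiPlus j x t z :=
  Classical.epsilon_spec h.exists

theorem isJostColumn_phiMinus {j : Fin 2} {z : ℂ} (h : ∃! f, P.IsJostColumn P.um atBot j z f) :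
    P.IsJostColumn P.um atBot j z fun x t => P.phiMinus j x t z :=
  Classical.epsilon_spec h.exists

theorem phiPlus_eq {j : Fin 2} {z : ℂ} (h : ∃! f, P.IsJostColumn P.up atTop j z f)
    {f : ℝ → ℝ → Fin 2 → ℂ} (hf : P.IsJostColumn P.up atTop j z f) (x t : ℝ) :
    P.phiPlus j x t z = f x t :=
  congrFun (congrFun (h.unique (isJostColumn_phiPlus h) hf) x) t

theorem phiMinus_eq {j : Fin 2} {z : ℂ} (h : ∃! f, P.IsJostColumn P.um atBot j z f)
    {f : ℝ → ℝ → Fin 2 → ℂ} (hf : P.IsJostColumn P.um atBot j z f) (x t : ℝ) :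
    P.phiMinus j x t z = f x t :=
  congrFun (congrFun (h.unique (isJostColumn_phiMinus h) hf) x) t

theorem varphiPlus_zero_eq (hP : P.IsSolution) {z : ℂ} (hz : z ∈ Dbar) (x t : ℝ) :
    P.varphiPlus 0 x t z = P.jost x t z := by
  rw [varphiPlus, phiPlus_eq (existsUnique_plus_zero hP hz) (isJostColumn_jostFull hP hz), jostFull,
    smul_smul, ← exp_add]
  simp [sigma3]

theorem varphiMinus_one_eq (hP : P.IsSolution) {z : ℂ} (hz : z ∈ Dbar) (x t : ℝ) :
    P.varphiMinus 1 x t z = ![P.refl.jost (-x) (-t) z 1, P.refl.jost (-x) (-t) z 0] := by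
  have h1 := (isJostColumn_jostFull hP.refl hz).refl tendsto_neg_atBot_atTop
  rw [refl_refl, show -conj P.refl.up = P.um by simp [refl], sub_zero] at h1
  rw [varphiMinus, phiMinus_eq (existsUnique_minus_one hP hz) h1]
  ext i
  fin_cases i <;> simp [jostFull, theta_refl, sigma3, ← mul_assoc, ← exp_add]

theorem phiPlus_one_conj (hP : P.IsSolution) {z : ℂ} (hz : z ∈ Dbar) (x t : ℝ) :
    P.phiPlus 1 x t (conj z) = ![-conj (P.phiPlus 0 x t z 1), conj (P.phiPlus 0 x t z 0)] := by
  have h := (isJostColumn_phiPlus (existsUnique_plus_zero hP hz)).conj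
  rw [sub_zero] at h
  rw [phiPlus_eq (existsUnique_plus_one hP (by rwa [conj_mem_Dbar'])) h]
  simp [sigma3]

theorem phiMinus_zero_conj (hP : P.IsSolution) {z : ℂ} (hz : z ∈ Dbar) (x t : ℝ) :
    P.phiMinus 0 x t (conj z) = ![conj (P.phiMinus 1 x t z 1), -conj (P.phiMinus 1 x t z 0)] := by
  have h := (isJostColumn_phiMinus (existsUnique_minus_one hP hz)).conj
  rw [sub_self] at h
  rw [phiMinus_eq (existsUnique_minus_zero hP (by rwa [conj_mem_Dbar'])) h]
  simp [sigma3]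

theorem phiPlus_zero_neg (hP : P.IsSolution) {z : ℂ} (hz : z ∈ Dbar) (x t : ℝ) :
    P.phiPlus 0 x t (-z) = ![P.phiPlus 0 x t z 0, -P.phiPlus 0 x t z 1] := by
  have h := (isJostColumn_phiPlus (existsUnique_plus_zero hP hz)).neg
  rw [phiPlus_eq (existsUnique_plus_zero hP (neg_mem_Dbar.2 hz)) h]
  simp [sigma3]

theorem phiMinus_one_neg (hP : P.IsSolution) {z : ℂ} (hz : z ∈ Dbar) (x t : ℝ) :
    P.phiMinus 1 x t (-z) = ![-P.phiMinus 1 x t z 0, P.phiMinus 1 x t z 1] := by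
  have h := (isJostColumn_phiMinus (existsUnique_minus_one hP hz)).neg
  rw [phiMinus_eq (existsUnique_minus_one hP (neg_mem_Dbar.2 hz)) h]
  simp [sigma3]

theorem phiPlus_zero_inv (hP : P.IsSolution) {z : ℂ} (hz : z ∈ Dbar) (x t : ℝ) :
    P.phiPlus 0 x t z = (-conj P.up / z) • P.phiPlus 1 x t (P.inv z) := by
  have h := (isJostColumn_phiPlus (existsUnique_plus_one hP ((inv_mem_Dbar' hP).2 hz))).inv_one hP
    (conj_mul_up hP) (inv_ne_zero hP hz.2)
  rw [inv_inv hP] at h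
  exact phiPlus_eq (existsUnique_plus_zero hP hz) h x t

theorem phiMinus_one_inv (hP : P.IsSolution) {z : ℂ} (hz : z ∈ Dbar) (x t : ℝ) :
    P.phiMinus 1 x t z = (P.um / z) • P.phiMinus 0 x t (P.inv z) := by
  have h := (isJostColumn_phiMinus (existsUnique_minus_zero hP ((inv_mem_Dbar' hP).2 hz))).inv_zero
    hP (conj_mul_um hP) (inv_ne_zero hP hz.2)
  rw [inv_inv hP] at h
  exact phiMinus_eq (existsUnique_minus_one hP hz) h x t

theorem varphiPlus_one_conj (hP : P.IsSolution) {z : ℂ} (hz : z ∈ Dbar) (x t : ℝ) :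
    P.varphiPlus 1 x t (conj z) =
      ![-conj (P.varphiPlus 0 x t z 1), conj (P.varphiPlus 0 x t z 0)] := by
  rw [varphiPlus, varphiPlus, phiPlus_one_conj hP hz, theta_conj]
  ext i
  fin_cases i <;> simp [sigma3, ← exp_conj]

theorem varphiMinus_zero_conj (hP : P.IsSolution) {z : ℂ} (hz : z ∈ Dbar) (x t : ℝ) :
    P.varphiMinus 0 x t (conj z) =
      ![conj (P.varphiMinus 1 x t z 1), -conj (P.varphiMinus 1 x t z 0)] := by
  rw [varphiMinus, varphiMinus, phiMinus_zero_conj hP hz, theta_conj]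
  ext i
  fin_cases i <;> simp [sigma3, ← exp_conj]

theorem varphiPlus_zero_neg (hP : P.IsSolution) {z : ℂ} (hz : z ∈ Dbar) (x t : ℝ) :
    P.varphiPlus 0 x t (-z) = ![P.varphiPlus 0 x t z 0, -P.varphiPlus 0 x t z 1] := by
  rw [varphiPlus, varphiPlus, phiPlus_zero_neg hP hz, theta_neg]
  ext i
  fin_cases i <;> simp

theorem varphiMinus_one_neg (hP : P.IsSolution) {z : ℂ} (hz : z ∈ Dbar) (x t : ℝ) :
    P.varphiMinus 1 x t (-z) = ![-P.varphiMinus 1 x t z 0, P.varphiMinus 1 x t z 1] := by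
  rw [varphiMinus, varphiMinus, phiMinus_one_neg hP hz, theta_neg]
  ext i
  fin_cases i <;> simp

theorem varphiPlus_zero_inv (hP : P.IsSolution) {z : ℂ} (hz : z ∈ Dbar) (x t : ℝ) :
    P.varphiPlus 0 x t z = (-conj P.up / z) • P.varphiPlus 1 x t (P.inv z) := by
  rw [varphiPlus, varphiPlus, phiPlus_zero_inv hP hz, theta_inv hP x t hz.2, smul_comm]
  simp [sigma3]

theorem varphiMinus_one_inv (hP : P.IsSolution) {z : ℂ} (hz : z ∈ Dbar) (x t : ℝ) :
    P.varphiMinus 1 x t z = (P.um / z) • P.varphiMinus 0 x t (P.inv z) := by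
  rw [varphiMinus, varphiMinus, phiMinus_one_inv hP hz, theta_inv hP x t hz.2, smul_comm]
  simp [sigma3]

/-- The Wronskian of two solutions of the Lax pair is constant. -/
theorem wronskian_eq {w w' z : ℂ} {l l' : Filter ℝ} {i j : Fin 2} {f g : ℝ → ℝ → Fin 2 → ℂ}
    (hf : P.IsJostColumn w l i z f) (hg : P.IsJostColumn w' l' j z g) (x t y s : ℝ) :
    wronskian (f x t) (g x t) = wronskian (f y s) (g y s) := by
  have dx : ∀ x t, HasDerivAt (fun y => wronskian (f y t) (g y t)) 0 x := by
    intro x t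
    have hf0 := hf.x_part x t
    have hg0 := hg.x_part x t
    rw [laxX_apply] at hf0 hg0
    have f0 := hasDerivAt_pi.1 hf0
    have g0 := hasDerivAt_pi.1 hg0
    refine (((f0 0).mul (g0 1)).sub ((f0 1).mul (g0 0))).congr_deriv ?_
    simp; ring
  have dt : ∀ x t, HasDerivAt (fun s => wronskian (f x s) (g x s)) 0 t := by
    intro x t
    have hf0 := hf.t_part x t
    have hg0 := hg.t_part x t
    rw [laxT_apply] at hf0 hg0
    have f0 := hasDerivAt_pi.1 hf0
    have g0 := hasDerivAt_pi.1 hg0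
    refine (((f0 0).mul (g0 1)).sub ((f0 1).mul (g0 0))).congr_deriv ?_
    simp; ring
  have h1 := is_const_of_deriv_eq_zero (fun x => (dx x t).differentiableAt)
    (fun x => (dx x t).deriv) x y
  have h2 := is_const_of_deriv_eq_zero (fun t => (dt y t).differentiableAt)
    (fun t => (dt y t).deriv) t s
  exact h1.trans h2

theorem gam_ne_zero {z : ℂ} (hz : z ≠ 0) (h1 : z ≠ I * P.u₀)
    (h2 : z ≠ -(I * P.u₀)) : P.gam z ≠ 0 := by
  intro h
  have h3 : (z - I * P.u₀) * (z + I * P.u₀) = 0 := by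
    have : z ^ 2 * P.gam z = 0 := by rw [h, mul_zero]
    rw [gam, mul_add, mul_one, mul_div_cancel₀ _ (pow_ne_zero 2 hz)] at this
    linear_combination this - (P.u₀ : ℂ) ^ 2 * I_sq
  rcases mul_eq_zero.1 h3 with h | h
  · exact h1 (sub_eq_zero.1 h)
  · exact h2 (eq_neg_of_add_eq_zero_left h)

theorem not_mem_axis {z : ℂ} (hz : z.re * z.im ≠ 0) (r : ℝ) : z ≠ I * r ∧ z ≠ -(I * r) := by
  refine ⟨?_, ?_⟩ <;> rintro rfl <;> simp at hz

theorem gam_ne_zero_of_mem (hP : P.IsSolution) {z : ℂ}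
    (hz : z ∈ Dplus ∪ Dminus ∪ P.regularContour) : P.gam z ≠ 0 := by
  rcases hz with (hz | hz) | hz
  · have := not_mem_axis (ne_of_lt (show z.re * z.im < 0 from hz)) P.u₀
    exact gam_ne_zero (Dplus_subset_Dbar hz).2 this.1 this.2
  · have := not_mem_axis (ne_of_gt (show 0 < z.re * z.im from hz)) P.u₀
    exact gam_ne_zero (Dminus_subset_Dbar' hz).2 this.1 this.2
  · exact gam_ne_zero hz.1.2 (fun h => hz.2 (Or.inl h)) fun h => hz.2 (Or.inr h)

theorem regularContour_subset : P.regularContour ⊆ Dbar ∩ Dbar' :=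
  fun _ hz => ⟨Contour_subset_Dbar hz.1, Contour_subset_Dbar' hz.1⟩

theorem wronskian_smul (a b : ℂ) (v w : Fin 2 → ℂ) :
    wronskian (a • v) (b • w) = a * b * wronskian v w := by
  simp [wronskian]; ring

/-- The Wronskian of `φ₊,₁` and `φ₋,₂` in terms of the normalised columns. -/
theorem gam_mul_s11 (hP : P.IsSolution) {z : ℂ} (hz : z ∈ Dbar) (hg : P.gam z ≠ 0) (x t : ℝ) :
    P.gam z * P.s11 z = wronskian (P.varphiPlus 0 x t z) (P.varphiMinus 1 x t z) ∧
    P.gam z * P.s11 z = wronskian (P.phiPlus 0 x t z) (P.phiMinus 1 x t z) := by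
  have h := wronskian_eq (isJostColumn_phiPlus (existsUnique_plus_zero hP hz))
    (isJostColumn_phiMinus (existsUnique_minus_one hP hz)) x t 0 0
  have h2 : P.gam z * P.s11 z = wronskian (P.phiPlus 0 x t z) (P.phiMinus 1 x t z) := by
    rw [h, s11, mul_div_cancel₀ _ hg]
  refine ⟨?_, h2⟩
  rw [h2, varphiPlus, varphiMinus, wronskian_smul, ← exp_add]
  simp [sigma3]

theorem s22_conj (hP : P.IsSolution) {z : ℂ} (hz : z ∈ Dbar) :
    P.s22 (conj z) = conj (P.s11 z) := by
  rw [s22, s11, phiMinus_zero_conj hP hz, phiPlus_one_conj hP hz, gam_conj, map_div₀]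
  congr 1
  simp [wronskian]
  ring

theorem s22_eq (hP : P.IsSolution) {z : ℂ} (hz : z ∈ Dbar') :
    P.s22 z = conj (P.s11 (conj z)) := by
  rw [← s22_conj hP (conj_mem_Dbar.2 hz), conj_conj]

theorem s11_neg (hP : P.IsSolution) {z : ℂ} (hz : z ∈ Dbar) : P.s11 (-z) = P.s11 z := by
  rw [s11, s11, phiPlus_zero_neg hP hz, phiMinus_one_neg hP hz, gam_neg]
  congr 1
  simp [wronskian]

/-- Inversion expresses φ₊,₁ and φ₋,₂ at z through φ₊,₂ and φ₋,₁ at -u₀²/z, with factors -u₊*/z and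
u₋/z. The order in the Wronskian is reversed, and γ(-u₀²/z) = (z²/u₀²)γ(z) removes the powers of z.
-/
theorem s11_inv (hP : P.IsSolution) {z : ℂ} (hz : z ∈ Dbar) :
    P.s11 z = conj P.up * P.um / (P.u₀ : ℂ) ^ 2 * P.s22 (P.inv z) := by
  have hu : (P.u₀ : ℂ) ≠ 0 := by exact_mod_cast hP.u₀_pos.ne'
  have hz0 := hz.2
  have hg : P.gam (P.inv z) = z ^ 2 / (P.u₀ : ℂ) ^ 2 * P.gam z := by
    simp only [gam, inv]; field_simp; ring
  rw [s11, s22, hg, phiPlus_zero_inv hP hz, phiMinus_one_inv hP hz, wronskian_smul]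
  -- If γ(z) = 0, both sides are quotients with denominator 0 and so equal 0.
  rcases eq_or_ne (P.gam z) 0 with h | h
  · simp [h]
  · simp only [wronskian]
    field_simp
    ring

end NZBC

/-! ### Cauchy's theorem on quadrants for functions bounded near exceptional boundary points -/

/-- The closed first quadrant without the origin. -/
def quadrant : Set ℂ := {z | 0 ≤ z.re ∧ 0 ≤ z.im ∧ z ≠ 0}

/-- The open first quadrant. -/
def openQuadrant : Set ℂ := {z | 0 < z.re ∧ 0 < z.im}

theorem openQuadrant_subset : openQuadrant ⊆ quadrant := fun z hz =>
  ⟨hz.1.le, hz.2.le, fun h => by simp [openQuadrant, h] at hz⟩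

theorem add_mem_openQuadrant {w : ℂ} (h1 : 0 ≤ w.re) (h2 : 0 ≤ w.im) {ε : ℝ} (hε : 0 < ε) :
    w + ε * (1 + I) ∈ openQuadrant := by
  constructor <;> simp <;> linarith

/-- Boundary values of an integral, approached diagonally from inside the quadrant. -/
theorem tendsto_integral_diagonal {f : ℂ → ℂ} {T : Set ℂ} {w : ℝ → ℂ} {R : ℝ}
    (hd : DifferentiableOn ℂ f openQuadrant)
    (hc : ∀ z ∈ quadrant, z ∉ T → ContinuousWithinAt f quadrant z)
    (hb : ∀ r : ℝ, ∃ C, ∀ z ∈ quadrant, ‖z‖ ≤ r → ‖f z‖ ≤ C) (hR : 0 ≤ R)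
    (hw : Continuous w) (hw1 : ∀ s ∈ Icc 0 R, 0 ≤ (w s).re ∧ 0 ≤ (w s).im)
    (hw0 : Function.Injective w) (hT : T.Countable) :
    Tendsto (fun ε : ℝ => ∫ s in (0 : ℝ)..R, f (w s + ε * (1 + I))) (𝓝[>] 0)
      (𝓝 (∫ s in (0 : ℝ)..R, f (w s))) := by
  obtain ⟨B, hB⟩ := (isCompact_Icc (a := (0 : ℝ)) (b := R)).exists_bound_of_continuousOn
    hw.continuousOn
  obtain ⟨C, hC⟩ := hb (B + 2)
  have hsub : uIoc (0 : ℝ) R ⊆ Icc 0 R := by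
    rw [uIoc_of_le hR]; exact Ioc_subset_Icc_self
  have hnI : ‖(1 + I : ℂ)‖ ≤ 2 := by
    refine (norm_add_le _ _).trans ?_
    rw [norm_one, norm_I]; norm_num
  -- An injective path meets the countable exceptional set in a null set of parameters, so pointwise
  -- convergence there is not needed.
  have hae : ∀ᵐ s : ℝ, w s ∉ T ∧ w s ≠ 0 := by
    have h1 : (w ⁻¹' T).Countable := hT.preimage hw0
    have h2 : (w ⁻¹' {0}).Countable := (countable_singleton 0).preimage hw0
    filter_upwards [h1.ae_notMem volume, h2.ae_notMem volume] with s a b using ⟨a, b⟩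
  refine intervalIntegral.tendsto_integral_filter_of_dominated_convergence (fun _ => C) ?_ ?_ ?_ ?_
  · filter_upwards [self_mem_nhdsWithin] with ε hε
    refine ContinuousOn.aestronglyMeasurable ?_ measurableSet_uIoc
    refine hd.continuousOn.comp (by fun_prop) fun s hs => ?_
    have := hw1 s (hsub hs)
    exact add_mem_openQuadrant this.1 this.2 hε
  · filter_upwards [Ioc_mem_nhdsGT (zero_lt_one' ℝ)] with ε hε
    refine ae_of_all _ fun s hs => hC _ (openQuadrant_subset ?_) ?_
    · have := hw1 s (hsub hs)
      exact add_mem_openQuadrant this.1 this.2 hε.1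
    · refine (norm_add_le _ _).trans (add_le_add (hB s (hsub hs)) ?_)
      rw [norm_mul, norm_real, Real.norm_of_nonneg hε.1.le]
      calc ε * ‖(1 + I : ℂ)‖ ≤ 1 * 2 := by
            have := hε.2; have := hε.1.le; gcongr
        _ = 2 := one_mul _
  · exact intervalIntegrable_const
  · filter_upwards [hae] with s hs hsR
    have h1 := hw1 s (hsub hsR)
    have h2 : Tendsto (fun ε : ℝ => w s + ε * (1 + I)) (𝓝[>] 0) (𝓝[quadrant] (w s)) := by
      refine tendsto_nhdsWithin_iff.2 ⟨?_, ?_⟩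
      · have : Continuous fun ε : ℝ => w s + ε * (1 + I) := by fun_prop
        have h := this.tendsto 0
        simp only [ofReal_zero, zero_mul, add_zero] at h
        exact h.mono_left nhdsWithin_le_nhds
      · filter_upwards [self_mem_nhdsWithin] with ε hε
        exact openQuadrant_subset (add_mem_openQuadrant h1.1 h1.2 hε)
    exact (hc _ ⟨h1.1, h1.2, hs.2⟩ hs.1).tendsto.comp h2

/-- Cauchy's theorem for the square `[0, R]²`. -/
theorem integral_square_eq_zero {f : ℂ → ℂ} {T : Set ℂ} {R : ℝ} (hT : T.Countable)
    (hd : DifferentiableOn ℂ f openQuadrant)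
    (hc : ∀ z ∈ quadrant, z ∉ T → ContinuousWithinAt f quadrant z)
    (hb : ∀ r : ℝ, ∃ C, ∀ z ∈ quadrant, ‖z‖ ≤ r → ‖f z‖ ≤ C) (hR : 0 ≤ R) :
    (∫ s in (0 : ℝ)..R, f s) - (∫ s in (0 : ℝ)..R, f (s + R * I))
      + I * (∫ s in (0 : ℝ)..R, f (R + s * I)) - I * (∫ s in (0 : ℝ)..R, f (I * s)) = 0 := by
  have inj1 : ∀ a : ℂ, Function.Injective fun s : ℝ => (s : ℂ) + a := fun a s s' h => by
    simpa using h
  have inj2 : ∀ a : ℂ, Function.Injective fun s : ℝ => a + (s : ℂ) * I := fun a s s' h => by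
    simpa using h
  have t1 := tendsto_integral_diagonal (w := fun s => (s : ℂ)) hd hc hb hR (by fun_prop)
    (fun s hs => by simpa using hs.1) ofReal_injective hT
  have t2 := tendsto_integral_diagonal (w := fun s => (s : ℂ) + R * I) hd hc hb hR (by fun_prop)
    (fun s hs => by simpa using ⟨hs.1, hR⟩) (inj1 _) hT
  have t3 := tendsto_integral_diagonal (w := fun s => (R : ℂ) + s * I) hd hc hb hR (by fun_prop)
    (fun s hs => by simpa using ⟨hR, hs.1⟩) (inj2 _) hT
  have t4 := tendsto_integral_diagonal (w := fun s => I * (s : ℂ)) hd hc hb hR (by fun_prop)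
    (fun s hs => by simpa using hs.1) (fun s s' h => by simpa using h) hT
  have t := ((t1.sub t2).add (t3.const_mul I)).sub (t4.const_mul I)
  refine tendsto_nhds_unique (t.congr' ?_) tendsto_const_nhds
  filter_upwards [self_mem_nhdsWithin] with ε hε
  have hε0 : 0 < ε := hε
  -- The square is shifted by ε(1 + i), which places the closed square inside the open quadrant,
  -- where f is analytic.
  have hrect := integral_boundary_rect_eq_zero_of_differentiableOn f (ε + ε * I)
    ((R + ε : ℝ) + (R + ε : ℝ) * I) (hd.mono fun z hz => by
      rw [mem_reProdIm] at hz
      simp only [add_re, add_im, ofReal_re, ofReal_im, mul_re, mul_im, I_re, I_im, mul_zero, mul_one,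
        sub_zero, add_zero, zero_add] at hz
      rw [uIcc_of_le (by linarith)] at hz
      exact ⟨hε0.trans_le hz.1.1, hε0.trans_le hz.2.1⟩)
  simp only [add_re, add_im, ofReal_re, ofReal_im, mul_re, mul_im, I_re, I_im, mul_zero, mul_one,
    sub_zero, add_zero, zero_add, smul_eq_mul] at hrect
  have sh : ∀ g : ℝ → ℂ, ∫ x in ε..R + ε, g x = ∫ s in (0 : ℝ)..R, g (s + ε) := fun g => by
    rw [intervalIntegral.integral_comp_add_right, zero_add]
  simp only [sh] at hrect
  rw [← hrect]
  congr 1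
  · congr 1
    · congr 1
      · refine intervalIntegral.integral_congr fun s _ => ?_
        congr 1; push_cast; ring
      · refine intervalIntegral.integral_congr fun s _ => ?_
        congr 1; push_cast; ring
    · congr 1
      refine intervalIntegral.integral_congr fun s _ => ?_
      congr 1; push_cast; ring
  · congr 1
    refine intervalIntegral.integral_congr fun s _ => ?_
    congr 1; push_cast; ring

/-- The two far sides subtend the angle π/2 at the origin. Combined under one integral sign they
have the antiderivative 2i arctan(s/R), and arctan 1 = π/4. -/
theorem integral_square_inv {R : ℝ} (hR : 0 < R) :
    I * (∫ s in (0 : ℝ)..R, ((R : ℂ) + s * I)⁻¹) - (∫ s in (0 : ℝ)..R, ((s : ℂ) + R * I)⁻¹)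
      = I * (Real.pi / 2) := by
  have hne : ∀ s : ℝ, (R : ℂ) + s * I ≠ 0 := fun s h => by
    have := congrArg re h
    simp at this; exact hR.ne' this
  have hne' : ∀ s : ℝ, (s : ℂ) + R * I ≠ 0 := fun s h => by
    have := congrArg im h
    simp at this; exact hR.ne' this
  have c1 : Continuous fun s : ℝ => ((R : ℂ) + s * I)⁻¹ :=
    Continuous.inv₀ (by fun_prop) hne
  have c2 : Continuous fun s : ℝ => ((s : ℂ) + R * I)⁻¹ :=
    Continuous.inv₀ (by fun_prop) hne'
  have c3 : Continuous fun s : ℝ => I * ((R : ℂ) + s * I)⁻¹ := continuous_const.mul c1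
  rw [← intervalIntegral.integral_const_mul, ← intervalIntegral.integral_sub
    (c3.intervalIntegrable _ _) (c2.intervalIntegrable _ _)]
  have hder : ∀ s : ℝ, HasDerivAt (fun s : ℝ => 2 * I * ((Real.arctan (s / R) : ℝ) : ℂ))
      (I * ((R : ℂ) + s * I)⁻¹ - ((s : ℂ) + R * I)⁻¹) s := by
    intro s
    have h := (((hasDerivAt_id s).div_const R).arctan.ofReal_comp).const_mul (2 * I)
    refine h.congr_deriv ?_
    have h1 : (R : ℂ) ^ 2 + (s : ℂ) ^ 2 ≠ 0 := by
      have : (0 : ℝ) < R ^ 2 + s ^ 2 := by positivity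
      exact_mod_cast this.ne'
    have h2 : (R : ℂ) ≠ 0 := by exact_mod_cast hR.ne'
    have e1 : ((R : ℂ) + s * I)⁻¹ = (R - s * I) / (R ^ 2 + s ^ 2) := by
      rw [inv_eq_one_div, div_eq_div_iff (hne s) h1]
      linear_combination (s : ℂ) ^ 2 * I_sq
    have e2 : ((s : ℂ) + R * I)⁻¹ = (s - R * I) / (R ^ 2 + s ^ 2) := by
      rw [inv_eq_one_div, div_eq_div_iff (hne' s) h1]
      linear_combination (R : ℂ) ^ 2 * I_sq
    have e3 : (1 : ℂ) + (s / R) ^ 2 = (R ^ 2 + s ^ 2) / R ^ 2 := by field_simp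
    rw [e1, e2]
    simp only [id]
    push_cast
    rw [e3]
    field_simp
    linear_combination (s : ℂ) * I_sq
  rw [intervalIntegral.integral_eq_sub_of_hasDerivAt (fun s _ => hder s)
    ((c3.sub c2).intervalIntegrable _ _)]
  rw [div_self hR.ne', zero_div, Real.arctan_one, Real.arctan_zero]
  push_cast
  ring

/-- Cauchy's theorem for the first quadrant. -/
theorem tendsto_integral_quadrant {f : ℂ → ℂ} {T : Set ℂ} {c : ℂ} (hT : T.Countable)
    (hd : DifferentiableOn ℂ f openQuadrant)
    (hc : ∀ z ∈ quadrant, z ∉ T → ContinuousWithinAt f quadrant z)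
    (hb : ∀ r : ℝ, ∃ C, ∀ z ∈ quadrant, ‖z‖ ≤ r → ‖f z‖ ≤ C)
    (hi : ∃ C r : ℝ, ∀ z ∈ quadrant, r ≤ ‖z‖ → ‖f z - c / z‖ ≤ C / ‖z‖ ^ 2) :
    Tendsto (fun R : ℝ => (∫ s in (0 : ℝ)..R, f s) - I * (∫ s in (0 : ℝ)..R, f (I * s))) atTop
      (𝓝 (-(I * (Real.pi / 2) * c))) := by
  obtain ⟨C, r, hC⟩ := hi
  have key : ∀ᶠ R : ℝ in atTop,
      ‖((∫ s in (0 : ℝ)..R, f s) - I * (∫ s in (0 : ℝ)..R, f (I * s)))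
        - (-(I * (Real.pi / 2) * c))‖ ≤ 2 * |C| / R := by
    filter_upwards [eventually_ge_atTop r, eventually_gt_atTop 0] with R hRr hR
    have hsq := integral_square_eq_zero hT hd hc hb hR.le
    have hinv := integral_square_inv hR
    obtain ⟨B, hB⟩ := hb (R + R)
    -- On a far side the points have modulus at least R, so replacing f by c/z costs at most |C|/R²
    -- times the length R.
    have side : ∀ w : ℝ → ℂ, Continuous w → (∀ s ∈ Ioc 0 R, w s ∈ openQuadrant ∧ R ≤ ‖w s‖ ∧
        ‖w s‖ ≤ R + R) → (IntervalIntegrable (fun s => f (w s)) volume 0 R ∧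
        ‖(∫ s in (0 : ℝ)..R, f (w s)) - c * ∫ s in (0 : ℝ)..R, (w s)⁻¹‖ ≤ |C| / R) := by
      intro w hw h
      have hne : ∀ s ∈ Ioc 0 R, w s ≠ 0 := fun s hs => (openQuadrant_subset (h s hs).1).2.2
      have i1 : IntervalIntegrable (fun s => f (w s)) volume 0 R := by
        rw [intervalIntegrable_iff_integrableOn_Ioc_of_le hR.le]
        refine Integrable.mono' (integrable_const B) ?_ ?_
        · exact (hd.continuousOn.comp hw.continuousOn fun s hs => (h s hs).1).aestronglyMeasurable
            measurableSet_Ioc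
        · exact (ae_restrict_iff' measurableSet_Ioc).2 (ae_of_all _ fun s hs =>
            hB _ (openQuadrant_subset (h s hs).1) (h s hs).2.2)
      have i2 : IntervalIntegrable (fun s => (w s)⁻¹) volume 0 R := by
        rw [intervalIntegrable_iff_integrableOn_Ioc_of_le hR.le]
        refine Integrable.mono' (integrable_const R⁻¹) ?_ ?_
        · exact (hw.continuousOn.inv₀ hne).aestronglyMeasurable measurableSet_Ioc
        · refine (ae_restrict_iff' measurableSet_Ioc).2 (ae_of_all _ fun s hs => ?_)
          rw [norm_inv]; exact inv_anti₀ hR (h s hs).2.1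
      refine ⟨i1, ?_⟩
      rw [← intervalIntegral.integral_const_mul, ← intervalIntegral.integral_sub i1
        (i2.const_mul c)]
      refine (intervalIntegral.norm_integral_le_of_norm_le_const (C := |C| / R ^ 2)
        fun s hs => ?_).trans (le_of_eq ?_)
      · rw [uIoc_of_le hR.le] at hs
        have h1 := hC (w s) (openQuadrant_subset (h s hs).1) (hRr.trans (h s hs).2.1)
        rw [div_eq_mul_inv] at h1
        refine h1.trans ?_
        have h2 := (h s hs).2.1
        calc C / ‖w s‖ ^ 2 ≤ |C| / ‖w s‖ ^ 2 := by gcongr; exact le_abs_self C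
          _ ≤ |C| / R ^ 2 := by gcongr
      · rw [sub_zero, abs_of_pos hR]; field_simp
    obtain ⟨-, s1⟩ := side (fun s => (R : ℂ) + s * I) (by fun_prop) fun s hs => by
      refine ⟨⟨by simpa using hR, by simpa using hs.1⟩, ?_, ?_⟩
      · have := abs_re_le_norm ((R : ℂ) + s * I)
        simpa [abs_of_pos hR] using this
      · refine (norm_add_le _ _).trans ?_
        simp [abs_of_pos hR, abs_of_pos hs.1, hs.2]
    obtain ⟨-, s2⟩ := side (fun s => (s : ℂ) + R * I) (by fun_prop) fun s hs => by
      refine ⟨⟨by simpa using hs.1, by simpa using hR⟩, ?_, ?_⟩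
      · have := abs_im_le_norm ((s : ℂ) + R * I)
        simpa [abs_of_pos hR] using this
      · refine (norm_add_le _ _).trans ?_
        simp [abs_of_pos hR, abs_of_pos hs.1, hs.2]
    have e : ((∫ s in (0 : ℝ)..R, f s) - I * (∫ s in (0 : ℝ)..R, f (I * s)))
        - (-(I * (Real.pi / 2) * c)) =
        ((∫ s in (0 : ℝ)..R, f (s + R * I)) - c * ∫ s in (0 : ℝ)..R, ((s : ℂ) + R * I)⁻¹)
        - I * ((∫ s in (0 : ℝ)..R, f (R + s * I)) - c * ∫ s in (0 : ℝ)..R, ((R : ℂ) + s * I)⁻¹) := by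
      linear_combination hsq - c * hinv
    rw [e]
    refine (norm_sub_le _ _).trans ((add_le_add s2 (?_ : _ ≤ |C| / R)).trans (le_of_eq (by ring)))
    rw [norm_mul, norm_I, one_mul]
    exact s1
  rw [tendsto_iff_norm_sub_tendsto_zero]
  refine squeeze_zero' (Eventually.of_forall fun _ => norm_nonneg _) key ?_
  exact tendsto_const_nhds.div_atTop tendsto_id

/-- `F` is analytic in `D`, continuous on `S` up to finitely many points `T` where it is bounded,
and `F = c/z + O(z⁻²)` at infinity. -/
structure SectorRegular (D S T : Set ℂ) (c : ℂ) (F : ℂ → ℂ) : Prop where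
  diff : DifferentiableOn ℂ F D
  cont : ∀ z ∈ S, z ∉ T → ContinuousWithinAt F S z
  bdd : ∀ p ∈ T, ∃ C, ∀ᶠ z in 𝓝[S] p, ‖F z‖ ≤ C
  infty : (fun z => F z - c / z) =O[Bornology.cobounded ℂ ⊓ 𝓟 S] fun z => (z ^ 2)⁻¹

theorem exists_bound_of_isBigO {S : Set ℂ} {f : ℂ → ℂ} {n : ℕ}
    (h : f =O[Bornology.cobounded ℂ ⊓ 𝓟 S] fun z => (z ^ n)⁻¹) :
    ∃ C r : ℝ, ∀ z ∈ S, r ≤ ‖z‖ → ‖f z‖ ≤ C / ‖z‖ ^ n := by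
  obtain ⟨C, hC⟩ := h.bound
  rw [eventually_inf_principal, hasBasis_cobounded_norm.eventually_iff] at hC
  obtain ⟨r, -, hr⟩ := hC
  refine ⟨C, r, fun z hz hzr => ?_⟩
  have := hr hzr hz
  rwa [norm_inv, norm_pow, ← div_eq_mul_inv] at this

theorem isBigO_of_exists_bound {S : Set ℂ} {f : ℂ → ℂ} {n : ℕ} {C r : ℝ}
    (h : ∀ z ∈ S, r ≤ ‖z‖ → ‖f z‖ ≤ C / ‖z‖ ^ n) :
    f =O[Bornology.cobounded ℂ ⊓ 𝓟 S] fun z => (z ^ n)⁻¹ := by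
  refine Asymptotics.IsBigO.of_bound C ?_
  rw [eventually_inf_principal, hasBasis_cobounded_norm.eventually_iff]
  refine ⟨r, trivial, fun z hzr hz => ?_⟩
  rw [norm_inv, norm_pow, ← div_eq_mul_inv]
  exact h z hz hzr

namespace SectorRegular

variable {D S T : Set ℂ} {c : ℂ} {F : ℂ → ℂ}

/-- Compactness of the closed set S ∪ {0} inside a ball: each point has a local bound, by continuity
off T and by assumption on T. The added origin causes no gap because it belongs to T. -/
theorem exists_bound (h : SectorRegular D S T c F) (hS : IsClosed (insert 0 S)) (h0 : (0 : ℂ) ∈ T)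
    (r : ℝ) : ∃ C, ∀ z ∈ S, ‖z‖ ≤ r → ‖F z‖ ≤ C := by
  have hK : IsCompact (insert 0 S ∩ Metric.closedBall 0 r) :=
    (isCompact_closedBall 0 r).inter_left hS
  have key : ∃ C, ∀ z ∈ (insert 0 S ∩ Metric.closedBall 0 r) ∩ S, ‖F z‖ ≤ C := by
    refine hK.induction_on (p := fun s => ∃ C, ∀ z ∈ s ∩ S, ‖F z‖ ≤ C) ⟨0, by simp⟩ ?_ ?_ ?_
    · rintro s t hst ⟨C, hC⟩
      exact ⟨C, fun z hz => hC z ⟨hst hz.1, hz.2⟩⟩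
    · rintro s t ⟨C, hC⟩ ⟨C', hC'⟩
      refine ⟨max C C', fun z hz => ?_⟩
      rcases hz.1 with h | h
      · exact (hC z ⟨h, hz.2⟩).trans (le_max_left _ _)
      · exact (hC' z ⟨h, hz.2⟩).trans (le_max_right _ _)
    · intro p hp
      have hloc : ∃ C, ∀ᶠ z in 𝓝[S] p, ‖F z‖ ≤ C := by
        by_cases hT : p ∈ T
        · exact h.bdd p hT
        · have hpS : p ∈ S := by
            rcases hp.1 with rfl | hp
            · exact absurd h0 hT
            · exact hp
          refine ⟨‖F p‖ + 1, ?_⟩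
          have := (h.cont p hpS hT).norm
          exact (this.eventually (eventually_lt_nhds (lt_add_one _))).mono fun z hz => hz.le
      obtain ⟨C, hC⟩ := hloc
      rw [eventually_nhdsWithin_iff] at hC
      exact ⟨_, mem_nhdsWithin_of_mem_nhds hC, C, fun z hz => hz.1 hz.2⟩
  obtain ⟨C, hC⟩ := key
  exact ⟨C, fun z hz hr => hC z ⟨⟨Or.inr hz, by simpa using hr⟩, hz⟩⟩

/-- Cauchy's theorem for a rotated quadrant. -/
theorem tendsto_integral_rotated (h : SectorRegular D S T c F) (hS : IsClosed (insert 0 S))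
    (h0 : (0 : ℂ) ∈ T) (hT : T.Countable) {a : ℂ} (ha : ‖a‖ = 1)
    (haS : ∀ z ∈ quadrant, a * z ∈ S) (haD : ∀ z ∈ openQuadrant, a * z ∈ D) :
    Tendsto (fun R : ℝ => a * (∫ s in (0 : ℝ)..R, F (a * s))
      - I * a * (∫ s in (0 : ℝ)..R, F (a * (I * s)))) atTop (𝓝 (-(I * (Real.pi / 2) * c))) := by
  have ha0 : a ≠ 0 := norm_pos_iff.1 (by rw [ha]; exact one_pos)
  obtain ⟨C, r, hC⟩ := exists_bound_of_isBigO h.infty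
  have := tendsto_integral_quadrant (f := fun z => a * F (a * z)) (T := (fun z => a * z) ⁻¹' T)
    (c := c) (hT.preimage (mul_right_injective₀ ha0))
    ((h.diff.comp (by fun_prop) haD).const_mul a)
    (fun z hz hzT => ((h.cont _ (haS z hz) hzT).comp (by fun_prop) haS).const_mul a)
    (fun r => by
      obtain ⟨C, hC⟩ := h.exists_bound hS h0 r
      refine ⟨C, fun z hz hr => ?_⟩
      rw [norm_mul, ha, one_mul]
      exact hC _ (haS z hz) (by rwa [norm_mul, ha, one_mul]))
    ⟨C, r, fun z hz hr => by
      have h1 := hC _ (haS z hz) (by rwa [norm_mul, ha, one_mul])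
      rw [norm_mul, ha, one_mul] at h1
      refine le_trans (le_of_eq ?_) h1
      rw [← one_mul ‖F (a * z) - _‖, ← ha, ← norm_mul]
      congr 1
      have := hz.2.2
      field_simp⟩
  refine this.congr fun R => ?_
  simp only [intervalIntegral.integral_const_mul]
  ring

theorem intervalIntegrable_ray (h : SectorRegular D S T c F) (hS : IsClosed (insert 0 S))
    (h0 : (0 : ℂ) ∈ T) (hT : T.Countable) {b : ℂ} (hb : ‖b‖ = 1)
    (hbS : ∀ s : ℝ, 0 < s → b * s ∈ S) {R : ℝ} (hR : 0 ≤ R) :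
    IntervalIntegrable (fun s : ℝ => F (b * s)) volume 0 R := by
  have hb0 : b ≠ 0 := norm_pos_iff.1 (by rw [hb]; exact one_pos)
  obtain ⟨C, hC⟩ := h.exists_bound hS h0 R
  have hinj : Function.Injective fun s : ℝ => b * (s : ℂ) := fun s s' h => by
    simpa [hb0] using h
  have hcount : ((fun s : ℝ => b * (s : ℂ)) ⁻¹' T).Countable := hT.preimage hinj
  rw [intervalIntegrable_iff_integrableOn_Ioc_of_le hR]
  refine Integrable.mono' (integrable_const C) ?_ ?_
  · have hset : (Ioc 0 R \ ((fun s : ℝ => b * (s : ℂ)) ⁻¹' T) : Set ℝ) =ᵐ[volume] Ioc 0 R :=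
      sdiff_null_ae_eq_self (hcount.measure_zero _)
    rw [← Measure.restrict_congr_set hset]
    refine ContinuousOn.aestronglyMeasurable (fun s hs => ?_)
      (measurableSet_Ioc.diff hcount.measurableSet)
    have hcont : Continuous fun s : ℝ => b * (s : ℂ) := by fun_prop
    exact ContinuousWithinAt.comp (f := fun s : ℝ => b * (s : ℂ)) (h.cont _ (hbS s hs.1.1) hs.2)
      hcont.continuousWithinAt fun s hs => hbS s hs.1.1
  · refine (ae_restrict_iff' measurableSet_Ioc).2 (ae_of_all _ fun s hs => hC _ (hbS s hs.1) ?_)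
    rw [norm_mul, hb, one_mul, norm_real, Real.norm_of_nonneg hs.1.le]
    exact hs.2

end SectorRegular

theorem isClosed_insert_Dbar : IsClosed (insert 0 Dbar) := by
  have : insert 0 Dbar = {z : ℂ | z.re * z.im ≤ 0} := by
    ext z
    rcases eq_or_ne z 0 with rfl | h
    · simp
    · simp [Dbar, h]
  rw [this]
  exact isClosed_le (continuous_re.mul continuous_im) continuous_const

theorem isClosed_insert_Dbar' : IsClosed (insert 0 Dbar') := by
  have : insert 0 Dbar' = {z : ℂ | 0 ≤ z.re * z.im} := by
    ext z
    rcases eq_or_ne z 0 with rfl | h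
    · simp
    · simp [Dbar', h]
  rw [this]
  exact isClosed_le continuous_const (continuous_re.mul continuous_im)

/-- The terms c/z are not integrable at infinity separately, but they cancel in the difference,
leaving O(s⁻²). On compact parts both functions are bounded. -/
theorem integrable_ray_sub {T : Set ℂ} {c : ℂ} {Fp Fm : ℂ → ℂ} (h0 : (0 : ℂ) ∈ T)
    (hT : T.Countable) (hp : SectorRegular Dplus Dbar T c Fp)
    (hm : SectorRegular Dminus Dbar' T c Fm) {b : ℂ} (hb : ‖b‖ = 1) (hbr : b.re * b.im = 0) :
    Integrable fun s : ℝ => Fp (b * s) - Fm (b * s) := by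
  have hb0 : b ≠ 0 := norm_pos_iff.1 (by rw [hb]; exact one_pos)
  have hre : ∀ s : ℝ, (b * s).re * (b * s).im = 0 := fun s => by
    rw [mul_comm b, re_ofReal_mul, im_ofReal_mul]
    linear_combination s ^ 2 * hbr
  have hS : ∀ s : ℝ, s ≠ 0 → b * s ∈ Dbar ∧ b * s ∈ Dbar' := fun s hs =>
    ⟨⟨(hre s).le, by simpa [hb0] using hs⟩, ⟨(hre s).ge, by simpa [hb0] using hs⟩⟩
  have hn : ∀ s : ℝ, ‖b * s‖ = |s| := fun s => by rw [norm_mul, hb, one_mul, norm_real]; rfl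
  obtain ⟨C₁, r₁, h₁⟩ := exists_bound_of_isBigO hp.infty
  obtain ⟨C₂, r₂, h₂⟩ := exists_bound_of_isBigO hm.infty
  set r := max 1 (max r₁ r₂) with hr
  obtain ⟨B₁, hB₁⟩ := hp.exists_bound isClosed_insert_Dbar h0 r
  obtain ⟨B₂, hB₂⟩ := hm.exists_bound isClosed_insert_Dbar' h0 r
  have hinj : Function.Injective fun s : ℝ => b * (s : ℂ) := fun s s' h => by
    simpa [hb0] using h
  have hcount : ((fun s : ℝ => b * (s : ℂ)) ⁻¹' T).Countable := hT.preimage hinj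
  have hcont : Continuous fun s : ℝ => b * (s : ℂ) := by fun_prop
  have hT0 : ∀ s : ℝ, b * s ∉ T → s ≠ 0 := fun s hs h => hs (by rw [h]; simpa using h0)
  set K := (|B₁| + |B₂|) * (1 + r ^ 2) + 2 * (|C₁| + |C₂|) with hK
  refine Integrable.mono' (integrable_inv_one_add_sq.const_mul K) ?_ ?_
  · have hset : (univ \ ((fun s : ℝ => b * (s : ℂ)) ⁻¹' T) : Set ℝ) =ᵐ[volume] univ :=
      sdiff_null_ae_eq_self (hcount.measure_zero _)
    rw [← Measure.restrict_univ (μ := volume), ← Measure.restrict_congr_set hset]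
    refine ContinuousOn.aestronglyMeasurable (fun s hs => ?_)
      (MeasurableSet.univ.diff hcount.measurableSet)
    have hs0 := hT0 s hs.2
    exact (ContinuousWithinAt.comp (f := fun s : ℝ => b * (s : ℂ)) (hp.cont _ (hS s hs0).1 hs.2)
      hcont.continuousWithinAt fun s hs => (hS s (hT0 s hs.2)).1).sub
      (ContinuousWithinAt.comp (f := fun s : ℝ => b * (s : ℂ)) (hm.cont _ (hS s hs0).2 hs.2)
      hcont.continuousWithinAt fun s hs => (hS s (hT0 s hs.2)).2)
  · have hae : ∀ᵐ s : ℝ, s ≠ 0 := by simp [ae_iff, measure_singleton]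
    filter_upwards [hae] with s hs
    have hpos : 0 < 1 + s ^ 2 := by positivity
    rw [← div_eq_mul_inv, le_div_iff₀ hpos]
    rcases le_total |s| r with h | h
    · have b1 := (hB₁ _ (hS s hs).1 (by rwa [hn])).trans (le_abs_self _)
      have b2 := (hB₂ _ (hS s hs).2 (by rwa [hn])).trans (le_abs_self _)
      have h3 : s ^ 2 ≤ r ^ 2 := sq_le_sq' (by linarith [neg_abs_le s]) ((le_abs_self s).trans h)
      have hC : 0 ≤ 2 * (|C₁| + |C₂|) := by positivity
      calc _ ≤ (|B₁| + |B₂|) * (1 + r ^ 2) := by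
            gcongr
            exact (norm_sub_le _ _).trans (add_le_add b1 b2)
        _ ≤ K := by rw [hK]; linarith
    · have s1 : 1 ≤ |s| := (le_max_left _ _).trans h
      have c1 := h₁ _ (hS s hs).1 (by
        rw [hn]; exact ((le_max_left _ _).trans (le_max_right _ _)).trans h)
      have c2 := h₂ _ (hS s hs).2 (by
        rw [hn]; exact ((le_max_right _ _).trans (le_max_right _ _)).trans h)
      rw [hn, sq_abs] at c1 c2
      have s2 : 1 ≤ s ^ 2 := by rw [← sq_abs]; nlinarith
      have e : ‖Fp (b * s) - Fm (b * s)‖ ≤ (|C₁| + |C₂|) / s ^ 2 := by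
        rw [show Fp (b * s) - Fm (b * s) = (Fp (b * s) - c / (b * s)) - (Fm (b * s) - c / (b * s))
          by ring, add_div]
        refine (norm_sub_le _ _).trans (add_le_add (c1.trans ?_) (c2.trans ?_)) <;>
        gcongr <;> exact le_abs_self _
      have hB : 0 ≤ (|B₁| + |B₂|) * (1 + r ^ 2) := by positivity
      calc _ ≤ (|C₁| + |C₂|) / s ^ 2 * (1 + s ^ 2) := by gcongr
        _ = (|C₁| + |C₂|) * ((1 + s ^ 2) / s ^ 2) := by ring
        _ ≤ (|C₁| + |C₂|) * 2 := by
            gcongr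
            rw [div_le_iff₀ (by linarith)]; linarith
        _ ≤ K := by rw [hK]; linarith

theorem contourIntegrable_sub {T : Set ℂ} {c : ℂ} {Fp Fm : ℂ → ℂ} (h0 : (0 : ℂ) ∈ T)
    (hT : T.Countable) (hp : SectorRegular Dplus Dbar T c Fp)
    (hm : SectorRegular Dminus Dbar' T c Fm) : ContourIntegrable fun z => Fp z - Fm z :=
  ⟨by simpa using integrable_ray_sub h0 hT hp hm (b := 1) (by simp) (by simp),
    integrable_ray_sub h0 hT hp hm (b := I) (by simp) (by simp)⟩

/-- The integral of the jump of a sectionally analytic function over the contour. -/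
theorem contourIntegral_sub {T : Set ℂ} {c : ℂ} {Fp Fm : ℂ → ℂ} (h0 : (0 : ℂ) ∈ T)
    (hT : T.Countable) (hp : SectorRegular Dplus Dbar T c Fp)
    (hm : SectorRegular Dminus Dbar' T c Fm) :
    contourIntegral (fun z => Fp z - Fm z) = -(2 * Real.pi * I * c) := by
  have hint := contourIntegrable_sub h0 hT hp hm
  -- The rotations by 1, i, -1, -i give the four quadrants, each contributing -(iπ/2)c. Each
  -- half-axis bounds one quadrant of either kind, so in the sum the integrals pair up to the jump.
  have q1 := hm.tendsto_integral_rotated isClosed_insert_Dbar' h0 hT (a := 1) (by simp)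
    (fun z hz => by rw [one_mul]; exact ⟨mul_nonneg hz.1 hz.2.1, hz.2.2⟩)
    (fun z hz => by rw [one_mul]; exact mul_pos hz.1 hz.2)
  have q2 := hp.tendsto_integral_rotated isClosed_insert_Dbar h0 hT (a := I) (by simp)
    (fun z hz => ⟨by simpa using mul_nonneg hz.2.1 hz.1, by simpa using hz.2.2⟩)
    (fun z hz => by simpa [Dplus] using mul_pos hz.2 hz.1)
  have q3 := hm.tendsto_integral_rotated isClosed_insert_Dbar' h0 hT (a := -1) (by simp)
    (fun z hz => ⟨by simpa using mul_nonneg hz.1 hz.2.1, by simpa using hz.2.2⟩)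
    (fun z hz => by simpa [Dminus] using mul_pos hz.1 hz.2)
  have q4 := hp.tendsto_integral_rotated isClosed_insert_Dbar h0 hT (a := -I) (by simp)
    (fun z hz => ⟨by simpa using mul_nonneg hz.2.1 hz.1, by simpa using hz.2.2⟩)
    (fun z hz => by simpa [Dplus] using mul_pos hz.2 hz.1)
  have hsum := ((q2.add q4).add q1).add q3
  have mp : ∀ b : ℂ, b = 1 ∨ b = -1 ∨ b = I ∨ b = -I →
      ‖b‖ = 1 ∧ (∀ s : ℝ, 0 < s → b * s ∈ Dbar) ∧ (∀ s : ℝ, 0 < s → b * s ∈ Dbar') := by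
    rintro b (rfl | rfl | rfl | rfl) <;>
    exact ⟨by simp, fun s hs => ⟨by simp, by simpa using hs.ne'⟩,
      fun s hs => ⟨by simp, by simpa using hs.ne'⟩⟩
  have ray : ∀ b : ℂ, b = 1 ∨ b = -1 ∨ b = I ∨ b = -I → IntegrableOn
      (fun s : ℝ => Fp (b * s) - Fm (b * s)) (Ioi 0) →
      Tendsto (fun R : ℝ => (∫ s in (0 : ℝ)..R, Fp (b * s)) - ∫ s in (0 : ℝ)..R, Fm (b * s)) atTop
        (𝓝 (∫ s in Ioi (0 : ℝ), (Fp (b * s) - Fm (b * s)))) := by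
    intro b hb hi
    obtain ⟨b1, b2, b3⟩ := mp b hb
    refine (intervalIntegral_tendsto_integral_Ioi 0 hi tendsto_id).congr' ?_
    filter_upwards [eventually_ge_atTop 0] with R hR
    exact intervalIntegral.integral_sub
      (hp.intervalIntegrable_ray isClosed_insert_Dbar h0 hT b1 b2 hR)
      (hm.intervalIntegrable_ray isClosed_insert_Dbar' h0 hT b1 b3 hR)
  have r1 := ray 1 (by simp) (by simpa using hint.1.integrableOn)
  have r2 := ray (-1) (by simp) (by simpa using! hint.1.comp_neg.integrableOn)
  have r3 := ray I (by simp) hint.2.integrableOn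
  have r4 := ray (-I) (by simp) (by simpa using! hint.2.comp_neg.integrableOn)
  have e2 : ∀ f : ℝ → ℂ, ∫ s in Iio (0 : ℝ), f s = ∫ s in Ioi (0 : ℝ), f (-s) := fun f => by
    rw [integral_comp_neg_Ioi, neg_zero, integral_Iic_eq_integral_Iio]
  have hc : contourIntegral (fun z => Fp z - Fm z) =
      (∫ s in Ioi (0 : ℝ), (Fp (-1 * s) - Fm (-1 * s)))
      - (∫ s in Ioi (0 : ℝ), (Fp (1 * s) - Fm (1 * s)))
      + I * (∫ s in Ioi (0 : ℝ), (Fp (I * s) - Fm (I * s)))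
      - I * ∫ s in Ioi (0 : ℝ), (Fp (-I * s) - Fm (-I * s)) := by
    rw [contourIntegral, e2, e2]
    simp
  rw [hc]
  have hlim := ((r2.sub r1).add (r3.const_mul I)).sub (r4.const_mul I)
  refine tendsto_nhds_unique hlim (?_ : Tendsto _ _ _)
  have e : -(2 * Real.pi * I * c) = -(I * (Real.pi / 2) * c) + -(I * (Real.pi / 2) * c)
      + -(I * (Real.pi / 2) * c) + -(I * (Real.pi / 2) * c) := by ring
  rw [e]
  refine hsum.congr fun R => ?_
  have f1 : ∀ s : ℝ, I * (I * (s : ℂ)) = -1 * s := fun s => by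
    rw [← mul_assoc, I_mul_I]
  have f2 : ∀ s : ℝ, -I * (I * (s : ℂ)) = 1 * s := fun s => by
    rw [← mul_assoc, neg_mul, I_mul_I, neg_neg]
  have f3 : ∀ s : ℝ, -1 * (I * (s : ℂ)) = -I * s := fun s => by ring
  have f4 : ∀ s : ℝ, 1 * (I * (s : ℂ)) = I * s := fun s => by ring
  simp only [f1, f2, f3, f4]
  linear_combination (-(∫ s in (0 : ℝ)..R, Fp (-1 * s)) + ∫ s in (0 : ℝ)..R, Fp (1 * s)) * I_sq

theorem isBigO_div_sub (r a : ℂ) {S : Set ℂ} :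
    (fun z => r / (z - a) - r / z) =O[Bornology.cobounded ℂ ⊓ 𝓟 S] fun z => (z ^ 2)⁻¹ := by
  refine isBigO_of_exists_bound (C := 2 * ‖r‖ * ‖a‖) (r := 2 * ‖a‖ + 1) fun z _ hz => ?_
  have hn : 0 < ‖z‖ := by linarith [norm_nonneg a]
  have h1 : ‖z‖ / 2 ≤ ‖z - a‖ := by
    have := norm_sub_norm_le z a
    linarith
  have h2 : z - a ≠ 0 := norm_pos_iff.1 (by linarith)
  have h3 : z ≠ 0 := norm_pos_iff.1 hn
  have e : r / (z - a) - r / z = r * a / ((z - a) * z) := by field_simp; ring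
  rw [e, norm_div, norm_mul, norm_mul]
  calc ‖r‖ * ‖a‖ / (‖z - a‖ * ‖z‖) ≤ ‖r‖ * ‖a‖ / (‖z‖ / 2 * ‖z‖) := by gcongr
    _ = _ := by field_simp

section

variable {ι : Type*} [Fintype ι] {D S T : Set ℂ} {a r : ι → ℂ} {c : ℂ}

theorem isBigO_sum_div_sub (a r : ι → ℂ) (S : Set ℂ) :
    (fun z => (∑ i, r i / (z - a i)) - (∑ i, r i) / z) =O[Bornology.cobounded ℂ ⊓ 𝓟 S]
      fun z => (z ^ 2)⁻¹ := by
  have : (fun z => (∑ i, r i / (z - a i)) - (∑ i, r i) / z)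
      = fun z => ∑ i, (r i / (z - a i) - r i / z) := by
    funext z
    rw [Finset.sum_sub_distrib, Finset.sum_div]
  rw [this]
  exact Asymptotics.IsBigO.fun_sum fun i _ => isBigO_div_sub _ _

theorem differentiableAt_sum_div_sub {z : ℂ} (hz : z ∉ range a) :
    DifferentiableAt ℂ (fun z => ∑ i, r i / (z - a i)) z := by
  refine DifferentiableAt.fun_sum fun i _ => ?_
  refine (differentiableAt_const _).div (by fun_prop) fun h => hz ⟨i, (sub_eq_zero.1 h).symm⟩

theorem SectorRegular.sub_sum {F : ℂ → ℂ} (h : SectorRegular D S T c F)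
    (ha : ∀ i, a i ∉ D ∪ S ∪ T) :
    SectorRegular D S T (c - ∑ i, r i) fun z => F z - ∑ i, r i / (z - a i) where
  diff := fun z hz => (h.diff z hz).sub (differentiableAt_sum_div_sub
    (by rintro ⟨i, rfl⟩; exact ha i (Or.inl (Or.inl hz)))).differentiableWithinAt
  cont := fun z hz hT => (h.cont z hz hT).sub (differentiableAt_sum_div_sub
    (by rintro ⟨i, rfl⟩; exact ha i (Or.inl (Or.inr hz)))).continuousAt.continuousWithinAt
  bdd := fun p hp => by
    obtain ⟨C, hC⟩ := h.bdd p hp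
    have h1 := (differentiableAt_sum_div_sub (a := a) (r := r) (z := p)
      (by rintro ⟨i, rfl⟩; exact ha i (Or.inr hp))).continuousAt.norm
    have h2 := h1.eventually (eventually_lt_nhds (lt_add_one _))
    refine ⟨C + (‖∑ i, r i / (p - a i)‖ + 1), ?_⟩
    filter_upwards [hC, nhdsWithin_le_nhds h2] with z h3 h4
    exact (norm_sub_le _ _).trans (add_le_add h3 h4.le)
  infty := by
    refine (h.infty.sub (isBigO_sum_div_sub a r S)).congr_left fun z => ?_
    ring

/-- Removal of finitely many simple poles. -/
theorem exists_sectorRegular_sub_poles {N : ℂ → ℂ} (hD : IsOpen D) (hDT : Disjoint D T)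
    (haD : ∀ i, a i ∈ D) (ha : Function.Injective a)
    (hd : DifferentiableOn ℂ N (D \ range a))
    (hc : ∀ z ∈ S, z ∉ T → z ∉ range a → ContinuousWithinAt N S z)
    (hb : ∀ p ∈ T, ∃ C, ∀ᶠ z in 𝓝[S] p, ‖N z‖ ≤ C)
    (hi : (fun z => N z - c / z) =O[Bornology.cobounded ℂ ⊓ 𝓟 S] fun z => (z ^ 2)⁻¹)
    (hpole : ∀ i, ∃ g, AnalyticAt ℂ g (a i) ∧ ∀ᶠ z in 𝓝[≠] (a i), N z = r i / (z - a i) + g z) :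
    ∃ F, SectorRegular D S T (c - ∑ i, r i) F ∧
      ∀ z, z ∉ range a → F z = N z - ∑ i, r i / (z - a i) := by
  classical
  set f : ℂ → ℂ := fun z => N z - ∑ i, r i / (z - a i) with hf
  -- The value of the difference at a pole is replaced by its limit, which makes the singularity
  -- removable.
  set F : ℂ → ℂ := fun z => if z ∈ range a then limUnder (𝓝[≠] z) f else f z with hF
  have hfin : (range a).Finite := finite_range a
  have off : ∀ z, z ∉ range a → F z = f z := fun z hz => if_neg hz
  have near : ∀ z, z ∉ range a → F =ᶠ[𝓝 z] f := fun z hz => by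
    filter_upwards [hfin.isClosed.isOpen_compl.mem_nhds hz] with w hw using off w hw
  have at_pole : ∀ i, DifferentiableAt ℂ F (a i) := by
    intro i
    obtain ⟨g, hg, hN⟩ := hpole i
    set g' : ℂ → ℂ := fun z => g z - ∑ j ∈ Finset.univ.erase i, r j / (z - a j) with hg'
    have dg : DifferentiableAt ℂ g' (a i) := by
      refine hg.differentiableAt.sub (DifferentiableAt.fun_sum fun j hj => ?_)
      refine (differentiableAt_const _).div (by fun_prop) fun h => ?_
      exact (Finset.ne_of_mem_erase hj) (ha (sub_eq_zero.1 h)).symm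
    have e1 : f =ᶠ[𝓝[≠] (a i)] g' := by
      filter_upwards [hN] with z hz
      rw [hf, hg']
      simp only
      rw [hz, ← Finset.add_sum_erase _ _ (Finset.mem_univ i)]
      ring
    have e2 : F (a i) = g' (a i) := by
      rw [hF]
      simp only [mem_range_self, if_true]
      refine Tendsto.limUnder_eq ?_
      exact (dg.continuousAt.tendsto.mono_left nhdsWithin_le_nhds).congr' e1.symm
    have e3 : F =ᶠ[𝓝 (a i)] g' := by
      have h1 : ∀ᶠ z in 𝓝[≠] (a i), z ∉ range a \ {a i} :=
        nhdsWithin_le_nhds ((hfin.subset sdiff_subset).isClosed.isOpen_compl.mem_nhds (by simp))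
      rw [EventuallyEq, eventually_nhdsWithin_iff] at e1
      rw [eventually_nhdsWithin_iff] at h1
      filter_upwards [e1, h1] with z hz hz1
      rcases eq_or_ne z (a i) with rfl | hne
      · exact e2
      · rw [off z fun h => hz1 hne ⟨h, hne⟩]
        exact hz hne
    exact dg.congr_of_eventuallyEq e3
  have bigO : (fun z => F z - (c - ∑ i, r i) / z) =O[Bornology.cobounded ℂ ⊓ 𝓟 S]
      fun z => (z ^ 2)⁻¹ := by
    refine (hi.sub (isBigO_sum_div_sub a r S)).congr' ?_ EventuallyEq.rfl
    have : ∀ᶠ z in Bornology.cobounded ℂ, z ∉ range a :=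
      Bornology.isBounded_def.1 hfin.isBounded
    filter_upwards [this.filter_mono inf_le_left] with z hz
    rw [off z hz, hf]; ring
  refine ⟨F, ⟨fun z hz => ?_, fun z hz hT => ?_, fun p hp => ?_, bigO⟩, off⟩
  · by_cases h : z ∈ range a
    · obtain ⟨i, rfl⟩ := h
      exact (at_pole i).differentiableWithinAt
    · refine DifferentiableAt.differentiableWithinAt ?_
      have h1 : DifferentiableAt ℂ N z :=
        hd.differentiableAt ((hD.sdiff hfin.isClosed).mem_nhds ⟨hz, h⟩)
      exact (h1.sub (differentiableAt_sum_div_sub h)).congr_of_eventuallyEq (near z h)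
  · by_cases h : z ∈ range a
    · obtain ⟨i, rfl⟩ := h
      exact (at_pole i).continuousAt.continuousWithinAt
    · refine ((hc z hz hT h).sub (differentiableAt_sum_div_sub
        h).continuousAt.continuousWithinAt).congr_of_eventuallyEq ?_ (off z h)
      exact nhdsWithin_le_nhds (near z h)
  · have hpa : p ∉ range a := by
      rintro ⟨i, rfl⟩
      exact disjoint_left.1 hDT (haD i) hp
    obtain ⟨C, hC⟩ := hb p hp
    have h1 := (differentiableAt_sum_div_sub (r := r) hpa).continuousAt.norm
    have h2 := h1.eventually (eventually_lt_nhds (lt_add_one _))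
    refine ⟨C + (‖∑ i, r i / (p - a i)‖ + 1), ?_⟩
    filter_upwards [hC, nhdsWithin_le_nhds h2, nhdsWithin_le_nhds (near p hpa)] with z h3 h4 h5
    rw [h5]
    exact (norm_sub_le _ _).trans (add_le_add h3 h4.le)

/-- The integral of the jump of a sectionally meromorphic function over the contour. -/
theorem contourIntegral_jump {T : Set ℂ} {c₀ c : ℂ} {Fp N : ℂ → ℂ} (h0 : (0 : ℂ) ∈ T)
    (hT : T.Countable) (hTD : Disjoint Dminus T) (haD : ∀ i, a i ∈ Dminus)
    (ha : Function.Injective a)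
    (hp : SectorRegular Dplus Dbar T (c - c₀) fun z => Fp z - c₀ / z)
    (hd : DifferentiableOn ℂ N (Dminus \ range a))
    (hc : ∀ z ∈ Dbar', z ∉ T → z ∉ range a → ContinuousWithinAt N Dbar' z)
    (hb : ∀ p ∈ T, ∃ C, ∀ᶠ z in 𝓝[Dbar'] p, ‖N z - c₀ / z‖ ≤ C)
    (hi : (fun z => N z - c / z) =O[Bornology.cobounded ℂ ⊓ 𝓟 Dbar'] fun z => (z ^ 2)⁻¹)
    (hpole : ∀ i, ∃ g, AnalyticAt ℂ g (a i) ∧ ∀ᶠ z in 𝓝[≠] (a i), N z = r i / (z - a i) + g z) :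
    (ContourIntegrable fun z => Fp z - N z) ∧
    contourIntegral (fun z => Fp z - N z) = -(2 * Real.pi * I * (c - c₀ - ∑ i, r i)) := by
  have ha0 : ∀ i, a i ≠ 0 := fun i => (Dminus_subset_Dbar' (haD i)).2
  -- The singular part c₀/z at the origin is subtracted from both functions, and so are the
  -- principal parts, which are analytic in D⁺ and on the contour. None of these changes the jump;
  -- all of them change the 1/z coefficient.
  obtain ⟨F, hF, hF'⟩ := exists_sectorRegular_sub_poles (N := fun z => N z - c₀ / z) (S := Dbar')
    (T := T) (r := r) (c := c - c₀) isOpen_Dminus hTD haD ha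
    (fun z hz => (hd z hz).sub ((differentiableAt_const _).div differentiableAt_id
      (Dminus_subset_Dbar' hz.1).2).differentiableWithinAt)
    (fun z hz h1 h2 => (hc z hz h1 h2).sub (continuousAt_const.div continuousAt_id
      hz.2).continuousWithinAt) hb
    (hi.congr_left fun z => by ring) fun i => by
      obtain ⟨g, hg, hg'⟩ := hpole i
      refine ⟨fun z => g z - c₀ / z, hg.sub (analyticAt_const.div analyticAt_id (ha0 i)), ?_⟩
      filter_upwards [hg'] with z hz
      rw [hz]; ring
  have hp' := hp.sub_sum (a := a) (r := r) fun i h => by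
    have h1 : 0 < (a i).re * (a i).im := haD i
    rcases h with (h | h) | h
    · exact absurd (show (a i).re * (a i).im < 0 from h) (by linarith)
    · exact absurd h.1 (by linarith)
    · exact disjoint_left.1 hTD (haD i) h
  have hax : ∀ z : ℂ, z.re * z.im = 0 → z ∉ range a := by
    rintro _ hz ⟨i, rfl⟩
    exact (ne_of_gt (show 0 < (a i).re * (a i).im from haD i)) hz
  have e1 : ∀ s : ℝ, (Fp s - c₀ / s - ∑ i, r i / (s - a i)) - F s = Fp s - N s := fun s => by
    rw [hF' _ (hax _ (by simp))]; ring
  have e2 : ∀ s : ℝ, (Fp (I * s) - c₀ / (I * s) - ∑ i, r i / (I * s - a i)) - F (I * s)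
      = Fp (I * s) - N (I * s) := fun s => by
    rw [hF' _ (hax _ (by simp))]; ring
  have key := contourIntegral_sub h0 hT hp' hF
  have hint := contourIntegrable_sub h0 hT hp' hF
  refine ⟨⟨hint.1.congr (ae_of_all _ e1), hint.2.congr (ae_of_all _ e2)⟩, ?_⟩
  rw [← key, contourIntegral, contourIntegral]
  simp only [e1, e2]

end

/-! ### The scattering relation and the coefficient s₁₁ near ±iu₀ -/

theorem wronskian_cramer (a b v : Fin 2 → ℂ) :
    wronskian a b • v = wronskian v b • a + wronskian a v • b := by
  ext i
  fin_cases i <;> simp [wronskian] <;> ring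

theorem neg_mem_Dplus {z : ℂ} : -z ∈ Dplus ↔ z ∈ Dplus := by simp [Dplus]

theorem neg_mem_Dminus {z : ℂ} : -z ∈ Dminus ↔ z ∈ Dminus := by simp [Dminus]

theorem conj_mem_Dplus {z : ℂ} : conj z ∈ Dplus ↔ z ∈ Dminus := by simp [Dplus, Dminus]

theorem conj_mem_Dminus {z : ℂ} : conj z ∈ Dminus ↔ z ∈ Dplus := by simp [Dplus, Dminus]

namespace NZBC

variable {P : NZBC}

/-- The Wronskian is constant, the exponential factors of the two columns cancel, and at the end of
the line it tends to det Y = γ. -/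
theorem wronskian_eq_gam {w z : ℂ} {l : Filter ℝ} [l.NeBot] (hw : w * conj w = (P.u₀ : ℂ) ^ 2)
    {f g : ℝ → ℝ → Fin 2 → ℂ} (hf : P.IsJostColumn w l 0 z f) (hg : P.IsJostColumn w l 1 z g)
    (x t : ℝ) : wronskian (f x t) (g x t) = P.gam z := by
  have h1 := tendsto_pi_nhds.1 (hf.asymp t)
  have h2 := tendsto_pi_nhds.1 (hg.asymp t)
  have h := ((h1 0).mul (h2 1)).sub ((h1 1).mul (h2 0))
  refine tendsto_nhds_unique (tendsto_const_nhds (f := l)) (?_ : Tendsto _ _ _)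
  have e : asymY w z 0 0 * asymY w z 1 1 - asymY w z 1 0 * asymY w z 0 1 = P.gam z := by
    obtain ⟨a1, a2, a3, a4⟩ := asymY_apply_zero w z
    rw [a1, a2, a3, a4, gam, ← hw]
    ring
  rw [e] at h
  refine h.congr fun y => ?_
  rw [wronskian_eq hf hg x t y t, wronskian]
  have : exp (-(I * P.theta y t z * sigma3 0 0)) * exp (-(I * P.theta y t z * sigma3 1 1)) = 1 := by
    rw [← exp_add]; simp [sigma3]
  simp only [Pi.smul_apply, smul_eq_mul]
  linear_combination (f y t 0 * g y t 1 - f y t 1 * g y t 0) * this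

theorem scattering_relation (hP : P.IsSolution) {z : ℂ} (hz : z ∈ P.regularContour) (x t : ℝ) :
    P.phiPlus 0 x t z = P.s11 z • P.phiMinus 0 x t z + P.s21 z • P.phiMinus 1 x t z ∧
    P.phiPlus 1 x t z = P.s12 z • P.phiMinus 0 x t z + P.s22 z • P.phiMinus 1 x t z := by
  obtain ⟨hz1, hz2⟩ := regularContour_subset hz
  have hg := gam_ne_zero_of_mem hP (Or.inr hz)
  have p0 := isJostColumn_phiPlus (existsUnique_plus_zero hP hz1)
  have p1 := isJostColumn_phiPlus (existsUnique_plus_one hP hz2)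
  have m0 := isJostColumn_phiMinus (existsUnique_minus_zero hP hz2)
  have m1 := isJostColumn_phiMinus (existsUnique_minus_one hP hz1)
  have key := wronskian_eq_gam (conj_mul_um hP) m0 m1 x t
  have main : ∀ v : Fin 2 → ℂ, v = (wronskian v (P.phiMinus 1 x t z) / P.gam z) • P.phiMinus 0 x t z
      + (wronskian (P.phiMinus 0 x t z) v / P.gam z) • P.phiMinus 1 x t z := by
    intro v
    have h := wronskian_cramer (P.phiMinus 0 x t z) (P.phiMinus 1 x t z) v
    rw [key] at h
    rw [div_eq_inv_mul, div_eq_inv_mul, mul_smul, mul_smul, ← smul_add, ← h, smul_smul,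
      inv_mul_cancel₀ hg, one_smul]
  refine ⟨?_, ?_⟩
  · rw [s11, s21, ← wronskian_eq p0 m1 x t 0 0, ← wronskian_eq m0 p0 x t 0 0]
    exact main _
  · rw [s12, s22, ← wronskian_eq p1 m1 x t 0 0, ← wronskian_eq m0 p1 x t 0 0]
    exact main _

theorem det_scattering (hP : P.IsSolution) {z : ℂ} (hz : z ∈ P.regularContour) :
    P.s11 z * P.s22 z - P.s12 z * P.s21 z = 1 := by
  obtain ⟨hz1, hz2⟩ := regularContour_subset hz
  have hg := gam_ne_zero_of_mem hP (Or.inr hz)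
  have p0 := isJostColumn_phiPlus (existsUnique_plus_zero hP hz1)
  have p1 := isJostColumn_phiPlus (existsUnique_plus_one hP hz2)
  have m0 := isJostColumn_phiMinus (existsUnique_minus_zero hP hz2)
  have m1 := isJostColumn_phiMinus (existsUnique_minus_one hP hz1)
  have k1 := wronskian_eq_gam (conj_mul_um hP) m0 m1 0 0
  have k2 := wronskian_eq_gam (conj_mul_up hP) p0 p1 0 0
  obtain ⟨r1, r2⟩ := scattering_relation hP hz 0 0
  rw [r1, r2] at k2
  have e : (P.s11 z * P.s22 z - P.s12 z * P.s21 z) * P.gam z = P.gam z := by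
    rw [← k1] at k2
    rw [← k1]
    refine Eq.trans ?_ k2
    simp only [wronskian, Pi.add_apply, Pi.smul_apply, smul_eq_mul]
    ring
  exact mul_right_cancel₀ hg (e.trans (one_mul _).symm)

/-- On the imaginary axis `|s₁₁| ≥ 1`. -/
theorem one_le_norm_s11 (hP : P.IsSolution) {z : ℂ} (hz : z ∈ P.regularContour)
    (hc : conj z = -z) : 1 ≤ ‖P.s11 z‖ := by
  obtain ⟨hz1, hz2⟩ := regularContour_subset hz
  have hn := neg_mem_Dbar.2 hz1
  have hcz : conj (-z) = z := by rw [map_neg, hc, neg_neg]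
  -- On the imaginary axis z* = -z, so conjugation and sign change combine to s₂₂ = s₁₁* and s₁₂ =
  -- s₂₁*. Then det S = 1 reads |s₁₁|² - |s₂₁|² = 1.
  have e1 : P.s22 z = conj (P.s11 z) := by rw [s22_eq hP hz2, hc, s11_neg hP hz1]
  have hgam : conj (P.gam z) = P.gam z := by rw [← gam_conj, hc, gam_neg]
  have p1 := phiPlus_one_conj hP hn 0 0
  have m0 := phiMinus_zero_conj hP hn 0 0
  rw [hcz, phiPlus_zero_neg hP hz1] at p1
  rw [hcz, phiMinus_one_neg hP hz1] at m0
  have e2 : P.s12 z = conj (P.s21 z) := by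
    rw [s12, s21, p1, m0, map_div₀, hgam]
    congr 1
    simp [wronskian]
    ring
  have h := det_scattering hP hz
  rw [e1, e2, mul_conj, mul_comm (conj (P.s21 z)), mul_conj] at h
  have h2 : normSq (P.s11 z) - normSq (P.s21 z) = 1 := by exact_mod_cast h
  have h3 := normSq_nonneg (P.s21 z)
  have h4 : 1 ≤ ‖P.s11 z‖ ^ 2 := by rw [← normSq_eq_norm_sq]; linarith
  nlinarith [norm_nonneg (P.s11 z)]

theorem differentiableOn_varphiPlus_zero (hP : P.IsSolution) (x t : ℝ) (i : Fin 2) :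
    DifferentiableOn ℂ (fun z => P.varphiPlus 0 x t z i) Dbar :=
  (differentiableOn_pi.1 (differentiableOn_jost hP x t) i).congr fun z hz => by
    rw [varphiPlus_zero_eq hP hz]

theorem differentiableOn_varphiMinus_one (hP : P.IsSolution) (x t : ℝ) (i : Fin 2) :
    DifferentiableOn ℂ (fun z => P.varphiMinus 1 x t z i) Dbar := by
  have h := differentiableOn_pi.1 (differentiableOn_jost hP.refl (-x) (-t))
  fin_cases i
  · exact (h 1).congr fun z hz => by simp [varphiMinus_one_eq hP hz]
  · exact (h 0).congr fun z hz => by simp [varphiMinus_one_eq hP hz]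

theorem theta_zero_zero (P : NZBC) (z : ℂ) : P.theta 0 0 z = 0 := by simp [theta]

/-- The Wronskian `γ s₁₁`. -/
noncomputable def wr11 (P : NZBC) (z : ℂ) : ℂ :=
  wronskian (P.varphiPlus 0 0 0 z) (P.varphiMinus 1 0 0 z)

theorem s11_eq_div (P : NZBC) (z : ℂ) : P.s11 z = P.wr11 z / P.gam z := by
  simp [wr11, s11, varphiPlus, varphiMinus, theta_zero_zero]

theorem differentiableOn_wr11 (hP : P.IsSolution) : DifferentiableOn ℂ P.wr11 Dbar :=
  ((differentiableOn_varphiPlus_zero hP 0 0 0).mul (differentiableOn_varphiMinus_one hP 0 0 1)).sub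
    ((differentiableOn_varphiPlus_zero hP 0 0 1).mul (differentiableOn_varphiMinus_one hP 0 0 0))

theorem differentiableAt_gam {z : ℂ} (hz : z ≠ 0) : DifferentiableAt ℂ P.gam z := by
  unfold gam
  fun_prop (disch := exact pow_ne_zero 2 hz)

theorem differentiableWithinAt_s11 (hP : P.IsSolution) {z : ℂ} (hz : z ∈ Dbar)
    (hg : P.gam z ≠ 0) : DifferentiableWithinAt ℂ P.s11 Dbar z := by
  have : P.s11 = fun z => P.wr11 z / P.gam z := funext P.s11_eq_div
  rw [this]
  exact (differentiableOn_wr11 hP z hz).div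
    (differentiableAt_gam hz.2).differentiableWithinAt hg

theorem differentiableAt_s11 (hP : P.IsSolution) {z : ℂ} (hz : z ∈ Dplus) :
    DifferentiableAt ℂ P.s11 z :=
  (differentiableWithinAt_s11 hP (Dplus_subset_Dbar hz)
    (gam_ne_zero_of_mem hP (Or.inl (Or.inl hz)))).differentiableAt
    (mem_of_superset (isOpen_Dplus.mem_nhds hz) Dplus_subset_Dbar)

/-- `1/s₁₁` is bounded near the zeros `±iu₀` of `γ`. -/
theorem inv_s11_bounded (hP : P.IsSolution) {p : ℂ} (hp : p = I * P.u₀ ∨ p = -(I * P.u₀)) :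
    ∃ C, ∀ᶠ z in 𝓝[Dbar] p, ‖(P.s11 z)⁻¹‖ ≤ C := by
  have hu : P.u₀ ≠ 0 := hP.u₀_pos.ne'
  have hu' : (P.u₀ : ℂ) ≠ 0 := by exact_mod_cast hu
  have hp2 : p ^ 2 = -(P.u₀ : ℂ) ^ 2 := by
    rcases hp with rfl | rfl
    · linear_combination (P.u₀ : ℂ) ^ 2 * I_sq
    · linear_combination (P.u₀ : ℂ) ^ 2 * I_sq
  have hp0 : p ≠ 0 := by
    rintro rfl
    simp [hu'] at hp2
  have hpD : p ∈ Dbar := by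
    refine ⟨?_, hp0⟩
    rcases hp with rfl | rfl <;> simp
  have hgp : P.gam p = 0 := by
    rw [gam, hp2, div_neg, div_self (pow_ne_zero 2 hu')]; ring
  -- If the Wronskian W = γs₁₁ is nonzero at p, then 1/s₁₁ = γ/W → 0. If it vanishes, W and γ have a
  -- zero together and s₁₁ tends to W'(p) p²/(2p); here differentiability within the closed sector
  -- at the boundary point p is needed.
  by_cases hW : P.wr11 p = 0
  · obtain ⟨w, hw⟩ := (differentiableOn_wr11 hP p hpD)
    have hd : HasDerivWithinAt P.wr11 (w 1) Dbar p := hw.hasDerivWithinAt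
    have hslope := hasDerivWithinAt_iff_tendsto_slope.1 hd
    have hlim : Tendsto P.s11 (𝓝[Dbar \ {p}] p) (𝓝 (w 1 * (p ^ 2 / (p + p)))) := by
      have h2 : Tendsto (fun z : ℂ => z ^ 2 / (z + p)) (𝓝[Dbar \ {p}] p) (𝓝 (p ^ 2 / (p + p))) := by
        have : ContinuousAt (fun z : ℂ => z ^ 2 / (z + p)) p :=
          ContinuousAt.div (by fun_prop) (by fun_prop) (by simpa [← two_mul] using hp0)
        exact this.tendsto.mono_left nhdsWithin_le_nhds
      refine (hslope.mul h2).congr' ?_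
      filter_upwards [self_mem_nhdsWithin] with z hz
      have hz0 : z ≠ 0 := hz.1.2
      have hzp : z - p ≠ 0 := sub_ne_zero.2 hz.2
      have hg : P.gam z = (z - p) * (z + p) / z ^ 2 := by
        rw [gam]; field_simp; linear_combination hp2
      rw [s11_eq_div, hg, slope_def_field, hW, sub_zero]
      rcases eq_or_ne (z + p) 0 with h | h
      · simp [h]
      · field_simp
    -- The limit can be computed along the imaginary axis, where |s₁₁| ≥ 1. It therefore has modulus
    -- at least 1, in whichever way p is approached within the sector.
    have hray : Tendsto (fun s : ℝ => p + I * s) (𝓝[≠] 0) (𝓝[Dbar \ {p}] p) := by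
      refine tendsto_nhdsWithin_iff.2 ⟨?_, ?_⟩
      · have : Continuous fun s : ℝ => p + I * s := by fun_prop
        have h := this.tendsto 0
        simp only [ofReal_zero, mul_zero, add_zero] at h
        exact h.mono_left nhdsWithin_le_nhds
      · have hc : ContinuousAt (fun s : ℝ => p + I * s) 0 := by fun_prop
        have h0 : ∀ᶠ s : ℝ in 𝓝 0, p + I * s ≠ 0 := hc.eventually_ne (by simpa using hp0)
        filter_upwards [nhdsWithin_le_nhds h0, self_mem_nhdsWithin] with s hs hs1
        refine ⟨⟨?_, hs⟩, ?_⟩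
        · rcases hp with rfl | rfl <;> simp
        · simpa using hs1
    have hge : 1 ≤ ‖w 1 * (p ^ 2 / (p + p))‖ := by
      refine ge_of_tendsto (hlim.comp hray).norm ?_
      have hc : ContinuousAt (fun s : ℝ => p + I * s) 0 := by fun_prop
      have h0 : ∀ᶠ s : ℝ in 𝓝 0, p + I * s ≠ 0 := hc.eventually_ne (by simpa using hp0)
      have h1 : ∀ᶠ s : ℝ in 𝓝 0, p + I * s ≠ -p := hc.eventually_ne (by
        simp only [ofReal_zero, mul_zero, add_zero]
        exact fun h => hp0 (self_eq_neg.1 h))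
      filter_upwards [nhdsWithin_le_nhds h0, nhdsWithin_le_nhds h1, self_mem_nhdsWithin]
        with s hs0 hs1 hs2
      have hs3 : p + I * s ≠ p := by simpa using hs2
      refine one_le_norm_s11 hP ⟨⟨?_, hs0⟩, ?_⟩ ?_
      · rcases hp with rfl | rfl <;> simp
      · rcases hp with rfl | rfl
        · rintro (h | h)
          · exact hs3 h
          · exact hs1 h
        · rintro (h | h)
          · exact hs1 (by rw [neg_neg]; exact h)
          · exact hs3 h
      · rcases hp with rfl | rfl <;> simp <;> ring
    refine ⟨2, ?_⟩
    have hev := hlim.norm.eventually (eventually_gt_nhds (show (1 / 2 : ℝ) < _ by linarith))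
    rw [eventually_nhdsWithin_iff] at hev ⊢
    filter_upwards [hev] with z hz hzD
    -- At p itself s₁₁ is a quotient by 0, so s₁₁ and its inverse are both 0.
    rcases eq_or_ne z p with rfl | hne
    · rw [s11_eq_div, hgp, div_zero]; norm_num
    · have := hz ⟨hzD, hne⟩
      rw [norm_inv]
      calc ‖P.s11 z‖⁻¹ ≤ (1 / 2 : ℝ)⁻¹ := inv_anti₀ (by norm_num) this.le
        _ = 2 := by norm_num
  · have h1 : Tendsto (fun z => P.gam z / P.wr11 z) (𝓝[Dbar] p) (𝓝 (P.gam p / P.wr11 p)) :=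
      ((differentiableAt_gam hp0).continuousAt.continuousWithinAt.div
        (differentiableOn_wr11 hP p hpD).continuousWithinAt hW)
    rw [hgp, zero_div] at h1
    refine ⟨1, ?_⟩
    have := h1.norm.eventually (eventually_lt_nhds (show ‖(0 : ℂ)‖ < 1 by simp))
    filter_upwards [this] with z hz
    rw [s11_eq_div, inv_div]
    exact hz.le

/-- The jump relation. -/
theorem jump_relation (hP : P.IsSolution) {z : ℂ} (hz : z ∈ P.regularContour) (h11 : P.s11 z ≠ 0)
    (h22 : P.s22 z ≠ 0) (x t : ℝ) :
    P.Mminus x t z = P.Mplus x t z * (1 - P.G x t z) := by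
  obtain ⟨r1, r2⟩ := scattering_relation hP hz x t
  have hE : exp (I * P.theta x t z) ≠ 0 := exp_ne_zero _
  have e1 : exp (2 * I * P.theta x t z) = exp (I * P.theta x t z) ^ 2 := by
    rw [← exp_nat_mul]; congr 1; push_cast; ring
  have e2 : exp (-(2 * I * P.theta x t z)) = (exp (I * P.theta x t z) ^ 2)⁻¹ := by
    rw [exp_neg, e1]
  ext i j
  have r1 := congrFun r1 i
  have r2 := congrFun r2 i
  fin_cases j <;>
  simp [Mminus, Mplus, G, Matrix.mul_apply, Fin.sum_univ_two, varphiPlus, varphiMinus, sigma3,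
    Matrix.one_apply, e1, e2, exp_neg, rho, rhoT] at r1 r2 ⊢ <;>
  rw [r1]
  · field_simp; ring
  · rw [r2]; field_simp; ring

end NZBC

/-! ### Asymptotics of the columns of M at infinity and at the origin -/

open Asymptotics in
theorem isBigO_conj_cobounded {f : ℂ → ℂ} {n : ℕ}
    (h : f =O[Bornology.cobounded ℂ ⊓ 𝓟 Dbar] fun z => (z ^ n)⁻¹) :
    (fun z => conj (f (conj z))) =O[Bornology.cobounded ℂ ⊓ 𝓟 Dbar'] fun z => (z ^ n)⁻¹ := by
  obtain ⟨C, r, hC⟩ := exists_bound_of_isBigO h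
  refine isBigO_of_exists_bound (C := C) (r := r) fun z hz hr => ?_
  have := hC (conj z) (conj_mem_Dbar.2 hz) (by rwa [RCLike.norm_conj])
  rw [RCLike.norm_conj] at this ⊢
  exact this

open Asymptotics in
theorem isBigO_conj_nhds {f : ℂ → ℂ} (h : f =O[𝓝[Dbar] 0] fun _ => (1 : ℂ)) :
    (fun z => conj (f (conj z))) =O[𝓝[Dbar'] 0] fun _ => (1 : ℂ) := by
  have ht : Tendsto (starRingEnd ℂ) (𝓝[Dbar'] 0) (𝓝[Dbar] 0) := by
    refine tendsto_nhdsWithin_iff.2 ⟨?_, ?_⟩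
    · have := continuous_conj.tendsto (0 : ℂ)
      rw [map_zero] at this
      exact this.mono_left nhdsWithin_le_nhds
    · filter_upwards [self_mem_nhdsWithin] with z hz using conj_mem_Dbar.2 hz
  refine IsBigO.trans (isBigO_of_le _ fun z => ?_) (h.comp_tendsto ht)
  rw [RCLike.norm_conj, Function.comp_apply]

open Asymptotics in
theorem isBigO_inv_pow_succ (S : Set ℂ) (n : ℕ) : (fun z : ℂ => (z ^ (n + 1))⁻¹)
    =O[Bornology.cobounded ℂ ⊓ 𝓟 S] fun z => (z ^ n)⁻¹ := by
  refine isBigO_of_exists_bound (C := 1) (r := 1) fun z _ hr => ?_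
  rw [norm_inv, norm_pow, ← one_div]
  gcongr
  omega

open Asymptotics in
theorem isBigO_inv_of_sub_div {f : ℂ → ℂ} {S : Set ℂ} (c : ℂ) (hf : (fun z => f z - c / z)
    =O[Bornology.cobounded ℂ ⊓ 𝓟 S] fun z => (z ^ 2)⁻¹) :
    f =O[Bornology.cobounded ℂ ⊓ 𝓟 S] fun z => (z ^ 1)⁻¹ := by
  have h2 : (fun z : ℂ => c / z) =O[Bornology.cobounded ℂ ⊓ 𝓟 S] fun z => (z ^ 1)⁻¹ := by
    refine ((isBigO_refl (fun z : ℂ => (z ^ 1)⁻¹) _).const_mul_left c).congr_left fun z => ?_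
    rw [pow_one, div_eq_mul_inv]
  exact ((hf.trans (isBigO_inv_pow_succ _ 1)).add h2).congr_left fun z => by ring

namespace NZBC

variable {P : NZBC}

/-- Translates the leading phase at the reflected end: after y ↦ -y, the integral over (-x,∞)
becomes the integral over (-∞,x] that defines ν₋. -/
theorem limPhase_refl (hP : P.IsSolution) (x t : ℝ) :
    P.refl.limPhase (-t) (-x) = (exp (I * P.nuMinus x t))⁻¹ := by
  rw [limPhase, ← exp_neg]
  congr 2
  have h1 : ∀ y, P.refl.defect (-t) y = ((P.u₀ ^ 2 - ‖P.u (-y) t‖ ^ 2 : ℝ) : ℂ) := fun y => by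
    rw [defect, mul_conj, normSq_eq_norm_sq]
    simp [refl]
  have h2 : ∫ y in Ioi (-x), ((P.u₀ ^ 2 - ‖P.u (-y) t‖ ^ 2 : ℝ) : ℂ)
      = ((∫ y in Iic x, (P.u₀ ^ 2 - ‖P.u y t‖ ^ 2) : ℝ) : ℂ) := by
    rw [integral_comp_neg_Ioi (-x) (fun y => ((P.u₀ ^ 2 - ‖P.u y t‖ ^ 2 : ℝ) : ℂ)), neg_neg]
    exact integral_complex_ofReal
  rw [integral_const_mul]
  simp only [h1]
  rw [h2, nuMinus]
  have : (P.α : ℂ) ≠ 0 := by exact_mod_cast hP.α_pos.ne'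
  simp only [refl]
  push_cast
  field_simp

section

open Asymptotics

variable (hP : P.IsSolution) (x t : ℝ)

include hP

theorem varphiPlus_asymptotics :
    ((fun z => P.varphiPlus 0 x t z 0 - P.limPhase t x)
      =O[Bornology.cobounded ℂ ⊓ 𝓟 Dbar] fun z => (z ^ 1)⁻¹) ∧
    ((fun z => P.varphiPlus 0 x t z 1 + conj (P.u x t) * P.limPhase t x / z)
      =O[Bornology.cobounded ℂ ⊓ 𝓟 Dbar] fun z => (z ^ 2)⁻¹) := by
  obtain ⟨C, Z, h⟩ := jost_asymptotics hP x t
  refine ⟨isBigO_of_exists_bound (C := C) (r := Z) fun z hz hr => ?_,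
    isBigO_of_exists_bound (C := C) (r := Z) fun z hz hr => ?_⟩
  · rw [varphiPlus_zero_eq hP hz, pow_one]; exact (h z hz hr).1
  · rw [varphiPlus_zero_eq hP hz]; exact (h z hz hr).2

theorem varphiMinus_asymptotics :
    ((fun z => P.varphiMinus 1 x t z 1 - (exp (I * P.nuMinus x t))⁻¹)
      =O[Bornology.cobounded ℂ ⊓ 𝓟 Dbar] fun z => (z ^ 1)⁻¹) ∧
    ((fun z => P.varphiMinus 1 x t z 0 - P.u x t * (exp (I * P.nuMinus x t))⁻¹ / z)
      =O[Bornology.cobounded ℂ ⊓ 𝓟 Dbar] fun z => (z ^ 2)⁻¹) := by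
  obtain ⟨C, Z, h⟩ := jost_asymptotics hP.refl (-x) (-t)
  rw [limPhase_refl hP] at h
  refine ⟨isBigO_of_exists_bound (C := C) (r := Z) fun z hz hr => ?_,
    isBigO_of_exists_bound (C := C) (r := Z) fun z hz hr => ?_⟩
  · rw [varphiMinus_one_eq hP hz, pow_one]; exact (h z hz hr).1
  · have := (h z hz hr).2
    rw [varphiMinus_one_eq hP hz]
    simpa [refl, sub_eq_add_neg, neg_div] using! this

/-- `s₁₁` tends to a constant of modulus one at infinity. -/
theorem s11_asymptotics : ∃ e : ℂ, e ≠ 0 ∧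
    e = P.limPhase t x * (exp (I * P.nuMinus x t))⁻¹ ∧
    ((fun z => P.s11 z - e) =O[Bornology.cobounded ℂ ⊓ 𝓟 Dbar] fun z => (z ^ 1)⁻¹) ∧
    ((fun z => (P.s11 z)⁻¹) =O[Bornology.cobounded ℂ ⊓ 𝓟 Dbar] fun _ => (1 : ℂ)) ∧
    ∀ᶠ z in Bornology.cobounded ℂ ⊓ 𝓟 Dbar, P.s11 z ≠ 0 := by
  set l := Bornology.cobounded ℂ ⊓ 𝓟 Dbar with hl
  obtain ⟨a0, a1⟩ := varphiPlus_asymptotics hP x t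
  obtain ⟨b1, b0⟩ := varphiMinus_asymptotics hP x t
  set E := P.limPhase t x with hE
  set n := (exp (I * P.nuMinus x t))⁻¹ with hn
  have hE0 : E ≠ 0 := exp_ne_zero _
  have hn0 : n ≠ 0 := _root_.inv_ne_zero (exp_ne_zero _)
  have t0 : Tendsto (fun z : ℂ => (z ^ 1)⁻¹) l (𝓝 0) := by
    simp only [pow_one]
    exact (tendsto_inv₀_cobounded (α := ℂ)).mono_left inf_le_left
  have o1 : (fun z : ℂ => (z ^ 1)⁻¹) =O[l] fun _ => (1 : ℂ) := t0.isBigO_one ℂ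
  have B0 : (fun z => P.varphiMinus 1 x t z 0) =O[l] fun z => (z ^ 1)⁻¹ :=
    isBigO_inv_of_sub_div _ b0
  have A1 : (fun z => P.varphiPlus 0 x t z 1) =O[l] fun z => (z ^ 1)⁻¹ :=
    isBigO_inv_of_sub_div (-(conj (P.u x t) * E)) (a1.congr_left fun z => by ring)
  have B1 : (fun z => P.varphiMinus 1 x t z 1) =O[l] fun _ => (1 : ℂ) :=
    ((b1.trans o1).add (isBigO_const_const n one_ne_zero l)).congr_left fun z => by ring
  have hW : (fun z => P.gam z * P.s11 z - E * n) =O[l] fun z => (z ^ 1)⁻¹ := by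
    have h1 : (fun z => (P.varphiPlus 0 x t z 0 - E) * P.varphiMinus 1 x t z 1
        + E * (P.varphiMinus 1 x t z 1 - n)
        - P.varphiPlus 0 x t z 1 * P.varphiMinus 1 x t z 0) =O[l] fun z => (z ^ 1)⁻¹ := by
      refine IsBigO.sub (IsBigO.add ?_ (b1.const_mul_left E)) ?_
      · simpa using a0.mul B1
      · simpa using A1.mul (B0.trans o1)
    refine h1.congr' ?_ EventuallyEq.rfl
    have hg : ∀ᶠ z in l, z ≠ I * P.u₀ ∧ z ≠ -(I * P.u₀) := by
      have h1 : ∀ w : ℂ, ∀ᶠ z in Bornology.cobounded ℂ, z ≠ w := fun w =>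
        Bornology.isBounded_def.1 (Bornology.isBounded_singleton (x := w))
      exact ((h1 _).and (h1 _)).filter_mono inf_le_left
    filter_upwards [hg, mem_inf_of_right (mem_principal_self _)] with z hz hzD
    rw [(gam_mul_s11 hP hzD (gam_ne_zero hzD.2 hz.1 hz.2) x t).1, wronskian]
    ring
  have tg : Tendsto P.gam l (𝓝 1) := by
    have : Tendsto (fun z : ℂ => 1 + (P.u₀ : ℂ) ^ 2 * ((z ^ 1)⁻¹ * (z ^ 1)⁻¹)) l
        (𝓝 (1 + (P.u₀ : ℂ) ^ 2 * (0 * 0))) := ((t0.mul t0).const_mul _).const_add _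
    rw [mul_zero, mul_zero, add_zero] at this
    refine this.congr fun z => ?_
    rw [gam, pow_one, ← mul_inv, ← sq, div_eq_mul_inv]
  have hgi : Tendsto (fun z => (P.gam z)⁻¹) l (𝓝 1) := by
    simpa using tg.inv₀ one_ne_zero
  have hg1 : (fun z => (P.gam z)⁻¹) =O[l] fun _ => (1 : ℂ) := hgi.isBigO_one ℂ
  have hgne : ∀ᶠ z in l, P.gam z ≠ 0 := tg.eventually_ne one_ne_zero
  have hs : (fun z => P.s11 z - E * n) =O[l] fun z => (z ^ 1)⁻¹ := by
    have h1 : (fun z => (P.gam z)⁻¹ * (P.gam z * P.s11 z - E * n)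
        - E * n * ((P.gam z)⁻¹ * ((P.u₀ : ℂ) ^ 2 * ((z ^ 1)⁻¹ * (z ^ 1)⁻¹))))
        =O[l] fun z => (z ^ 1)⁻¹ := by
      refine IsBigO.sub (by simpa using hg1.mul hW) (IsBigO.const_mul_left ?_ _)
      have h3 : (fun z : ℂ => (P.u₀ : ℂ) ^ 2 * ((z ^ 1)⁻¹ * (z ^ 1)⁻¹)) =O[l]
          fun z => (z ^ 1)⁻¹ := IsBigO.const_mul_left (by simpa using o1.mul (isBigO_refl _ _)) _
      simpa using hg1.mul h3
    refine h1.congr' ?_ EventuallyEq.rfl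
    filter_upwards [hgne, mem_inf_of_right (mem_principal_self _)] with z hz hzD
    have hz0 : z ≠ 0 := hzD.2
    have e : (P.u₀ : ℂ) ^ 2 * ((z ^ 1)⁻¹ * (z ^ 1)⁻¹) = P.gam z - 1 := by
      rw [gam]; field_simp; ring
    rw [e]
    field_simp
    ring
  have hlim : Tendsto P.s11 l (𝓝 (E * n)) := by
    have := (hs.trans_tendsto t0).add_const (E * n)
    simpa using this
  have hne : E * n ≠ 0 := mul_ne_zero hE0 hn0
  exact ⟨E * n, hne, rfl, hs, (hlim.inv₀ hne).isBigO_one ℂ, hlim.eventually_ne hne⟩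

/-- The first column of `M⁺` at infinity. -/
theorem quotient_asymptotics :
    ((fun z => P.varphiPlus 0 x t z 0 / P.s11 z - exp (I * P.nuMinus x t))
      =O[Bornology.cobounded ℂ ⊓ 𝓟 Dbar] fun z => (z ^ 1)⁻¹) ∧
    ((fun z => P.varphiPlus 0 x t z 1 / P.s11 z
        + conj (P.u x t) * exp (I * P.nuMinus x t) / z)
      =O[Bornology.cobounded ℂ ⊓ 𝓟 Dbar] fun z => (z ^ 2)⁻¹) := by
  set l := Bornology.cobounded ℂ ⊓ 𝓟 Dbar with hl
  obtain ⟨a0, a1⟩ := varphiPlus_asymptotics hP x t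
  obtain ⟨e, he0, he, hs, hs1, hs0⟩ := s11_asymptotics hP x t
  set n := exp (I * P.nuMinus x t) with hn
  have hn0 : n ≠ 0 := exp_ne_zero _
  -- The limit e of s₁₁ contains the phase from +∞, so dividing by s₁₁ leaves only e^{iν₋}.
  have hE : P.limPhase t x = e * n := by rw [he]; field_simp
  rw [hE] at a0 a1
  refine ⟨?_, ?_⟩
  · have h := hs1.mul (a0.sub (hs.const_mul_left n))
    simp only [one_mul] at h
    refine h.congr' ?_ EventuallyEq.rfl
    filter_upwards [hs0] with z hz
    field_simp
    ring
  · have h2 : (fun z => conj (P.u x t) * n * ((z ^ 1)⁻¹ * (P.s11 z - e)))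
        =O[l] fun z : ℂ => (z ^ 2)⁻¹ := by
      refine (((isBigO_refl _ _).mul hs).const_mul_left _).congr_right fun z => ?_
      rw [← mul_inv, ← pow_add]
    have h := hs1.mul (a1.add h2)
    simp only [one_mul] at h
    refine h.congr' ?_ EventuallyEq.rfl
    filter_upwards [hs0, mem_inf_of_right (mem_principal_self _)] with z hz hzD
    have hz0 : z ≠ 0 := hzD.2
    field_simp
    ring

theorem conj_exp_nu : conj (exp (I * P.nuMinus x t)) = (exp (I * P.nuMinus x t))⁻¹ := by
  rw [← exp_conj, ← exp_neg]; simp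

/-- `M⁻` at infinity. -/
theorem minus_asymptotics :
    ((fun z => P.varphiMinus 0 x t z 0 - exp (I * P.nuMinus x t))
      =O[Bornology.cobounded ℂ ⊓ 𝓟 Dbar'] fun z => (z ^ 1)⁻¹) ∧
    ((fun z => P.varphiMinus 0 x t z 1 + conj (P.u x t) * exp (I * P.nuMinus x t) / z)
      =O[Bornology.cobounded ℂ ⊓ 𝓟 Dbar'] fun z => (z ^ 2)⁻¹) ∧
    ((fun z => P.varphiPlus 1 x t z 0 / P.s22 z - P.u x t * (exp (I * P.nuMinus x t))⁻¹ / z)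
      =O[Bornology.cobounded ℂ ⊓ 𝓟 Dbar'] fun z => (z ^ 2)⁻¹) ∧
    ((fun z => P.varphiPlus 1 x t z 1 / P.s22 z - (exp (I * P.nuMinus x t))⁻¹)
      =O[Bornology.cobounded ℂ ⊓ 𝓟 Dbar'] fun z => (z ^ 1)⁻¹) := by
  obtain ⟨a0, a1⟩ := quotient_asymptotics hP x t
  obtain ⟨b1, b0⟩ := varphiMinus_asymptotics hP x t
  have hn := conj_exp_nu hP x t
  have c00 : ∀ z ∈ Dbar', P.varphiMinus 0 x t z 0 = conj (P.varphiMinus 1 x t (conj z) 1) ∧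
      P.varphiMinus 0 x t z 1 = -conj (P.varphiMinus 1 x t (conj z) 0) ∧
      P.varphiPlus 1 x t z 0 = -conj (P.varphiPlus 0 x t (conj z) 1) ∧
      P.varphiPlus 1 x t z 1 = conj (P.varphiPlus 0 x t (conj z) 0) := by
    intro z hz
    have h1 := varphiMinus_zero_conj hP (conj_mem_Dbar.2 hz) x t
    have h2 := varphiPlus_one_conj hP (conj_mem_Dbar.2 hz) x t
    rw [conj_conj] at h1 h2
    exact ⟨by rw [h1]; rfl, by rw [h1]; rfl, by rw [h2]; rfl, by rw [h2]; rfl⟩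
  have ev : ∀ᶠ z in Bornology.cobounded ℂ ⊓ 𝓟 Dbar', z ∈ Dbar' :=
    mem_inf_of_right (mem_principal_self _)
  refine ⟨?_, ?_, ?_, ?_⟩
  · refine (isBigO_conj_cobounded b1).congr' ?_ EventuallyEq.rfl
    filter_upwards [ev] with z hz
    rw [(c00 z hz).1, map_sub, map_inv₀, hn, _root_.inv_inv]
  · refine (isBigO_conj_cobounded b0).neg_left.congr' ?_ EventuallyEq.rfl
    filter_upwards [ev] with z hz
    rw [(c00 z hz).2.1, map_sub, map_div₀, map_mul, map_inv₀, hn, _root_.inv_inv, conj_conj]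
    ring
  · refine (isBigO_conj_cobounded a1).neg_left.congr' ?_ EventuallyEq.rfl
    filter_upwards [ev] with z hz
    rw [(c00 z hz).2.2.1, s22_eq hP hz, map_add, map_div₀, map_div₀, map_mul, hn, conj_conj,
      conj_conj]
    ring
  · refine (isBigO_conj_cobounded a0).congr' ?_ EventuallyEq.rfl
    filter_upwards [ev] with z hz
    rw [(c00 z hz).2.2.2, s22_eq hP hz, map_sub, map_div₀, hn]

theorem tendsto_inv_Dbar : Tendsto P.inv (𝓝[Dbar] 0) (Bornology.cobounded ℂ ⊓ 𝓟 Dbar') := by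
  refine tendsto_inf.2 ⟨?_, tendsto_principal.2 ?_⟩
  · have hu : (P.u₀ : ℂ) ≠ 0 := by exact_mod_cast hP.u₀_pos.ne'
    have h1 : Tendsto (fun z : ℂ => -(z / (P.u₀ : ℂ) ^ 2)) (𝓝[Dbar] 0) (𝓝[≠] 0) := by
      refine tendsto_nhdsWithin_iff.2 ⟨?_, ?_⟩
      · have : Continuous fun z : ℂ => -(z / (P.u₀ : ℂ) ^ 2) := by fun_prop
        have h := this.tendsto 0
        rw [zero_div, neg_zero] at h
        exact h.mono_left nhdsWithin_le_nhds
      · filter_upwards [self_mem_nhdsWithin] with z hz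
        simp [hz.2, hu]
    refine ((tendsto_inv₀_nhdsNE_zero (α := ℂ)).comp h1).congr fun z => ?_
    simp [inv]
  · filter_upwards [self_mem_nhdsWithin] with z hz using (inv_mem_Dbar' hP).2 hz

/-- `M⁺` at zero. -/
theorem plus_zero_asymptotics :
    ((fun z => P.varphiPlus 0 x t z 0 / P.s11 z) =O[𝓝[Dbar] 0] fun _ => (1 : ℂ)) ∧
    ((fun z => P.varphiPlus 0 x t z 1 / P.s11 z
      + (exp (I * P.nuMinus x t))⁻¹ * conj P.um / z) =O[𝓝[Dbar] 0] fun _ => (1 : ℂ)) ∧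
    ((fun z => P.varphiMinus 1 x t z 0 - exp (I * P.nuMinus x t) * P.um / z)
      =O[𝓝[Dbar] 0] fun _ => (1 : ℂ)) ∧
    ((fun z => P.varphiMinus 1 x t z 1) =O[𝓝[Dbar] 0] fun _ => (1 : ℂ)) := by
  obtain ⟨c0, c1, d0, d1⟩ := minus_asymptotics hP x t
  have hu : (P.u₀ : ℂ) ≠ 0 := by exact_mod_cast hP.u₀_pos.ne'
  have hup : P.up ≠ 0 := fun h => hP.u₀_pos.ne' (by rw [← hP.norm_up, h, norm_zero])
  have hum : P.um ≠ 0 := fun h => hP.u₀_pos.ne' (by rw [← hP.norm_um, h, norm_zero])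
  have hum' : conj P.um ≠ 0 := by simpa using hum
  have hup' : conj P.up ≠ 0 := by simpa using hup
  have ht := tendsto_inv_Dbar hP
  -- Inversion sends the origin to infinity; decay of order 1/w there, at w = -u₀²/z, compensates
  -- the factor c/z.
  have key : ∀ (f : ℂ → ℂ) (c : ℂ), (f =O[Bornology.cobounded ℂ ⊓ 𝓟 Dbar'] fun z => (z ^ 1)⁻¹) →
      (fun z => c / z * f (P.inv z)) =O[𝓝[Dbar] 0] fun _ => (1 : ℂ) := by
    intro f c hf
    have h1 := (isBigO_refl (fun z : ℂ => c / z) (𝓝[Dbar] 0)).mul (hf.comp_tendsto ht)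
    refine h1.trans (IsBigO.of_bound ‖c / (P.u₀ : ℂ) ^ 2‖ ?_)
    filter_upwards [self_mem_nhdsWithin] with z hz
    have hz0 : z ≠ 0 := hz.2
    have : c / z * ((P.inv z ^ 1)⁻¹) = -(c / (P.u₀ : ℂ) ^ 2) := by
      simp only [inv]; field_simp
    rw [Function.comp_apply, this, norm_neg, norm_one, mul_one]
  have ev : ∀ᶠ z in 𝓝[Dbar] (0 : ℂ), z ∈ Dbar := self_mem_nhdsWithin
  -- The factor u₊* from the inversion of φ₊,₁ cancels against the one in s₁₁, leaving only u₋*.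
  have quot : ∀ z ∈ Dbar, ∀ i, P.varphiPlus 0 x t z i / P.s11 z
      = -conj P.um / z * (P.varphiPlus 1 x t (P.inv z) i / P.s22 (P.inv z)) := by
    intro z hz i
    rw [varphiPlus_zero_inv hP hz, s11_inv hP hz, ← conj_mul_um hP]
    have hz0 := hz.2
    simp only [Pi.smul_apply, smul_eq_mul]
    rcases eq_or_ne (P.s22 (P.inv z)) 0 with h | h
    · simp [h]
    · field_simp
  refine ⟨?_, ?_, ?_, ?_⟩
  · refine (key _ (-conj P.um) (isBigO_inv_of_sub_div _ d0)).congr' ?_ EventuallyEq.rfl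
    filter_upwards [ev] with z hz
    rw [quot z hz]
  · refine (key _ (-conj P.um) d1).congr' ?_ EventuallyEq.rfl
    filter_upwards [ev] with z hz
    rw [quot z hz]
    ring
  · refine (key _ P.um c0).congr' ?_ EventuallyEq.rfl
    filter_upwards [ev] with z hz
    rw [varphiMinus_one_inv hP hz]
    simp only [Pi.smul_apply, smul_eq_mul]
    ring
  · have c1' : (fun z => P.varphiMinus 0 x t z 1 - -(conj (P.u x t) * exp (I * P.nuMinus x t)) / z)
      =O[Bornology.cobounded ℂ ⊓ 𝓟 Dbar'] fun z => (z ^ 2)⁻¹ := c1.congr_left fun z => by ring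
    refine (key _ P.um (isBigO_inv_of_sub_div _ c1')).congr' ?_ EventuallyEq.rfl
    filter_upwards [ev] with z hz
    rw [varphiMinus_one_inv hP hz]
    rfl

end

end NZBC

/-! ### The matrix M: symmetries and behaviour at infinity and zero -/

theorem not_mem_Dplus_of_mem_Dminus {z : ℂ} (hz : z ∈ Dminus) : z ∉ Dplus :=
  fun h => lt_asymm (show z.re * z.im < 0 from h) hz

namespace NZBC

variable {P : NZBC}

theorem M_of_mem_Dplus (x t : ℝ) {z : ℂ} (hz : z ∈ Dplus) : P.M x t z = P.Mplus x t z :=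
  if_pos hz

theorem M_of_mem_Dminus (x t : ℝ) {z : ℂ} (hz : z ∈ Dminus) : P.M x t z = P.Mminus x t z := by
  rw [M, if_neg (not_mem_Dplus_of_mem_Dminus hz), if_pos hz]

open Asymptotics in
theorem isBigO_M {l : Filter ℂ} (x t : ℝ) (i j : Fin 2) {c g : ℂ → ℂ}
    (h1 : (fun z => P.Mplus x t z i j - c z) =O[l ⊓ 𝓟 Dbar] g)
    (h2 : (fun z => P.Mminus x t z i j - c z) =O[l ⊓ 𝓟 Dbar'] g) :
    (fun z => P.M x t z i j - c z) =O[l ⊓ 𝓟 (Dplus ∪ Dminus)] g := by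
  rw [← sup_principal, inf_sup_left]
  refine IsBigO.sup ?_ ?_
  · refine (h1.mono (inf_le_inf_left _ (principal_mono.2 Dplus_subset_Dbar))).congr' ?_
      EventuallyEq.rfl
    filter_upwards [mem_inf_of_right (mem_principal_self _)] with z hz
    rw [M_of_mem_Dplus x t hz]
  · refine (h2.mono (inf_le_inf_left _ (principal_mono.2 Dminus_subset_Dbar'))).congr' ?_
      EventuallyEq.rfl
    filter_upwards [mem_inf_of_right (mem_principal_self _)] with z hz
    rw [M_of_mem_Dminus x t hz]

/-- Because s₂₂(z) = s₁₁(z*)*, the conjugation symmetry passes to the quotients. Statements about M⁻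
thereby reduce to statements about M⁺ at z*. -/
theorem Mminus_eq (hP : P.IsSolution) {z : ℂ} (hz : z ∈ Dbar') (x t : ℝ) :
    P.Mminus x t z = !![conj (P.Mplus x t (conj z) 1 1), -conj (P.Mplus x t (conj z) 1 0);
      -conj (P.Mplus x t (conj z) 0 1), conj (P.Mplus x t (conj z) 0 0)] := by
  have h1 := varphiMinus_zero_conj hP (conj_mem_Dbar.2 hz) x t
  have h2 := varphiPlus_one_conj hP (conj_mem_Dbar.2 hz) x t
  rw [conj_conj] at h1 h2
  ext i j
  fin_cases i <;> fin_cases j <;> simp [Mminus, Mplus, h1, h2, s22_eq hP hz, neg_div]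

theorem Mplus_neg (hP : P.IsSolution) {z : ℂ} (hz : z ∈ Dbar) (x t : ℝ) :
    P.Mplus x t (-z) = !![P.Mplus x t z 0 0, -P.Mplus x t z 0 1;
      -P.Mplus x t z 1 0, P.Mplus x t z 1 1] := by
  ext i j
  fin_cases i <;> fin_cases j <;>
    simp [Mplus, varphiPlus_zero_neg hP hz, varphiMinus_one_neg hP hz, s11_neg hP hz, neg_div]

section

open Asymptotics

variable (hP : P.IsSolution) (x t : ℝ)

include hP

theorem M_asymptotics_infty (i j : Fin 2) :
    (fun z => P.M x t z i j - P.expNu x t i j)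
      =O[Bornology.cobounded ℂ ⊓ 𝓟 (Dplus ∪ Dminus)] (fun z => z⁻¹) := by
  obtain ⟨a0, a1⟩ := quotient_asymptotics hP x t
  obtain ⟨b1, b0⟩ := varphiMinus_asymptotics hP x t
  obtain ⟨c0, c1, d0, d1⟩ := minus_asymptotics hP x t
  have a1' := isBigO_inv_of_sub_div (-(conj (P.u x t) * exp (I * P.nuMinus x t)))
    (a1.congr_left fun z => by rw [neg_div, sub_neg_eq_add])
  have c1' := isBigO_inv_of_sub_div (-(conj (P.u x t) * exp (I * P.nuMinus x t)))
    (c1.congr_left fun z => by rw [neg_div, sub_neg_eq_add])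
  have b0' := isBigO_inv_of_sub_div _ b0
  have d0' := isBigO_inv_of_sub_div _ d0
  simp only [pow_one] at a0 a1' b0' b1 c0 c1' d0' d1
  refine isBigO_M x t i j (c := fun _ => P.expNu x t i j) ?_ ?_ <;>
  · fin_cases i <;> fin_cases j <;>
      simpa [Mplus, Mminus, expNu, exp_neg]

theorem M_limit_infty : Tendsto (fun z => exp (I * P.nuMinus x t) * (z * P.M x t z 0 1))
    (Bornology.cobounded ℂ ⊓ 𝓟 (Dplus ∪ Dminus)) (𝓝 (P.u x t)) := by
  set l := Bornology.cobounded ℂ ⊓ 𝓟 (Dplus ∪ Dminus) with hl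
  set n := exp (I * P.nuMinus x t) with hn
  have hn0 : n ≠ 0 := exp_ne_zero _
  have h := isBigO_M x t 0 1 (c := fun z => P.u x t * n⁻¹ / z)
    (varphiMinus_asymptotics hP x t).2 (minus_asymptotics hP x t).2.2.1
  have h0 : ∀ᶠ z in l, z ≠ 0 := by
    filter_upwards [mem_inf_of_right (mem_principal_self _)] with z hz
    rcases hz with hz | hz
    exacts [(Dplus_subset_Dbar hz).2, (Dminus_subset_Dbar' hz).2]
  have h1 := (isBigO_refl (fun z : ℂ => n * z) l).mul h
  have h2 : Tendsto (fun z : ℂ => n * z * (z ^ 2)⁻¹) l (𝓝 0) := by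
    have := ((tendsto_inv₀_cobounded (α := ℂ)).mono_left
      (inf_le_left (b := 𝓟 (Dplus ∪ Dminus)))).const_mul n
    rw [mul_zero] at this
    refine this.congr' ?_
    filter_upwards [h0] with z hz
    field_simp
  have h3 := (h1.trans_tendsto h2).add_const (P.u x t)
  rw [zero_add] at h3
  refine h3.congr' ?_
  filter_upwards [h0] with z hz
  field_simp
  ring

theorem minus_zero_asymptotics :
    (fun z => P.Mminus x t z 0 1 - exp (I * P.nuMinus x t) * P.um / z)
      =O[𝓝[Dbar'] 0] fun _ => (1 : ℂ) := by
  have hn := conj_exp_nu hP x t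
  refine (isBigO_conj_nhds (plus_zero_asymptotics hP x t).2.1).neg_left.congr' ?_ EventuallyEq.rfl
  filter_upwards [self_mem_nhdsWithin] with z hz
  rw [Mminus_eq hP hz]; simp [Mplus, hn]; ring

theorem M_asymptotics_zero (i j : Fin 2) :
    (fun z => P.M x t z i j - z⁻¹ * (P.expNu x t * sigma3 * potQ P.um) i j)
      =O[𝓝[Dplus ∪ Dminus] 0] (fun _ => (1 : ℂ)) := by
  obtain ⟨a0, a1, b0, b1⟩ := plus_zero_asymptotics hP x t
  have hn := conj_exp_nu hP x t
  have ev : ∀ᶠ z in 𝓝[Dbar'] (0 : ℂ), z ∈ Dbar' := self_mem_nhdsWithin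
  set n := exp (I * P.nuMinus x t) with hn'
  have hE : P.expNu x t * sigma3 * potQ P.um = !![0, n * P.um; -(n⁻¹ * conj P.um), 0] := by
    ext i j
    fin_cases i <;> fin_cases j <;>
      simp [expNu, sigma3, potQ, Matrix.mul_apply, Fin.sum_univ_two, exp_neg, n]
  rw [hE]
  refine isBigO_M (l := 𝓝 0) x t i j ?_ ?_
  · fin_cases i <;> fin_cases j
    · simpa [Mplus] using! a0
    · refine b0.congr_left fun z => ?_
      simp [Mplus]; ring
    · refine a1.congr_left fun z => ?_
      simp [Mplus]; ring
    · simpa [Mplus] using! b1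
  · fin_cases i <;> fin_cases j
    · refine (isBigO_conj_nhds b1).congr' ?_ EventuallyEq.rfl
      filter_upwards [ev] with z hz
      rw [Mminus_eq hP hz]; simp [Mplus]
    · refine (minus_zero_asymptotics hP x t).congr_left fun z => ?_
      simp [n]; ring
    · refine (isBigO_conj_nhds b0).neg_left.congr' ?_ EventuallyEq.rfl
      filter_upwards [ev] with z hz
      rw [Mminus_eq hP hz]; simp [Mplus, hn]; ring
    · refine (isBigO_conj_nhds a0).congr' ?_ EventuallyEq.rfl
      filter_upwards [ev] with z hz
      rw [Mminus_eq hP hz]; simp [Mplus]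

end

end NZBC

/-! ### Norming constants, reflected zeros and residues -/

theorem wronskian_linear_dependence {v w : Fin 2 → ℂ} (hv : v ≠ 0) (hw : w ≠ 0)
    (h : wronskian v w = 0) : ∃ b : ℂ, b ≠ 0 ∧ v = b • w := by
  rw [wronskian, sub_eq_zero] at h
  have key : ∃ b : ℂ, v = b • w := by
    by_cases h0 : w 0 = 0
    · have h1 : w 1 ≠ 0 := fun h1 => hw (by ext i; fin_cases i <;> simp [h0, h1])
      have hv0 : v 0 = 0 := by simpa [h0, h1] using h
      refine ⟨v 1 / w 1, ?_⟩
      ext i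
      fin_cases i <;> simp [h0, h1, hv0]
    · refine ⟨v 0 / w 0, ?_⟩
      ext i
      fin_cases i
      · simp [h0]
      · simp only [Fin.mk_one, Pi.smul_apply, smul_eq_mul]
        field_simp
        exact h.symm
  obtain ⟨b, hb⟩ := key
  exact ⟨b, fun h => hv (by rw [hb, h, zero_smul]), hb⟩

namespace NZBC

variable {P : NZBC}

section

variable (hP : P.IsSolution)

include hP

theorem eq_zero_of_laxX {t : ℝ} {z : ℂ} {D : ℝ → Fin 2 → ℂ}
    (hD : ∀ x, HasDerivAt D (P.laxX x t z *ᵥ D x) x) {b : ℝ} (hb : D b = 0) (x : ℝ) : D x = 0 := by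
  have h := hP.continuous_u t
  refine eq_zero_of_hasDerivAt_linear (M := fun y => mat2 (-I * P.α * P.k z ^ 2)
    (I * P.k z * P.u y t) (I * P.k z * conj (P.u y t)) (I * P.α * P.k z ^ 2))
    (continuous_mat2 continuous_const (by fun_prop)
      (continuous_const.mul (continuous_conj.comp h)) continuous_const)
    (x₀ := min b x - 1) (b := b) (by linarith [min_le_left b x]) (fun y _ => ?_) hb
    (by linarith [min_le_right b x])
  rw [mat2_apply, ← laxX_apply]
  exact hD y

theorem continuous_ux_time (x : ℝ) : Continuous fun s => P.ux x s := by
  have h1 : ContDiff ℝ 1 (fun p : ℝ × ℝ => fderiv ℝ (fun p : ℝ × ℝ => P.u p.1 p.2) p (1, 0)) :=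
    (hP.contDiff.fderiv_right (m := 1) (by norm_num)).clm_apply contDiff_const
  have e : (fun s : ℝ => P.ux x s) = fun s =>
      fderiv ℝ (fun p : ℝ × ℝ => P.u p.1 p.2) (x, s) (1, 0) := funext fun s => (hP.ux_eq x s).1
  rw [e]
  exact h1.continuous.comp (by fun_prop : Continuous fun s : ℝ => (x, s))

theorem eq_zero_of_laxT {x : ℝ} {z : ℂ} {D : ℝ → Fin 2 → ℂ}
    (hD : ∀ t, HasDerivAt D (P.laxT x t z *ᵥ D t) t) {b : ℝ} (hb : D b = 0) (t : ℝ) : D t = 0 := by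
  have h : Continuous fun s => P.u x s :=
    continuous_iff_continuousAt.2 fun s => (hP.hasDerivAt_u_time x s).continuousAt
  have h' := continuous_ux_time hP x
  have hc := continuous_conj.comp h
  have hc' := continuous_conj.comp h'
  simp only [Function.comp_def] at hc hc'
  refine eq_zero_of_hasDerivAt_linear (M := fun s => mat2 (P.laxTdiag x s z)
    (P.laxTup x s z) (P.laxTdown x s z) (-P.laxTdiag x s z))
    (continuous_mat2 ?_ ?_ ?_ ?_)
    (x₀ := min b t - 1) (b := b) (by linarith [min_le_left b t]) (fun y _ => ?_) hb
    (by linarith [min_le_right b t])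
  · unfold laxTdiag; fun_prop
  · unfold laxTup; fun_prop
  · unfold laxTdown; fun_prop
  · unfold laxTdiag; fun_prop
  · have := hD y
    rw [laxT_apply] at this
    rw [mat2_apply]
    simpa [sub_eq_add_neg] using this

/-- Jost columns do not vanish. -/
theorem IsJostColumn.ne_zero {w z : ℂ} {l : Filter ℝ} [l.NeBot] {j : Fin 2}
    {f : ℝ → ℝ → Fin 2 → ℂ} (hf : P.IsJostColumn w l j z f) (x t : ℝ) : f x t ≠ 0 := by
  intro h
  have h0 := eq_zero_of_laxX hP (fun y => hf.x_part y t) h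
  have h1 := hf.asymp t
  simp only [h0, smul_zero] at h1
  have h2 := congrFun (tendsto_nhds_unique h1 tendsto_const_nhds) j
  obtain ⟨a1, a2, a3, a4⟩ := asymY_apply_zero w z
  fin_cases j
  · simp [a1] at h2
  · simp [a4] at h2

/-- The difference solves both linear equations and vanishes at the origin; it vanishes first along
t = 0 and then, for each x, in t. This is why norming constants do not depend on x and t. -/
theorem IsJostColumn.eq_smul {w w' z b : ℂ} {l l' : Filter ℝ} {i j : Fin 2}
    {f g : ℝ → ℝ → Fin 2 → ℂ} (hf : P.IsJostColumn w l i z f) (hg : P.IsJostColumn w' l' j z g)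
    (h : f 0 0 = b • g 0 0) (x t : ℝ) : f x t = b • g x t := by
  have dx : ∀ y s, HasDerivAt (fun y => f y s - b • g y s)
      (P.laxX y s z *ᵥ (f y s - b • g y s)) y := fun y s => by
    refine ((hf.x_part y s).sub ((hg.x_part y s).const_smul b)).congr_deriv ?_
    rw [Matrix.mulVec_sub, Matrix.mulVec_smul]
  have dt : ∀ y s, HasDerivAt (fun s => f y s - b • g y s)
      (P.laxT y s z *ᵥ (f y s - b • g y s)) s := fun y s => by
    refine ((hf.t_part y s).sub ((hg.t_part y s).const_smul b)).congr_deriv ?_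
    rw [Matrix.mulVec_sub, Matrix.mulVec_smul]
  have h1 := eq_zero_of_laxX hP (fun y => dx y 0) (sub_eq_zero.2 h) x
  exact sub_eq_zero.1 (eq_zero_of_laxT hP (fun s => dt x s) h1 t)

/-- At a zero of `s₁₁` the columns `φ₊,₁` and `φ₋,₂` are proportional. -/
theorem exists_norming_constant {z : ℂ} (hz : z ∈ Dbar) (hg : P.gam z ≠ 0) (hs : P.s11 z = 0) :
    ∃ b : ℂ, b ≠ 0 ∧ ∀ x t, P.phiPlus 0 x t z = b • P.phiMinus 1 x t z := by
  have hf := isJostColumn_phiPlus (existsUnique_plus_zero hP hz)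
  have hg' := isJostColumn_phiMinus (existsUnique_minus_one hP hz)
  have hW := (gam_mul_s11 hP hz hg 0 0).2
  rw [hs, mul_zero] at hW
  obtain ⟨b, hb, h⟩ := wronskian_linear_dependence (hf.ne_zero hP 0 0) (hg'.ne_zero hP 0 0) hW.symm
  exact ⟨b, hb, fun x t => hf.eq_smul hP hg' h x t⟩

theorem varphiMinus_one_ne_zero {z : ℂ} (hz : z ∈ Dbar) (x t : ℝ) : P.varphiMinus 1 x t z ≠ 0 :=
  smul_ne_zero (exp_ne_zero _)
    ((isJostColumn_phiMinus (existsUnique_minus_one hP hz)).ne_zero hP x t)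

/-- The symmetry of `s₁₁` under the reflection in the circle `|z| = u₀`. -/
theorem s11_conj_inv {z : ℂ} (hz : z ∈ Dbar) : P.s11 z
    = conj P.up * P.um / (P.u₀ : ℂ) ^ 2 * conj (P.s11 (conj (P.inv z))) := by
  rw [s11_inv hP hz, s22_eq hP ((inv_mem_Dbar' hP).2 hz)]

theorem s11_eq_zero_iff_conj_inv {z : ℂ} (hz : z ∈ Dbar) :
    P.s11 (conj (P.inv z)) = 0 ↔ P.s11 z = 0 := by
  have hup : P.up ≠ 0 := fun h => hP.u₀_pos.ne' (by rw [← hP.norm_up, h, norm_zero])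
  have hum : P.um ≠ 0 := fun h => hP.u₀_pos.ne' (by rw [← hP.norm_um, h, norm_zero])
  have hu : (P.u₀ : ℂ) ≠ 0 := by exact_mod_cast hP.u₀_pos.ne'
  rw [s11_conj_inv hP hz]
  simp [hup, hum, hu]

theorem conj_inv_mem_Dplus {z : ℂ} (hz : z ∈ Dplus) : conj (P.inv z) ∈ Dplus :=
  conj_mem_Dplus.2 ((inv_mem_Dminus hP).2 hz)

/-- Simplicity of a zero passes to its reflection in the circle: by the symmetry of s₁₁ and the
chain rule, a vanishing derivative at the reflected point would force one at z. -/
theorem deriv_s11_conj_inv_ne_zero {z : ℂ} (hz : z ∈ Dplus) (h : deriv P.s11 z ≠ 0) :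
    deriv P.s11 (conj (P.inv z)) ≠ 0 := by
  intro h0
  apply h
  have h1 := (differentiableAt_s11 hP (conj_inv_mem_Dplus hP hz)).hasDerivAt
  rw [h0] at h1
  have h2 := h1.conj_conj
  rw [conj_conj, map_zero] at h2
  have hz0 := (Dplus_subset_Dbar hz).2
  have h3 : DifferentiableAt ℂ P.inv z := by
    unfold inv
    exact ((differentiableAt_const _).div differentiableAt_id hz0).neg
  have h4 := (h2.comp z h3.hasDerivAt).const_mul (conj P.up * P.um / (P.u₀ : ℂ) ^ 2)
  rw [zero_mul, mul_zero] at h4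
  refine (h4.congr_of_eventuallyEq ?_).deriv
  filter_upwards [isOpen_Dplus.mem_nhds hz] with w hw
  exact s11_conj_inv hP (Dplus_subset_Dbar hw)

theorem norm_inv_eq (z : ℂ) : ‖P.inv z‖ = P.u₀ ^ 2 / ‖z‖ := by
  have := hP.u₀_pos
  simp [inv]

end

end NZBC

theorem AnalyticAt.dslope_self {f : ℂ → ℂ} {a : ℂ} (hf : AnalyticAt ℂ f a) :
    AnalyticAt ℂ (dslope f a) a := by
  have h := hf.eventually_analyticAt
  have hd : DifferentiableOn ℂ f {z | AnalyticAt ℂ f z} := fun z hz =>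
    (show AnalyticAt ℂ f z from hz).differentiableAt.differentiableWithinAt
  exact ((Complex.differentiableOn_dslope h).2 hd).analyticAt h

theorem AnalyticAt.conj_comp_conj {f : ℂ → ℂ} {a : ℂ} (hf : AnalyticAt ℂ f (conj a)) :
    AnalyticAt ℂ (fun z => conj (f (conj z))) a := by
  rw [analyticAt_iff_eventually_differentiableAt] at hf ⊢
  have h := (continuous_conj.tendsto a).eventually hf
  filter_upwards [h] with z hz
  have := DifferentiableAt.conj_conj hz
  rwa [conj_conj] at this

/-- The entrywise complex conjugate of `m`, conjugated by `σ₂`. -/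
noncomputable def conjAdj (m : Matrix (Fin 2) (Fin 2) ℂ) : Matrix (Fin 2) (Fin 2) ℂ :=
  !![conj (m 1 1), -conj (m 1 0); -conj (m 0 1), conj (m 0 0)]

/-- Conjugation by `σ₃`. -/
def flipSign (m : Matrix (Fin 2) (Fin 2) ℂ) : Matrix (Fin 2) (Fin 2) ℂ :=
  !![m 0 0, -m 0 1; -m 1 0, m 1 1]

theorem conjAdj_smul (c : ℂ) (m : Matrix (Fin 2) (Fin 2) ℂ) :
    conjAdj (c • m) = conj c • conjAdj m := by
  ext i j; fin_cases i <;> fin_cases j <;> simp [conjAdj]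

theorem flipSign_smul (c : ℂ) (m : Matrix (Fin 2) (Fin 2) ℂ) :
    flipSign (c • m) = c • flipSign m := by
  ext i j; fin_cases i <;> fin_cases j <;> simp [flipSign]

theorem conjAdj_conjAdj (m : Matrix (Fin 2) (Fin 2) ℂ) : conjAdj (conjAdj m) = m := by
  ext i j; fin_cases i <;> fin_cases j <;> simp [conjAdj]

theorem flipSign_flipSign (m : Matrix (Fin 2) (Fin 2) ℂ) : flipSign (flipSign m) = m := by
  ext i j; fin_cases i <;> fin_cases j <;> simp [flipSign]

theorem conjAdj_zero : conjAdj 0 = 0 := by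
  ext i j; fin_cases i <;> fin_cases j <;> simp [conjAdj]

theorem flipSign_zero : flipSign 0 = 0 := by
  ext i j; fin_cases i <;> fin_cases j <;> simp [flipSign]

theorem HasSimplePoleAt.comp_conj {f : ℂ → Matrix (Fin 2) (Fin 2) ℂ} {a : ℂ}
    {R : Matrix (Fin 2) (Fin 2) ℂ} (h : HasSimplePoleAt f a R)
    (hf : ∀ᶠ z in 𝓝 (conj a), f z = conjAdj (f (conj z))) :
    HasSimplePoleAt f (conj a) (conjAdj R) := by
  obtain ⟨hR, g, hg, hga, hgf⟩ := h
  refine ⟨fun h0 => hR ?_, fun z => conjAdj (g (conj z)), fun i j => ?_, ?_, ?_⟩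
  · rw [← conjAdj_conjAdj R, h0, conjAdj_zero]
  · have hg' : ∀ i j, AnalyticAt ℂ (fun z => conj (g (conj z) i j)) (conj a) := fun i j =>
      AnalyticAt.conj_comp_conj (f := fun z => g z i j) (by rw [conj_conj]; exact hg i j)
    fin_cases i <;> fin_cases j
    · exact hg' 1 1
    · exact (hg' 1 0).neg
    · exact (hg' 0 1).neg
    · exact hg' 0 0
  · simp only [conj_conj, hga]
  · have ht : Tendsto (starRingEnd ℂ) (𝓝[≠] conj a) (𝓝[≠] a) := by
      refine tendsto_nhdsWithin_iff.2 ⟨?_, ?_⟩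
      · have := continuous_conj.tendsto (conj a)
        rw [conj_conj] at this
        exact this.mono_left nhdsWithin_le_nhds
      · filter_upwards [self_mem_nhdsWithin] with z hz h
        exact hz (by rw [← (show conj z = a from h), conj_conj]; rfl)
    filter_upwards [ht.eventually hgf, nhdsWithin_le_nhds hf] with z h1 h2
    rw [h2, h1, conjAdj_smul, map_inv₀, map_sub, conj_conj]

/-- The outer minus sign in the new residue comes from (-z - a)⁻¹ = -(z + a)⁻¹. -/
theorem HasSimplePoleAt.comp_neg {f : ℂ → Matrix (Fin 2) (Fin 2) ℂ} {a : ℂ}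
    {R : Matrix (Fin 2) (Fin 2) ℂ} (h : HasSimplePoleAt f a R)
    (hf : ∀ᶠ z in 𝓝 (-a), f z = flipSign (f (-z))) :
    HasSimplePoleAt f (-a) (-flipSign R) := by
  obtain ⟨hR, g, hg, hga, hgf⟩ := h
  refine ⟨fun h0 => hR ?_, fun z => -flipSign (g (-z)), fun i j => ?_, ?_, ?_⟩
  · rw [← flipSign_flipSign R, neg_eq_zero.1 h0, flipSign_zero]
  · have hg' : ∀ i j, AnalyticAt ℂ (fun z => g (-z) i j) (-a) := fun i j =>
      AnalyticAt.fun_comp (f := fun z => -z) (g := fun z => g z i j) (by rw [neg_neg]; exact hg i j)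
        analyticAt_id.neg
    fin_cases i <;> fin_cases j
    · exact (hg' 0 0).neg
    · exact (hg' 0 1).neg.neg
    · exact (hg' 1 0).neg.neg
    · exact (hg' 1 1).neg
  · simp only [neg_neg, hga]
  · have ht : Tendsto (fun z : ℂ => -z) (𝓝[≠] (-a)) (𝓝[≠] a) := by
      refine tendsto_nhdsWithin_iff.2 ⟨?_, ?_⟩
      · have := (continuous_neg (G := ℂ)).tendsto (-a)
        rw [neg_neg] at this
        exact this.mono_left nhdsWithin_le_nhds
      · filter_upwards [self_mem_nhdsWithin] with z hz h
        exact hz (by rw [← (show -z = a from h), neg_neg]; rfl)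
    filter_upwards [ht.eventually hgf, nhdsWithin_le_nhds hf] with z h1 h2
    rw [h2, h1, flipSign_smul, ← neg_add', inv_neg, add_comm z a, sub_neg_eq_add, add_comm z a]
    simp

/-- The principal part of an entry. -/
theorem HasSimplePoleAt.entry {f : ℂ → Matrix (Fin 2) (Fin 2) ℂ} {a : ℂ}
    {R : Matrix (Fin 2) (Fin 2) ℂ} (h : HasSimplePoleAt f a R) (i j : Fin 2) :
    ∃ g : ℂ → ℂ, AnalyticAt ℂ g a ∧ ∀ᶠ z in 𝓝[≠] a, f z i j = R i j / (z - a) + g z := by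
  obtain ⟨-, g, hg, hga, hgf⟩ := h
  refine ⟨_, (hg i j).dslope_self, ?_⟩
  filter_upwards [hgf, self_mem_nhdsWithin] with z hz hza
  have h1 := sub_smul_dslope (fun z => g z i j) a z
  have h2 : z - a ≠ 0 := sub_ne_zero.2 hza
  rw [hz, Matrix.smul_apply, ← hga]
  simp only [smul_eq_mul] at h1 ⊢
  field_simp
  linear_combination -h1

namespace NZBC

variable {P : NZBC}

section

variable (hP : P.IsSolution) (x t : ℝ)

include hP

theorem M_neg {z : ℂ} (hz : z ∈ Dplus ∪ Dminus) : P.M x t z = flipSign (P.M x t (-z)) := by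
  have hp : ∀ w ∈ Dbar, P.Mplus x t w = flipSign (P.Mplus x t (-w)) := fun w hw => by
    rw [Mplus_neg hP hw]
    ext i j; fin_cases i <;> fin_cases j <;> simp [flipSign]
  rcases hz with hz | hz
  · rw [M_of_mem_Dplus x t hz, M_of_mem_Dplus x t (neg_mem_Dplus.2 hz),
      hp z (Dplus_subset_Dbar hz)]
  · have hz' := Dminus_subset_Dbar' hz
    rw [M_of_mem_Dminus x t hz, M_of_mem_Dminus x t (neg_mem_Dminus.2 hz), Mminus_eq hP hz',
      Mminus_eq hP (neg_mem_Dbar'.2 hz'), hp _ (conj_mem_Dbar.2 hz'), map_neg]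
    ext i j; fin_cases i <;> fin_cases j <;> simp [flipSign]

theorem Mminus_eq_conjAdj {z : ℂ} (hz : z ∈ Dbar') :
    P.Mminus x t z = conjAdj (P.Mplus x t (conj z)) := Mminus_eq hP hz x t

theorem M_conj {z : ℂ} (hz : z ∈ Dminus) : P.M x t z = conjAdj (P.M x t (conj z)) := by
  rw [M_of_mem_Dminus x t hz, M_of_mem_Dplus x t (conj_mem_Dplus.2 hz),
    Mminus_eq_conjAdj hP x t (Dminus_subset_Dbar' hz)]

theorem Mplus_continuousWithinAt {z : ℂ} (hz : z ∈ Dbar) (hg : P.gam z ≠ 0) (hs : P.s11 z ≠ 0)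
    (i j : Fin 2) : ContinuousWithinAt (fun z => P.Mplus x t z i j) Dbar z := by
  fin_cases j
  · exact (differentiableOn_varphiPlus_zero hP x t i z hz).continuousWithinAt.div
      (differentiableWithinAt_s11 hP hz hg).continuousWithinAt hs
  · exact (differentiableOn_varphiMinus_one hP x t i z hz).continuousWithinAt

theorem Mminus_continuousWithinAt {z : ℂ} (hz : z ∈ Dbar') (hg : P.gam z ≠ 0)
    (hs : P.s22 z ≠ 0) (i j : Fin 2) :
    ContinuousWithinAt (fun z => P.Mminus x t z i j) Dbar' z := by
  have hz' := conj_mem_Dbar.2 hz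
  have hg' : P.gam (conj z) ≠ 0 := by rw [gam_conj]; simpa using hg
  have hs' : P.s11 (conj z) ≠ 0 := fun h => hs (by rw [s22_eq hP hz, h, map_zero])
  have key : ∀ i j, ContinuousWithinAt (fun z => conj (P.Mplus x t (conj z) i j)) Dbar' z :=
    fun i j => continuous_conj.continuousAt.comp_continuousWithinAt
      ((Mplus_continuousWithinAt hP x t hz' hg' hs' i j).comp
        continuous_conj.continuousWithinAt fun w hw => conj_mem_Dbar.2 hw)
  have h : ContinuousWithinAt (fun z => conjAdj (P.Mplus x t (conj z)) i j) Dbar' z := by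
    fin_cases i <;> fin_cases j
    · exact key 1 1
    · exact (key 1 0).neg
    · exact (key 0 1).neg
    · exact key 0 0
  exact h.congr (fun w hw => by rw [Mminus_eq_conjAdj hP x t hw])
    (by rw [Mminus_eq_conjAdj hP x t hz])

theorem M_tendsto_plus {z : ℂ} (hz : z ∈ Dbar) (hg : P.gam z ≠ 0) (hs : P.s11 z ≠ 0) :
    Tendsto (P.M x t) (𝓝[Dplus] z) (𝓝 (P.Mplus x t z)) := by
  have h : Tendsto (P.Mplus x t) (𝓝[Dplus] z) (𝓝 (P.Mplus x t z)) :=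
    tendsto_pi_nhds.2 fun i => tendsto_pi_nhds.2 fun j =>
      (Mplus_continuousWithinAt hP x t hz hg hs i j).mono Dplus_subset_Dbar
  refine h.congr' ?_
  filter_upwards [self_mem_nhdsWithin] with w hw using (M_of_mem_Dplus x t hw).symm

theorem M_tendsto_minus {z : ℂ} (hz : z ∈ Dbar') (hg : P.gam z ≠ 0) (hs : P.s22 z ≠ 0) :
    Tendsto (P.M x t) (𝓝[Dminus] z) (𝓝 (P.Mminus x t z)) := by
  have h : Tendsto (P.Mminus x t) (𝓝[Dminus] z) (𝓝 (P.Mminus x t z)) :=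
    tendsto_pi_nhds.2 fun i => tendsto_pi_nhds.2 fun j =>
      (Mminus_continuousWithinAt hP x t hz hg hs i j).mono Dminus_subset_Dbar'
  refine h.congr' ?_
  filter_upwards [self_mem_nhdsWithin] with w hw using (M_of_mem_Dminus x t hw).symm

theorem analyticAt_s11 {z : ℂ} (hz : z ∈ Dplus) : AnalyticAt ℂ P.s11 z :=
  DifferentiableOn.analyticAt (s := Dplus)
    (fun _ hw => (differentiableAt_s11 hP hw).differentiableWithinAt) (isOpen_Dplus.mem_nhds hz)

theorem analyticAt_varphiPlus_zero {z : ℂ} (hz : z ∈ Dplus) (i : Fin 2) :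
    AnalyticAt ℂ (fun z => P.varphiPlus 0 x t z i) z :=
  ((differentiableOn_varphiPlus_zero hP x t i).mono Dplus_subset_Dbar).analyticAt
    (isOpen_Dplus.mem_nhds hz)

theorem analyticAt_varphiMinus_one {z : ℂ} (hz : z ∈ Dplus) (i : Fin 2) :
    AnalyticAt ℂ (fun z => P.varphiMinus 1 x t z i) z :=
  ((differentiableOn_varphiMinus_one hP x t i).mono Dplus_subset_Dbar).analyticAt
    (isOpen_Dplus.mem_nhds hz)

theorem M_analyticAt_plus {z : ℂ} (hz : z ∈ Dplus) (hs : P.s11 z ≠ 0) (i j : Fin 2) :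
    AnalyticAt ℂ (fun z => P.M x t z i j) z := by
  have h : AnalyticAt ℂ (fun z => P.Mplus x t z i j) z := by
    fin_cases j
    · exact (analyticAt_varphiPlus_zero hP x t hz i).div (analyticAt_s11 hP hz) hs
    · exact analyticAt_varphiMinus_one hP x t hz i
  refine h.congr ?_
  filter_upwards [isOpen_Dplus.mem_nhds hz] with w hw
  rw [M_of_mem_Dplus x t hw]

theorem M_analyticAt_minus {z : ℂ} (hz : z ∈ Dminus) (hs : P.s11 (conj z) ≠ 0) (i j : Fin 2) :
    AnalyticAt ℂ (fun z => P.M x t z i j) z := by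
  have key : ∀ i j, AnalyticAt ℂ (fun z => conj (P.M x t (conj z) i j)) z := fun i j =>
    AnalyticAt.conj_comp_conj (M_analyticAt_plus hP x t (conj_mem_Dplus.2 hz) hs i j)
  have h : AnalyticAt ℂ (fun z => conjAdj (P.M x t (conj z)) i j) z := by
    fin_cases i <;> fin_cases j
    · exact key 1 1
    · exact (key 1 0).neg
    · exact (key 0 1).neg
    · exact key 0 0
  refine h.congr ?_
  filter_upwards [isOpen_Dminus.mem_nhds hz] with w hw
  rw [← M_conj hP x t hw]

/-- The pole of `M` at a simple zero of `s₁₁`. -/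
theorem hasSimplePoleAt_M {a b : ℂ} (ha : a ∈ Dplus) (h0 : P.s11 a = 0)
    (h1 : deriv P.s11 a ≠ 0) (hb : b ≠ 0)
    (hab : P.phiPlus 0 x t a = b • P.phiMinus 1 x t a) :
    HasSimplePoleAt (P.M x t) a
      (colMatrix ((b / deriv P.s11 a * exp (-(2 * I * P.theta x t a))) •
        P.varphiMinus 1 x t a) 0) := by
  set c := b / deriv P.s11 a * exp (-(2 * I * P.theta x t a)) with hc
  have hc0 : c ≠ 0 := mul_ne_zero (div_ne_zero hb h1) (exp_ne_zero _)
  -- The two columns are normalised with opposite exponentials e^{∓iθ}, hence the factor e^{-2iθ} in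
  -- the residue.
  have hA : P.varphiPlus 0 x t a = (c * deriv P.s11 a) • P.varphiMinus 1 x t a := by
    rw [varphiPlus, varphiMinus, hab, smul_smul, smul_smul]
    congr 1
    have : exp (-(I * P.theta x t a * sigma3 0 0))
        = exp (-(2 * I * P.theta x t a)) * exp (-(I * P.theta x t a * sigma3 1 1)) := by
      rw [← exp_add]; congr 1; simp [sigma3]; ring
    rw [this, hc]
    field_simp
  -- Near a one has s₁₁(z) = (z - a)·`dslope`, and the value of `dslope` at a is s₁₁'(a) ≠ 0. The
  -- regular second column acquires the factor z - a and does not contribute to the residue.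
  refine ⟨fun h => ?_, fun z => Matrix.of fun i j => if j = 0 then
    P.varphiPlus 0 x t z i / dslope P.s11 a z else (z - a) * P.varphiMinus 1 x t z i,
    fun i j => ?_, ?_, ?_⟩
  · refine smul_ne_zero hc0 (varphiMinus_one_ne_zero hP (Dplus_subset_Dbar ha) x t) ?_
    ext i
    simpa [colMatrix] using congrFun (congrFun h i) 0
  · fin_cases j
    · exact (analyticAt_varphiPlus_zero hP x t ha i).div (analyticAt_s11 hP ha).dslope_self
        (by rwa [dslope_same])
    · exact (analyticAt_id.sub analyticAt_const).mul (analyticAt_varphiMinus_one hP x t ha i)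
  · ext i j
    fin_cases j
    · simp only [Matrix.of_apply, colMatrix, dslope_same, hA]
      simp
      field_simp
    · simp [colMatrix]
  · filter_upwards [nhdsWithin_le_nhds (isOpen_Dplus.mem_nhds ha), self_mem_nhdsWithin]
      with z hz hza
    have h2 : z - a ≠ 0 := sub_ne_zero.2 hza
    have h3 := sub_smul_dslope_of_zero h0 z
    rw [M_of_mem_Dplus x t hz]
    ext i j
    fin_cases j
    · simp [Mplus, ← h3]
      field_simp
    · simp [Mplus]
      field_simp

end

end NZBC

/-! ### The discrete spectrum -/

namespace NZBC

variable {P : NZBC}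

section

variable (hP : P.IsSolution) {N₁ N₂ : ℕ} {zs : Fin N₁ → ℂ} {ws : Fin N₂ → ℂ}
  (hspec : P.HasSimpleSpectrum zs ws)

include hP

theorem zeta_inr_inl (n : Fin N₁) : P.zeta zs ws (.inr (.inl n)) = conj (P.inv (zs n)) := by
  simp [zeta, inv]

theorem im_conj_inv (z : ℂ) : (conj (P.inv z)).im = -(P.u₀ ^ 2 * z.im / normSq z) := by
  have : (P.u₀ : ℂ) ^ 2 / z = ((P.u₀ ^ 2 : ℝ) : ℂ) * z⁻¹ := by push_cast; rw [div_eq_mul_inv]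
  rw [inv, this, conj_im, neg_im, im_ofReal_mul, inv_im]
  ring

include hspec

theorem zs_mem (n : Fin N₁) : zs n ∈ Dplus ∧ 0 < (zs n).im ∧ P.u₀ < ‖zs n‖ ∧ P.s11 (zs n) = 0 := by
  have : zs n ∈ range zs := mem_range_self n
  rwa [hspec.range_zs] at this

theorem ws_mem (n : Fin N₂) : ws n ∈ Dplus ∧ 0 < (ws n).im ∧ ‖ws n‖ = P.u₀ ∧ P.s11 (ws n) = 0 := by
  have : ws n ∈ range ws := mem_range_self n
  rwa [hspec.range_ws] at this

/-- The zeros `ζ` lie in `D⁺` and are simple. -/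
theorem zeta_spec (n : Fin N₁ ⊕ Fin N₁ ⊕ Fin N₂) : P.zeta zs ws n ∈ Dplus ∧
    P.s11 (P.zeta zs ws n) = 0 ∧ deriv P.s11 (P.zeta zs ws n) ≠ 0 := by
  rcases n with n | n | n
  · have h := zs_mem hP hspec n
    exact ⟨h.1, h.2.2.2, hspec.zs_simple n⟩
  · rw [zeta_inr_inl hP]
    have h := zs_mem hP hspec n
    exact ⟨conj_inv_mem_Dplus hP h.1,
      (s11_eq_zero_iff_conj_inv hP (Dplus_subset_Dbar h.1)).2 h.2.2.2,
      deriv_s11_conj_inv_ne_zero hP h.1 (hspec.zs_simple n)⟩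
  · have h := ws_mem hP hspec n
    exact ⟨h.1, h.2.2.2, hspec.ws_simple n⟩

theorem zeta_position (n : Fin N₁) : (P.zeta zs ws (.inr (.inl n))).im < 0 ∧
    ‖P.zeta zs ws (.inr (.inl n))‖ < P.u₀ := by
  have hu := hP.u₀_pos
  have h := zs_mem hP hspec n
  have hz : zs n ≠ 0 := (Dplus_subset_Dbar h.1).2
  rw [zeta_inr_inl hP]
  refine ⟨?_, ?_⟩
  · rw [im_conj_inv hP]
    have := h.2.1
    have := normSq_pos.2 hz
    rw [neg_lt_zero]
    positivity
  · rw [RCLike.norm_conj, norm_inv_eq hP, div_lt_iff₀ (norm_pos_iff.2 hz), sq]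
    exact mul_lt_mul_of_pos_left h.2.2.1 hu

/-- The three families are separated by position: outside the circle with Im > 0, inside it with Im
< 0, and on it with Im > 0. -/
theorem zeta_injective : Function.Injective (P.zeta zs ws) := by
  have h1 : ∀ n, 0 < (P.zeta zs ws (.inl n)).im ∧ P.u₀ < ‖P.zeta zs ws (.inl n)‖ := fun n =>
    ⟨(zs_mem hP hspec n).2.1, (zs_mem hP hspec n).2.2.1⟩
  have h2 := zeta_position hP hspec
  have h3 : ∀ n, 0 < (P.zeta zs ws (.inr (.inr n))).im ∧ ‖P.zeta zs ws (.inr (.inr n))‖ = P.u₀ :=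
    fun n => ⟨(ws_mem hP hspec n).2.1, (ws_mem hP hspec n).2.2.1⟩
  have key : ∀ z w : ℂ, z = w → z.im = w.im ∧ ‖z‖ = ‖w‖ := by rintro z _ rfl; simp
  rintro (n | n | n) (m | m | m) h <;> have hk := key _ _ h
  · rw [hspec.zs_injective h]
  · linarith [h1 n, h2 m]
  · linarith [h1 n, h3 m]
  · linarith [h2 n, h1 m]
  · rw [zeta_inr_inl hP, zeta_inr_inl hP] at h
    have h' := congrArg (fun w => P.inv (conj w)) h
    simp only [conj_conj, inv_inv hP] at h'
    rw [hspec.zs_injective h']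
  · linarith [h2 n, h3 m]
  · linarith [h3 n, h1 m]
  · linarith [h3 n, h2 m]
  · rw [hspec.ws_injective h]

/-- Equality of moduli would put both points in the same family, where the imaginary parts have the
same sign. -/
theorem zeta_ne_neg_zeta (n m : Fin N₁ ⊕ Fin N₁ ⊕ Fin N₂) :
    P.zeta zs ws n ≠ -P.zeta zs ws m := by
  have h1 : ∀ n, 0 < (P.zeta zs ws (.inl n)).im ∧ P.u₀ < ‖P.zeta zs ws (.inl n)‖ := fun n =>
    ⟨(zs_mem hP hspec n).2.1, (zs_mem hP hspec n).2.2.1⟩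
  have h2 := zeta_position hP hspec
  have h3 : ∀ n, 0 < (P.zeta zs ws (.inr (.inr n))).im ∧ ‖P.zeta zs ws (.inr (.inr n))‖ = P.u₀ :=
    fun n => ⟨(ws_mem hP hspec n).2.1, (ws_mem hP hspec n).2.2.1⟩
  have key : ∀ z w : ℂ, z = -w → z.im = -w.im ∧ ‖z‖ = ‖w‖ := by rintro _ w rfl; simp
  intro h
  have hk := key _ _ h
  rcases n with n | n | n <;> rcases m with m | m | m
  · linarith [h1 n, h1 m]
  · linarith [h1 n, h2 m]
  · linarith [h1 n, h3 m]
  · linarith [h2 n, h1 m]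
  · linarith [h2 n, h2 m]
  · linarith [h2 n, h3 m]
  · linarith [h3 n, h1 m]
  · linarith [h3 n, h2 m]
  · linarith [h3 n, h3 m]

/-- All zeros of `s₁₁` in `D⁺`. -/
theorem exists_zeta_of_s11_eq_zero {z : ℂ} (hz : z ∈ Dplus) (h : P.s11 z = 0) :
    ∃ n, z = P.zeta zs ws n ∨ z = -P.zeta zs ws n := by
  have hu := hP.u₀_pos
  have upper : ∀ w ∈ Dplus, 0 < w.im → P.s11 w = 0 →
      ∃ n, w = P.zeta zs ws n ∨ w = -P.zeta zs ws n := by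
    intro w hw hi h
    have hw0 : w ≠ 0 := (Dplus_subset_Dbar hw).2
    rcases lt_trichotomy P.u₀ ‖w‖ with hn | hn | hn
    · have : w ∈ range zs := by rw [hspec.range_zs]; exact ⟨hw, hi, hn, h⟩
      obtain ⟨n, rfl⟩ := this
      exact ⟨.inl n, Or.inl rfl⟩
    · have : w ∈ range ws := by rw [hspec.range_ws]; exact ⟨hw, hi, hn.symm, h⟩
      obtain ⟨n, rfl⟩ := this
      exact ⟨.inr (.inr n), Or.inl rfl⟩
    · have hv := conj_inv_mem_Dplus hP hw
      -- A zero w inside the circle in the upper half-plane has the partner u₀²/w*, a zero outside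
      -- the circle still in the second quadrant, hence some z_n. Then w = u₀²/z_n* = -ζ for the
      -- reflected point ζ.
      have : -conj (P.inv w) ∈ range zs := by
        rw [hspec.range_zs]
        refine ⟨neg_mem_Dplus.2 hv, ?_, ?_, ?_⟩
        · rw [neg_im, im_conj_inv hP, neg_neg]
          have := normSq_pos.2 hw0
          positivity
        · rw [norm_neg, RCLike.norm_conj, norm_inv_eq hP, lt_div_iff₀ (norm_pos_iff.2 hw0), sq]
          exact mul_lt_mul_of_pos_left hn hu
        · rw [s11_neg hP (Dplus_subset_Dbar hv)]
          exact (s11_eq_zero_iff_conj_inv hP (Dplus_subset_Dbar hw)).2 h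
      obtain ⟨n, hn⟩ := this
      refine ⟨.inr (.inl n), Or.inr ?_⟩
      rw [zeta_inr_inl hP, hn]
      have : P.inv (-conj (P.inv w)) = -conj (P.inv (P.inv w)) := by simp [inv, div_neg]
      rw [this, inv_inv hP]
      simp
  have him : z.im ≠ 0 := fun h0 => by
    have : z.re * z.im < 0 := hz
    rw [h0, mul_zero] at this
    exact lt_irrefl _ this
  rcases lt_or_gt_of_ne him with hi | hi
  · obtain ⟨n, hn⟩ := upper (-z) (neg_mem_Dplus.2 hz) (by simpa using hi)
      (by rw [s11_neg hP (Dplus_subset_Dbar hz), h])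
    refine ⟨n, hn.symm.imp (fun h => ?_) fun h => ?_⟩
    · exact neg_injective h
    · rw [← h, neg_neg]
  · exact upper z hz hi h

theorem s11_ne_zero_off_spectralSet {z : ℂ} (hz : z ∈ Dplus) (h : z ∉ P.spectralSet zs ws) :
    P.s11 z ≠ 0 := fun h0 => by
  obtain ⟨n, hn⟩ := exists_zeta_of_s11_eq_zero hP hspec hz h0
  exact h ⟨n, hn.elim Or.inl fun h => Or.inr (Or.inl h)⟩

theorem M_analyticOnNhd (x t : ℝ) (i j : Fin 2) : AnalyticOnNhd ℂ (fun z => P.M x t z i j)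
    ((Dplus ∪ Dminus) \ P.spectralSet zs ws) := by
  rintro z ⟨hz | hz, hs⟩
  · exact M_analyticAt_plus hP x t hz (s11_ne_zero_off_spectralSet hP hspec hz hs) i j
  · refine M_analyticAt_minus hP x t hz
      (s11_ne_zero_off_spectralSet hP hspec (conj_mem_Dplus.2 hz) ?_) i j
    rintro ⟨n, h⟩
    refine hs ⟨n, ?_⟩
    have : z = conj (conj z) := (conj_conj z).symm
    rcases h with h | h | h | h <;> rw [h] at this <;> simp [this]

theorem scattering_ne_zero {z : ℂ} (hz : z ∈ P.regularContour) : P.s11 z ≠ 0 ∧ P.s22 z ≠ 0 := by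
  refine ⟨hspec.contour z hz, ?_⟩
  rw [s22_eq hP (regularContour_subset hz).2]
  have : conj z ∈ P.regularContour := by
    refine ⟨⟨?_, ?_⟩, ?_⟩
    · have := hz.1.1; simpa using this
    · simpa using hz.1.2
    · rintro (h | h)
      · apply hz.2; right
        rw [mem_singleton_iff, ← conj_conj z, h]; simp
      · apply hz.2; left
        rw [← conj_conj z, (h : conj z = _)]; simp
  simpa using hspec.contour _ this

end

end NZBC

/-! ### The contour integral of the jump and the reconstruction of u -/

theorem contour_congr {f g : ℂ → ℂ} (h1 : ∀ᵐ s : ℝ, f s = g s)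
    (h2 : ∀ᵐ s : ℝ, f (I * s) = g (I * s)) :
    (ContourIntegrable f ↔ ContourIntegrable g) ∧ contourIntegral f = contourIntegral g := by
  refine ⟨?_, ?_⟩
  · rw [ContourIntegrable, ContourIntegrable, integrable_congr h1, integrable_congr h2]
  · simp only [contourIntegral]
    rw [integral_congr_ae (ae_restrict_of_ae h1), integral_congr_ae (ae_restrict_of_ae h2),
      integral_congr_ae (ae_restrict_of_ae h1), integral_congr_ae (ae_restrict_of_ae h2)]

namespace NZBC

variable {P : NZBC}

/-- On the two parametrised axes only 0 and ±iu₀ are lost, a null set, so integrands need to agree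
only on the regular contour. -/
theorem contour_congr_regular (hP : P.IsSolution) {f g : ℂ → ℂ}
    (h : ∀ z ∈ P.regularContour, f z = g z) :
    (ContourIntegrable f ↔ ContourIntegrable g) ∧ contourIntegral f = contourIntegral g := by
  have hu := hP.u₀_pos
  have hne : ∀ a : ℝ, ∀ᵐ s : ℝ, s ≠ a := fun a => by
    simp [ae_iff]
  refine contour_congr ?_ ?_
  · filter_upwards [hne 0] with s hs
    refine h _ ⟨⟨by simp, by simpa using hs⟩, ?_⟩
    rintro (h | h)
    · have := congrArg Complex.re h
      simp at this
      exact hs this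
    · have := congrArg Complex.re (show (s : ℂ) = -(I * P.u₀) from h)
      simp at this
      exact hs this
  · filter_upwards [hne 0, hne P.u₀, hne (-P.u₀)] with s h0 h1 h2
    refine h _ ⟨⟨by simp, by simpa using h0⟩, ?_⟩
    rintro (h | h)
    · have := congrArg Complex.im h
      simp at this
      exact h1 this
    · have := congrArg Complex.im (show I * (s : ℂ) = -(I * P.u₀) from h)
      simp at this
      exact h2 this

section

variable (hP : P.IsSolution)

include hP

/-- The poles of `M` at the four points attached to a simple zero of `s₁₁`. -/
theorem poles_of_M {a b : ℂ} (x t : ℝ) (ha : a ∈ Dplus) (h0 : P.s11 a = 0)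
    (h1 : deriv P.s11 a ≠ 0) (hb : b ≠ 0)
    (hab : P.phiPlus 0 x t a = b • P.phiMinus 1 x t a) :
    HasSimplePoleAt (P.M x t) a
      (colMatrix ((b / deriv P.s11 a * exp (-(2 * I * P.theta x t a))) •
        P.varphiMinus 1 x t a) 0) ∧
    HasSimplePoleAt (P.M x t) (-a)
      (colMatrix (-((b / deriv P.s11 a * exp (-(2 * I * P.theta x t a))) •
        (sigma3 *ᵥ P.varphiMinus 1 x t a))) 0) ∧
    HasSimplePoleAt (P.M x t) (conj a)
      (colMatrix 0 ((-conj (b / deriv P.s11 a) * exp (2 * I * P.theta x t (conj a))) •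
        P.varphiMinus 0 x t (conj a))) ∧
    HasSimplePoleAt (P.M x t) (-conj a)
      (colMatrix 0 ((-conj (b / deriv P.s11 a) * exp (2 * I * P.theta x t (conj a))) •
        (sigma3 *ᵥ P.varphiMinus 0 x t (conj a)))) := by
  have p1 := hasSimplePoleAt_M hP x t ha h0 h1 hb hab
  have hca : conj a ∈ Dminus := conj_mem_Dminus.2 ha
  -- The other three poles follow from M(-z) = σ₃M(z)σ₃ and the conjugation symmetry of M.
  have p2 := p1.comp_neg (by
    filter_upwards [isOpen_Dplus.mem_nhds (neg_mem_Dplus.2 ha)] with z hz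
    exact M_neg hP x t (Or.inl hz))
  have p3 := p1.comp_conj (by
    filter_upwards [isOpen_Dminus.mem_nhds hca] with z hz
    exact M_conj hP x t hz)
  have p4 := p3.comp_neg (by
    filter_upwards [isOpen_Dminus.mem_nhds (neg_mem_Dminus.2 hca)] with z hz
    exact M_neg hP x t (Or.inr hz))
  have e3 : conjAdj (colMatrix ((b / deriv P.s11 a * exp (-(2 * I * P.theta x t a))) •
      P.varphiMinus 1 x t a) 0) = colMatrix 0 ((-conj (b / deriv P.s11 a) *
      exp (2 * I * P.theta x t (conj a))) • P.varphiMinus 0 x t (conj a)) := by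
    rw [varphiMinus_zero_conj hP (Dplus_subset_Dbar ha), theta_conj]
    ext i j
    fin_cases i <;> fin_cases j <;>
      simp [conjAdj, colMatrix, ← exp_conj, map_ofNat]
  refine ⟨p1, ?_, ?_, ?_⟩
  · convert p2 using 1
    ext i j
    fin_cases i <;> fin_cases j <;>
      simp [flipSign, colMatrix, sigma3, dotProduct, Fin.sum_univ_two]
  · rwa [e3] at p3
  · rw [e3] at p4
    convert p4 using 1
    ext i j
    fin_cases i <;> fin_cases j <;>
      simp [flipSign, colMatrix, sigma3, dotProduct, Fin.sum_univ_two]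

/-- The upper right entry of `M⁺` minus its singular part at the origin. -/
theorem sectorRegular_plus (x t : ℝ) :
    SectorRegular Dplus Dbar {0, I * (P.u₀ : ℂ), -(I * P.u₀)}
      (P.u x t * (exp (I * P.nuMinus x t))⁻¹ - exp (I * P.nuMinus x t) * P.um)
      fun z => P.Mplus x t z 0 1 - exp (I * P.nuMinus x t) * P.um / z := by
  have hu : (P.u₀ : ℂ) ≠ 0 := by exact_mod_cast hP.u₀_pos.ne'
  have hd : DifferentiableOn ℂ (fun z => P.Mplus x t z 0 1 - exp (I * P.nuMinus x t) * P.um / z)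
      Dbar := (differentiableOn_varphiMinus_one hP x t 0).sub fun z hz =>
    ((differentiableAt_const _).div differentiableAt_id hz.2).differentiableWithinAt
  -- This entry belongs to φ₋,₂ and is not divided by s₁₁, so it has no poles and is regular at
  -- ±iu₀; only the origin uses the asymptotics.
  refine ⟨hd.mono Dplus_subset_Dbar, fun z hz _ => (hd z hz).continuousWithinAt, ?_, ?_⟩
  · have key : ∀ p ∈ Dbar, ∃ C, ∀ᶠ z in 𝓝[Dbar] p,
        ‖P.Mplus x t z 0 1 - exp (I * P.nuMinus x t) * P.um / z‖ ≤ C := fun p hp => by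
      have := (hd p hp).continuousWithinAt.norm.eventually
        (eventually_lt_nhds (lt_add_one _))
      exact ⟨_, this.mono fun z hz => hz.le⟩
    rintro p (rfl | rfl | rfl)
    · obtain ⟨C, hC⟩ := (plus_zero_asymptotics hP x t).2.2.1.bound
      exact ⟨C, hC.mono fun z hz => by simpa [Mplus] using! hz⟩
    · exact key _ ⟨by simp, by simpa using hu⟩
    · exact key _ ⟨by simp, by simpa using hu⟩
  · refine (varphiMinus_asymptotics hP x t).2.congr_left fun z => ?_
    simp [Mplus]
    ring

/-- By conjugation the entry is -(φ₊,₂₁/s₁₁)* at the conjugate point, where the numerator is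
continuous and 1/s₁₁ is bounded. Hence ±iu₀ contribute nothing to the contour integral. -/
theorem Mminus_bounded (x t : ℝ) (c : ℂ) {p : ℂ} (hp : p = I * P.u₀ ∨ p = -(I * P.u₀)) :
    ∃ C, ∀ᶠ z in 𝓝[Dbar'] p, ‖P.Mminus x t z 0 1 - c / z‖ ≤ C := by
  have hu : (P.u₀ : ℂ) ≠ 0 := by exact_mod_cast hP.u₀_pos.ne'
  have hp' : conj p = I * P.u₀ ∨ conj p = -(I * P.u₀) := by
    rcases hp with rfl | rfl <;> simp
  have hpD : conj p ∈ Dbar := by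
    rcases hp' with h | h <;> rw [h] <;> exact ⟨by simp, by simpa using hu⟩
  have hp0 : p ≠ 0 := by rintro rfl; simpa using hpD.2
  have ht : Tendsto (starRingEnd ℂ) (𝓝[Dbar'] p) (𝓝[Dbar] conj p) :=
    continuous_conj.continuousWithinAt.tendsto_nhdsWithin fun z hz => conj_mem_Dbar.2 hz
  obtain ⟨C, hC⟩ := inv_s11_bounded hP hp'
  have h1 := ((differentiableOn_varphiPlus_zero hP x t 1 _ hpD).continuousWithinAt.norm).eventually
    (eventually_lt_nhds (lt_add_one _))
  have h2 : ContinuousAt (fun z => c / z) p := continuousAt_const.div continuousAt_id hp0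
  have h3 := (h2.norm.eventually (eventually_lt_nhds (lt_add_one _))).filter_mono
    (nhdsWithin_le_nhds (s := Dbar'))
  refine ⟨(‖P.varphiPlus 0 x t (conj p) 1‖ + 1) * C + (‖c / p‖ + 1), ?_⟩
  filter_upwards [ht.eventually hC, ht.eventually h1, h3, self_mem_nhdsWithin] with z a1 a2 a3 hz
  refine (norm_sub_le _ _).trans (add_le_add ?_ a3.le)
  rw [Mminus_eq hP hz]
  simp only [Mplus, Matrix.of_apply, Matrix.cons_val', Matrix.cons_val_zero, Matrix.cons_val_one,
    Matrix.cons_val_fin_one, if_true, norm_neg, RCLike.norm_conj]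
  rw [div_eq_mul_inv, norm_mul]
  exact mul_le_mul a2.le a1 (norm_nonneg _) (by positivity)

/-- The jump of `M`. -/
theorem Mplus_mul_G {z : ℂ} (hz : z ∈ P.regularContour) (h11 : P.s11 z ≠ 0) (h22 : P.s22 z ≠ 0)
    (x t : ℝ) : (P.Mplus x t z * P.G x t z) 0 1 = P.Mplus x t z 0 1 - P.Mminus x t z 0 1 := by
  rw [jump_relation hP hz h11 h22, mul_sub, mul_one, Matrix.sub_apply, sub_sub_cancel]

end

section

variable (hP : P.IsSolution) {N₁ N₂ : ℕ} {zs : Fin N₁ → ℂ} {ws : Fin N₂ → ℂ}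
  (hspec : P.HasSimpleSpectrum zs ws)

include hP hspec

theorem conj_zeta_injective : Function.Injective
    (Sum.elim (fun n => conj (P.zeta zs ws n)) fun n => -conj (P.zeta zs ws n)) := by
  have hi := zeta_injective hP hspec
  have hn := zeta_ne_neg_zeta hP hspec
  have hc := (starRingEnd ℂ).injective
  rintro (n | n) (m | m) h <;> simp only [Sum.elim_inl, Sum.elim_inr] at h
  · rw [hi (hc h)]
  · rw [← map_neg] at h; exact absurd (hc h) (hn n m)
  · rw [← map_neg] at h; exact absurd (hc h).symm (hn m n)
  · rw [hi (hc (neg_injective h))]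

theorem s11_conj_ne_zero {z : ℂ} (hz : z ∈ Dminus) (h : z ∉ range
    (Sum.elim (fun n => conj (P.zeta zs ws n)) fun n => -conj (P.zeta zs ws n))) :
    P.s11 (conj z) ≠ 0 := fun h0 => by
  obtain ⟨n, hn | hn⟩ := exists_zeta_of_s11_eq_zero hP hspec (conj_mem_Dplus.2 hz) h0
  · exact h ⟨.inl n, by simp [← hn]⟩
  · exact h ⟨.inr n, by simp [← map_neg, ← hn]⟩

/-- The (1,2) entries of M^± have the same 1/z coefficient ue^{-iν₋} at infinity and the same
singular part e^{iν₋}u₋/z at 0; poles occur only in M⁻. As (M⁺G)₁₂ is their jump, Cauchy's theorem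
gives ue^{-iν₋} = e^{iν₋}u₋ + (sum of residues) - (1/2πi)∫(M⁺G)₁₂. -/
theorem reconstruction {r : Fin N₁ ⊕ Fin N₁ ⊕ Fin N₂ → ℂ} (x t : ℝ)
    (hr : ∀ n, (∃ g, AnalyticAt ℂ g (conj (P.zeta zs ws n)) ∧
        ∀ᶠ z in 𝓝[≠] (conj (P.zeta zs ws n)),
          P.M x t z 0 1 = r n / (z - conj (P.zeta zs ws n)) + g z) ∧
      ∃ g, AnalyticAt ℂ g (-conj (P.zeta zs ws n)) ∧
        ∀ᶠ z in 𝓝[≠] (-conj (P.zeta zs ws n)),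
          P.M x t z 0 1 = r n / (z - -conj (P.zeta zs ws n)) + g z) :
    ContourIntegrable (fun s => (P.Mplus x t s * P.G x t s) 0 1) ∧
    P.u x t = exp (2 * I * P.nuMinus x t) * P.um + exp (I * P.nuMinus x t) *
      (2 * ∑ n, r n - 1 / (2 * Real.pi * I) *
        contourIntegral (fun s => (P.Mplus x t s * P.G x t s) 0 1)) := by
  have hn : exp (2 * I * P.nuMinus x t) = exp (I * P.nuMinus x t) ^ 2 := by
    rw [← exp_nat_mul]; congr 1; push_cast; ring
  have hn0 : exp (I * P.nuMinus x t) ≠ 0 := exp_ne_zero _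
  have haD : ∀ i, Sum.elim (fun n => conj (P.zeta zs ws n)) (fun n => -conj (P.zeta zs ws n)) i
      ∈ Dminus := by
    rintro (n | n)
    · exact conj_mem_Dminus.2 (zeta_spec hP hspec n).1
    · exact neg_mem_Dminus.2 (conj_mem_Dminus.2 (zeta_spec hP hspec n).1)
  have hax : ∀ z ∈ Dminus, z ≠ 0 ∧ z ≠ I * P.u₀ ∧ z ≠ -(I * P.u₀) := fun z hz =>
    ⟨(Dminus_subset_Dbar' hz).2, not_mem_axis (ne_of_gt (show 0 < z.re * z.im from hz)) P.u₀⟩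
  have key := contourIntegral_jump (T := {0, I * (P.u₀ : ℂ), -(I * P.u₀)})
    (a := Sum.elim (fun n => conj (P.zeta zs ws n)) fun n => -conj (P.zeta zs ws n))
    (r := Sum.elim r r) (c₀ := exp (I * P.nuMinus x t) * P.um)
    (c := P.u x t * (exp (I * P.nuMinus x t))⁻¹)
    (Fp := fun z => P.Mplus x t z 0 1) (N := fun z => P.Mminus x t z 0 1)
    (by simp) ((Set.toFinite _).countable) ?_ haD (conj_zeta_injective hP hspec)
    (sectorRegular_plus hP x t) ?_ ?_ ?_ ?_ ?_
  · have hc := contour_congr_regular hP (f := fun s => (P.Mplus x t s * P.G x t s) 0 1)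
      (g := fun z => P.Mplus x t z 0 1 - P.Mminus x t z 0 1) fun z hz =>
        Mplus_mul_G hP hz (scattering_ne_zero hP hspec hz).1 (scattering_ne_zero hP hspec hz).2 x t
    refine ⟨hc.1.2 key.1, ?_⟩
    -- The points ζ* and -ζ* carry the same residue in this entry, hence the factor 2.
    have hsum : ∑ i, Sum.elim r r i = 2 * ∑ n, r n := by
      rw [Fintype.sum_sum_type]
      simp only [Sum.elim_inl, Sum.elim_inr]
      ring
    rw [hc.2, key.2, hn, hsum]
    have hpi : (Real.pi : ℂ) ≠ 0 := by exact_mod_cast Real.pi_ne_zero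
    have hI := I_ne_zero
    field_simp
    ring
  · rw [Set.disjoint_left]
    rintro z hz (h | h | h)
    exacts [(hax z hz).1 h, (hax z hz).2.1 h, (hax z hz).2.2 h]
  · rintro z ⟨hz, hzr⟩
    refine DifferentiableAt.differentiableWithinAt ?_
    refine (M_analyticAt_minus hP x t hz (s11_conj_ne_zero hP hspec hz hzr)
      0 1).differentiableAt.congr_of_eventuallyEq ?_
    filter_upwards [isOpen_Dminus.mem_nhds hz] with w hw
    rw [M_of_mem_Dminus x t hw]
  · intro z hz hzT hzr
    have hg : P.gam z ≠ 0 := gam_ne_zero hz.2 (fun h => hzT (Or.inr (Or.inl h)))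
      fun h => hzT (Or.inr (Or.inr h))
    refine Mminus_continuousWithinAt hP x t hz hg ?_ 0 1
    rcases hz.1.lt_or_eq with h | h
    · rw [s22_eq hP hz]
      simpa using s11_conj_ne_zero hP hspec h hzr
    · exact (scattering_ne_zero hP hspec ⟨⟨h.symm, hz.2⟩, fun h => hzT (Or.inr h)⟩).2
  · rintro p (rfl | rfl | rfl)
    · obtain ⟨C, hC⟩ := (minus_zero_asymptotics hP x t).bound
      exact ⟨C, hC.mono fun z hz => by simpa using hz⟩
    · exact Mminus_bounded hP x t _ (Or.inl rfl)
    · exact Mminus_bounded hP x t _ (Or.inr rfl)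
  · exact (minus_asymptotics hP x t).2.2.1
  · rintro (n | n)
    · obtain ⟨g, hg, h⟩ := (hr n).1
      refine ⟨g, hg, ?_⟩
      filter_upwards [h, nhdsWithin_le_nhds (isOpen_Dminus.mem_nhds (haD (.inl n)))] with z h1 h2
      rw [← M_of_mem_Dminus x t h2]; exact h1
    · obtain ⟨g, hg, h⟩ := (hr n).2
      refine ⟨g, hg, ?_⟩
      filter_upwards [h, nhdsWithin_le_nhds (isOpen_Dminus.mem_nhds (haD (.inr n)))] with z h1 h2
      rw [← M_of_mem_Dminus x t h2]; exact h1

end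

end NZBC

theorem mainTheorem2 (P : NZBC) (hP : P.IsSolution) {N₁ N₂ : ℕ}
    (zs : Fin N₁ → ℂ) (ws : Fin N₂ → ℂ) (hspec : P.HasSimpleSpectrum zs ws) :
    -- the Jost columns exist and are unique
    (∀ z ∈ Dplus ∪ P.regularContour,
      (∃! f, P.IsJostColumn P.up atTop 0 z f) ∧ (∃! f, P.IsJostColumn P.um atBot 1 z f)) ∧
    (∀ z ∈ Dminus ∪ P.regularContour,
      (∃! f, P.IsJostColumn P.um atBot 0 z f) ∧ (∃! f, P.IsJostColumn P.up atTop 1 z f)) ∧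
    -- the scattering relation, with coefficients that do not depend on `x` and `t`
    (∀ z ∈ P.regularContour, ∀ x t : ℝ,
      P.phiPlus 0 x t z = P.s11 z • P.phiMinus 0 x t z + P.s21 z • P.phiMinus 1 x t z ∧
      P.phiPlus 1 x t z = P.s12 z • P.phiMinus 0 x t z + P.s22 z • P.phiMinus 1 x t z) ∧
    (∀ z ∈ Dplus, ∀ x t : ℝ,
      wronskian (P.phiPlus 0 x t z) (P.phiMinus 1 x t z) = P.gam z * P.s11 z) ∧
    (∀ z ∈ Dminus, ∀ x t : ℝ,
      wronskian (P.phiMinus 0 x t z) (P.phiPlus 1 x t z) = P.gam z * P.s22 z) ∧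
    -- analyticity off the discrete spectrum
    (∀ (x t : ℝ) (i j : Fin 2), AnalyticOnNhd ℂ (fun z => P.M x t z i j)
      ((Dplus ∪ Dminus) \ P.spectralSet zs ws)) ∧
    -- boundary values and jump condition
    (∀ (x t : ℝ), ∀ z ∈ P.regularContour,
      P.s11 z ≠ 0 ∧ P.s22 z ≠ 0 ∧
      Tendsto (P.M x t) (𝓝[Dplus] z) (𝓝 (P.Mplus x t z)) ∧
      Tendsto (P.M x t) (𝓝[Dminus] z) (𝓝 (P.Mminus x t z)) ∧
      P.Mminus x t z = P.Mplus x t z * (1 - P.G x t z)) ∧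
    -- asymptotic behaviour at infinity and at zero
    (∀ (x t : ℝ) (i j : Fin 2),
      (fun z => P.M x t z i j - P.expNu x t i j)
        =O[Bornology.cobounded ℂ ⊓ 𝓟 (Dplus ∪ Dminus)] (fun z => z⁻¹)) ∧
    (∀ (x t : ℝ) (i j : Fin 2),
      (fun z => P.M x t z i j - z⁻¹ * (P.expNu x t * sigma3 * potQ P.um) i j)
        =O[𝓝[Dplus ∪ Dminus] 0] (fun _ => (1 : ℂ))) ∧
    -- reconstruction of `u` from the behaviour of `M` at infinity
    (∀ x t : ℝ, Tendsto (fun z => exp (I * P.nuMinus x t) * (z * P.M x t z 0 1))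
      (Bornology.cobounded ℂ ⊓ 𝓟 (Dplus ∪ Dminus)) (𝓝 (P.u x t))) ∧
    -- simple poles, residues, and reconstruction of `u` from the scattering data
    ∃ b C Ct : Fin N₁ ⊕ Fin N₁ ⊕ Fin N₂ → ℂ,
      (∀ n, b n ≠ 0 ∧ deriv P.s11 (P.zeta zs ws n) ≠ 0 ∧
        C n = b n / deriv P.s11 (P.zeta zs ws n) ∧ Ct n = -conj (C n)) ∧
      (∀ n, ∀ x t : ℝ,
        P.phiPlus 0 x t (P.zeta zs ws n) = b n • P.phiMinus 1 x t (P.zeta zs ws n)) ∧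
      (∀ n, ∀ x t : ℝ,
        HasSimplePoleAt (P.M x t) (P.zeta zs ws n)
          (colMatrix ((C n * exp (-(2 * I * P.theta x t (P.zeta zs ws n)))) •
            P.varphiMinus 1 x t (P.zeta zs ws n)) 0) ∧
        HasSimplePoleAt (P.M x t) (-P.zeta zs ws n)
          (colMatrix (-((C n * exp (-(2 * I * P.theta x t (P.zeta zs ws n)))) •
            (sigma3 *ᵥ P.varphiMinus 1 x t (P.zeta zs ws n)))) 0) ∧
        HasSimplePoleAt (P.M x t) (conj (P.zeta zs ws n))
          (colMatrix 0 ((Ct n * exp (2 * I * P.theta x t (conj (P.zeta zs ws n)))) •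
            P.varphiMinus 0 x t (conj (P.zeta zs ws n)))) ∧
        HasSimplePoleAt (P.M x t) (-conj (P.zeta zs ws n))
          (colMatrix 0 ((Ct n * exp (2 * I * P.theta x t (conj (P.zeta zs ws n)))) •
            (sigma3 *ᵥ P.varphiMinus 0 x t (conj (P.zeta zs ws n)))))) ∧
      (∀ x t : ℝ,
        ContourIntegrable (fun s => (P.Mplus x t s * P.G x t s) 0 1) ∧
        P.u x t = exp (2 * I * P.nuMinus x t) * P.um
          + exp (I * P.nuMinus x t) *
            (2 * ∑ n, Ct n * exp (2 * I * P.theta x t (conj (P.zeta zs ws n))) *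
                P.varphiMinus 0 x t (conj (P.zeta zs ws n)) 0
              - 1 / (2 * Real.pi * I) *
                contourIntegral (fun s => (P.Mplus x t s * P.G x t s) 0 1))) := by
  have sub0 : ∀ z ∈ Dplus ∪ P.regularContour, z ∈ Dbar := fun z hz =>
    hz.elim (fun h => Dplus_subset_Dbar h) fun h => (NZBC.regularContour_subset h).1
  have sub1 : ∀ z ∈ Dminus ∪ P.regularContour, z ∈ Dbar' := fun z hz =>
    hz.elim (fun h => Dminus_subset_Dbar' h) fun h => (NZBC.regularContour_subset h).2
  refine ⟨fun z hz => ⟨NZBC.existsUnique_plus_zero hP (sub0 z hz),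
      NZBC.existsUnique_minus_one hP (sub0 z hz)⟩,
    fun z hz => ⟨NZBC.existsUnique_minus_zero hP (sub1 z hz),
      NZBC.existsUnique_plus_one hP (sub1 z hz)⟩,
    fun z hz x t => NZBC.scattering_relation hP hz x t,
    fun z hz x t => ((NZBC.gam_mul_s11 hP (Dplus_subset_Dbar hz)
      (NZBC.gam_ne_zero_of_mem hP (Or.inl (Or.inl hz))) x t).2).symm,
    fun z hz x t => ?_, NZBC.M_analyticOnNhd hP hspec, fun x t z hz => ?_,
    NZBC.M_asymptotics_infty hP, NZBC.M_asymptotics_zero hP, NZBC.M_limit_infty hP, ?_⟩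
  · have hz' := Dminus_subset_Dbar' hz
    have hg := NZBC.gam_ne_zero_of_mem hP (z := z) (Or.inl (Or.inr hz))
    rw [NZBC.wronskian_eq (NZBC.isJostColumn_phiMinus (NZBC.existsUnique_minus_zero hP hz'))
      (NZBC.isJostColumn_phiPlus (NZBC.existsUnique_plus_one hP hz')) x t 0 0, NZBC.s22,
      mul_div_cancel₀ _ hg]
  · have hs := NZBC.scattering_ne_zero hP hspec hz
    have hg := NZBC.gam_ne_zero_of_mem hP (z := z) (Or.inr hz)
    have hzD := NZBC.regularContour_subset hz
    exact ⟨hs.1, hs.2, NZBC.M_tendsto_plus hP x t hzD.1 hg hs.1,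
      NZBC.M_tendsto_minus hP x t hzD.2 hg hs.2, NZBC.jump_relation hP hz hs.1 hs.2 x t⟩
  · have hζ := NZBC.zeta_spec hP hspec
    -- The constants are fixed before x and t are introduced, each serving all (x,t) at once.
    choose b hb hφ using fun n => NZBC.exists_norming_constant hP (Dplus_subset_Dbar (hζ n).1)
      (NZBC.gam_ne_zero_of_mem hP (Or.inl (Or.inl (hζ n).1))) (hζ n).2.1
    have hM := fun n x t => NZBC.poles_of_M hP x t (hζ n).1 (hζ n).2.1 (hζ n).2.2 (hb n) (hφ n x t)
    refine ⟨b, fun n => b n / deriv P.s11 (P.zeta zs ws n),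
      fun n => -conj (b n / deriv P.s11 (P.zeta zs ws n)),
      fun n => ⟨hb n, (hζ n).2.2, rfl, rfl⟩, hφ, hM, fun x t => ?_⟩
    refine NZBC.reconstruction hP hspec x t fun n => ⟨?_, ?_⟩
    · simpa [colMatrix] using (hM n x t).2.2.1.entry 0 1
    · simpa [colMatrix, sigma3, Matrix.mulVec, dotProduct, Fin.sum_univ_two] using
        (hM n x t).2.2.2.entry 0 1
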